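/- **Setting.** Formulas: $A ::= 1\mid\bot\mid X\mid X^\bot\mid A\otimes A\mid A⅋A$, with involutive linear negation. Atoms $1,X$ are positive, $\bot,X^\bot$ negative; positive formulas are $P::=1\mid P\otimes P$, negative ones $N::=\bot\mid N⅋N$. For a set $S$, $\mathbb H(2^S)$ is the Hilbert space with orthonormal basis the assignments $S\to\{0,1\}$. Fix a set of symbols denoting unitary operators on finitely many qubits. A *structure* with conclusions $\Gamma=A_1,\dots,A_n$ is a finite graph with typed edges, built from the nodes $\mathsf{ax}$ (conclusions $A,A^\bot$), $\mathsf{cut}$ (premisses $A,A^\bot$), $\otimes$, $⅋$, $\mathsf{one}$ (conclusion $1$), *sync* nodes, and *boxes*. A sync node has $k\ge 1$ premisses and $k$ corresponding conclusions of the same types, each positive or negative, and is labelled by a unitary whose arity is the number of atom occurrences in its premisses; its in-edges are the positive premisses and negative conclusions, its out-edges the other ones. A box has conclusions $\bot$ (its lock) and $\Delta$, and two contents (number $0$ and $1$), each a structure with conclusions $\Delta$; boxes are properly nested. A structure is a *net* if neither it nor any content of a box has a switching cycle, i.e. a simple undirected cycle (boxes seen as nodes without premisses) using at most one premiss of each $⅋$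 and at most one out-edge of each sync node. A *quantum net* is a pair $\mathbf R=(R,Q)$ of a net $R$ and a unit vector $Q\in\mathbb H(2^{L_0})$, where $L_0$ is a set of $\mathsf{one}$ nodes of $R$ at depth $0$ (not inside any box). **Reduction** $\mathbf R\hookrightarrow\{\mathbf S_1^{p_1},\dots,\mathbf S_n^{p_n}\}$ takes place at depth $0$. The following rules have one outcome, of probability $1$. (1) $\mathsf{ax}/\mathsf{cut}$ and $\otimes/⅋$ (cut), as for MLL. (2) A sync node acting on the conclusion $A*B$ of a $\otimes$ or $⅋$ node is moved above it, acting on $A$ and $B$; a sync node acting on the conclusion $P$ (positive) of an axiom is moved to its conclusion $P^\bot$; a sync node whose negative conclusion $P^\bot$ is premiss of a cut is moved to the premiss $P$ of that cut. (3) A $\mathsf{one}$ node $r\notin L_0$ joins the register: $Q$ becomes $Q\otimes|r\leftarrow 0\rangle$. (4) A sync node labelled $U$ all of whose premisses are conclusions of $\mathsf{one}$ nodes in $L_0$ is erased, and $Q$ becomes $U(Q)$. In addition, (5) if a node $r\in L_0$ is cut against the lock of a box, then for each $b\in\{0,1\}$ of nonzero probability $p_b$, where $p_b$ is the probability of observing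 $b$ when measuring $r$ in $Q$, there is an outcome with probability $p_b$, in which the $\mathsf{one}$ node, the cut, the box and its other content are removed, content $b$ is put at depth $0$ with its conclusions $\Delta$ replacing those of the box, and the register is the normalized projection of $Q$ to $r=b$, with the qubit $r$ dropped. Multi-step reduction $\leadsto$ is the least relation with $\mathbf R\leadsto\{\mathbf R^1\}$, and $\mathbf R\leadsto\sum_i p_i\mathscr R_i$ whenever $\mathbf R\hookrightarrow\{\mathbf S_1^{p_1},\dots,\mathbf S_n^{p_n}\}$ and $\mathbf S_i\leadsto\mathscr R_i$ for all $i$. **The machine (QSIAM).** A position of $R$ is an atom occurrence in the type of an edge, or a pair $(k,b)$ with $k$ the lock of a box and $b\in\{0,1\}$. $\mathtt{INIT}$ (resp. $\mathtt{FIN}$) is the set of negative (resp. positive) atom occurrences in the conclusions $\Gamma$. A state is a pair $(T,P)$, where $T$ maps $\mathtt{INIT}\cup L$ to positions (the current positions of tokens, named by their origins), $L$ is a set of $\mathsf{one}$ nodes of $R$, and $P\in\mathbb H(2^{\mathtt{INIT}\cup L})$. A box is unlocked with content $b$ if a token is at $(k,b)$. The transitions from states to finite distributions of states are as follows. Tokens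 on positive atoms go down and tokens on negative atoms go up, through $\mathsf{ax},\mathsf{cut},\otimes,⅋$, and across the border of the content $b$ of a box unlocked with content $b$. When all in-edges of a sync node are filled with tokens, these cross together and its unitary is applied to their qubits (in the order of the atoms). A $\mathsf{one}$ node that is not in $L$ and is at depth $0$, or at depth $0$ inside an unlocked content, is added to $L$, with a token on its conclusion and a new qubit $|0\rangle$. A token reaching the lock $k$ of a box is measured in $P$: with the probability of observing $b$ it moves to $(k,b)$, and $P$ is projected accordingly and normalized. A state is terminal if no transition applies. A terminal state is *final* if the image of $T$ is $\mathtt{FIN}\cup B$, where $B$ consists of positions of the form $(k,b)$; otherwise it is a deadlock. A final state yields a result $(f,\varphi)$: $f$ is the partial injection $\mathtt{INIT}\rightharpoonup\mathtt{FIN}$ which restricts $T$ to the elements of $\mathtt{INIT}$ with image in $\mathtt{FIN}$, and $\varphi\in\mathbb H(2^{\mathtt{FIN}})$ is the register of the qubits at the positions in $\mathtt{FIN}$ (each token at a position $(k,b)$ has the classical value $b$). A deadlock yields the result $\Box$. Evaluation $s\looparrowright\mathscr D$ is the least relation with $s\looparrowright\emptyset$; $s\looparrowright\{x^1\}$ if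 $s$ is terminal with result $x$; and $s\looparrowright\sum_i p_i\mathscr D_i$ if there is a transition from $s$ to $\{t_1^{p_1},\dots,t_n^{p_n}\}$ and $t_i\looparrowright\mathscr D_i$ for all $i$. The *interpretation* $[\mathbf R]$ maps each unit vector $\psi\in\mathbb H(2^{\mathtt{INIT}})$ to the pointwise supremum of all $\mathscr D$ with $s_\psi\looparrowright\mathscr D$, where $s_\psi$ is the state with $L=L_0$, with every token at its origin, and with register $\psi\otimes Q$; it is thus a distribution over $((\mathtt{INIT}\rightharpoonup\mathtt{FIN})\times\mathbb H(2^{\mathtt{FIN}}))\cup\{\Box\}$. For a finite distribution $\mathscr R$ of quantum nets, $[\mathscr R](\psi)=\sum_{\mathbf S}\mathscr R(\mathbf S)\,[\mathbf S](\psi)$. **Theorem (Soundness of QSIAM).** If $\mathbf R$ is a quantum net and $\mathbf R\leadsto\mathscr R$, then $[\mathbf R]=[\mathscr R]$. -/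

import Mathlib

open scoped NNReal ENNReal

namespace QSMLL

/-! ### Formulas -/

/-- Formulas of multiplicative linear logic with units; `nvar X` is the dual of `var X`. -/
inductive Formula : Type
  | one : Formula
  | bot : Formula
  | var (X : ℕ) : Formula
  | nvar (X : ℕ) : Formula
  | tens (A B : Formula) : Formula
  | par (A B : Formula) : Formula

namespace Formula

/-- Linear negation. -/
def dual : Formula → Formula
  | one => bot
  | bot => one
  | var X => nvar X
  | nvar X => var X
  | tens A B => par A.dual B.dual
  | par A B => tens A.dual B.dual

/-- Positive formulas `P ::= 1 | P ⊗ P`. -/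
def isPos : Formula → Bool
  | one => true
  | tens A B => A.isPos && B.isPos
  | _ => false

/-- Negative formulas `N ::= ⊥ | N ⅋ N`. -/
def isNeg : Formula → Bool
  | bot => true
  | par A B => A.isNeg && B.isNeg
  | _ => false

/-- Addresses of the occurrences of atoms, from left to right (`false` = left, `true` = right). -/
def addrs : Formula → List (List Bool)
  | tens A B => A.addrs.map (false :: ·) ++ B.addrs.map (true :: ·)
  | par A B => A.addrs.map (false :: ·) ++ B.addrs.map (true :: ·)
  | _ => [[]]

/-- Polarity of the occurrence of atom at an address: `some true` for the positive atoms `1`, `X`,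
`some false` for the negative atoms `⊥`, `X^⊥`, `none` if the address is not that of an atom. -/
def pol : Formula → List Bool → Option Bool
  | one, [] => some true
  | var _, [] => some true
  | bot, [] => some false
  | nvar _, [] => some false
  | tens A _, false :: m => A.pol m
  | tens _ B, true :: m => B.pol m
  | par A _, false :: m => A.pol m
  | par _ B, true :: m => B.pol m
  | _, _ => none

/-- The (addresses of) occurrences of atoms of polarity `b`. -/
def atoms (A : Formula) (b : Bool) : Finset (List Bool) :=
  (A.addrs.filter (fun m => A.pol m = some b)).toFinset

end Formula

/-! ### Quantum registers -/

/-- The Hilbert space with orthonormal basis the assignments `ι → {0,1}`. -/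
abbrev Qubits (ι : Type) : Type := EuclideanSpace ℂ (ι → Bool)

/-- A set of symbols, each denoting a unitary operator on `arity u` qubits. -/
structure GateSet : Type 1 where
  Sym : Type
  arity : Sym → ℕ
  op : (u : Sym) → Matrix.unitaryGroup (Fin (arity u) → Bool) ℂ

namespace Qubits

variable {ι κ : Type}

/-- Apply the operator `U` to the qubits `q 0, …, q (n-1)` (in this order) of the register. -/
noncomputable def applyGate {n : ℕ} (U : Matrix (Fin n → Bool) (Fin n → Bool) ℂ) (q : Fin n → ι)
    (Q : Qubits ι) : Qubits ι :=
  WithLp.toLp 2 fun x => ∑ y : Fin n → Bool, U (x ∘ q) y * Q (Function.extend q y x)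

/-- `Q ⊗ |r ← 0⟩`: the qubits of `Q` are embedded by `f`, and `r` is the new qubit. -/
noncomputable def adjoinZero (f : ι → κ) (r : κ) (Q : Qubits ι) : Qubits κ :=
  WithLp.toLp 2 fun x => if x r = true then 0 else Q (x ∘ f)

/-- Projection to the subspace where the qubit `r` has value `b`. -/
noncomputable def proj (r : ι) (b : Bool) (Q : Qubits ι) : Qubits ι :=
  WithLp.toLp 2 fun x => if x r = b then Q x else 0

/-- Probability of observing `b` when measuring the qubit `r` of the (normalized) register. -/
noncomputable def prob [Fintype ι] [DecidableEq ι] (r : ι) (b : Bool) (Q : Qubits ι) : ℝ≥0 :=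
  ‖proj r b Q‖₊ ^ 2

/-- The normalized register after `b` has been observed on the qubit `r`. -/
noncomputable def collapse [Fintype ι] [DecidableEq ι] (r : ι) (b : Bool) (Q : Qubits ι) :
    Qubits ι :=
  ((‖proj r b Q‖⁻¹ : ℝ) : ℂ) • proj r b Q

/-- Forget the qubit `e`, which is known to have the classical value `b`. -/
noncomputable def discard {reg : Finset ℕ} (e : ℕ) (b : Bool) (Q : Qubits reg) :
    Qubits (reg.erase e) :=
  WithLp.toLp 2 fun x =>
    Q fun i => if h : (i : ℕ) = e then b else x ⟨i, Finset.mem_erase.2 ⟨h, i.2⟩⟩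

end Qubits

/-- A finite distribution `{x₁^{p₁}, …, xₙ^{pₙ}}`, given as an indexed family. -/
structure Fam (α : Type) : Type 1 where
  ι : Type
  fin : Fintype ι
  weight : ι → ℝ≥0
  pt : ι → α

attribute [instance] Fam.fin

/-- The distribution `{x^1}`. -/
def Fam.pure {α : Type} (x : α) : Fam α := ⟨Unit, inferInstance, fun _ => 1, fun _ => x⟩

/-! ### Structures with boxes

Edges are named by natural numbers, and nodes list their edges. A box is a node `box k aux cont`
with lock `k` of type `⊥` and auxiliary conclusions `aux`; it has two contents, and `cont b` lists
the conclusions of the content number `b`. All nodes, at all depths, are kept together; the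
function `loc` says in which content of which box (named by its lock) an edge directly lies. -/

/-- Nodes; for `tens` and `par` the conclusion comes last, a sync node lists its pairs
(premiss, corresponding conclusion). -/
inductive Node (G : GateSet) : Type
  | ax (a b : ℕ) : Node G
  | cut (a b : ℕ) : Node G
  | tens (a b c : ℕ) : Node G
  | par (a b c : ℕ) : Node G
  | one (c : ℕ) : Node G
  | sync (u : G.Sym) (l : List (ℕ × ℕ)) : Node G
  | box (k : ℕ) (aux : List ℕ) (cont : Bool → List ℕ) : Node G

namespace Node

variable {G : GateSet}

def concls : Node G → List ℕ
  | ax a b => [a, b]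
  | cut _ _ => []
  | tens _ _ c => [c]
  | par _ _ c => [c]
  | one c => [c]
  | sync _ l => l.map Prod.snd
  | box k aux _ => k :: aux

def prems : Node G → List ℕ
  | ax _ _ => []
  | cut a b => [a, b]
  | tens a b _ => [a, b]
  | par a b _ => [a, b]
  | one _ => []
  | sync _ l => l.map Prod.fst
  | box _ _ _ => []

/-- The conclusions of the contents of a box. -/
def inner : Node G → List ℕ
  | box _ _ cont => cont false ++ cont true
  | _ => []

def rename (σ : ℕ → ℕ) : Node G → Node G
  | ax a b => ax (σ a) (σ b)
  | cut a b => cut (σ a) (σ b)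
  | tens a b c => tens (σ a) (σ b) (σ c)
  | par a b c => par (σ a) (σ b) (σ c)
  | one c => one (σ c)
  | sync u l => sync u (l.map fun p => (σ p.1, σ p.2))
  | box k aux cont => box (σ k) (aux.map σ) (fun b => (cont b).map σ)

/-- The typing constraints on the edges of a node. A sync node has at least one premiss, and the
arity of its operator is the number of occurrences of atoms in its premisses. -/
def WellTyped (ty : ℕ → Formula) : Node G → Prop
  | ax a b => ty b = (ty a).dual
  | cut a b => ty b = (ty a).dual
  | tens a b c => ty c = .tens (ty a) (ty b)
  | par a b c => ty c = .par (ty a) (ty b)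
  | one c => ty c = .one
  | sync u l => l ≠ [] ∧
      (∀ p ∈ l, ty p.1 = ty p.2 ∧ ((ty p.1).isPos = true ∨ (ty p.1).isNeg = true)) ∧
      G.arity u = (l.map fun p => (ty p.1).addrs.length).sum
  | box k aux cont => ty k = .bot ∧ ∀ b, (cont b).map ty = aux.map ty

/-- The conclusions of the content `b` of the box with lock `k` lie in that content. -/
def ContentPlaced (loc : ℕ → Option (ℕ × Bool)) : Node G → Prop
  | box k _ cont => ∀ b, ∀ e ∈ cont b, loc e = some (k, b)
  | _ => True

end Node

/-- Structures with boxes, with conclusions (in order) of types `Γ`. -/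
structure Struct (G : GateSet) {n : ℕ} (Γ : Fin n → Formula) : Type where
  nodes : Multiset (Node G)
  concl : Fin n → ℕ
  /-- type of an edge -/
  ty : ℕ → Formula
  /-- innermost box content in which an edge lies; `none` at depth `0` -/
  loc : ℕ → Option (ℕ × Bool)
  /-- every edge is a conclusion of exactly one node -/
  src_nodup : (nodes.bind fun v => (v.concls : Multiset ℕ)).Nodup
  /-- every edge is exactly one of: premiss of one node, conclusion of the content of one box,
  conclusion of the structure -/
  src_eq_tgt : (nodes.bind fun v => (v.concls : Multiset ℕ)) =
    (List.ofFn concl : Multiset ℕ) + nodes.bind fun v => ((v.prems ++ v.inner : List ℕ) : Multiset ℕ)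
  ty_concl : ∀ i, ty (concl i) = Γ i
  ty_node : ∀ v ∈ nodes, v.WellTyped ty
  loc_concl : ∀ i, loc (concl i) = none
  /-- all the edges of a node lie in the same place -/
  loc_node : ∀ v ∈ nodes, ∀ e ∈ v.prems ++ v.concls, ∀ f ∈ v.prems ++ v.concls, loc e = loc f
  loc_content : ∀ v ∈ nodes, v.ContentPlaced loc
  /-- places belong to boxes of the structure, and boxes are properly nested -/
  nested : ∃ depth : ℕ → ℕ, ∀ v ∈ nodes, ∀ e ∈ v.concls, ∀ k b, loc e = some (k, b) →
    (∃ aux cont, Node.box k aux cont ∈ nodes) ∧ depth k < depth e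

namespace Struct

variable {G : GateSet} {n : ℕ} {Γ : Fin n → Formula}

def IsEdge (R : Struct G Γ) (e : ℕ) : Prop := ∃ v ∈ R.nodes, e ∈ v.concls

/-- In-edges of sync nodes: positive premisses and negative conclusions. -/
def inEdge (R : Struct G Γ) (p : ℕ × ℕ) : ℕ := if (R.ty p.1).isPos = true then p.1 else p.2

/-- Out-edges of sync nodes: positive conclusions and negative premisses. -/
def outEdge (R : Struct G Γ) (p : ℕ × ℕ) : ℕ := if (R.ty p.1).isPos = true then p.2 else p.1

/-- The edge `e` connects the nodes `v` and `w`. -/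
def Joins (e : ℕ) (v w : Node G) : Prop :=
  (e ∈ v.concls ∧ e ∈ w.prems) ∨ (e ∈ w.concls ∧ e ∈ v.prems)

/-- There is a cyclic switching path (at depth `0` or inside some box): a simple undirected cycle
using at most one premiss of each par node and at most one out-edge of each sync node. A box
counts as a node without premisses. -/
def HasSwitchingCycle (R : Struct G Γ) : Prop :=
  ∃ (k : ℕ) (v : Fin (k + 1) → Node G) (e : Fin (k + 1) → ℕ),
    Function.Injective v ∧ Function.Injective e ∧ (∀ i, v i ∈ R.nodes) ∧
    (∀ i, Joins (e i) (v i) (v (i + 1))) ∧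
    (∀ a b c, Node.par a b c ∈ R.nodes → ¬ (a ∈ Set.range e ∧ b ∈ Set.range e)) ∧
    (∀ u l, Node.sync u l ∈ R.nodes → ∀ p ∈ l, ∀ q ∈ l,
      R.outEdge p ∈ Set.range e → R.outEdge q ∈ Set.range e → R.outEdge p = R.outEdge q)

/-- The correctness criterion, for the structure itself and for the contents of all its boxes. -/
def Correct (R : Struct G Γ) : Prop := ¬ R.HasSwitchingCycle

/-! ### Reduction of structures (always at depth `0`) -/

/-- The edges of `R` keep their types and places in `S`. -/
def Agree (R S : Struct G Γ) : Prop := ∀ e, R.IsEdge e → S.ty e = R.ty e ∧ S.loc e = R.loc e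

/-- `w` is a new edge of `S` at depth `0`, of the same type as the edge `e` of `R`. -/
def Fresh (R S : Struct G Γ) (w e : ℕ) : Prop :=
  ¬ R.IsEdge w ∧ S.ty w = R.ty e ∧ S.loc w = none

/-- The multiplicative rules and the commutations with sync nodes. -/
inductive Red (R S : Struct G Γ) : Prop
  | ax_cut (a b c : ℕ) (v w : Node G) (rest : Multiset (Node G))
      (hv : v = .ax a b ∨ v = .ax b a) (hw : w = .cut b c ∨ w = .cut c b)
      (hR : R.nodes = v ::ₘ w ::ₘ rest) (hd : R.loc b = none)
      (hS : S.nodes = rest.map (Node.rename (Function.update id a c)))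
      (hc : S.concl = Function.update id a c ∘ R.concl) (hA : R.Agree S)
  | tens_par (a b c a' b' c' : ℕ) (w : Node G) (rest : Multiset (Node G))
      (hw : w = .cut c c' ∨ w = .cut c' c)
      (hR : R.nodes = .tens a b c ::ₘ .par a' b' c' ::ₘ w ::ₘ rest) (hd : R.loc c = none)
      (hS : S.nodes = .cut a a' ::ₘ .cut b b' ::ₘ rest)
      (hc : S.concl = R.concl) (hA : R.Agree S)
  | sync_tens (a b c d a' b' : ℕ) (u : G.Sym) (l₁ l₂ : List (ℕ × ℕ)) (rest : Multiset (Node G))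
      (hR : R.nodes = .tens a b c ::ₘ .sync u (l₁ ++ (c, d) :: l₂) ::ₘ rest) (hd : R.loc c = none)
      (hne : a' ≠ b') (ha : R.Fresh S a' a) (hb : R.Fresh S b' b)
      (hS : S.nodes = .tens a' b' d ::ₘ .sync u (l₁ ++ (a, a') :: (b, b') :: l₂) ::ₘ rest)
      (hc : S.concl = R.concl) (hA : R.Agree S)
  | sync_par (a b c d a' b' : ℕ) (u : G.Sym) (l₁ l₂ : List (ℕ × ℕ)) (rest : Multiset (Node G))
      (hR : R.nodes = .par a b c ::ₘ .sync u (l₁ ++ (c, d) :: l₂) ::ₘ rest) (hd : R.loc c = none)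
      (hne : a' ≠ b') (ha : R.Fresh S a' a) (hb : R.Fresh S b' b)
      (hS : S.nodes = .par a' b' d ::ₘ .sync u (l₁ ++ (a, a') :: (b, b') :: l₂) ::ₘ rest)
      (hc : S.concl = R.concl) (hA : R.Agree S)
  | sync_ax (p q d w : ℕ) (v : Node G) (u : G.Sym) (l₁ l₂ : List (ℕ × ℕ))
      (rest : Multiset (Node G)) (hv : v = .ax p q ∨ v = .ax q p)
      (hp : (R.ty p).isPos = true)
      (hR : R.nodes = v ::ₘ .sync u (l₁ ++ (p, d) :: l₂) ::ₘ rest) (hd : R.loc p = none)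
      (hw : R.Fresh S w q)
      (hS : S.nodes = .ax d w ::ₘ .sync u (l₁ ++ (w, q) :: l₂) ::ₘ rest)
      (hc : S.concl = R.concl) (hA : R.Agree S)
  | sync_cut (x m p w : ℕ) (v : Node G) (u : G.Sym) (l₁ l₂ : List (ℕ × ℕ))
      (rest : Multiset (Node G)) (hv : v = .cut m p ∨ v = .cut p m)
      (hm : (R.ty m).isNeg = true)
      (hR : R.nodes = v ::ₘ .sync u (l₁ ++ (x, m) :: l₂) ::ₘ rest) (hd : R.loc m = none)
      (hw : R.Fresh S w p)
      (hS : S.nodes = .cut x w ::ₘ .sync u (l₁ ++ (p, w) :: l₂) ::ₘ rest)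
      (hc : S.concl = R.concl) (hA : R.Agree S)

/-- `S` arises from `R` by erasing, at depth `0`, a sync node `sync u l` whose premisses are all
conclusions of `one` nodes; premisses and corresponding conclusions are identified. -/
def EraseSync (R S : Struct G Γ) (u : G.Sym) (l : List (ℕ × ℕ)) : Prop :=
  ∃ (rest : Multiset (Node G)) (σ : ℕ → ℕ),
    R.nodes = .sync u l ::ₘ rest ∧
    (∀ p ∈ l, .one p.1 ∈ rest ∧ R.loc p.1 = none ∧ σ p.2 = p.1) ∧
    (∀ x, x ∉ l.map Prod.snd → σ x = x) ∧
    S.nodes = rest.map (Node.rename σ) ∧ S.concl = σ ∘ R.concl ∧ R.Agree S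

/-- The edge `e` lies, at any depth, inside the content `b` of the box with lock `k`. -/
inductive Inside (R : Struct G Γ) (k : ℕ) (b : Bool) : ℕ → Prop
  | here (e : ℕ) (h : R.loc e = some (k, b)) : Inside R k b e
  | deeper (e k' : ℕ) (b' : Bool) (h : R.loc e = some (k', b')) (h' : Inside R k b k') :
      Inside R k b e

open Classical in
/-- `S` arises from `R` by opening, at depth `0`, the box whose lock is cut against the node
`one e`, and keeping the content `b`: the `one` node, the cut, the box and the whole other content
disappear, and the conclusions of the content `b` become the auxiliary conclusions of the box. -/
def OpenBox (R S : Struct G Γ) (e : ℕ) (b : Bool) : Prop :=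
  ∃ (k : ℕ) (aux : List ℕ) (cont : Bool → List ℕ) (v : Node G) (rest : Multiset (Node G))
    (σ : ℕ → ℕ),
    (v = .cut e k ∨ v = .cut k e) ∧
    R.nodes = .one e ::ₘ v ::ₘ .box k aux cont ::ₘ rest ∧ R.loc e = none ∧
    aux.map σ = cont b ∧ (∀ x, x ∉ aux → σ x = x) ∧
    S.nodes = (rest.filter fun w => ∀ x ∈ w.prems ++ w.concls, ¬ R.Inside k (!b) x).map
      (Node.rename σ) ∧
    S.concl = σ ∘ R.concl ∧
    ∀ x, R.IsEdge x →
      S.ty x = R.ty x ∧ S.loc x = if R.loc x = some (k, b) then none else R.loc x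

end Struct

/-! ### Quantum nets and their reduction -/

/-- The edges in `reg` are conclusions of `one` nodes at depth `0`. -/
def Struct.HoldsOnes {G : GateSet} {n : ℕ} {Γ : Fin n → Formula} (R : Struct G Γ)
    (reg : Finset ℕ) : Prop := ∀ e ∈ reg, Node.one e ∈ R.nodes ∧ R.loc e = none

/-- A structure with a normalized quantum register whose qubits are (the conclusions of) some of
the `one` nodes at depth `0`. A *quantum net* is such a pair with a correct structure. -/
structure QStruct (G : GateSet) {n : ℕ} (Γ : Fin n → Formula) : Type where
  net : Struct G Γ
  reg : Finset ℕ
  reg_one : net.HoldsOnes reg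
  vec : Qubits reg
  vec_norm : ‖vec‖ = 1

section Reduction

variable {G : GateSet} {n : ℕ} {Γ : Fin n → Formula}

/-- One-step reduction `𝐑 ↪ {𝐒₁^{p₁}, …, 𝐒ₙ^{pₙ}}`. -/
inductive QRed : QStruct G Γ → Fam (QStruct G Γ) → Prop
  /-- a rule that does not touch the register -/
  | struct (R S : Struct G Γ) (reg : Finset ℕ) (hR : R.HoldsOnes reg) (hS : S.HoldsOnes reg)
      (Q : Qubits reg) (hQ : ‖Q‖ = 1) (h : R.Red S) :
      QRed ⟨R, reg, hR, Q, hQ⟩ (.pure ⟨S, reg, hS, Q, hQ⟩)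
  /-- a `one` node is linked to a new qubit in state `|0⟩` -/
  | new (R : Struct G Γ) (reg : Finset ℕ) (hR : R.HoldsOnes reg) (Q : Qubits reg) (hQ : ‖Q‖ = 1)
      (e : ℕ) (he : e ∉ reg) (hone : Node.one e ∈ R.nodes) (hd : R.loc e = none)
      (hRn : R.HoldsOnes (insert e reg)) (Qn : Qubits (insert e reg : Finset ℕ)) (hQn : ‖Qn‖ = 1)
      (h : Qn = Qubits.adjoinZero (fun i : reg => ⟨i, Finset.mem_insert_of_mem i.2⟩)
        ⟨e, Finset.mem_insert_self e reg⟩ Q) :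
      QRed ⟨R, reg, hR, Q, hQ⟩ (.pure ⟨R, insert e reg, hRn, Qn, hQn⟩)
  /-- a sync node below `one` nodes linked to the register is executed -/
  | sync (R S : Struct G Γ) (reg : Finset ℕ) (hR : R.HoldsOnes reg) (hS : S.HoldsOnes reg)
      (Q : Qubits reg) (hQ : ‖Q‖ = 1) (u : G.Sym) (l : List (ℕ × ℕ))
      (q : Fin (G.arity u) → reg) (hq : List.ofFn (fun j => (q j : ℕ)) = l.map Prod.fst)
      (h : R.EraseSync S u l) (Qn : Qubits reg) (hQn : ‖Qn‖ = 1)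
      (hU : Qn = Qubits.applyGate (G.op u) q Q) :
      QRed ⟨R, reg, hR, Q, hQ⟩ (.pure ⟨S, reg, hS, Qn, hQn⟩)
  /-- a box whose lock is cut against a `one` node linked to the register is opened; its content
  is chosen by measurement (only the outcomes of nonzero probability are listed) -/
  | measure (R : Struct G Γ) (reg : Finset ℕ) (hR : R.HoldsOnes reg) (Q : Qubits reg)
      (hQ : ‖Q‖ = 1) (e : ℕ) (he : e ∈ reg)
      (S : {b : Bool // Qubits.prob ⟨e, he⟩ b Q ≠ 0} → QStruct G Γ)
      (h : ∀ b, R.OpenBox (S b).net e b)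
      (hreg : ∀ b, (S b).reg = reg.erase e)
      (hvec : ∀ b x, (S b).vec x = Qubits.discard e b (Qubits.collapse ⟨e, he⟩ b Q)
        (fun i => x ⟨i, by rw [hreg b]; exact i.2⟩)) :
      QRed ⟨R, reg, hR, Q, hQ⟩
        { ι := {b : Bool // Qubits.prob ⟨e, he⟩ b Q ≠ 0}
          fin := Fintype.ofFinite _
          weight := fun b => Qubits.prob ⟨e, he⟩ b Q
          pt := S }

/-- Multi-step reduction `𝐑 ⇝ ℛ`. -/
inductive QRedStar : QStruct G Γ → (QStruct G Γ →₀ ℝ≥0) → Prop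
  | refl (R : QStruct G Γ) : QRedStar R (Finsupp.single R 1)
  | step (R : QStruct G Γ) (F : Fam (QStruct G Γ)) (D : F.ι → QStruct G Γ →₀ ℝ≥0)
      (h : QRed R F) (hD : ∀ i, QRedStar (F.pt i) (D i)) :
      QRedStar R (∑ i, F.weight i • D i)

end Reduction

/-! ### The token machine -/

/-- Positions: `edge e m` is the occurrence of atom with address `m` on the edge `e`, and
`lock k b` is the position `(k, b)` on the lock `k` of a box. -/
inductive Pos : Type
  | edge (e : ℕ) (m : List Bool) : Pos
  | lock (k : ℕ) (b : Bool) : Pos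

section Machine

variable {G : GateSet} {n : ℕ} {Γ : Fin n → Formula}

/-- Initial positions: the negative occurrences of atoms in the conclusions. -/
abbrev InitPos (Γ : Fin n → Formula) : Type := Σ i : Fin n, ((Γ i).atoms false : Finset (List Bool))

/-- Final positions: the positive occurrences of atoms in the conclusions. -/
abbrev FinPos (Γ : Fin n → Formula) : Type := Σ i : Fin n, ((Γ i).atoms true : Finset (List Bool))

/-- States: `T` maps the origin of each token (an initial position, or the conclusion of one of the
`one` nodes in `ones`) to its current position; each token carries a qubit of the register `P`. -/
structure State (Γ : Fin n → Formula) : Type where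
  ones : Finset ℕ
  T : InitPos Γ ⊕ ones → Pos
  P : Qubits (InitPos Γ ⊕ ones)

/-- The box with lock `k` is unlocked, with content `b`. -/
def State.Unlocked (s : State Γ) (k : ℕ) (b : Bool) : Prop := ∃ x, s.T x = .lock k b

namespace Struct

/-- The node with conclusion `e` is at depth `0`, or at depth `0` in an unlocked content. -/
def Active (R : Struct G Γ) (s : State Γ) (e : ℕ) : Prop :=
  ∀ k b, R.loc e = some (k, b) → s.Unlocked k b

/-- The positions on the in-edges of a sync node, in order. -/
def inPositions (R : Struct G Γ) (l : List (ℕ × ℕ)) : List Pos :=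
  l.flatMap fun p => (R.ty p.1).addrs.map (Pos.edge (R.inEdge p))

/-- The corresponding positions on the out-edges of a sync node. -/
def outPositions (R : Struct G Γ) (l : List (ℕ × ℕ)) : List Pos :=
  l.flatMap fun p => (R.ty p.1).addrs.map (Pos.edge (R.outEdge p))

/-- The moves of a single token: tokens on positive atoms go down, tokens on negative atoms
go up. -/
inductive Move (R : Struct G Γ) (s : State Γ) : Pos → Pos → Prop
  | ax (a b : ℕ) (m : List Bool) (h : Node.ax a b ∈ R.nodes ∨ Node.ax b a ∈ R.nodes)
      (hm : (R.ty a).pol m = some false) : Move R s (.edge a m) (.edge b m)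
  | cut (a b : ℕ) (m : List Bool) (h : Node.cut a b ∈ R.nodes ∨ Node.cut b a ∈ R.nodes)
      (hm : (R.ty a).pol m = some true) : Move R s (.edge a m) (.edge b m)
  | downLeft (a b c : ℕ) (m : List Bool)
      (h : Node.tens a b c ∈ R.nodes ∨ Node.par a b c ∈ R.nodes)
      (hm : (R.ty a).pol m = some true) : Move R s (.edge a m) (.edge c (false :: m))
  | downRight (a b c : ℕ) (m : List Bool)
      (h : Node.tens a b c ∈ R.nodes ∨ Node.par a b c ∈ R.nodes)
      (hm : (R.ty b).pol m = some true) : Move R s (.edge b m) (.edge c (true :: m))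
  | upLeft (a b c : ℕ) (m : List Bool)
      (h : Node.tens a b c ∈ R.nodes ∨ Node.par a b c ∈ R.nodes)
      (hm : (R.ty a).pol m = some false) : Move R s (.edge c (false :: m)) (.edge a m)
  | upRight (a b c : ℕ) (m : List Bool)
      (h : Node.tens a b c ∈ R.nodes ∨ Node.par a b c ∈ R.nodes)
      (hm : (R.ty b).pol m = some false) : Move R s (.edge c (true :: m)) (.edge b m)
  | exit (k : ℕ) (aux : List ℕ) (cont : Bool → List ℕ) (b : Bool) (x y : ℕ) (m : List Bool)
      (h : Node.box k aux cont ∈ R.nodes) (hu : s.Unlocked k b) (hxy : (x, y) ∈ (cont b).zip aux)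
      (hm : (R.ty x).pol m = some true) : Move R s (.edge x m) (.edge y m)
  | enter (k : ℕ) (aux : List ℕ) (cont : Bool → List ℕ) (b : Bool) (x y : ℕ) (m : List Bool)
      (h : Node.box k aux cont ∈ R.nodes) (hu : s.Unlocked k b) (hxy : (x, y) ∈ (cont b).zip aux)
      (hm : (R.ty y).pol m = some false) : Move R s (.edge y m) (.edge x m)

/-- The transitions of the machine, from states to finite distributions of states. -/
inductive Step (R : Struct G Γ) : State Γ → Fam (State Γ) → Prop
  /-- a token moves alone -/
  | move (s : State Γ) (x : InitPos Γ ⊕ s.ones) (p : Pos) (h : R.Move s (s.T x) p) :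
      Step R s (.pure { s with T := Function.update s.T x p })
  /-- all in-edges of a sync node are saturated: the tokens `q 0, q 1, …` found there cross
  together, and the operator is applied to their qubits -/
  | sync (s : State Γ) (u : G.Sym) (l : List (ℕ × ℕ)) (q : Fin (G.arity u) → InitPos Γ ⊕ s.ones)
      (T' : InitPos Γ ⊕ s.ones → Pos) (h : Node.sync u l ∈ R.nodes)
      (hin : List.ofFn (fun j => s.T (q j)) = R.inPositions l)
      (hout : List.ofFn (fun j => T' (q j)) = R.outPositions l)
      (hrest : ∀ x, (∀ j, q j ≠ x) → T' x = s.T x) :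
      Step R s (.pure ⟨s.ones, T', Qubits.applyGate (G.op u) q s.P⟩)
  /-- an active `one` node issues a token, with a qubit in state `|0⟩` -/
  | one (s : State Γ) (e : ℕ) (h : Node.one e ∈ R.nodes) (ha : R.Active s e) (he : e ∉ s.ones) :
      Step R s (.pure ⟨insert e s.ones,
        Sum.elim (fun i => s.T (.inl i)) (fun i => if hi : (i : ℕ) = e then .edge e []
          else s.T (.inr ⟨i, Finset.mem_of_mem_insert_of_ne i.2 hi⟩)),
        Qubits.adjoinZero
          (Sum.map id (fun i : s.ones => (⟨i, Finset.mem_insert_of_mem i.2⟩ :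
            (insert e s.ones : Finset ℕ))))
          (.inr ⟨e, Finset.mem_insert_self e s.ones⟩) s.P⟩)
  /-- a token on the lock of a box is measured, and the content of the box chosen accordingly -/
  | measure (s : State Γ) (x : InitPos Γ ⊕ s.ones) (k : ℕ) (aux : List ℕ) (cont : Bool → List ℕ)
      (h : Node.box k aux cont ∈ R.nodes) (hx : s.T x = .edge k []) :
      Step R s
        { ι := {b : Bool // Qubits.prob x b s.P ≠ 0}
          fin := Fintype.ofFinite _
          weight := fun b => Qubits.prob x b s.P
          pt := fun b =>
            ⟨s.ones, Function.update s.T x (.lock k b), Qubits.collapse x b s.P⟩ }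

/-- No transition applies. -/
def Terminal (R : Struct G Γ) (s : State Γ) : Prop := ∀ F, ¬ R.Step s F

def finPos (R : Struct G Γ) (j : FinPos Γ) : Pos := .edge (R.concl j.1) j.2

def initPos (R : Struct G Γ) (i : InitPos Γ) : Pos := .edge (R.concl i.1) i.2

/-- The positions `(k, b)` with `k` the lock of a box. -/
def botBox (R : Struct G Γ) : Set Pos :=
  {p | ∃ k b aux cont, Node.box k aux cont ∈ R.nodes ∧ p = .lock k b}

/-- The tokens fill exactly the final positions, apart from those on locks of boxes. -/
def FinalImage (R : Struct G Γ) (s : State Γ) : Prop :=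
  ∃ B ⊆ R.botBox, Set.range s.T = Set.range R.finPos ∪ B

/-- A run that ends in the state `s` yields the partial injection `f` and the register `φ`: `f` is
the restriction of `T` to the initial positions whose image is a final position, and `φ` is the
register of the qubits at the final positions (those of the tokens at positions `(k, b)` have the
classical value `b`). -/
def ReadOut (R : Struct G Γ) (s : State Γ) (f : InitPos Γ ≃. FinPos Γ) (φ : Qubits (FinPos Γ)) :
    Prop :=
  (∀ i j, f i = some j ↔ s.T (.inl i) = R.finPos j) ∧
  ∀ (g : FinPos Γ → Bool) (h : InitPos Γ ⊕ s.ones → Bool),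
    (∀ x j, s.T x = R.finPos j → h x = g j) → (∀ x k b, s.T x = .lock k b → h x = b) →
    φ g = s.P h

end Struct

/-- Results of the machine; `none` is the symbol for deadlock. -/
abbrev Outcome (Γ : Fin n → Formula) : Type :=
  Option ((InitPos Γ ≃. FinPos Γ) × Qubits (FinPos Γ))

/-- Multi-step evaluation of a state to a finite subdistribution of results. -/
inductive Struct.Eval (R : Struct G Γ) : State Γ → (Outcome Γ →₀ ℝ≥0) → Prop
  | zero (s : State Γ) : Struct.Eval R s 0
  | final (s : State Γ) (f : InitPos Γ ≃. FinPos Γ) (φ : Qubits (FinPos Γ))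
      (ht : R.Terminal s) (hs : R.FinalImage s) (ho : R.ReadOut s f φ) :
      Struct.Eval R s (Finsupp.single (some (f, φ)) 1)
  | stuck (s : State Γ) (ht : R.Terminal s) (hs : ¬ R.FinalImage s) :
      Struct.Eval R s (Finsupp.single none 1)
  | step (s : State Γ) (F : Fam (State Γ)) (D : F.ι → Outcome Γ →₀ ℝ≥0)
      (h : R.Step s F) (hD : ∀ i, Struct.Eval R (F.pt i) (D i)) :
      Struct.Eval R s (∑ i, F.weight i • D i)

/-- The initial state for the input `ψ`: there is a token on each initial position and on the
conclusion of each `one` node linked to the register `Q`, and the qubits are in state `ψ ⊗ Q`. -/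
noncomputable def QStruct.initState (R : QStruct G Γ) (ψ : Qubits (InitPos Γ)) : State Γ where
  ones := R.reg
  T := Sum.elim R.net.initPos (fun e => .edge e [])
  P := WithLp.toLp 2 fun x => ψ (fun i => x (.inl i)) * R.vec (fun e => x (.inr e))

/-- The interpretation `[𝐑]`: it maps each normalized input register to a distribution of results,
the supremum of the distributions to which the initial state evaluates. -/
noncomputable def QStruct.interp (R : QStruct G Γ) (ψ : {ψ : Qubits (InitPos Γ) // ‖ψ‖ = 1})
    (o : Outcome Γ) : ℝ≥0∞ :=
  ⨆ (D : Outcome Γ →₀ ℝ≥0) (_ : R.net.Eval (R.initState ψ) D), (D o : ℝ≥0∞)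

/-- The interpretation `[ℛ]` of a finite distribution of quantum nets. -/
noncomputable def interpDist (D : QStruct G Γ →₀ ℝ≥0) (ψ : {ψ : Qubits (InitPos Γ) // ‖ψ‖ = 1})
    (o : Outcome Γ) : ℝ≥0∞ :=
  D.sum fun S p => (p : ℝ≥0∞) * S.interp ψ o

end Machine

end QSMLL

/-! The interpretation is the value of a probabilistic transition system: the supremum of the
subdistributions of results to which a state evaluates by finite schedules. It is enough that one
reduction step preserves this value, averaged over its outcomes (`QRed.interp_eq`); multi-step
reduction follows by induction, because `interpDist` is linear. Two general principles compare
values.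

The first is confluence. Transitions that concern different tokens commute, also when both are
measurements (`Wiring.diam_of_disjoint`). Hence if the tokens of an enabled transition can do
nothing else, now or after other transitions, then every evaluation can be rearranged to begin with
it, and the value of the state is the average of the values of its outcomes
(`TSys.val_eq_of_diamond`, `Wiring.val_eq_of_committed`).

The second is bisimulation up to stuttering. If two systems match each other's steps except for
deterministic silent steps that decrease a measure, then related states evaluate to the same
distributions (`TSys.val_eq_of_bisim`). No hypothesis of global termination is involved, since only
finite evaluations are compared.

To apply these principles, a structure is replaced by its `Wiring`, which records only what the
machine sees: moves of single tokens with guards, synchronizations, sources of tokens, locks and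
final positions. Linearity of edges gives the decisive fact that each position is entered from at
most one node and left through at most one node (`Struct.prod_unique`, `Struct.cons_unique`).

Rules that leave the register alone are local changes of the graph. A `View` identifies the
positions on the two sides of the rewritten nodes and declares the moves through them silent;
`Wiring.Simulated.val_eq` then yields equal values. The structure `Surgery` reduces the verification
to the rewritten nodes. All commutations with sync nodes are instances of
`Struct.interp_eq_of_shift`: a node that only passes tokens on stands before the synchronization on
one side and after it on the other.

Rules that act on the register are reproduced by the machine at the start of its run. A new qubit is
the issue of a token (`Wiring.val_issue`). Execution of a sync node is a crossing to which all its
tokens are committed (`Wiring.val_sync`), after which the node can be erased. For the opening of a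
box, the token of the `one` node crosses the cut and is measured on the lock, again without
alternative (`Wiring.val_move`, `Wiring.val_meas`). It then stays at `(k, b)` forever, so it can be
forgotten and the content `b` declared permanently open (`Wiring.Discards.val_eq`). What remains is
a bisimulation in which crossing the border of the opened box is silent and the other content is
unreachable (`Opening.simulated`, `Opening.simulated'`). -/

namespace QSMLL

/-! ### Probabilistic transition systems -/

/-- A transition system with finite probabilistic branching, and results of terminal states. -/
structure TSys (α O : Type) where
  step : α → Fam α → Prop
  res : α → O → Prop

namespace TSys

variable {α β O : Type}

def Terminal (X : TSys α O) (s : α) : Prop := ∀ F, ¬ X.step s F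

inductive Eval (X : TSys α O) : α → (O →₀ ℝ≥0) → Prop
  | zero (s : α) : Eval X s 0
  | final (s : α) (o : O) (ht : X.Terminal s) (ho : X.res s o) : Eval X s (Finsupp.single o 1)
  | step (s : α) (F : Fam α) (D : F.ι → O →₀ ℝ≥0) (h : X.step s F)
      (hD : ∀ i, Eval X (F.pt i) (D i)) : Eval X s (∑ i, F.weight i • D i)

/-- Supremum of the subdistributions of results to which a state evaluates. -/
noncomputable def val (X : TSys α O) (s : α) (o : O) : ℝ≥0∞ :=
  ⨆ (D : O →₀ ℝ≥0) (_ : X.Eval s D), (D o : ℝ≥0∞)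

theorem Eval.le_val {X : TSys α O} {s : α} {D : O →₀ ℝ≥0} (h : X.Eval s D) (o : O) :
    (D o : ℝ≥0∞) ≤ X.val s o :=
  le_iSup₂ (f := fun (D : O →₀ ℝ≥0) (_ : X.Eval s D) => (D o : ℝ≥0∞)) D h

theorem coe_sum_smul {ι : Type} [Fintype ι] (w : ι → ℝ≥0) (D : ι → O →₀ ℝ≥0) (o : O) :
    (((∑ i, w i • D i) o : ℝ≥0) : ℝ≥0∞) = ∑ i, (w i : ℝ≥0∞) * (D i o : ℝ≥0∞) := by
  rw [Finsupp.finsetSum_apply]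
  push_cast
  simp

theorem sum_pure {M : Type*} [AddCommMonoid M] (x : α) (f : (Fam.pure x).ι → M) :
    ∑ i, f i = f () := by
  exact Finset.sum_singleton f ()

theorem val_eq_iSup (X : TSys α O) (s : α) (o : O) :
    X.val s o = ⨆ D : {D // X.Eval s D}, (D.1 o : ℝ≥0∞) := by
  rw [val, iSup_subtype']

/-- Evaluations of the outcomes can be chosen independently, so a finite sum of suprema is a
supremum of sums, each of which is an evaluation starting with `F`. The induction takes the suprema
one outcome at a time: those in `A` are already taken, the others still use a given evaluation `D`.
-/
theorem sum_val_le {X : TSys α O} {s : α} {F : Fam α} (h : X.step s F) (o : O) :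
    ∑ i, (F.weight i : ℝ≥0∞) * X.val (F.pt i) o ≤ X.val s o := by
  classical
  have key : ∀ A : Finset F.ι, ∀ D : F.ι → O →₀ ℝ≥0, (∀ i, X.Eval (F.pt i) (D i)) →
      ∑ i ∈ A, (F.weight i : ℝ≥0∞) * X.val (F.pt i) o +
        ∑ i ∈ Finset.univ \ A, (F.weight i : ℝ≥0∞) * (D i o : ℝ≥0∞) ≤ X.val s o := by
    intro A
    induction A using Finset.induction_on with
    | empty =>
      intro D hD
      simpa [coe_sum_smul] using (Eval.step s F D h hD).le_val o
    | insert a A ha ih =>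
      intro D hD
      have hsp : ∀ D' : F.ι → O →₀ ℝ≥0, ∑ i ∈ Finset.univ \ A, (F.weight i : ℝ≥0∞) * (D' i o : ℝ≥0∞)
          = (F.weight a : ℝ≥0∞) * (D' a o : ℝ≥0∞) +
            ∑ i ∈ Finset.univ \ insert a A, (F.weight i : ℝ≥0∞) * (D' i o : ℝ≥0∞) := by
        intro D'
        rw [← Finset.sum_insert (f := fun i => (F.weight i : ℝ≥0∞) * (D' i o : ℝ≥0∞)) (by simp)]
        congr 1
        ext i
        by_cases hi : i = a <;> simp [hi, ha]
      -- Moving a supremum out of a sum needs a nonempty index set; the zero evaluation provides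
      -- one.
      have : Nonempty {D // X.Eval (F.pt a) D} := ⟨⟨0, .zero _⟩⟩
      rw [Finset.sum_insert ha, val_eq_iSup X (F.pt a), ENNReal.mul_iSup, ENNReal.iSup_add,
        ENNReal.iSup_add]
      refine iSup_le fun ⟨Da, hDa⟩ => ?_
      refine le_trans (le_of_eq ?_) (ih (Function.update D a Da) fun i => ?_)
      · rw [hsp, Function.update_self]
        have : ∑ i ∈ Finset.univ \ insert a A,
            (F.weight i : ℝ≥0∞) * ((Function.update D a Da i o : ℝ≥0) : ℝ≥0∞) =
            ∑ i ∈ Finset.univ \ insert a A, (F.weight i : ℝ≥0∞) * (D i o : ℝ≥0∞) := by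
          refine Finset.sum_congr rfl fun i hi => ?_
          rw [Function.update_of_ne]
          rintro rfl
          simp at hi
        rw [this]
        ring
      · by_cases hi : i = a
        · subst hi; simpa using hDa
        · simpa [hi] using hD i
  simpa using key Finset.univ (fun _ => 0) fun i => Eval.zero _

/-- A step that commutes with all the other steps does not change the value. -/
theorem val_eq_of_diamond (X : TSys α O) (P : α → Fam α → Prop)
    (hstep : ∀ s F, P s F → X.step s F)
    (hdiam : ∀ s F G, P s F → X.step s G → G = F ∨
      ∃ (K : G.ι → Fam α) (L : F.ι → Fam α), (∀ j, P (G.pt j) (K j)) ∧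
        (∀ i, X.step (F.pt i) (L i)) ∧ ∀ V : α → ℝ≥0∞,
          ∑ j, (G.weight j : ℝ≥0∞) * ∑ m, ((K j).weight m : ℝ≥0∞) * V ((K j).pt m) =
          ∑ i, (F.weight i : ℝ≥0∞) * ∑ m, ((L i).weight m : ℝ≥0∞) * V ((L i).pt m))
    {s : α} {F : Fam α} (h : P s F) (o : O) :
    X.val s o = ∑ i, (F.weight i : ℝ≥0∞) * X.val (F.pt i) o := by
  refine le_antisymm ?_ (sum_val_le (hstep s F h) o)
  -- An evaluation may postpone the step `F`. Induction on the evaluation brings it to the front.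
  refine iSup₂_le fun D hD => ?_
  induction hD generalizing F with
  | zero s => simp
  | final s o' ht ho => exact absurd (hstep s F h) (ht F)
  | step s G D hG hD ih =>
    rw [coe_sum_smul]
    -- If the evaluation starts with another step `G`, the distinguished step is still available
    -- after `G`, where the induction hypothesis applies; the diamond then exchanges the two steps.
    -- Two-step distributions are compared by integrating functions `V`, so no reindexing of
    -- families is needed.
    rcases hdiam s F G h hG with rfl | ⟨K, L, hK, hL, hV⟩
    · gcongr with i
      exact (hD i).le_val o
    · calc _ ≤ ∑ j, (G.weight j : ℝ≥0∞) *
            ∑ m, ((K j).weight m : ℝ≥0∞) * X.val ((K j).pt m) o := by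
            gcongr with j
            exact ih j (hK j)
        _ = _ := hV fun t => X.val t o
        _ ≤ _ := by
            gcongr with i
            exact sum_val_le (hL i) o

/-- Families related pointwise, up to a reindexing. -/
def FamRel (Rel : α → β → Prop) (F : Fam α) (F' : Fam β) : Prop :=
  ∃ e : F.ι ≃ F'.ι, ∀ i, F.weight i = F'.weight (e i) ∧ Rel (F.pt i) (F'.pt (e i))

theorem FamRel.flip {Rel : α → β → Prop} {F : Fam α} {F' : Fam β} (h : FamRel Rel F F') :
    FamRel (fun t s => Rel s t) F' F := by
  obtain ⟨e, he⟩ := h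
  refine ⟨e.symm, fun i => ?_⟩
  have := he (e.symm i)
  simp only [Equiv.apply_symm_apply] at this
  exact ⟨this.1.symm, this.2⟩

theorem famRel_pure {Rel : α → β → Prop} {s : α} {t : β} (h : Rel s t) :
    FamRel Rel (.pure s) (.pure t) := ⟨Equiv.refl _, fun _ => ⟨rfl, h⟩⟩

/-- Sequences of deterministic steps. -/
def Runs (X : TSys α O) : α → α → Prop := Relation.ReflTransGen fun s t => X.step s (.pure t)

theorem Eval.of_runs {X : TSys α O} {s t : α} (h : X.Runs s t) {D : O →₀ ℝ≥0} (hD : X.Eval t D) :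
    X.Eval s D := by
  induction h using Relation.ReflTransGen.head_induction_on with
  | refl => exact hD
  | head h _ ih =>
    have := Eval.step _ (Fam.pure _) (fun _ => D) h (fun _ => ih)
    rw [sum_pure] at this
    simpa [Fam.pure] using this

/-- One half of a stuttering bisimulation: each step of `X` is either matched by no step of `Y` (and
then the measure `μ` decreases), or by a step of `Y` preceded by deterministic steps. -/
def Sim (X : TSys α O) (Y : TSys β O) (Rel : α → β → Prop) (μ : α → ℕ) : Prop :=
  ∀ s t F, Rel s t → X.step s F →
    (∃ s', F = .pure s' ∧ Rel s' t ∧ μ s' < μ s) ∨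
    ∃ t' F', Y.Runs t t' ∧ Y.step t' F' ∧ FamRel Rel F F'

/-- While `t` is not terminal, each of its steps must be unmatched, since a matching step would give
a step from the terminal `s`. Unmatched steps preserve the relation and decrease `μ`, so they come
to an end. -/
theorem Sim.exists_terminal {X : TSys α O} {Y : TSys β O} {Rel : α → β → Prop} {μ : β → ℕ}
    (h : Sim Y X (fun t s => Rel s t) μ) {s : α} (hs : X.Terminal s) :
    ∀ t, Rel s t → ∃ t', Y.Runs t t' ∧ Rel s t' ∧ Y.Terminal t' := by
  have : ∀ n t, μ t = n → Rel s t → ∃ t', Y.Runs t t' ∧ Rel s t' ∧ Y.Terminal t' := by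
    intro n
    induction n using Nat.strong_induction_on with
    | _ n ih =>
      intro t hn ht
      by_cases hT : Y.Terminal t
      · exact ⟨t, .refl, ht, hT⟩
      · simp only [Terminal, not_forall, not_not] at hT
        obtain ⟨F, hF⟩ := hT
        rcases h t s F ht hF with ⟨t', rfl, ht', hlt⟩ | ⟨s', F', hr, hF', -⟩
        · obtain ⟨t'', h1, h2, h3⟩ := ih _ (hn ▸ hlt) t' rfl ht'
          exact ⟨t'', .head hF h1, h2, h3⟩
        · rcases Relation.ReflTransGen.cases_head hr with rfl | ⟨s'', h1, -⟩
          · exact absurd hF' (hs _)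
          · exact absurd h1 (hs _)
  exact fun t => this _ t rfl

/-- Unmatched steps are deterministic of weight one, so they do not change the distribution
obtained; matched ones are copied, with deterministic steps inserted before them. -/
theorem Sim.eval {X : TSys α O} {Y : TSys β O} {Rel : α → β → Prop} {μ : α → ℕ} {μ' : β → ℕ}
    (h : Sim X Y Rel μ) (h' : Sim Y X (fun t s => Rel s t) μ')
    (hres : ∀ s t, Rel s t → X.Terminal s → Y.Terminal t → ∀ o, X.res s o → Y.res t o)
    {s : α} {D : O →₀ ℝ≥0} (hD : X.Eval s D) : ∀ t, Rel s t → Y.Eval t D := by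
  induction hD with
  | zero s => exact fun t _ => .zero t
  -- The partner of a terminal state may still have silent steps to perform before a result can be
  -- read off.
  | final s o ht ho =>
    intro t hR
    obtain ⟨t', h1, h2, h3⟩ := h'.exists_terminal ht t hR
    exact .of_runs h1 (.final t' o h3 (hres s t' h2 ht h3 o ho))
  | step s F D hF hD ih =>
    intro t hR
    rcases h s t F hR hF with ⟨s', rfl, hR', -⟩ | ⟨t', F', hr, hF', e, he⟩
    · rw [sum_pure]
      simpa [Fam.pure] using ih () t hR'
    · refine .of_runs hr ?_
      have := Eval.step t' F' (fun i => D (e.symm i)) hF' fun i => by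
        refine ih (e.symm i) _ ?_
        have := (he (e.symm i)).2
        rwa [e.apply_symm_apply] at this
      convert this using 1
      refine Fintype.sum_equiv e _ _ fun i => ?_
      rw [e.symm_apply_apply, (he i).1]

/-- Related states evaluate to exactly the same distributions, by `Sim.eval` in both directions, so
the two suprema agree. -/
theorem val_eq_of_bisim {X : TSys α O} {Y : TSys β O} {Rel : α → β → Prop} {μ : α → ℕ} {μ' : β → ℕ}
    (h : Sim X Y Rel μ) (h' : Sim Y X (fun t s => Rel s t) μ')
    (hres : ∀ s t, Rel s t → X.Terminal s → Y.Terminal t → ∀ o, X.res s o ↔ Y.res t o)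
    {s : α} {t : β} (hR : Rel s t) (o : O) : X.val s o = Y.val t o := by
  refine le_antisymm (iSup₂_le fun D hD => ?_) (iSup₂_le fun D hD => ?_)
  · exact (h.eval h' (fun s t r a b o => (hres s t r a b o).1) hD t hR).le_val o
  · exact (h'.eval (Rel := fun t s => Rel s t) h
      (fun t s r a b o => (hres s t r b a o).2) hD s hR).le_val o

end TSys

end QSMLL

namespace QSMLL

/-! ### Operations on registers -/

namespace Qubits

variable {ι κ : Type}

/-- `Q ⊗ |r ← b⟩`: the qubits of `Q` are embedded by `f`, and `r` is the new qubit. -/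
noncomputable def adjoinBit (f : ι → κ) (r : κ) (b : Bool) (Q : Qubits ι) : Qubits κ :=
  WithLp.toLp 2 fun x => if x r = b then Q (x ∘ f) else 0

theorem adjoinZero_eq (f : ι → κ) (r : κ) (Q : Qubits ι) :
    adjoinZero f r Q = adjoinBit f r false Q := by
  ext x
  simp only [adjoinZero, adjoinBit]
  cases x r <;> simp

theorem extend_comp_apply {α : Type} {q : α → ι} {f : ι → κ} (hf : f.Injective)
    (y : α → Bool) (x : κ → Bool) :
    Function.extend (f ∘ q) y x ∘ f = Function.extend q y (x ∘ f) := by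
  classical
  funext i
  by_cases h : ∃ j, q j = i
  · simp only [Function.comp, Function.extend_def]
    have e : ∀ a, f (q a) = f i ↔ q a = i := fun a => hf.eq_iff
    simp [e]
  · rw [Function.comp, Function.extend_apply' _ _ _ h, Function.extend_apply']
    · rfl
    · rintro ⟨j, hj⟩
      exact h ⟨j, hf hj⟩

/-- A gate on old qubits overwrites no value at `r`, so the test on the new qubit can be taken
before or after the gate. -/
theorem applyGate_adjoinBit {n : ℕ} (U : Matrix (Fin n → Bool) (Fin n → Bool) ℂ) (q : Fin n → ι)
    {f : ι → κ} (hf : f.Injective) {r : κ} (hr : ∀ i, f i ≠ r) (b : Bool) (Q : Qubits ι) :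
    applyGate U (f ∘ q) (adjoinBit f r b Q) = adjoinBit f r b (applyGate U q Q) := by
  ext x
  simp only [applyGate, adjoinBit]
  have h : ∀ y : Fin n → Bool, Function.extend (f ∘ q) y x r = x r := fun y =>
    Function.extend_apply' _ _ _ fun ⟨j, hj⟩ => hr _ hj
  simp only [h, extend_comp_apply hf]
  split_ifs
  · rfl
  · simp

theorem proj_adjoinBit {f : ι → κ} {r : κ} (i : ι) (c b : Bool) (Q : Qubits ι) :
    proj (f i) c (adjoinBit f r b Q) = adjoinBit f r b (proj i c Q) := by
  ext x
  simp only [proj, adjoinBit, Function.comp]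
  split_ifs <;> rfl

theorem adjoinBit_smul (f : ι → κ) (r : κ) (b : Bool) (a : ℂ) (Q : Qubits ι) :
    adjoinBit f r b (a • Q) = a • adjoinBit f r b Q := by
  ext x
  simp only [adjoinBit, PiLp.smul_apply]
  split_ifs <;> simp

theorem norm_sq_eq [Fintype ι] [DecidableEq ι] (Q : Qubits ι) : ‖Q‖ ^ 2 = ∑ x, ‖Q x‖ ^ 2 :=
  EuclideanSpace.norm_sq_eq Q

/-- The amplitudes vanish unless `r` has value `b`, and by `hs` the assignments with that value
correspond bijectively to the assignments of the old qubits. -/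
theorem norm_adjoinBit [Fintype ι] [DecidableEq ι] [Fintype κ] [DecidableEq κ] {f : ι → κ}
    (hf : f.Injective) {r : κ} (hr : ∀ i, f i ≠ r) (hs : ∀ k, k = r ∨ ∃ i, f i = k) (b : Bool)
    (Q : Qubits ι) : ‖adjoinBit f r b Q‖ = ‖Q‖ := by
  rw [← sq_eq_sq₀ (norm_nonneg _) (norm_nonneg _), norm_sq_eq, norm_sq_eq]
  symm
  refine Finset.sum_of_injOn (fun y => Function.extend f y fun _ => b) ?_ ?_ ?_ ?_
  · intro y _ y' _ h
    funext i
    have := congrFun h (f i)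
    simpa [hf.extend_apply] using this
  · simp
  · intro x _ hx
    simp only [adjoinBit]
    rw [if_neg]
    · simp
    · intro hb
      refine hx ⟨x ∘ f, by simp, ?_⟩
      funext k
      change Function.extend f (x ∘ f) (fun _ => b) k = x k
      rcases hs k with rfl | ⟨i, rfl⟩
      · rw [Function.extend_apply' _ _ _ fun ⟨i, hi⟩ => hr i hi, hb]
      · rw [hf.extend_apply]; rfl
  · intro y _
    simp only [adjoinBit]
    rw [if_pos (Function.extend_apply' _ _ _ fun ⟨i, hi⟩ => hr i hi)]
    have : (Function.extend f y fun _ => b) ∘ f = y := by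
      funext i
      simp [hf.extend_apply]
    rw [this]

section

variable [Fintype ι] [DecidableEq ι] [Fintype κ] [DecidableEq κ]

theorem prob_adjoinBit {f : ι → κ} (hf : f.Injective) {r : κ} (hr : ∀ i, f i ≠ r)
    (hs : ∀ k, k = r ∨ ∃ i, f i = k) (i : ι) (c b : Bool) (Q : Qubits ι) :
    prob (f i) c (adjoinBit f r b Q) = prob i c Q := by
  rw [prob, prob, proj_adjoinBit]
  congr 1
  exact NNReal.eq (norm_adjoinBit hf hr hs b _)

theorem collapse_adjoinBit {f : ι → κ} (hf : f.Injective) {r : κ} (hr : ∀ i, f i ≠ r)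
    (hs : ∀ k, k = r ∨ ∃ i, f i = k) (i : ι) (c b : Bool) (Q : Qubits ι) :
    collapse (f i) c (adjoinBit f r b Q) = adjoinBit f r b (collapse i c Q) := by
  rw [collapse, collapse, proj_adjoinBit, norm_adjoinBit hf hr hs, adjoinBit_smul]

end

theorem proj_comm (i j : ι) (b c : Bool) (Q : Qubits ι) :
    proj i b (proj j c Q) = proj j c (proj i b Q) := by
  ext x
  simp only [proj]
  split_ifs <;> rfl

theorem proj_smul (i : ι) (b : Bool) (a : ℂ) (Q : Qubits ι) :
    proj i b (a • Q) = a • proj i b Q := by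
  ext x
  simp only [proj, PiLp.smul_apply]
  split_ifs <;> simp

/-! Gates -/

variable {n m : ℕ}

theorem extend_comp_self {α : Type} {q : α → ι} (hq : q.Injective) (y : α → Bool) (x : ι → Bool) :
    Function.extend q y x ∘ q = y := by
  funext j
  simp [hq.extend_apply]

theorem extend_extend_self {α : Type} (q : α → ι) (y : α → Bool) (x : ι → Bool) (hy : y = x ∘ q) :
    Function.extend q y x = x := by
  classical
  funext i
  subst hy
  by_cases h : ∃ j, q j = i
  · simp only [Function.extend_def, h, dif_pos]
    exact congrArg x (Classical.choose_spec h)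
  · exact Function.extend_apply' _ _ _ h

theorem extend_extend {α : Type} (q : α → ι) (y z : α → Bool) (x : ι → Bool) :
    Function.extend q y (Function.extend q z x) = Function.extend q y x := by
  classical
  funext i
  by_cases h : ∃ j, q j = i
  · simp only [Function.extend_def, h, dif_pos]
  · rw [Function.extend_apply' _ _ _ h, Function.extend_apply' _ _ _ h,
      Function.extend_apply' _ _ _ h]

theorem extend_comm {α β : Type} {q : α → ι} {q' : β → ι} (h : ∀ i j, q i ≠ q' j)
    (y : α → Bool) (z : β → Bool) (x : ι → Bool) :
    Function.extend q y (Function.extend q' z x) = Function.extend q' z (Function.extend q y x) := by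
  classical
  funext i
  by_cases h1 : ∃ j, q j = i
  · have h2 : ¬ ∃ j, q' j = i := by
      rintro ⟨j', rfl⟩
      obtain ⟨j, hj⟩ := h1
      exact h _ _ hj
    rw [Function.extend_apply' (f := q') _ _ _ h2]
    simp only [Function.extend_def, h1, dif_pos]
  · rw [Function.extend_apply' (f := q) _ _ _ h1]
    by_cases h2 : ∃ j, q' j = i
    · simp only [Function.extend_def, h2, dif_pos]
    · rw [Function.extend_apply' _ _ _ h2, Function.extend_apply' _ _ _ h2,
        Function.extend_apply' _ _ _ h1]

theorem extend_comp_disjoint {α β : Type} {q : α → ι} {q' : β → ι} (h : ∀ i j, q i ≠ q' j)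
    (y : α → Bool) (x : ι → Bool) : Function.extend q y x ∘ q' = x ∘ q' := by
  funext j
  exact Function.extend_apply' _ _ _ fun ⟨i, hi⟩ => h i j hi

/-- For disjoint sets of qubits the overwritings commute and neither gate reads what the other one
writes, so both sides are the same double sum. -/
theorem applyGate_comm (U : Matrix (Fin n → Bool) (Fin n → Bool) ℂ)
    (V : Matrix (Fin m → Bool) (Fin m → Bool) ℂ) {q : Fin n → ι} {q' : Fin m → ι}
    (h : ∀ i j, q i ≠ q' j) (Q : Qubits ι) :
    applyGate U q (applyGate V q' Q) = applyGate V q' (applyGate U q Q) := by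
  ext x
  simp only [applyGate, Finset.mul_sum, extend_comp_disjoint h,
    extend_comp_disjoint (fun i j => (h j i).symm)]
  rw [Finset.sum_comm]
  refine Finset.sum_congr rfl fun z _ => Finset.sum_congr rfl fun y _ => ?_
  rw [extend_comm (fun i j => (h j i).symm)]
  ring

theorem applyGate_proj (U : Matrix (Fin n → Bool) (Fin n → Bool) ℂ) {q : Fin n → ι} {i : ι}
    (h : ∀ j, q j ≠ i) (b : Bool) (Q : Qubits ι) :
    proj i b (applyGate U q Q) = applyGate U q (proj i b Q) := by
  ext x
  have h' : ∀ y, Function.extend q y x i = x i := fun y =>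
    Function.extend_apply' _ _ _ fun ⟨j, hj⟩ => h j hj
  simp only [applyGate, proj, h']
  split_ifs
  · rfl
  · simp

theorem applyGate_smul (U : Matrix (Fin n → Bool) (Fin n → Bool) ℂ) (q : Fin n → ι) (a : ℂ)
    (Q : Qubits ι) : applyGate U q (a • Q) = a • applyGate U q Q := by
  ext x
  simp only [applyGate, PiLp.smul_apply, smul_eq_mul, Finset.mul_sum]
  exact Finset.sum_congr rfl fun y _ => by ring

theorem applyGate_mul (U V : Matrix (Fin n → Bool) (Fin n → Bool) ℂ) {q : Fin n → ι}
    (hq : q.Injective) (Q : Qubits ι) :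
    applyGate U q (applyGate V q Q) = applyGate (U * V) q Q := by
  ext x
  simp only [applyGate, extend_comp_self hq, extend_extend, Matrix.mul_apply, Finset.mul_sum,
    Finset.sum_mul]
  rw [Finset.sum_comm]
  exact Finset.sum_congr rfl fun z _ => Finset.sum_congr rfl fun y _ => by ring

theorem applyGate_one (q : Fin n → ι) (Q : Qubits ι) :
    applyGate (1 : Matrix (Fin n → Bool) (Fin n → Bool) ℂ) q Q = Q := by
  ext x
  simp only [applyGate, Matrix.one_apply]
  rw [Finset.sum_eq_single (x ∘ q)]
  · simp [extend_extend_self q _ x rfl]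
  · intro y _ hy
    simp [Ne.symm hy]
  · simp

section

variable [Fintype ι] [DecidableEq ι]

/-- Exchange of the bits of `x` at `q` with `y`. -/
noncomputable def swapAt (q : Fin n → ι) (p : (ι → Bool) × (Fin n → Bool)) : (ι → Bool) × (Fin n → Bool) :=
  (Function.extend q p.2 p.1, p.1 ∘ q)

/-- Both inner products are sums over pairs of an assignment of the register and an assignment of
the gate's qubits. The involution `swapAt` turns one summand into the other. -/
theorem inner_applyGate (U : Matrix (Fin n → Bool) (Fin n → Bool) ℂ) {q : Fin n → ι}
    (hq : q.Injective) (P Q : Qubits ι) :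
    inner ℂ (applyGate U q P) Q = inner ℂ P (applyGate U.conjTranspose q Q) := by
  simp only [PiLp.inner_apply, RCLike.inner_apply, applyGate, map_sum, Finset.mul_sum,
    Finset.sum_mul, map_mul]
  rw [← Finset.sum_product', ← Finset.sum_product', Finset.univ_product_univ]
  have inv : Function.Involutive (swapAt q) := by
    rintro ⟨x, y⟩
    simp only [swapAt, extend_comp_self hq, extend_extend]
    rw [extend_extend_self q _ x rfl]
  refine Fintype.sum_equiv inv.toPerm _ _ ?_
  rintro ⟨x, y⟩
  simp only [Function.Involutive.coe_toPerm, swapAt, extend_comp_self hq, extend_extend,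
    Matrix.conjTranspose_apply]
  rw [extend_extend_self q _ x rfl]
  simp only [starRingEnd_apply]
  ring

/-- By `inner_applyGate` the adjoint of the gate is the gate of the conjugate transpose, and for
injective `q` the composite is the gate of the product matrix, which is `1`. -/
theorem norm_applyGate (U : Matrix.unitaryGroup (Fin n → Bool) ℂ) {q : Fin n → ι}
    (hq : q.Injective) (Q : Qubits ι) : ‖applyGate U q Q‖ = ‖Q‖ := by
  have h : inner ℂ (applyGate (U : Matrix (Fin n → Bool) (Fin n → Bool) ℂ) q Q)
      (applyGate (U : Matrix (Fin n → Bool) (Fin n → Bool) ℂ) q Q) = inner ℂ Q Q := by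
    rw [inner_applyGate _ hq, applyGate_mul _ _ hq]
    have : (U : Matrix (Fin n → Bool) (Fin n → Bool) ℂ).conjTranspose * U = 1 := U.2.1
    rw [this, applyGate_one]
  rw [inner_self_eq_norm_sq_to_K, inner_self_eq_norm_sq_to_K] at h
  have h2 : ‖applyGate (U : Matrix (Fin n → Bool) (Fin n → Bool) ℂ) q Q‖ ^ 2 = ‖Q‖ ^ 2 := by
    exact_mod_cast h
  exact (sq_eq_sq₀ (norm_nonneg _) (norm_nonneg _)).1 h2

theorem prob_applyGate (U : Matrix.unitaryGroup (Fin n → Bool) ℂ) {q : Fin n → ι}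
    (hq : q.Injective) {i : ι} (h : ∀ j, q j ≠ i) (b : Bool) (Q : Qubits ι) :
    prob i b (applyGate U q Q) = prob i b Q := by
  rw [prob, prob, applyGate_proj _ h]
  congr 1
  exact NNReal.eq (norm_applyGate U hq _)

theorem collapse_applyGate (U : Matrix.unitaryGroup (Fin n → Bool) ℂ) {q : Fin n → ι}
    (hq : q.Injective) {i : ι} (h : ∀ j, q j ≠ i) (b : Bool) (Q : Qubits ι) :
    collapse i b (applyGate U q Q) = applyGate U q (collapse i b Q) := by
  rw [collapse, collapse, applyGate_proj _ h, norm_applyGate U hq, applyGate_smul]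

theorem prob_ne_zero {i : ι} {b : Bool} {Q : Qubits ι} : prob i b Q ≠ 0 ↔ ‖proj i b Q‖ ≠ 0 := by
  simp [prob]

/-- The joint probability of two observations. -/
theorem prob_mul_prob {i j : ι} {b c : Bool} {Q : Qubits ι} (h : prob j c Q ≠ 0) :
    prob j c Q * prob i b (collapse j c Q) = ‖proj i b (proj j c Q)‖₊ ^ 2 := by
  have h0 := prob_ne_zero.1 h
  apply NNReal.eq
  simp only [prob, collapse, proj_smul, NNReal.coe_mul, NNReal.coe_pow, coe_nnnorm, norm_smul,
    Complex.norm_real, norm_inv, norm_norm]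
  field_simp

/-- Both sides are multiples of the same joint projection, and the intermediate normalizations
cancel. The joint probability may be zero; both sides are then zero. -/
theorem collapse_comm {i j : ι} {b c : Bool} {Q : Qubits ι} (hj : prob j c Q ≠ 0)
    (hi : prob i b Q ≠ 0) :
    collapse i b (collapse j c Q) = collapse j c (collapse i b Q) := by
  have h1 := prob_ne_zero.1 hi
  have h2 := prob_ne_zero.1 hj
  simp only [collapse, proj_smul, norm_smul, Complex.norm_real, norm_inv, norm_norm,
    proj_comm j i c b Q, smul_smul]
  congr 1
  push_cast
  have h1' : (‖proj i b Q‖ : ℂ) ≠ 0 := by exact_mod_cast h1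
  have h2' : (‖proj j c Q‖ : ℂ) ≠ 0 := by exact_mod_cast h2
  simp only [mul_inv, inv_inv]
  field_simp

end

end Qubits

end QSMLL

namespace QSMLL

/-! ### Wirings -/

section Wirings

variable {G : GateSet} {n : ℕ} {Γ : Fin n → Formula}

/-- Global names of tokens. -/
abbrev Tok (Γ : Fin n → Formula) : Type := InitPos Γ ⊕ ℕ

/-- The index type of the tokens depends on the state. Global names make it possible to speak of the
same token in different states. -/
def tok {o : Finset ℕ} (x : InitPos Γ ⊕ o) : Tok Γ := Sum.map id Subtype.val x

theorem tok_injective {o : Finset ℕ} : Function.Injective (tok : InitPos Γ ⊕ o → Tok Γ) :=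
  Function.injective_id.sumMap Subtype.val_injective

/-- What the token machine sees of a structure: the moves of single tokens, with their guards, the
synchronizations, the sources of tokens with their guards, the locks of boxes and the final
positions. -/
structure Wiring (G : GateSet) {n : ℕ} (Γ : Fin n → Formula) : Type where
  mv : Option (ℕ × Bool) → Pos → Pos → Prop
  syn : G.Sym → List Pos → List Pos → Prop
  one : Option (ℕ × Bool) → ℕ → Prop
  box : ℕ → Prop
  fin : FinPos Γ → Pos
  mv_edge : ∀ {g p q}, mv g p q → ∃ e m, p = .edge e m
  syn_edge : ∀ {u I O}, syn u I O → ∀ p ∈ I, ∃ e m, p = .edge e m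
  syn_nodup : ∀ {u I O}, syn u I O → I.Nodup

namespace State

/-- For states whose sets `ones` are equal only propositionally, comparing through global names
avoids transport along that equality. -/
theorem ext_tok {s t : State Γ} (h : s.ones = t.ones) (hT : ∀ x y, tok x = tok y → s.T x = t.T y)
    (hP : ∀ f : Tok Γ → Bool, s.P (fun x => f (tok x)) = t.P (fun x => f (tok x))) : s = t := by
  obtain ⟨o, T, P⟩ := s
  obtain ⟨o', T', P'⟩ := t
  obtain rfl : o = o' := h
  obtain rfl : T = T' := funext fun x => hT x x rfl
  obtain rfl : P = P' := by
    ext x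
    -- Every assignment of the local tokens is the restriction of one of the global names, with an
    -- irrelevant default outside.
    have : (fun i => Function.extend tok x (fun _ => false) (tok i)) = x := by
      funext i
      simp [tok_injective.extend_apply]
    have h2 := hP (Function.extend tok x fun _ => false)
    simp only [this] at h2
    exact h2
  rfl

theorem mk_congr {o : Finset ℕ} {T T' : InitPos Γ ⊕ o → Pos} {P P' : Qubits (InitPos Γ ⊕ o)}
    (hT : T = T') (hP : P = P') : (⟨o, T, P⟩ : State Γ) = ⟨o, T', P'⟩ := by rw [hT, hP]

/-- The guard is satisfied. -/
def Opens (s : State Γ) (g : Option (ℕ × Bool)) : Prop := ∀ k b, g = some (k, b) → s.Unlocked k b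

theorem Opens.mono {s t : State Γ} {g : Option (ℕ × Bool)} (h : s.Opens g)
    (hst : ∀ k b, s.Unlocked k b → t.Unlocked k b) : t.Opens g :=
  fun k b hg => hst k b (h k b hg)

def emb {o : Finset ℕ} (e : ℕ) (x : InitPos Γ ⊕ o) : InitPos Γ ⊕ (insert e o : Finset ℕ) :=
  Sum.map id (fun i : o => (⟨i, Finset.mem_insert_of_mem i.2⟩ : (insert e o : Finset ℕ))) x

def new (Γ : Fin n → Formula) (o : Finset ℕ) (e : ℕ) : InitPos Γ ⊕ (insert e o : Finset ℕ) :=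
  .inr ⟨e, Finset.mem_insert_self e o⟩

/-- This has literally the form used in the machine's rule for `one` nodes, so that the translation
in `Struct.step_iff` is definitional. -/
def issueT {o : Finset ℕ} (e : ℕ) (T : InitPos Γ ⊕ o → Pos) :
    InitPos Γ ⊕ (insert e o : Finset ℕ) → Pos :=
  Sum.elim (fun i => T (.inl i)) (fun i => if hi : (i : ℕ) = e then .edge e []
    else T (.inr ⟨i, Finset.mem_of_mem_insert_of_ne i.2 hi⟩))

theorem issueT_inr {o : Finset ℕ} (e : ℕ) (T : InitPos Γ ⊕ o → Pos) (i : ℕ)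
    (hi : i ∈ insert e o) : issueT e T (.inr ⟨i, hi⟩) = if h : i = e then .edge e []
      else T (.inr ⟨i, Finset.mem_of_mem_insert_of_ne hi h⟩) := rfl

/-- The state after a new token has been issued. -/
noncomputable def issue (s : State Γ) (e : ℕ) : State Γ :=
  ⟨insert e s.ones, issueT e s.T, Qubits.adjoinZero (emb e) (new Γ s.ones e) s.P⟩

section

variable {o : Finset ℕ} {e : ℕ}

theorem tok_emb (x : InitPos Γ ⊕ o) : tok (emb e x) = tok x := by
  rcases x with i | i <;> rfl

theorem emb_injective : Function.Injective (emb e : InitPos Γ ⊕ o → _) := fun x y h =>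
  tok_injective <| by rw [← tok_emb (e := e), h, tok_emb]

theorem emb_ne_new (he : e ∉ o) (x : InitPos Γ ⊕ o) : emb e x ≠ new Γ o e := by
  intro h
  rcases x with i | i
  · simp [emb, new] at h
  · simp only [emb, new, Sum.map_inr, Sum.inr.injEq, Subtype.mk.injEq] at h
    exact he (h ▸ i.2)

theorem eq_new_or_emb (y : InitPos Γ ⊕ (insert e o : Finset ℕ)) :
    y = new Γ o e ∨ ∃ x, emb e x = y := by
  rcases y with i | ⟨i, hi⟩
  · exact .inr ⟨.inl i, rfl⟩
  · by_cases h : i = e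
    · subst h; exact .inl rfl
    · exact .inr ⟨.inr ⟨i, Finset.mem_of_mem_insert_of_ne hi h⟩, rfl⟩

theorem issueT_emb (he : e ∉ o) (T : InitPos Γ ⊕ o → Pos) (x : InitPos Γ ⊕ o) :
    issueT e T (emb e x) = T x := by
  rcases x with i | ⟨i, hi⟩
  · rfl
  · have : i ≠ e := fun h => he (h ▸ hi)
    simp [issueT, emb, this]

theorem issueT_new (T : InitPos Γ ⊕ o → Pos) : issueT e T (new Γ o e) = .edge e [] := by
  simp [issueT, new]

theorem eq_issueT (he : e ∉ o) {T : InitPos Γ ⊕ o → Pos}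
    {T' : InitPos Γ ⊕ (insert e o : Finset ℕ) → Pos} (h : ∀ x, T' (emb e x) = T x)
    (hn : T' (new Γ o e) = .edge e []) : T' = issueT e T := by
  funext y
  rcases eq_new_or_emb y with rfl | ⟨x, rfl⟩
  · rw [hn, issueT_new]
  · rw [h, issueT_emb he]

end

/-- The state after `b` has been observed on the token `x` at the lock `k`. -/
noncomputable def observed (s : State Γ) (x : InitPos Γ ⊕ s.ones) (k : ℕ) (b : Bool) : State Γ :=
  ⟨s.ones, Function.update s.T x (.lock k b), Qubits.collapse x b s.P⟩

/-- The outcomes of the measurement of the token `x` at the lock `k`. -/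
noncomputable def measure (s : State Γ) (x : InitPos Γ ⊕ s.ones) (k : ℕ) : Fam (State Γ) where
  ι := {b : Bool // Qubits.prob x b s.P ≠ 0}
  fin := Fintype.ofFinite _
  weight := fun b => Qubits.prob x b s.P
  pt := fun b => s.observed x k b

/-- The observed bit. -/
def bit {s : State Γ} {x : InitPos Γ ⊕ s.ones} {k : ℕ} (b : (s.measure x k).ι) : Bool :=
  Subtype.val (p := fun b => Qubits.prob x b s.P ≠ 0) b

theorem prob_bit {s : State Γ} {x : InitPos Γ ⊕ s.ones} {k : ℕ} (b : (s.measure x k).ι) :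
    Qubits.prob x (bit b) s.P ≠ 0 :=
  Subtype.property (p := fun b => Qubits.prob x b s.P ≠ 0) b

/-- The outcomes of probability zero, absent from the family, contribute nothing. Sums over a type
depending on the register thus become sums over `Bool`. -/
theorem sum_measure (s : State Γ) (x : InitPos Γ ⊕ s.ones) (k : ℕ)
    (f : (s.measure x k).ι → ℝ≥0∞) (f' : Bool → ℝ≥0∞)
    (h : ∀ b, f b = f' (bit b)) :
    ∑ b, ((s.measure x k).weight b : ℝ≥0∞) * f b = ∑ b, (Qubits.prob x b s.P : ℝ≥0∞) * f' b := by
  refine Finset.sum_of_injOn bit (fun b _ b' _ hb => Subtype.ext hb)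
    (fun b _ => Finset.mem_coe.2 (Finset.mem_univ _)) ?_ ?_
  · intro b _ hb
    by_cases h0 : Qubits.prob x b s.P = 0
    · simp [h0]
    · exact absurd ⟨⟨b, h0⟩, Finset.mem_coe.2 (Finset.mem_univ _), rfl⟩ hb
  · intro b _
    rw [h]
    rfl

end State

open State

/-- Names of transitions. -/
inductive Label (G : GateSet) {n : ℕ} (Γ : Fin n → Formula) : Type
  | move (x : Tok Γ) (p q : Pos)
  | sync (u : G.Sym) (q : Fin (G.arity u) → Tok Γ) (I O : List Pos)
  | one (e : ℕ)
  | meas (x : Tok Γ) (k : ℕ)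

/-- The tokens concerned by a transition. -/
def Label.touch : Label G Γ → Set (Tok Γ)
  | .move x _ _ => {x}
  | .sync _ q _ _ => Set.range q
  | .one e => {.inr e}
  | .meas x _ => {x}

namespace Wiring

/-- Labels use global names and record all positions involved, so that one label can be followed
through different states and determines its outcome. -/
def LStep (W : Wiring G Γ) : Label G Γ → State Γ → Fam (State Γ) → Prop
  | .move x p q, s, F => ∃ x₀ g, tok x₀ = x ∧ s.T x₀ = p ∧ s.Opens g ∧ W.mv g p q ∧
      F = .pure ⟨s.ones, Function.update s.T x₀ q, s.P⟩
  | .sync u q I O, s, F => ∃ (q₀ : Fin (G.arity u) → InitPos Γ ⊕ s.ones)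
      (T' : InitPos Γ ⊕ s.ones → Pos), (∀ j, tok (q₀ j) = q j) ∧ W.syn u I O ∧
      List.ofFn (fun j => s.T (q₀ j)) = I ∧ List.ofFn (fun j => T' (q₀ j)) = O ∧
      (∀ x, (∀ j, q₀ j ≠ x) → T' x = s.T x) ∧
      F = .pure ⟨s.ones, T', Qubits.applyGate (G.op u) q₀ s.P⟩
  | .one e, s, F => ∃ g, W.one g e ∧ s.Opens g ∧ e ∉ s.ones ∧ F = .pure (s.issue e)
  | .meas x k, s, F => ∃ x₀, tok x₀ = x ∧ W.box k ∧ s.T x₀ = .edge k [] ∧ F = s.measure x₀ k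

def FinalImage (W : Wiring G Γ) (s : State Γ) : Prop :=
  ∃ B : Set Pos, (∀ p ∈ B, ∃ k b, W.box k ∧ p = .lock k b) ∧
    Set.range s.T = Set.range W.fin ∪ B

def ReadOut (W : Wiring G Γ) (s : State Γ) (f : InitPos Γ ≃. FinPos Γ) (φ : Qubits (FinPos Γ)) :
    Prop :=
  (∀ i j, f i = some j ↔ s.T (.inl i) = W.fin j) ∧
  ∀ (g : FinPos Γ → Bool) (h : InitPos Γ ⊕ s.ones → Bool),
    (∀ x j, s.T x = W.fin j → h x = g j) → (∀ x k b, s.T x = .lock k b → h x = b) →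
    φ g = s.P h

def Result (W : Wiring G Γ) (s : State Γ) : Outcome Γ → Prop
  | some (f, φ) => W.FinalImage s ∧ W.ReadOut s f φ
  | none => ¬ W.FinalImage s

/-- The token machine on a wiring. -/
def sys (W : Wiring G Γ) : TSys (State Γ) (Outcome Γ) where
  step s F := ∃ ℓ, W.LStep ℓ s F
  res := W.Result

variable {W : Wiring G Γ}

/-- Moves, synchronizations and measurements only take tokens from positions on edges. A token at a
position `(k, b)` therefore stays there, and guards once open remain open. -/
theorem unlocked_of_lstep {ℓ : Label G Γ} {s : State Γ} {F : Fam (State Γ)} (h : W.LStep ℓ s F)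
    (i : F.ι) {k : ℕ} {b : Bool} (hu : s.Unlocked k b) : (F.pt i).Unlocked k b := by
  obtain ⟨y, hy⟩ := hu
  cases ℓ with
  | move x p q =>
    obtain ⟨x₀, g, rfl, rfl, -, hm, rfl⟩ := h
    refine ⟨y, ?_⟩
    have : y ≠ x₀ := by
      rintro rfl
      obtain ⟨e, m, h⟩ := W.mv_edge hm
      rw [hy] at h
      cases h
    simpa [Fam.pure, this] using hy
  | sync u q I O =>
    obtain ⟨q₀, T', -, hs, hI, -, hr, rfl⟩ := h
    refine ⟨y, (hr y fun j hj => ?_).trans hy⟩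
    obtain ⟨e, m, h⟩ := W.syn_edge hs (s.T (q₀ j)) (hI ▸ (List.mem_ofFn.2 ⟨j, rfl⟩))
    rw [hj, hy] at h
    cases h
  | one e =>
    obtain ⟨g, -, -, he, rfl⟩ := h
    exact ⟨emb e y, (issueT_emb he s.T y).trans hy⟩
  | meas x k' =>
    obtain ⟨x₀, rfl, -, hx, rfl⟩ := h
    refine ⟨y, ?_⟩
    have : y ≠ x₀ := by
      rintro rfl
      rw [hy] at hx
      cases hx
    simpa [State.measure, State.observed, this] using hy

theorem opens_of_lstep {ℓ : Label G Γ} {s : State Γ} {F : Fam (State Γ)} (h : W.LStep ℓ s F)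
    (i : F.ι) {g : Option (ℕ × Bool)} (hg : s.Opens g) : (F.pt i).Opens g :=
  hg.mono fun _ _ => unlocked_of_lstep h i

/-- Global names determine local tokens, and for a synchronization the final positions are
prescribed by `O` on its tokens and unchanged on the others. -/
theorem lstep_deterministic {ℓ : Label G Γ} {s : State Γ} {F F' : Fam (State Γ)}
    (h : W.LStep ℓ s F) (h' : W.LStep ℓ s F') : F = F' := by
  cases ℓ with
  | move x p q =>
    obtain ⟨x₀, g, rfl, rfl, -, -, rfl⟩ := h
    obtain ⟨x₁, g, h1, -, -, -, rfl⟩ := h'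
    rw [tok_injective h1]
  | sync u q I O =>
    obtain ⟨q₀, T', hq, -, -, hO, hr, rfl⟩ := h
    obtain ⟨q₁, T'', hq', -, -, hO', hr', rfl⟩ := h'
    obtain rfl : q₀ = q₁ := funext fun j => tok_injective ((hq j).trans (hq' j).symm)
    have : T' = T'' := by
      funext x
      by_cases hx : ∃ j, q₀ j = x
      · obtain ⟨j, rfl⟩ := hx
        exact congrFun (List.ofFn_injective (hO.trans hO'.symm)) j
      · push Not at hx
        rw [hr x hx, hr' x hx]
    rw [this]
  | one e =>
    obtain ⟨g, -, -, -, rfl⟩ := h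
    obtain ⟨g', -, -, -, rfl⟩ := h'
    rfl
  | meas x k =>
    obtain ⟨x₀, rfl, -, -, rfl⟩ := h
    obtain ⟨x₁, h1, -, -, rfl⟩ := h'
    rw [tok_injective h1]

/-- The transitions `ℓ`, leading to `F`, and `ℓ'`, leading to `F'`, commute. -/
def Diam (W : Wiring G Γ) (ℓ ℓ' : Label G Γ) (F F' : Fam (State Γ)) : Prop :=
  ∃ (K : F'.ι → Fam (State Γ)) (L : F.ι → Fam (State Γ)),
    (∀ j, W.LStep ℓ (F'.pt j) (K j)) ∧ (∀ i, W.LStep ℓ' (F.pt i) (L i)) ∧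
    ∀ V : State Γ → ℝ≥0∞,
      ∑ j, (F'.weight j : ℝ≥0∞) * ∑ m, ((K j).weight m : ℝ≥0∞) * V ((K j).pt m) =
      ∑ i, (F.weight i : ℝ≥0∞) * ∑ m, ((L i).weight m : ℝ≥0∞) * V ((L i).pt m)

theorem Diam.symm {ℓ ℓ' : Label G Γ} {F F' : Fam (State Γ)} (h : W.Diam ℓ ℓ' F F') :
    W.Diam ℓ' ℓ F' F := by
  obtain ⟨K, L, h1, h2, h3⟩ := h
  exact ⟨L, K, h2, h1, fun V => (h3 V).symm⟩

theorem diam_pure {ℓ ℓ' : Label G Γ} {s s' t : State Γ} (h : W.LStep ℓ s' (.pure t))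
    (h' : W.LStep ℓ' s (.pure t)) : W.Diam ℓ ℓ' (.pure s) (.pure s') :=
  ⟨fun _ => .pure t, fun _ => .pure t, fun _ => h, fun _ => h', fun _ => rfl⟩

/-- The case of a measurement against a deterministic transition: it suffices that the latter
preserves the probabilities and commutes with each possible observation. -/
theorem diam_measure {ℓ' : Label G Γ} {s s' : State Γ} {x : InitPos Γ ⊕ s.ones}
    {x' : InitPos Γ ⊕ s'.ones} {k : ℕ} (hk : W.box k) (hxx : tok x' = tok x)
    (hx' : s'.T x' = .edge k []) (hp : ∀ b, Qubits.prob x' b s'.P = Qubits.prob x b s.P)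
    (h : ∀ b, Qubits.prob x b s.P ≠ 0 →
      W.LStep ℓ' (s.observed x k b) (.pure (s'.observed x' k b))) :
    W.Diam (.meas (tok x) k) ℓ' (s.measure x k) (.pure s') := by
  refine ⟨fun _ => s'.measure x' k, fun b => .pure (s'.observed x' k (bit b)),
    fun _ => ⟨x', hxx, hk, hx', rfl⟩, fun b => h _ (prob_bit b), fun V => ?_⟩
  rw [TSys.sum_pure]
  simp only [TSys.sum_pure]
  rw [sum_measure s x k _ (fun b => V (s'.observed x' k b)) (fun b => by simp [Fam.pure]),
    sum_measure s' x' k (fun m => V ((s'.measure x' k).pt m))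
      (fun b => V (s'.observed x' k b)) (fun b => rfl)]
  simp [Fam.pure, hp]

end Wiring

end Wirings

end QSMLL

/-! ### Commutation of transitions concerning different tokens -/

namespace QSMLL

section Diamond

variable {G : GateSet} {n : ℕ} {Γ : Fin n → Formula}

open State

namespace Wiring

variable {W : Wiring G Γ} {s : State Γ} {F F' : Fam (State Γ)}

theorem update_issueT {o : Finset ℕ} {e : ℕ} (he : e ∉ o) (T : InitPos Γ ⊕ o → Pos)
    (x : InitPos Γ ⊕ o) (p : Pos) :
    Function.update (issueT e T) (emb e x) p = issueT e (Function.update T x p) := by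
  refine eq_issueT he (fun y => ?_) ?_
  · by_cases h : y = x
    · subst h; simp
    · rw [Function.update_of_ne (emb_injective.ne h), Function.update_of_ne h, issueT_emb he]
  · rw [Function.update_of_ne (emb_ne_new he x).symm, issueT_new]

theorem diam_move_move {x y : Tok Γ} {p q p' q' : Pos} (h : W.LStep (.move x p q) s F)
    (h' : W.LStep (.move y p' q') s F') (hd : x ≠ y) :
    W.Diam (.move x p q) (.move y p' q') F F' := by
  -- The guard of each transition is still open after the other one.
  have ho := fun i g => opens_of_lstep (g := g) h i
  have ho' := fun i g => opens_of_lstep (g := g) h' i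
  obtain ⟨x, g, rfl, rfl, hg, hm, rfl⟩ := h
  obtain ⟨y, g', rfl, rfl, hg', hm', rfl⟩ := h'
  have hxy : x ≠ y := fun h => hd (h ▸ rfl)
  refine diam_pure (t := ⟨s.ones, Function.update (Function.update s.T x q) y q', s.P⟩)
    ⟨x, g, rfl, ?_, ho' () g hg, hm, ?_⟩ ⟨y, g', rfl, ?_, ho () g' hg', hm', rfl⟩
  · exact Function.update_of_ne hxy _ _
  · rw [Function.update_comm hxy]
  · exact Function.update_of_ne hxy.symm _ _

theorem diam_move_sync {x : Tok Γ} {p q : Pos} {u : G.Sym} {r : Fin (G.arity u) → Tok Γ}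
    {I O : List Pos} (h : W.LStep (.move x p q) s F)
    (h' : W.LStep (.sync u r I O) s F') (hd : ∀ j, r j ≠ x) :
    W.Diam (.move x p q) (.sync u r I O) F F' := by
  have ho' := fun i g => opens_of_lstep (g := g) h' i
  obtain ⟨x, g, rfl, rfl, hg, hm, rfl⟩ := h
  obtain ⟨r, T', hr, hs, hI, hO, hrest, rfl⟩ := h'
  have hxr : ∀ j, r j ≠ x := fun j h => hd j (by rw [← hr j, h])
  refine diam_pure
    (t := ⟨s.ones, Function.update T' x q, Qubits.applyGate (G.op u) r s.P⟩)
    ⟨x, g, rfl, hrest x hxr, ho' () g hg, hm, rfl⟩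
    ⟨r, Function.update T' x q, hr, hs, ?_, ?_, ?_, rfl⟩
  · rw [← hI]; congr 1; funext j; exact Function.update_of_ne (hxr j) _ _
  · rw [← hO]; congr 1; funext j; exact Function.update_of_ne (hxr j) _ _
  · intro (y : InitPos Γ ⊕ s.ones) hy
    change Function.update T' x q y = Function.update s.T x q y
    by_cases hyx : y = x
    · subst hyx; simp
    · rw [Function.update_of_ne hyx, Function.update_of_ne hyx, hrest y hy]

theorem diam_move_one {x : Tok Γ} {p q : Pos} {e : ℕ} (h : W.LStep (.move x p q) s F)
    (h' : W.LStep (.one e) s F') : W.Diam (.move x p q) (.one e) F F' := by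
  have ho := fun i g => opens_of_lstep (g := g) h i
  have ho' := fun i g => opens_of_lstep (g := g) h' i
  obtain ⟨x, g, rfl, rfl, hg, hm, rfl⟩ := h
  obtain ⟨g', h1, hg', he, rfl⟩ := h'
  refine diam_pure (t := State.issue ⟨s.ones, Function.update s.T x q, s.P⟩ e)
    ⟨emb e x, g, tok_emb x, issueT_emb he _ x, ho' () g hg, hm, ?_⟩
    ⟨g', h1, ho () g' hg', he, rfl⟩
  exact congrArg Fam.pure (mk_congr (update_issueT he s.T x q).symm rfl)

/-- Distinct input positions carry distinct tokens; this injectivity is what makes the gate act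
isometrically on the register. -/
theorem sync_injective {ι : Type} {k : ℕ} {T : ι → Pos} {q : Fin k → ι} {I : List Pos}
    (hI : List.ofFn (fun j => T (q j)) = I) (hn : I.Nodup) : Function.Injective q := by
  subst hI
  exact fun i j h => (List.nodup_ofFn.1 hn) (congrArg T h)

theorem diam_sync_sync {u v : G.Sym} {r : Fin (G.arity u) → Tok Γ} {r' : Fin (G.arity v) → Tok Γ}
    {I O I' O' : List Pos} (h : W.LStep (.sync u r I O) s F)
    (h' : W.LStep (.sync v r' I' O') s F') (hd : ∀ i j, r i ≠ r' j) :
    W.Diam (.sync u r I O) (.sync v r' I' O') F F' := by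
  classical
  obtain ⟨r, T, hr, hs, hI, hO, hrest, rfl⟩ := h
  obtain ⟨r', T', hr', hs', hI', hO', hrest', rfl⟩ := h'
  have hrr : ∀ i j, r i ≠ r' j := fun i j h => hd i j (by rw [← hr i, ← hr' j, h])
  -- The common result: tokens of the first synchronization are placed by `T`, all others by `T'`.
  let T'' : InitPos Γ ⊕ s.ones → Pos := fun x => if ∃ j, r j = x then T x else T' x
  have e1 : ∀ j, T'' (r j) = T (r j) := fun j => if_pos ⟨j, rfl⟩
  have e2 : ∀ j, T'' (r' j) = T' (r' j) := fun j => if_neg fun ⟨i, hi⟩ => hrr i j hi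
  refine diam_pure (t := ⟨s.ones, T'', Qubits.applyGate (G.op u) r
      (Qubits.applyGate (G.op v) r' s.P)⟩)
    ⟨r, T'', hr, hs, ?_, ?_, ?_, rfl⟩ ⟨r', T'', hr', hs', ?_, ?_, ?_, ?_⟩
  · rw [← hI]; congr 1; funext j
    exact hrest' _ fun i hi => hrr j i hi.symm
  · simp only [e1, hO]
  · intro x hx
    exact if_neg fun ⟨j, hj⟩ => hx j hj
  · rw [← hI']; congr 1; funext j
    exact hrest _ fun i hi => hrr i j hi
  · simp only [e2, hO']
  · intro x hx
    change (if ∃ j, r j = x then T x else T' x) = T x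
    split_ifs with h
    · rfl
    · rw [hrest' x hx, hrest x fun j hj => h ⟨j, hj⟩]
  · rw [Qubits.applyGate_comm _ _ hrr]

theorem diam_sync_one {u : G.Sym} {r : Fin (G.arity u) → Tok Γ} {I O : List Pos} {e : ℕ}
    (h : W.LStep (.sync u r I O) s F) (h' : W.LStep (.one e) s F') :
    W.Diam (.sync u r I O) (.one e) F F' := by
  have ho := fun i g => opens_of_lstep (g := g) h i
  obtain ⟨r, T, hr, hs, hI, hO, hrest, rfl⟩ := h
  obtain ⟨g', h1, hg', he, rfl⟩ := h'
  refine diam_pure (t := State.issue ⟨s.ones, T, Qubits.applyGate (G.op u) r s.P⟩ e)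
    ⟨fun j => emb e (r j), issueT e T, fun j => (tok_emb _).trans (hr j), hs, ?_, ?_, ?_, ?_⟩
    ⟨g', h1, ho () g' hg', he, rfl⟩
  · simp only [State.issue, issueT_emb he, hI]
  · simp only [issueT_emb he, hO]
  · intro y hy
    change _ = issueT e s.T y
    rcases eq_new_or_emb y with rfl | ⟨x, rfl⟩
    · rw [issueT_new, issueT_new]
    · rw [issueT_emb he, issueT_emb he, hrest]
      exact fun j hj => hy j (congrArg (emb e) hj)
  · simp only [State.issue, Qubits.adjoinZero_eq]
    exact congrArg Fam.pure (mk_congr rfl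
      (Qubits.applyGate_adjoinBit _ r emb_injective (emb_ne_new he) false s.P).symm)

theorem diam_one_one {e e' : ℕ} (h : W.LStep (.one e) s F) (h' : W.LStep (.one e') s F')
    (hd : e ≠ e') : W.Diam (.one e) (.one e') F F' := by
  have ho := fun i g => opens_of_lstep (g := g) h i
  have ho' := fun i g => opens_of_lstep (g := g) h' i
  obtain ⟨g, h1, hg, he, rfl⟩ := h
  obtain ⟨g', h1', hg', he', rfl⟩ := h'
  -- The two orders insert the new names in different orders, so the token types differ and the
  -- states are compared by global names.
  have key : (s.issue e).issue e' = (s.issue e').issue e := by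
    have hne : e ∉ insert e' s.ones := by simp [hd, he]
    have hne' : e' ∉ insert e s.ones := by simp [hd.symm, he']
    refine ext_tok (Finset.insert_comm _ _ _) ?_ ?_
    · intro x y hxy
      change issueT e' (issueT e s.T) x = issueT e (issueT e' s.T) y
      rcases x with i | ⟨i, hi⟩ <;> rcases y with j | ⟨j, hj⟩ <;>
        simp only [tok, Sum.map_inl, Sum.map_inr, id_eq, reduceCtorEq, Sum.inl.injEq,
          Sum.inr.injEq] at hxy
      · subst hxy; rfl
      · subst hxy
        have hi' : i ∈ insert e' (insert e s.ones) := hi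
        have hj' : i ∈ insert e (insert e' s.ones) := hj
        change issueT e' (issueT e s.T) (.inr ⟨i, hi'⟩) = issueT e (issueT e' s.T) (.inr ⟨i, hj'⟩)
        rw [issueT_inr, issueT_inr]
        by_cases h2 : i = e'
        · subst h2
          simp [hd.symm, issueT_inr]
        · by_cases h3 : i = e
          · subst h3
            simp [hd, issueT_inr]
          · simp [h2, h3, issueT_inr]
    · intro f
      have key : ∀ (a b : Bool) (z z' : ℂ), z = z' → (if a = true then 0 else
          if b = true then 0 else z) = if b = true then 0 else if a = true then 0 else z' := by
        rintro (_ | _) (_ | _) z z' rfl <;> rfl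
      refine key (f (.inr e')) (f (.inr e)) _ _ (congrArg s.P ?_)
      funext i
      rcases i with i | i <;> rfl
  refine diam_pure (t := (s.issue e).issue e')
    ⟨g, h1, ho' () g hg, by simpa [State.issue, Fam.pure, hd] using he, by rw [key]⟩
    ⟨g', h1', ho () g' hg', by simpa [State.issue, Fam.pure, hd.symm] using he', rfl⟩

theorem diam_meas_move {x y : Tok Γ} {k : ℕ} {p q : Pos} (h : W.LStep (.meas x k) s F)
    (h' : W.LStep (.move y p q) s F') (hd : x ≠ y) :
    W.Diam (.meas x k) (.move y p q) F F' := by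
  have ho := fun i g => opens_of_lstep (g := g) h i
  obtain ⟨x, rfl, hk, hx, rfl⟩ := h
  obtain ⟨y, g, rfl, rfl, hg, hm, rfl⟩ := h'
  have hxy : x ≠ y := fun h => hd (h ▸ rfl)
  refine diam_measure (s' := ⟨s.ones, Function.update s.T y q, s.P⟩)
    (ℓ' := .move (tok y) (s.T y) q) (x' := x) hk rfl ?_ (fun _ => rfl)
    fun b hb => ⟨y, g, rfl, Function.update_of_ne hxy.symm _ _, ho ⟨b, hb⟩ g hg, hm, ?_⟩
  · exact (Function.update_of_ne hxy _ _).trans hx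
  · exact congrArg Fam.pure (mk_congr (Function.update_comm hxy _ _ _).symm rfl)

theorem diam_measure_of_ones_eq {ℓ' : Label G Γ} {T' : InitPos Γ ⊕ s.ones → Pos}
    {P' : Qubits (InitPos Γ ⊕ s.ones)} {x : InitPos Γ ⊕ s.ones} {k : ℕ} (hk : W.box k)
    (hx' : T' x = .edge k []) (hp : ∀ b, Qubits.prob x b P' = Qubits.prob x b s.P)
    (h : ∀ b, W.LStep ℓ' (s.observed x k b)
      (.pure ⟨s.ones, Function.update T' x (.lock k b), Qubits.collapse x b P'⟩)) :
    W.Diam (.meas (tok x) k) ℓ' (s.measure x k) (.pure ⟨s.ones, T', P'⟩) :=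
  diam_measure (s' := ⟨s.ones, T', P'⟩) (x' := x) hk rfl hx' hp fun b _ => h b

/-- The gate is unitary and acts on qubits other than the measured one, so it changes neither the
probabilities nor the effect of the observation. -/
theorem diam_meas_sync {x : Tok Γ} {k : ℕ} {u : G.Sym} {r : Fin (G.arity u) → Tok Γ}
    {I O : List Pos} (h : W.LStep (.meas x k) s F) (h' : W.LStep (.sync u r I O) s F')
    (hd : ∀ j, r j ≠ x) : W.Diam (.meas x k) (.sync u r I O) F F' := by
  obtain ⟨x, rfl, hk, hx, rfl⟩ := h
  obtain ⟨r, T', hr, hs, hI, hO, hrest, rfl⟩ := h'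
  have hxr : ∀ j, r j ≠ x := fun j h => hd j (by rw [← hr j, h])
  have hinj := sync_injective hI (W.syn_nodup hs)
  refine diam_measure_of_ones_eq hk ((hrest x hxr).trans hx)
    (fun b => Qubits.prob_applyGate (G.op u) hinj hxr b s.P) fun b => ?_
  rw [Qubits.collapse_applyGate (G.op u) hinj hxr b s.P]
  have e1 : ∀ j, Function.update s.T x (.lock k b) (r j) = s.T (r j) := fun j =>
    Function.update_of_ne (hxr j) _ _
  have e2 : ∀ j, Function.update T' x (.lock k b) (r j) = T' (r j) := fun j =>
    Function.update_of_ne (hxr j) _ _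
  have e3 : ∀ y, (∀ j, r j ≠ y) →
      Function.update T' x (.lock k b) y = Function.update s.T x (.lock k b) y := by
    intro y hy
    by_cases hyx : y = x
    · subst hyx; simp
    · rw [Function.update_of_ne hyx, Function.update_of_ne hyx, hrest y hy]
  exact ⟨r, Function.update T' x (.lock k b), hr, hs, by rw [← hI]; exact congrArg _ (funext e1),
    by rw [← hO]; exact congrArg _ (funext e2), e3, rfl⟩

theorem diam_meas_one {x : Tok Γ} {k : ℕ} {e : ℕ} (h : W.LStep (.meas x k) s F)
    (h' : W.LStep (.one e) s F') : W.Diam (.meas x k) (.one e) F F' := by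
  have ho := fun i g => opens_of_lstep (g := g) h i
  obtain ⟨x, rfl, hk, hx, rfl⟩ := h
  obtain ⟨g, h1, hg, he, rfl⟩ := h'
  refine diam_measure (s' := s.issue e) (ℓ' := .one e) (x' := emb e x) hk (tok_emb x) ((issueT_emb he _ x).trans hx) (fun b => ?_)
    fun b hb => ⟨g, h1, ho ⟨b, hb⟩ g hg, he, ?_⟩
  · simp only [State.issue, Qubits.adjoinZero_eq]
    exact Qubits.prob_adjoinBit emb_injective (emb_ne_new he) eq_new_or_emb x b false s.P
  · simp only [observed, State.issue, Qubits.adjoinZero_eq]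
    exact congrArg Fam.pure (mk_congr (update_issueT he _ _ _)
      (Qubits.collapse_adjoinBit emb_injective (emb_ne_new he) eq_new_or_emb x b false s.P))

/-- Two successive measurements are written as a sum over joint outcomes weighted by the squared
norm of the double projection, an expression symmetric in the two measurements up to
`Qubits.proj_comm`. -/
theorem sum_measure_observed (V : State Γ → ℝ≥0∞) {x y : InitPos Γ ⊕ s.ones} {k k' : ℕ} :
    ∑ j, ((s.measure y k').weight j : ℝ≥0∞) *
      ∑ m, (((s.observed y k' (bit j)).measure x k).weight m : ℝ≥0∞) *
        V (((s.observed y k' (bit j)).measure x k).pt m) =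
    ∑ c, ∑ b, ((‖Qubits.proj x b (Qubits.proj y c s.P)‖₊ ^ 2 : ℝ≥0) : ℝ≥0∞) *
        V ((s.observed y k' c).observed x k b) := by
  rw [sum_measure s y k' _ (fun c => ∑ b,
    (Qubits.prob x b (s.observed y k' c).P : ℝ≥0∞) * V ((s.observed y k' c).observed x k b))]
  · refine Finset.sum_congr rfl fun c _ => ?_
    rw [Finset.mul_sum]
    refine Finset.sum_congr rfl fun b _ => ?_
    rw [← mul_assoc]
    -- If the first observation is impossible, the joint projection is zero too, so both terms
    -- vanish.
    by_cases h : Qubits.prob y c s.P = 0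
    · have h' : Qubits.proj y c s.P = 0 := by
        simpa [Qubits.prob] using h
      have : Qubits.proj x b (0 : Qubits (InitPos Γ ⊕ s.ones)) = 0 := by ext; simp [Qubits.proj]
      simp [h, h', this]
    · rw [← Qubits.prob_mul_prob h]
      simp [observed]
  · intro j
    exact sum_measure (s.observed y k' (bit j)) x k
      (fun m => V (((s.observed y k' (bit j)).measure x k).pt m)) _ (fun _ => rfl)

theorem diam_meas_meas {x y : Tok Γ} {k k' : ℕ} (h : W.LStep (.meas x k) s F)
    (h' : W.LStep (.meas y k') s F') (hd : x ≠ y) :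
    W.Diam (.meas x k) (.meas y k') F F' := by
  obtain ⟨x, rfl, hk, hx, rfl⟩ := h
  obtain ⟨y, rfl, hk', hy, rfl⟩ := h'
  have hxy : x ≠ y := fun h => hd (h ▸ rfl)
  refine ⟨fun j => (s.observed y k' (bit j)).measure x k,
    fun i => (s.observed x k (bit i)).measure y k', fun j => ⟨x, rfl, hk, ?_, rfl⟩,
    fun i => ⟨y, rfl, hk', ?_, rfl⟩, fun V => ?_⟩
  · exact (Function.update_of_ne hxy _ _).trans hx
  · exact (Function.update_of_ne hxy.symm _ _).trans hy
  · rw [sum_measure_observed, sum_measure_observed, Finset.sum_comm]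
    refine Finset.sum_congr rfl fun b _ => Finset.sum_congr rfl fun c _ => ?_
    rw [Qubits.proj_comm]
    -- Joint outcomes of weight zero need no comparison of states; for the others both single
    -- probabilities are nonzero, as `Qubits.collapse_comm` requires.
    by_cases h : Qubits.proj y c (Qubits.proj x b s.P) = 0
    · simp [h]
    · have z : ∀ (i : InitPos Γ ⊕ s.ones) (a : Bool),
          Qubits.proj i a (0 : Qubits (InitPos Γ ⊕ s.ones)) = 0 := by
        intro i a; ext; simp [Qubits.proj]
      have h1 : Qubits.prob x b s.P ≠ 0 := by
        rw [Qubits.prob_ne_zero, norm_ne_zero_iff]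
        intro h0; exact h (by rw [h0, z])
      have h2 : Qubits.prob y c s.P ≠ 0 := by
        rw [Qubits.prob_ne_zero, norm_ne_zero_iff]
        intro h0; exact h (by rw [Qubits.proj_comm, h0, z])
      congr 2
      exact mk_congr (Function.update_comm hxy _ _ _).symm (Qubits.collapse_comm h2 h1)

/-- Transitions concerning different tokens commute. -/
theorem diam_of_disjoint {ℓ ℓ' : Label G Γ} (h : W.LStep ℓ s F) (h' : W.LStep ℓ' s F')
    (hd : ∀ x ∈ ℓ.touch, x ∉ ℓ'.touch) : W.Diam ℓ ℓ' F F' := by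
  cases ℓ with
  | move x p q =>
    have hd := hd x rfl
    cases ℓ' with
    | move y p' q' => exact diam_move_move h h' hd
    | sync u r I O => exact diam_move_sync h h' fun j hj => hd ⟨j, hj⟩
    | one e => exact diam_move_one h h'
    | meas y k => exact (diam_meas_move h' h (Ne.symm hd)).symm
  | sync u r I O =>
    have hd := fun j => hd (r j) ⟨j, rfl⟩
    cases ℓ' with
    | move y p' q' => exact (diam_move_sync h' h hd).symm
    | sync v r' I' O' => exact diam_sync_sync h h' fun i j hij => hd i ⟨j, hij.symm⟩
    | one e => exact diam_sync_one h h'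
    | meas y k => exact (diam_meas_sync h' h hd).symm
  | one e =>
    have hd := hd _ rfl
    cases ℓ' with
    | move y p' q' => exact (diam_move_one h' h).symm
    | sync v r' I' O' => exact (diam_sync_one h' h).symm
    | one e' => exact diam_one_one h h' fun he => hd (he ▸ rfl)
    | meas y k => exact (diam_meas_one h' h).symm
  | meas x k =>
    have hd := hd x rfl
    cases ℓ' with
    | move y p' q' => exact diam_meas_move h h' hd
    | sync u r I O => exact diam_meas_sync h h' fun j hj => hd ⟨j, hj⟩
    | one e => exact diam_meas_one h h'
    | meas y k' => exact diam_meas_meas h h' hd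

/-- A transition whose tokens cannot do anything else does not change the value. -/
theorem val_eq_of_committed (ℓ : Label G Γ) (Inv : State Γ → Prop)
    (hinv : ∀ s F ℓ' F', Inv s → W.LStep ℓ s F → W.LStep ℓ' s F' →
      ℓ' = ℓ ∨ ((∀ x ∈ ℓ.touch, x ∉ ℓ'.touch) ∧ ∀ j, Inv (F'.pt j)))
    (hs : Inv s) (h : W.LStep ℓ s F) (o : Outcome Γ) :
    W.sys.val s o = ∑ i, (F.weight i : ℝ≥0∞) * W.sys.val (F.pt i) o := by
  -- The distinguished steps are those labelled `ℓ` from states satisfying `Inv`. Since competing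
  -- transitions preserve `Inv` and commute with `ℓ`, this class is stable as the diamond demands.
  refine TSys.val_eq_of_diamond W.sys (fun s F => Inv s ∧ W.LStep ℓ s F)
    (fun s F h => ⟨ℓ, h.2⟩) ?_ ⟨hs, h⟩ o
  rintro s F F' ⟨hs, h⟩ ⟨ℓ', h'⟩
  rcases hinv s F ℓ' F' hs h h' with rfl | ⟨hd, hi⟩
  · exact .inl (lstep_deterministic h' h)
  · obtain ⟨K, L, h1, h2, h3⟩ := diam_of_disjoint h h' hd
    exact .inr ⟨K, L, fun j => ⟨hi j, h1 j⟩, fun i => ⟨ℓ', h2 i⟩, h3⟩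

end Wiring

end Diamond

end QSMLL

/-! ### Transitions without alternative: issue, move, measurement, synchronization -/

namespace QSMLL

section Committed

variable {G : GateSet} {n : ℕ} {Γ : Fin n → Formula}

open State

namespace Wiring

variable {W : Wiring G Γ} {s : State Γ}

theorem tok_ne_of_not_mem {e : ℕ} (he : e ∉ s.ones) (x : InitPos Γ ⊕ s.ones) :
    tok x ≠ .inr e := by
  rintro h
  rcases x with x | ⟨x, hx⟩
  · simp [tok] at h
  · simp only [tok, Sum.map_inr, Sum.inr.injEq] at h
    exact he (h ▸ hx)

/-- The token about to be issued does not exist yet, so no other transition can concern it, and an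
unguarded source can fire at once. -/
theorem val_issue {e : ℕ} (h : W.one none e) (he : e ∉ s.ones) (o : Outcome Γ) :
    W.sys.val s o = W.sys.val (s.issue e) o := by
  rw [val_eq_of_committed (s := s) (.one e) (fun _ => True) ?_ trivial
    ⟨none, h, fun _ _ h => by simp at h, he, rfl⟩ o, TSys.sum_pure]
  · simp [Fam.pure]
  · intro s F ℓ' F' _ h1 h2
    obtain ⟨g, -, -, he, -⟩ := h1
    have key := fun x => (tok_ne_of_not_mem he x).symm
    simp only [Label.touch, Set.mem_singleton_iff, forall_eq, implies_true, and_true]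
    cases ℓ' with
    | move x p q =>
      obtain ⟨x, g, rfl, -⟩ := h2
      exact .inr (key x)
    | sync u r I O =>
      obtain ⟨r, T', hr, -⟩ := h2
      exact .inr fun ⟨j, hj⟩ => key (r j) (by rw [hr, hj])
    | one e' =>
      by_cases h : e' = e
      · exact .inl (h ▸ rfl)
      · exact .inr fun h' => h (by simpa using h'.symm)
    | meas x k =>
      obtain ⟨x, rfl, -⟩ := h2
      exact .inr (key x)

/-- The only thing the token can do from its position is the given unguarded move: there is no
second move, and the position is neither the input of a synchronization nor a lock. -/
theorem val_move {x : InitPos Γ ⊕ s.ones} {q : Pos} (h : W.mv none (s.T x) q)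
    (hu : ∀ g q', W.mv g (s.T x) q' → q' = q) (hsyn : ∀ u I O, W.syn u I O → s.T x ∉ I)
    (hbox : ∀ k, W.box k → s.T x ≠ .edge k []) (o : Outcome Γ) :
    W.sys.val s o = W.sys.val ⟨s.ones, Function.update s.T x q, s.P⟩ o := by
  rw [val_eq_of_committed (s := s) (.move (tok x) (s.T x) q) (fun _ => True) ?_ trivial
    ⟨x, none, rfl, rfl, fun _ _ h => by simp at h, h, rfl⟩ o, TSys.sum_pure]
  · simp [Fam.pure]
  · intro t F ℓ' F' _ h1 h2
    obtain ⟨y, g, hyx, hy, -, hm, -⟩ := h1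
    simp only [Label.touch, Set.mem_singleton_iff, forall_eq, implies_true, and_true]
    cases ℓ' with
    | move z p r =>
      obtain ⟨z, g', rfl, rfl, -, hm', -⟩ := h2
      by_cases hzx : z = y
      · subst hzx
        rw [hy] at hm' ⊢
        rw [hu _ _ hm', hyx]
        exact .inl rfl
      · exact .inr fun h => hzx (tok_injective (h.symm.trans hyx.symm))
    | sync u r I O =>
      obtain ⟨r, T', hr, hs, hI, -⟩ := h2
      refine .inr fun ⟨j, hj⟩ => hsyn u I O hs ?_
      have : r j = y := tok_injective (by rw [hr, hj, hyx])
      rw [← hI, ← hy, ← this]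
      exact List.mem_ofFn.2 ⟨j, rfl⟩
    | one e =>
      obtain ⟨_, -, -, he, -⟩ := h2
      exact .inr (hyx ▸ tok_ne_of_not_mem he y)
    | meas z k =>
      obtain ⟨z, rfl, hk, hz, -⟩ := h2
      refine .inr fun h => hbox k hk ?_
      have : z = y := tok_injective (h.symm.trans hyx.symm)
      rw [← hy, ← this, hz]

/-- A token on the lock can neither move on nor take part in a synchronization, so the measurement
may be performed first. -/
theorem val_meas {x : InitPos Γ ⊕ s.ones} {k : ℕ} (hk : W.box k) (hx : s.T x = .edge k [])
    (hmv : ∀ g q, ¬ W.mv g (.edge k []) q) (hsyn : ∀ u I O, W.syn u I O → .edge k [] ∉ I)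
    (o : Outcome Γ) :
    W.sys.val s o = ∑ b, (Qubits.prob x b s.P : ℝ≥0∞) * W.sys.val (s.observed x k b) o := by
  rw [val_eq_of_committed (s := s) (.meas (tok x) k) (fun _ => True) ?_ trivial
    ⟨x, rfl, hk, hx, rfl⟩ o]
  · exact sum_measure s x k (fun i => W.sys.val ((s.measure x k).pt i) o)
      (fun b => W.sys.val (s.observed x k b) o) (fun _ => rfl)
  · intro t F ℓ' F' _ h1 h2
    obtain ⟨y, hyx, -, hy, -⟩ := h1
    simp only [Label.touch, Set.mem_singleton_iff, forall_eq, implies_true, and_true]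
    cases ℓ' with
    | move z p r =>
      obtain ⟨z, g', rfl, rfl, -, hm', -⟩ := h2
      refine .inr fun h => hmv g' r ?_
      have : z = y := tok_injective (h.symm.trans hyx.symm)
      rwa [← hy, ← this]
    | sync u r I O =>
      obtain ⟨r, T', hr, hs, hI, -⟩ := h2
      refine .inr fun ⟨j, hj⟩ => hsyn u I O hs ?_
      have : r j = y := tok_injective (by rw [hr, hj, hyx])
      rw [← hI, ← hy, ← this]
      exact List.mem_ofFn.2 ⟨j, rfl⟩
    | one e =>
      obtain ⟨_, -, -, he, -⟩ := h2
      exact .inr (hyx ▸ tok_ne_of_not_mem he y)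
    | meas z k' =>
      obtain ⟨z, rfl, hk', hz, -⟩ := h2
      by_cases h : z = y
      · subst h
        rw [hz] at hy
        simp only [Pos.edge.injEq, and_true] at hy
        rw [hy, hyx]
        exact .inl rfl
      · exact .inr fun h' => h (tok_injective (h'.symm.trans hyx.symm))

/-- The positions in `I` are sealed off: no move leaves or reaches them, no lock is among them, no
synchronization puts a token there, one taking a token from there is the given one, and sources on
them belong to tokens of `q`. Tokens on `I` are therefore always among those of `q`, which can only
cross together. -/
theorem val_sync {u : G.Sym} {q : Fin (G.arity u) → InitPos Γ ⊕ s.ones}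
    {T' : InitPos Γ ⊕ s.ones → Pos} {I O : List Pos} (hs : W.syn u I O)
    (hI : List.ofFn (fun j => s.T (q j)) = I) (hO : List.ofFn (fun j => T' (q j)) = O)
    (hr : ∀ x, (∀ j, q j ≠ x) → T' x = s.T x)
    (hmv : ∀ g p r, W.mv g p r → p ∉ I ∧ r ∉ I)
    (hbox : ∀ k, W.box k → .edge k [] ∉ I)
    (hlock : ∀ k b, .lock k b ∉ I)
    (hsyn : ∀ u' I' O', W.syn u' I' O' → (∀ p ∈ O', p ∉ I) ∧
      ((∃ p ∈ I, p ∈ I') → u' = u ∧ I' = I ∧ O' = O))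
    (hone : ∀ g c, W.one g c → .edge c [] ∈ I → ∃ j, tok (q j) = .inr c)
    (hinv : ∀ x, s.T x ∈ I → ∃ j, q j = x) (o : Outcome Γ) :
    W.sys.val s o = W.sys.val ⟨s.ones, T', Qubits.applyGate (G.op u) q s.P⟩ o := by
  rw [val_eq_of_committed (s := s) (.sync u (fun j => tok (q j)) I O)
    -- The invariant excludes that other tokens occupy `I`, in which case the same node could be
    -- crossed by different tokens.
    (fun t => ∀ x, t.T x ∈ I → ∃ j, tok (q j) = tok x) ?_
    (fun x hx => (hinv x hx).imp fun j hj => by rw [hj])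
    ⟨q, T', fun _ => rfl, hs, hI, hO, hr, rfl⟩ o, TSys.sum_pure]
  · simp [Fam.pure]
  · intro t F ℓ' F' hinv h1 h2
    obtain ⟨q', T'', hqq, -, hI', -⟩ := h1
    have hmem : ∀ j, t.T (q' j) ∈ I := fun j => hI' ▸ List.mem_ofFn.2 ⟨j, rfl⟩
    simp only [Label.touch, Set.forall_mem_range]
    cases ℓ' with
    | move x p r =>
      obtain ⟨x, g, rfl, rfl, -, hm, rfl⟩ := h2
      refine .inr ⟨fun j hj => (hmv _ _ _ hm).1 ?_, fun _ (y : InitPos Γ ⊕ t.ones) hy => ?_⟩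
      · have : q' j = x := tok_injective ((hqq j).trans hj)
        exact this ▸ hmem j
      · change Function.update t.T x r y ∈ I at hy
        by_cases hyx : y = x
        · subst hyx
          rw [Function.update_self] at hy
          exact absurd hy (hmv _ _ _ hm).2
        · rw [Function.update_of_ne hyx] at hy
          exact hinv y hy
    | sync v r I' O' =>
      obtain ⟨r, T₁, hrr, hs', hI'', hO', hrest, rfl⟩ := h2
      by_cases hex : ∃ p ∈ I, p ∈ I'
      · left
        obtain ⟨rfl, rfl, rfl⟩ := (hsyn v I' O' hs').2 hex
        congr 1
        funext j
        -- Tokens with the same index stand at the same position. The invariant makes `r j` one of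
        -- the tokens `q' i`, and `i = j` because `I` has no repetition.
        have e1 : t.T (r j) = t.T (q' j) := congrFun (List.ofFn_injective (hI''.trans hI'.symm)) j
        obtain ⟨i, hi⟩ := hinv (r j) (e1 ▸ hmem j)
        have e2 : q' i = r j := tok_injective ((hqq i).trans hi)
        have e3 : t.T (q' i) = t.T (q' j) := by rw [e2, e1]
        have hn := W.syn_nodup hs'
        rw [← hI', List.nodup_ofFn] at hn
        rw [← hrr, ← hi, hn e3]
      · refine .inr ⟨?_, fun _ y hy => ?_⟩
        · rintro j ⟨i, hi⟩
          have : r i = q' j := tok_injective (by rw [hrr, hi, hqq])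
          exact hex ⟨t.T (q' j), hmem j, hI'' ▸ List.mem_ofFn.2 ⟨i, by rw [this]⟩⟩
        · change T₁ y ∈ I at hy
          by_cases h : ∃ i, r i = y
          · obtain ⟨i, rfl⟩ := h
            exact absurd hy ((hsyn _ _ _ hs').1 _ (hO' ▸ List.mem_ofFn.2 ⟨i, rfl⟩))
          · push Not at h
            exact hinv y (hrest y h ▸ hy)
    | one e =>
      obtain ⟨g, h1, -, he, rfl⟩ := h2
      refine .inr ⟨fun j hj => tok_ne_of_not_mem he (q' j) ?_,
        fun _ (y : InitPos Γ ⊕ (insert e t.ones : Finset ℕ)) hy => ?_⟩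
      · rw [hqq]; exact hj
      · change issueT e t.T y ∈ I at hy
        rcases eq_new_or_emb y with rfl | ⟨y, rfl⟩
        · rw [issueT_new] at hy
          exact hone g e h1 hy
        · rw [issueT_emb he] at hy
          exact (hinv y hy).imp fun j hj => hj.trans (tok_emb y).symm
    | meas x k =>
      obtain ⟨x, rfl, hk, hx, rfl⟩ := h2
      refine .inr ⟨fun j hj => hbox k hk ?_, fun b (y : InitPos Γ ⊕ t.ones) hy => ?_⟩
      · have : q' j = x := tok_injective ((hqq j).trans hj)
        exact hx ▸ this ▸ hmem j
      · change Function.update t.T x (.lock k (bit b)) y ∈ I at hy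
        by_cases hyx : y = x
        · subst hyx
          rw [Function.update_self] at hy
          exact absurd hy (hlock _ _)
        · rw [Function.update_of_ne hyx] at hy
          exact hinv y hy

end Wiring

end Committed

end QSMLL

/-! ### Bisimulation of wirings up to silent moves -/

namespace QSMLL

section Contraction

variable {G : GateSet} {n : ℕ} {Γ : Fin n → Formula}

open State

/-- A way to look at the positions of a wiring: positions are identified by `φ`, tokens may move
silently along `sil`, with decreasing weight, and only stand on good positions. -/
structure View : Type where
  φ : Pos → Pos
  sil : Pos → Pos → Prop
  w : Pos → ℕ
  good : Pos → Prop

namespace View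

/-- Tokens that stand, up to identification, at `p` resp. `p'`, can be brought there silently. -/
def Consumed (v v' : View) (p p' : Pos) : Prop :=
  v.φ p = v'.φ p' ∧ (∀ r, v'.good r → v'.φ r = v.φ p → Relation.ReflTransGen v'.sil r p') ∧
    ∀ r, v.good r → v.φ r = v'.φ p' → Relation.ReflTransGen v.sil r p

/-- Weaker than `Consumed` by design: a token that has just arrived only has to stand in the right
class, whereas a token about to be used must be able to reach the exact representative silently. -/
def Produced (v v' : View) (q q' : Pos) : Prop := v.good q ∧ v'.good q' ∧ v.φ q = v'.φ q'

theorem Consumed.symm {v v' : View} {p p' : Pos} (h : Consumed v v' p p') : Consumed v' v p' p :=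
  ⟨h.1.symm, h.2.2, h.2.1⟩

theorem Produced.symm {v v' : View} {p p' : Pos} (h : Produced v v' p p') : Produced v' v p' p :=
  ⟨h.2.1, h.1, h.2.2.symm⟩

def goodGuard (v : View) (g : Option (ℕ × Bool)) : Prop := ∀ k b, g = some (k, b) → v.good (.lock k b)

end View

open View

/-- Everything that can happen in `W` and is not silent can happen in `W'`. -/
structure Wiring.Simulated (W W' : Wiring G Γ) (v v' : View) (A : Set ℕ) : Prop where
  sil_mv : ∀ {p q}, v.sil p q → v.good p → W.mv none p q ∧ v.φ p = v.φ q ∧ v.good q ∧ v.w q < v.w p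
  lock : ∀ {r k b}, v'.good r → v'.φ r = v.φ (.lock k b) → r = .lock k b
  mv : ∀ {g p q}, W.mv g p q → v.good p → v.goodGuard g →
    v.sil p q ∨ ∃ p' q', W'.mv g p' q' ∧ Consumed v v' p p' ∧ Produced v v' q q'
  syn : ∀ {u I O}, W.syn u I O → (∀ p ∈ I, v.good p) →
    ∃ I' O', W'.syn u I' O' ∧ List.Forall₂ (Consumed v v') I I' ∧ List.Forall₂ (Produced v v') O O'
  one : ∀ {g e}, W.one g e → e ∉ A → v.goodGuard g →
    W'.one g e ∧ Produced v v' (.edge e []) (.edge e [])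
  box : ∀ {k}, W.box k → v.good (.edge k []) →
    W'.box k ∧ Consumed v v' (.edge k []) (.edge k []) ∧ ∀ b, Produced v v' (.lock k b) (.lock k b)
  box_lock : ∀ {k b}, W.box k → v.good (.lock k b) → W'.box k
  fin : ∀ j, Consumed v v' (W.fin j) (W'.fin j)

/-- Corresponding states. -/
def View.Rel (v v' : View) (A : Set ℕ) (s t : State Γ) : Prop :=
  ∃ (o : Finset ℕ) (T T' : InitPos Γ ⊕ o → Pos) (P : Qubits (InitPos Γ ⊕ o)),
    s = ⟨o, T, P⟩ ∧ t = ⟨o, T', P⟩ ∧ (∀ e ∈ A, e ∈ o) ∧ ∀ x, Produced v v' (T x) (T' x)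

theorem View.Rel.symm {v v' : View} {A : Set ℕ} {s t : State Γ} (h : View.Rel v v' A s t) :
    View.Rel v' v A t s := by
  obtain ⟨o, T, T', P, rfl, rfl, hA, h⟩ := h
  exact ⟨o, T', T, P, rfl, rfl, hA, fun x => (h x).symm⟩

theorem _root_.List.exists_ofFn_of_forall₂ {α β : Type} {R : α → β → Prop} {k : ℕ} {f : Fin k → α}
    {l : List β} (h : List.Forall₂ R (List.ofFn f) l) :
    ∃ g : Fin k → β, List.ofFn g = l ∧ ∀ j, R (f j) (g j) := by
  induction k generalizing l with
  | zero =>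
    simp only [List.ofFn_zero, List.forall₂_nil_left_iff] at h
    subst h
    exact ⟨fun j => j.elim0, by simp, fun j => j.elim0⟩
  | succ k ih =>
    rw [List.ofFn_succ, List.forall₂_cons_left_iff] at h
    obtain ⟨b, l, hb, hl, rfl⟩ := h
    obtain ⟨g, rfl, hg⟩ := ih hl
    refine ⟨Fin.cons b g, by simp [List.ofFn_succ], fun j => ?_⟩
    refine Fin.cases hb (fun i => ?_) j
    simpa using hg i

namespace Wiring.Simulated

variable {W W' : Wiring G Γ} {v v' : View} {A : Set ℕ}

theorem runs_update (h : W.Simulated W' v v' A) {o : Finset ℕ} {P : Qubits (InitPos Γ ⊕ o)}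
    {T : InitPos Γ ⊕ o → Pos} {x : InitPos Γ ⊕ o} {q : Pos} (hx : v.good (T x))
    (hr : Relation.ReflTransGen v.sil (T x) q) :
    W.sys.Runs ⟨o, T, P⟩ ⟨o, Function.update T x q, P⟩ := by
  have : v.good q ∧ W.sys.Runs ⟨o, T, P⟩ ⟨o, Function.update T x q, P⟩ := by
    induction hr with
    | refl =>
      rw [Function.update_eq_self]
      exact ⟨hx, .refl⟩
    | @tail b c _ hbc ih =>
      obtain ⟨h1, -, h2, -⟩ := h.sil_mv hbc ih.1
      refine ⟨h2, ih.2.tail ⟨.move (tok x) b c, x, none, rfl, Function.update_self _ _ _,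
        fun _ _ h => by simp at h, h1, ?_⟩⟩
      exact congrArg Fam.pure (mk_congr (Function.update_idem _ _ _).symm rfl)
  exact this.2

/-- Silent moves of different tokens are independent and unguarded, so all tokens can be relocated
one after the other. -/
theorem runs (h : W.Simulated W' v v' A) {o : Finset ℕ} {P : Qubits (InitPos Γ ⊕ o)}
    {T T' : InitPos Γ ⊕ o → Pos} (hT : ∀ x, v.good (T x))
    (hr : ∀ x, Relation.ReflTransGen v.sil (T x) (T' x)) :
    W.sys.Runs ⟨o, T, P⟩ ⟨o, T', P⟩ := by
  classical
  have key : ∀ B : Finset (InitPos Γ ⊕ o),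
      W.sys.Runs ⟨o, T, P⟩ ⟨o, fun x => if x ∈ B then T' x else T x, P⟩ := by
    intro B
    induction B using Finset.induction_on with
    | empty => exact .refl
    | insert a B ha ih =>
      refine ih.trans ?_
      have e1 : (fun x => if x ∈ insert a B then T' x else T x) =
          Function.update (fun x => if x ∈ B then T' x else T x) a (T' a) := by
        funext x
        by_cases hx : x = a
        · subst hx; simp
        · simp [hx]
      rw [e1]
      exact h.runs_update (by simpa [ha] using hT a) (by simpa [ha] using hr a)
  simpa using key Finset.univ

theorem opens (h : W.Simulated W' v v' A) {s t : State Γ} (hR : View.Rel v v' A s t)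
    {g : Option (ℕ × Bool)} (hg : s.Opens g) : t.Opens g ∧ v.goodGuard g := by
  obtain ⟨o, T, T', P, rfl, rfl, hA, hT⟩ := hR
  refine ⟨fun k b hkb => ?_, fun k b hkb => ?_⟩ <;> obtain ⟨y, hy⟩ := hg k b hkb <;>
    change T y = .lock k b at hy
  · exact ⟨y, h.lock (hT y).2.1 (by rw [← hy, (hT y).2.2])⟩
  · exact hy ▸ (hT y).1

theorem runs_sys_opens {s t : State Γ} (h : W.sys.Runs s t) {g : Option (ℕ × Bool)}
    (hg : s.Opens g) : t.Opens g := by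
  induction h with
  | refl => exact hg
  | tail _ h ih =>
    obtain ⟨ℓ, h⟩ := h
    exact opens_of_lstep h () ih

/-- The total weight of the positions decreases with each silent move. Every other transition is
matched after the tokens concerned have been relocated in `t`. The set `A` contains sources that
have already fired in related states, so nothing is asked about the positions where they issue
tokens. -/
theorem sim (h : W.Simulated W' v v' A) (h' : W'.Simulated W v' v A) :
    TSys.Sim W.sys W'.sys (View.Rel v v' A) fun s => ∑ x, v.w (s.T x) := by
  rintro s t F hR ⟨ℓ, hstep⟩
  have hopens := fun g => h.opens (g := g) hR
  obtain ⟨o, T, T', P, rfl, rfl, hA, hT⟩ := hR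
  cases ℓ with
  | move x p q =>
    obtain ⟨x, g, rfl, rfl, hg, hm, rfl⟩ := hstep
    change W.mv g (T x) q at hm
    rcases h.mv hm (hT x).1 (hopens g hg).2 with hs | ⟨p', q', hm', hC, hD⟩
    · left
      obtain ⟨-, h1, h2, h3⟩ := h.sil_mv hs (hT x).1
      refine ⟨_, rfl, ⟨o, Function.update T x q, T', P, rfl, rfl, hA, fun y => ?_⟩, ?_⟩
      · by_cases hy : y = x
        · subst hy
          rw [Function.update_self]
          exact ⟨h2, (hT y).2.1, h1.symm.trans (hT y).2.2⟩
        · rw [Function.update_of_ne hy]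
          exact hT y
      · refine Finset.sum_lt_sum (fun (y : InitPos Γ ⊕ o) _ => ?_) ⟨x, Finset.mem_univ _, ?_⟩
        · change v.w (Function.update T x q y) ≤ v.w (T y)
          by_cases hy : y = x
          · subst hy
            rw [Function.update_self]
            exact h3.le
          · rw [Function.update_of_ne hy]
        · change v.w (Function.update T x q x) < v.w (T x)
          rw [Function.update_self]
          exact h3
    · right
      -- In `t` the token may stand at another representative of its class; it is first moved
      -- silently to the starting point of the matching move.
      have hr := h'.runs_update (P := P) (hT x).2.1 (hC.2.1 _ (hT x).2.1 (hT x).2.2.symm)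
      refine ⟨_, _, hr, ⟨.move (tok x) p' q', x, g, rfl, Function.update_self _ _ _,
        runs_sys_opens hr (hopens g hg).1, hm', rfl⟩, TSys.famRel_pure
        ⟨o, Function.update T x q, Function.update T' x q', P, rfl, ?_, hA, fun y => ?_⟩⟩
      · exact mk_congr (Function.update_idem _ _ _) rfl
      · by_cases hy : y = x
        · subst hy
          simpa using hD
        · rw [Function.update_of_ne hy, Function.update_of_ne hy]
          exact hT y
  | sync u r I O =>
    obtain ⟨r, T₁, hr, hs, hI, hO, hrest, rfl⟩ := hstep
    have hinj := sync_injective hI (W.syn_nodup hs)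
    obtain ⟨I', O', hs', hC, hD⟩ := h.syn hs fun p hp => by
      rw [← hI, List.mem_ofFn] at hp
      obtain ⟨j, rfl⟩ := hp
      exact (hT _).1
    rw [← hI] at hC
    rw [← hO] at hD
    obtain ⟨i', rfl, hi'⟩ := List.exists_ofFn_of_forall₂ hC
    obtain ⟨o', rfl, ho'⟩ := List.exists_ofFn_of_forall₂ hD
    right
    -- All tokens of the synchronization are first moved silently to the input positions `i'`, then
    -- cross together to `o'`.
    refine ⟨⟨o, Function.extend r i' T', P⟩, .pure ⟨o, Function.extend r o' T',
      Qubits.applyGate (G.op u) r P⟩, h'.runs (fun x => (hT x).2.1) fun x => ?_,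
      ⟨.sync u (fun j => tok (r j)) _ _, r, Function.extend r o' T', fun _ => rfl, hs', ?_, ?_, ?_, rfl⟩,
      TSys.famRel_pure ⟨o, T₁, Function.extend r o' T', _, rfl, rfl, hA, fun x => ?_⟩⟩
    · by_cases hx : ∃ j, r j = x
      · obtain ⟨j, rfl⟩ := hx
        rw [hinj.extend_apply]
        exact (hi' j).2.1 _ (hT _).2.1 (hT _).2.2.symm
      · rw [Function.extend_apply' _ _ _ hx]
    · simp only [hinj.extend_apply]
    · simp only [hinj.extend_apply]
    · intro (x : InitPos Γ ⊕ o) hx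
      have hx' : ¬ ∃ j, r j = x := fun ⟨j, hj⟩ => hx j hj
      change Function.extend r o' T' x = Function.extend r i' T' x
      rw [Function.extend_apply' _ _ _ hx', Function.extend_apply' _ _ _ hx']
    · by_cases hx : ∃ j, r j = x
      · obtain ⟨j, rfl⟩ := hx
        rw [hinj.extend_apply]
        exact ho' j
      · rw [Function.extend_apply' _ _ _ hx, hrest x fun j hj => hx ⟨j, hj⟩]
        exact hT x
  | one e =>
    obtain ⟨g, h1, hg, he, rfl⟩ := hstep
    obtain ⟨h2, hD⟩ := h.one h1 (fun hA' => he (hA e hA')) (hopens g hg).2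
    right
    refine ⟨_, _, .refl, ⟨.one e, g, h2, (hopens g hg).1, he, rfl⟩, TSys.famRel_pure
      ⟨insert e o, issueT e T, issueT e T', _, rfl, rfl,
        fun c hc => Finset.mem_insert_of_mem (hA c hc), fun y => ?_⟩⟩
    rcases eq_new_or_emb y with rfl | ⟨x, rfl⟩
    · rw [issueT_new, issueT_new]
      exact hD
    · rw [issueT_emb he, issueT_emb he]
      exact hT x
  | meas x k =>
    obtain ⟨x, rfl, hk, hx, rfl⟩ := hstep
    change T x = _ at hx
    obtain ⟨hk', hC, hD⟩ := h.box hk (hx ▸ (hT x).1)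
    have hr := h'.runs_update (P := P) (hT x).2.1
      (hC.2.1 _ (hT x).2.1 (by rw [← hx]; exact (hT x).2.2.symm))
    right
    refine ⟨_, _, hr, ⟨.meas (tok x) k, x, rfl, hk', Function.update_self _ _ _, rfl⟩,
      Equiv.refl _, fun b => ⟨rfl, o, Function.update T x (.lock k (bit b)),
        Function.update T' x (.lock k (bit b)), Qubits.collapse x (bit b) P, rfl, ?_, hA,
        fun y => ?_⟩⟩
    · exact mk_congr (Function.update_idem _ _ _) rfl
    · by_cases hy : y = x
      · subst hy
        simpa using hD (bit b)
      · rw [Function.update_of_ne hy, Function.update_of_ne hy]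
        exact hT y

/-- A token in the class of a final position can reach that position silently; in a terminal state
no silent move is left, so it is already there. -/
theorem eq_fin (h : W.Simulated W' v v' A) (h' : W'.Simulated W v' v A)
    {o : Finset ℕ} {T T' : InitPos Γ ⊕ o → Pos} {P : Qubits (InitPos Γ ⊕ o)}
    (hT : ∀ x, Produced v v' (T x) (T' x)) (ht : W'.sys.Terminal ⟨o, T', P⟩) {x : InitPos Γ ⊕ o}
    {j : FinPos Γ} (hx : T x = W.fin j) : T' x = W'.fin j := by
  have hr := (h.fin j).2.1 _ (hT x).2.1 (by rw [← hx]; exact (hT x).2.2.symm)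
  rcases Relation.ReflTransGen.cases_head hr with h1 | ⟨c, h1, -⟩
  · exact h1
  · exact absurd ⟨.move (tok x) (T' x) c, x, none, rfl, rfl, fun _ _ h => by simp at h,
      (h'.sil_mv h1 (hT x).2.1).1, rfl⟩ (ht _)

/-- In terminal states, standing at a final position or at a given `(k, b)` means the same on both
sides: the former by `eq_fin`, the latter because such positions are alone in their class. Since the
registers coincide, so do the results. -/
theorem result (h : W.Simulated W' v v' A) (h' : W'.Simulated W v' v A) {s t : State Γ}
    (hR : View.Rel v v' A s t) (hs : W.sys.Terminal s) (ht : W'.sys.Terminal t) (z : Outcome Γ)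
    (hz : W.Result s z) : W'.Result t z := by
  obtain ⟨o, T, T', P, rfl, rfl, hA, hT⟩ := hR
  have hfin : ∀ x j, T x = W.fin j ↔ T' x = W'.fin j := fun x j =>
    ⟨h.eq_fin h' hT ht,
      h'.eq_fin h (fun x => (hT x).symm) hs⟩
  have hlock : ∀ x k b, T x = .lock k b ↔ T' x = .lock k b := fun x k b =>
    ⟨fun hx => h.lock (hT x).2.1 (by rw [← hx, (hT x).2.2]),
      fun hx => h'.lock (hT x).1 (by rw [← hx, (hT x).2.2])⟩
  have himg : ∀ {U U' : Wiring G Γ} {S S' : InitPos Γ ⊕ o → Pos},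
      (∀ x j, S x = U.fin j ↔ S' x = U'.fin j) → (∀ x k b, S x = .lock k b ↔ S' x = .lock k b) →
      (∀ x k b, S x = .lock k b → U.box k → U'.box k) →
      U.FinalImage ⟨o, S, P⟩ → U'.FinalImage ⟨o, S', P⟩ := by
    rintro U U' S S' h1 h2 h3 ⟨B, hB, hrange⟩
    -- The set `B` is recomputed as the set of occupied lock positions, because the given one
    -- belongs to the other wiring.
    refine ⟨{p | p ∈ Set.range S' ∧ ∃ k b, U'.box k ∧ p = .lock k b}, fun p hp => hp.2, ?_⟩
    change Set.range S = _ at hrange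
    change Set.range S' = _
    ext p
    constructor
    · rintro ⟨x, rfl⟩
      have : S x ∈ Set.range U.fin ∪ B := hrange ▸ ⟨x, rfl⟩
      rcases this with ⟨j, hj⟩ | hxB
      · exact .inl ⟨j, ((h1 x j).1 hj.symm).symm⟩
      · obtain ⟨k, b, hk, hx⟩ := hB _ hxB
        exact .inr ⟨⟨x, rfl⟩, k, b, h3 x k b hx hk, (h2 x k b).1 hx⟩
    · rintro (⟨j, rfl⟩ | ⟨h, -⟩)
      · have : U.fin j ∈ Set.range S := hrange ▸ .inl ⟨j, rfl⟩
        obtain ⟨x, hx⟩ := this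
        exact ⟨x, (h1 x j).1 hx⟩
      · exact h
  have hi : W.FinalImage ⟨o, T, P⟩ ↔ W'.FinalImage ⟨o, T', P⟩ :=
    ⟨himg hfin hlock fun x k b hx hk => h.box_lock hk (hx ▸ (hT x).1),
      himg (fun x j => (hfin x j).symm) (fun x k b => (hlock x k b).symm)
        fun x k b hx hk => h'.box_lock hk (hx ▸ (hT x).2.1)⟩
  rcases z with _ | ⟨f, φ⟩
  · exact fun hf => hz (hi.2 hf)
  · refine ⟨hi.1 hz.1, fun i j => (hz.2.1 i j).trans (hfin _ j), fun g e h1 h2 => ?_⟩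
    exact hz.2.2 g e (fun x j hx => h1 x j ((hfin x j).1 hx))
      fun x k b hx => h2 x k b ((hlock x k b).1 hx)

/-- Wirings that simulate each other give the same values to corresponding states. -/
theorem val_eq (h : W.Simulated W' v v' A) (h' : W'.Simulated W v' v A) {s t : State Γ}
    (hR : View.Rel v v' A s t) (o : Outcome Γ) : W.sys.val s o = W'.sys.val t o := by
  have hsim' : TSys.Sim W'.sys W.sys (fun t s => View.Rel v v' A s t) fun s => ∑ x, v'.w (s.T x) := by
    have e : (fun t s => View.Rel (Γ := Γ) v v' A s t) = View.Rel v' v A := by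
      funext t s
      exact propext ⟨fun h => h.symm, fun h => h.symm⟩
    rw [e]
    exact h'.sim h
  exact TSys.val_eq_of_bisim (h.sim h') hsim'
    (fun s t hR hs ht o => ⟨h.result h' hR hs ht o, h'.result h hR.symm ht hs o⟩) hR o

end Wiring.Simulated

end Contraction

end QSMLL

/-! ### Forgetting the token that has opened a box -/

namespace QSMLL

section Discard

variable {G : GateSet} {n : ℕ} {Γ : Fin n → Formula}

open State

namespace Wiring

/-- The wiring in which the content `b` of the box with lock `k` has been opened once and for all,
by the token issued by `one e`. -/
def opened (W : Wiring G Γ) (k : ℕ) (b : Bool) (e : ℕ) : Wiring G Γ where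
  mv g p q := (W.mv g p q ∧ ∀ c, g ≠ some (k, c)) ∨ (g = none ∧ W.mv (some (k, b)) p q)
  syn := W.syn
  one g c := c ≠ e ∧ ((W.one g c ∧ ∀ b', g ≠ some (k, b')) ∨ (g = none ∧ W.one (some (k, b)) c))
  box c := W.box c ∧ c ≠ k
  fin := W.fin
  mv_edge := by
    rintro g p q (h | h)
    · exact W.mv_edge h.1
    · exact W.mv_edge h.2
  syn_edge := W.syn_edge
  syn_nodup := W.syn_nodup

/-- Positions that are not used by the token issued by `one e` on its way to the lock `k`. -/
def Avoids (k e : ℕ) (p : Pos) : Prop :=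
  p ≠ .edge e [] ∧ p ≠ .edge k [] ∧ ∀ c, p ≠ .lock k c

/-- No token but the one issued by `one e` reaches the lock `k`. -/
structure Reserved (W : Wiring G Γ) (k e : ℕ) : Prop where
  mv : ∀ {g p q}, W.mv g p q → Avoids k e p → Avoids k e q
  syn : ∀ {u I O}, W.syn u I O → ∀ q ∈ O, Avoids k e q
  one : ∀ {g c}, W.one g c → c ≠ e → Avoids k e (.edge c [])
  fin : ∀ j, Avoids k e (W.fin j)
  box : W.box k

/-- `t` is `s` without the token `e`, which is at the position `(k, b)`. -/
structure Discards (k : ℕ) (b : Bool) (e : ℕ) (s t : State Γ)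
    (f : InitPos Γ ⊕ t.ones → InitPos Γ ⊕ s.ones) (r : InitPos Γ ⊕ s.ones) : Prop where
  tok_f : ∀ x, tok (f x) = tok x
  tok_r : tok r = .inr e
  not_mem : e ∉ t.ones
  cover : ∀ y, y = r ∨ ∃ x, f x = y
  T_f : ∀ x, s.T (f x) = t.T x
  T_r : s.T r = .lock k b
  P : s.P = Qubits.adjoinBit f r b t.P
  avoids : ∀ x, Avoids k e (t.T x)

namespace Discards

variable {W : Wiring G Γ} {k : ℕ} {b : Bool} {e : ℕ} {s t : State Γ}
  {f : InitPos Γ ⊕ t.ones → InitPos Γ ⊕ s.ones} {r : InitPos Γ ⊕ s.ones}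

theorem inj (h : Discards k b e s t f r) : Function.Injective f := fun x y hxy =>
  tok_injective <| by rw [← h.tok_f, hxy, h.tok_f]

theorem ne (h : Discards k b e s t f r) (x : InitPos Γ ⊕ t.ones) : f x ≠ r := fun hx =>
  tok_ne_of_not_mem h.not_mem x (by rw [← h.tok_f, hx, h.tok_r])

theorem move (h : Discards k b e s t f r) {x : InitPos Γ ⊕ t.ones} {q : Pos}
    (hq : Avoids k e q) : Discards k b e ⟨s.ones, Function.update s.T (f x) q, s.P⟩
      ⟨t.ones, Function.update t.T x q, t.P⟩ f r where
  tok_f := h.tok_f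
  tok_r := h.tok_r
  not_mem := h.not_mem
  cover := h.cover
  T_f y := by
    change Function.update s.T (f x) q (f y) = Function.update t.T x q y
    by_cases hy : y = x
    · rw [hy, Function.update_self, Function.update_self]
    · exact (Function.update_of_ne (h.inj.ne hy) _ _).trans
        ((h.T_f y).trans (Function.update_of_ne hy _ _).symm)
  T_r := (Function.update_of_ne (h.ne x).symm _ _).trans h.T_r
  P := h.P
  avoids y := by
    change Avoids k e (Function.update t.T x q y)
    by_cases hy : y = x
    · rw [hy, Function.update_self]; exact hq
    · rw [Function.update_of_ne hy]; exact h.avoids y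

theorem prob (h : Discards k b e s t f r) (x : InitPos Γ ⊕ t.ones) (c : Bool) :
    Qubits.prob (f x) c s.P = Qubits.prob x c t.P := by
  rw [h.P]
  exact Qubits.prob_adjoinBit h.inj h.ne h.cover x c b t.P

theorem observed (h : Discards k b e s t f r) {x : InitPos Γ ⊕ t.ones} {k' : ℕ} (hk : k' ≠ k)
    (c : Bool) : Discards k b e (s.observed (f x) k' c) (t.observed x k' c) f r := by
  have h' := h.move (x := x) (q := .lock k' c) ⟨by simp, by simp, by simp [hk]⟩
  refine ⟨h.tok_f, h.tok_r, h.not_mem, h.cover, h'.T_f, h'.T_r, ?_, h'.avoids⟩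
  change Qubits.collapse (f x) c s.P = _
  rw [h.P]
  exact Qubits.collapse_adjoinBit h.inj h.ne h.cover x c b t.P

theorem famRel_measure (h : Discards k b e s t f r) {x : InitPos Γ ⊕ t.ones} {k' : ℕ}
    (hk : k' ≠ k) : TSys.FamRel (fun s t => ∃ f r, Discards k b e s t f r)
      (s.measure (f x) k') (t.measure x k') :=
  ⟨Equiv.subtypeEquivRight fun c => by rw [h.prob x c],
    fun i => ⟨h.prob x (bit i), f, r, h.observed hk (bit i)⟩⟩

theorem issue (h : Discards k b e s t f r) {c : ℕ} (hc : c ∉ t.ones) (hs : c ∉ s.ones)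
    (ha : Avoids k e (.edge c [])) : ∃ f' r', Discards k b e (s.issue c) (t.issue c) f' r' := by
  classical
  have hce : c ≠ e := fun hce => ha.1 (by rw [hce])
  -- The embedding is extended by sending the new token to the new token; old tokens are recognized
  -- as the image of `emb`.
  let f' : InitPos Γ ⊕ (insert c t.ones : Finset ℕ) → InitPos Γ ⊕ (insert c s.ones : Finset ℕ) :=
    fun y => if hy : ∃ x, emb c x = y then emb c (f hy.choose) else new Γ s.ones c
  have hf : ∀ x, f' (emb c x) = emb c (f x) := fun x => by
    have hx : ∃ y, emb c y = emb c x := ⟨x, rfl⟩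
    have : hx.choose = x := emb_injective hx.choose_spec
    simp only [f', hx, dif_pos, this]
  have hn : f' (new Γ t.ones c) = new Γ s.ones c := dif_neg fun ⟨x, hx⟩ => emb_ne_new hc x hx
  refine ⟨f', emb c r, ?_, ?_, ?_, ?_, ?_, ?_, ?_, ?_⟩
  · intro y
    rcases eq_new_or_emb y with rfl | ⟨x, rfl⟩
    · exact congrArg tok hn
    · exact (congrArg tok (hf x)).trans ((tok_emb _).trans ((h.tok_f x).trans (tok_emb x).symm))
  · exact (tok_emb r).trans h.tok_r
  · change e ∉ insert c t.ones
    simp [h.not_mem, hce.symm]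
  · intro y
    rcases eq_new_or_emb y with rfl | ⟨x, rfl⟩
    · exact .inr ⟨_, hn⟩
    · rcases h.cover x with rfl | ⟨z, rfl⟩
      · exact .inl rfl
      · exact .inr ⟨emb c z, hf z⟩
  · intro y
    rcases eq_new_or_emb y with rfl | ⟨x, rfl⟩
    · exact (congrArg (issueT c s.T) hn).trans ((issueT_new _).trans (issueT_new _).symm)
    · exact (congrArg (issueT c s.T) (hf x)).trans ((issueT_emb hs _ _).trans
        ((h.T_f x).trans (issueT_emb hc _ _).symm))
  · exact (issueT_emb hs _ _).trans h.T_r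
  · ext x
    have e1 : f' ∘ emb c = emb c ∘ f := funext hf
    simp only [State.issue, Qubits.adjoinZero_eq, h.P, Qubits.adjoinBit, Function.comp_apply,
      Function.comp_assoc, hn, e1]
    split_ifs <;> rfl
  · intro y
    change Avoids k e (issueT c t.T y)
    rcases eq_new_or_emb y with rfl | ⟨x, rfl⟩
    · rw [issueT_new]; exact ha
    · rw [issueT_emb hc]; exact h.avoids x

theorem sync (h : Discards k b e s t f r) {m : ℕ} (U : Matrix (Fin m → Bool) (Fin m → Bool) ℂ)
    {q : Fin m → InitPos Γ ⊕ t.ones} {T : InitPos Γ ⊕ s.ones → Pos} {T' : InitPos Γ ⊕ t.ones → Pos}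
    (hT : ∀ x, T (f x) = T' x) (hr : T r = s.T r) (ha : ∀ x, Avoids k e (T' x)) :
    Discards k b e ⟨s.ones, T, Qubits.applyGate U (f ∘ q) s.P⟩
      ⟨t.ones, T', Qubits.applyGate U q t.P⟩ f r := by
  refine ⟨h.tok_f, h.tok_r, h.not_mem, h.cover, hT, hr.trans h.T_r, ?_, ha⟩
  change Qubits.applyGate U (f ∘ q) s.P = _
  rw [h.P]
  exact Qubits.applyGate_adjoinBit U q h.inj h.ne b t.P

theorem opens_iff (h : Discards k b e s t f r) {g : Option (ℕ × Bool)} (hg : ∀ c, g ≠ some (k, c)) :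
    s.Opens g ↔ t.Opens g := by
  constructor
  · rintro ho k' c rfl
    obtain ⟨y, hy⟩ := ho k' c rfl
    rcases h.cover y with rfl | ⟨x, rfl⟩
    · rw [h.T_r] at hy
      cases hy
      exact absurd rfl (hg b)
    · exact ⟨x, by rw [← h.T_f, hy]⟩
  · rintro ho k' c rfl
    obtain ⟨x, hx⟩ := ho k' c rfl
    exact ⟨f x, by rw [h.T_f, hx]⟩

/-- The forgotten token is the only one on the lock `k`, all others avoiding it, so exactly the
content `b` is open. -/
theorem opens_lock (h : Discards k b e s t f r) {c : Bool} : s.Opens (some (k, c)) ↔ c = b := by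
  constructor
  · intro ho
    obtain ⟨y, hy⟩ := ho k c rfl
    rcases h.cover y with rfl | ⟨x, rfl⟩
    · rw [h.T_r] at hy
      cases hy
      rfl
    · rw [h.T_f] at hy
      exact absurd hy ((h.avoids x).2.2 c)
  · rintro rfl k' c' hc
    cases hc
    exact ⟨r, h.T_r⟩

/-- The systems run in lockstep, without silent steps. The forgotten token stands at a position no
transition uses, and since no other token can reach `k`, the guard `(k, b)` is always satisfied and
the guard on the other content never; `opened` makes the former trivial and drops the latter. It
also drops the source `e`, whose token no longer counts as issued. -/
theorem sim (hW : W.Reserved k e) : TSys.Sim W.sys (W.opened k b e).sys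
    (fun s t => ∃ f r, Discards k b e s t f r) fun _ => 0 := by
  classical
  rintro s t F ⟨f, r, h⟩ ⟨ℓ, hstep⟩
  right
  cases ℓ with
  | move x p q =>
    obtain ⟨y, g, rfl, rfl, hg, hm, rfl⟩ := hstep
    rcases h.cover y with rfl | ⟨x, rfl⟩
    · obtain ⟨_, _, h0⟩ := W.mv_edge hm
      rw [h.T_r] at h0
      cases h0
    rw [h.T_f] at hm
    have ha := hW.mv hm (h.avoids x)
    by_cases hgk : ∃ c, g = some (k, c)
    · obtain ⟨c, rfl⟩ := hgk
      obtain rfl := h.opens_lock.1 hg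
      exact ⟨t, _, .refl, ⟨.move (tok x) (t.T x) q, x, none, rfl, rfl, fun _ _ h => by simp at h,
        .inr ⟨rfl, hm⟩, rfl⟩, TSys.famRel_pure ⟨f, r, h.move ha⟩⟩
    · push Not at hgk
      exact ⟨t, _, .refl, ⟨.move (tok x) (t.T x) q, x, g, rfl, rfl, (h.opens_iff hgk).1 hg,
        .inl ⟨hm, hgk⟩, rfl⟩, TSys.famRel_pure ⟨f, r, h.move ha⟩⟩
  | sync u q I O =>
    obtain ⟨q, T, hq, hs, hI, hO, hrest, rfl⟩ := hstep
    have hqr : ∀ j, q j ≠ r := fun j hj => by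
      obtain ⟨_, _, h0⟩ := W.syn_edge hs (s.T (q j)) (hI ▸ List.mem_ofFn.2 ⟨j, rfl⟩)
      rw [hj, h.T_r] at h0
      cases h0
    choose q' hq' using fun j => (h.cover (q j)).resolve_left (hqr j)
    obtain rfl : f ∘ q' = q := funext hq'
    refine ⟨t, _, .refl, ⟨.sync u (fun j => tok (q' j)) I O, q', T ∘ f, fun _ => rfl, hs, ?_, hO,
      fun x hx => ?_, rfl⟩, TSys.famRel_pure ⟨f, r, h.sync (m := G.arity u) (q := q') (T' := T ∘ f) (G.op u).1
        (fun _ => rfl) (hrest r hqr) ?_⟩⟩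
    · rw [← hI]; congr 1; funext j; exact (h.T_f _).symm
    · exact (hrest (f x) fun j hj => hx j (h.inj hj)).trans (h.T_f x)
    · intro x
      by_cases hx : ∃ j, q' j = x
      · obtain ⟨j, rfl⟩ := hx
        exact hW.syn hs _ (hO ▸ List.mem_ofFn.2 ⟨j, rfl⟩)
      · have : T (f x) = t.T x := (hrest (f x) fun j hj => hx ⟨j, h.inj hj⟩).trans (h.T_f x)
        exact (show (T ∘ f) x = t.T x from this) ▸ h.avoids x
  | one c =>
    obtain ⟨g, h1, hg, hc, rfl⟩ := hstep
    have hct : c ∉ t.ones := fun hct => hc <| by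
      have h2 := h.tok_f (.inr ⟨c, hct⟩)
      generalize f (.inr ⟨c, hct⟩) = y at h2
      rcases y with y | ⟨y, hy⟩
      · simp [tok] at h2
      · simp only [tok, Sum.map_inr, Sum.inr.injEq] at h2
        exact h2 ▸ hy
    have hce : c ≠ e := by
      rintro rfl
      exact tok_ne_of_not_mem hc r h.tok_r
    have ha := hW.one h1 hce
    by_cases hgk : ∃ c, g = some (k, c)
    · obtain ⟨c, rfl⟩ := hgk
      obtain rfl := h.opens_lock.1 hg
      exact ⟨t, _, .refl, ⟨.one _, none, ⟨hce, .inr ⟨rfl, h1⟩⟩, fun _ _ h => by simp at h, hct, rfl⟩,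
        TSys.famRel_pure (h.issue hct hc ha)⟩
    · push Not at hgk
      exact ⟨t, _, .refl, ⟨.one _, g, ⟨hce, .inl ⟨h1, hgk⟩⟩, (h.opens_iff hgk).1 hg, hct, rfl⟩,
        TSys.famRel_pure (h.issue hct hc ha)⟩
  | meas x k' =>
    obtain ⟨y, rfl, hk, hy, rfl⟩ := hstep
    rcases h.cover y with rfl | ⟨x, rfl⟩
    · rw [h.T_r] at hy
      cases hy
    rw [h.T_f] at hy
    have hk' : k' ≠ k := fun hkk => (h.avoids x).2.1 (by rw [hy, hkk])
    exact ⟨t, _, .refl, ⟨.meas (tok x) k', x, rfl, ⟨hk, hk'⟩, hy, rfl⟩, h.famRel_measure hk'⟩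

theorem sim' (hW : W.Reserved k e) : TSys.Sim (W.opened k b e).sys W.sys
    (fun t s => ∃ f r, Discards k b e s t f r) fun _ => 0 := by
  classical
  rintro t s F ⟨f, r, h⟩ ⟨ℓ, hstep⟩
  right
  cases ℓ with
  | move x p q =>
    obtain ⟨x, g, rfl, rfl, hg, hm, rfl⟩ := hstep
    rcases hm with ⟨hm, hgk⟩ | ⟨rfl, hm⟩
    · exact ⟨s, _, .refl, ⟨.move (tok (f x)) (s.T (f x)) q, f x, g, rfl, rfl,
        (h.opens_iff hgk).2 hg, by rwa [h.T_f], rfl⟩,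
        TSys.famRel_pure ⟨f, r, h.move (hW.mv hm (h.avoids x))⟩⟩
    · exact ⟨s, _, .refl, ⟨.move (tok (f x)) (s.T (f x)) q, f x, some (k, b), rfl, rfl,
        h.opens_lock.2 rfl, by rwa [h.T_f], rfl⟩,
        TSys.famRel_pure ⟨f, r, h.move (hW.mv hm (h.avoids x))⟩⟩
  | sync u q I O =>
    obtain ⟨q, T, hq, hs, hI, hO, hrest, rfl⟩ := hstep
    -- Final positions of the enlarged state: those of `T` along the embedding, while the forgotten
    -- token stays where it is.
    let T' : InitPos Γ ⊕ s.ones → Pos := fun y => if hy : ∃ x, f x = y then T hy.choose else s.T y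
    have hT' : ∀ x, T' (f x) = T x := fun x => by
      have hx : ∃ y, f y = f x := ⟨x, rfl⟩
      have : hx.choose = x := h.inj hx.choose_spec
      simp only [T', hx, dif_pos, this]
    have hTr : T' r = s.T r := dif_neg fun ⟨x, hx⟩ => h.ne x hx
    refine ⟨s, _, .refl, ⟨.sync u (fun j => tok (f (q j))) I O, f ∘ q, T', fun _ => rfl, hs, ?_, ?_,
      fun y hy => ?_, rfl⟩, TSys.famRel_pure ⟨f, r, h.sync (m := G.arity u) (q := q) (G.op u).1
        hT' hTr ?_⟩⟩
    · rw [← hI]; congr 1; funext j; exact h.T_f _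
    · rw [← hO]; congr 1; funext j; exact hT' _
    · rcases h.cover y with rfl | ⟨x, rfl⟩
      · exact hTr
      · rw [hT', h.T_f]
        exact hrest x fun j hj => hy j (congrArg f hj)
    · intro x
      by_cases hx : ∃ j, q j = x
      · obtain ⟨j, rfl⟩ := hx
        exact hW.syn hs _ (hO ▸ List.mem_ofFn.2 ⟨j, rfl⟩)
      · rw [hrest x fun j hj => hx ⟨j, hj⟩]
        exact h.avoids x
  | one c =>
    obtain ⟨g, ⟨hce, h1⟩, hg, hc, rfl⟩ := hstep
    have hcs : c ∉ s.ones := fun hcs => by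
      have h2 : tok (Sum.inr ⟨c, hcs⟩ : InitPos Γ ⊕ s.ones) = .inr c := rfl
      rcases h.cover (.inr ⟨c, hcs⟩) with h3 | ⟨x, h3⟩
      · rw [h3, h.tok_r] at h2
        exact hce (by simpa using h2.symm)
      · rw [← h3, h.tok_f] at h2
        exact tok_ne_of_not_mem hc x h2
    rcases h1 with ⟨h1, hgk⟩ | ⟨rfl, h1⟩
    · exact ⟨s, _, .refl, ⟨.one _, g, h1, (h.opens_iff hgk).2 hg, hcs, rfl⟩,
        TSys.famRel_pure (h.issue hc hcs (hW.one h1 hce))⟩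
    · exact ⟨s, _, .refl, ⟨.one _, some (k, b), h1, h.opens_lock.2 rfl, hcs, rfl⟩,
        TSys.famRel_pure (h.issue hc hcs (hW.one h1 hce))⟩
  | meas x k' =>
    obtain ⟨x, rfl, ⟨hk, hk'⟩, hx, rfl⟩ := hstep
    exact ⟨s, _, .refl, ⟨.meas (tok (f x)) k', f x, rfl, hk, (h.T_f x).trans hx, rfl⟩,
      (h.famRel_measure hk').flip⟩

theorem finalImage_iff (hW : W.Reserved k e) (h : Discards k b e s t f r) :
    W.FinalImage s ↔ (W.opened k b e).FinalImage t := by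
  constructor
  · rintro ⟨B, hB, hrange⟩
    refine ⟨{p | p ∈ Set.range t.T ∧ ∃ k' b', (W.box k' ∧ k' ≠ k) ∧ p = .lock k' b'},
      fun p hp => hp.2, ?_⟩
    ext p
    constructor
    · rintro ⟨x, rfl⟩
      have : t.T x ∈ Set.range W.fin ∪ B := hrange ▸ ⟨f x, h.T_f x⟩
      rcases this with hx | hx
      · exact .inl hx
      · obtain ⟨k', b', hk, hx⟩ := hB _ hx
        exact .inr ⟨⟨x, rfl⟩, k', b', ⟨hk, fun hkk => (h.avoids x).2.2 b' (hkk ▸ hx)⟩, hx⟩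
    · rintro (⟨j, rfl⟩ | ⟨h, -⟩)
      · have : W.fin j ∈ Set.range s.T := hrange ▸ .inl ⟨j, rfl⟩
        obtain ⟨y, hy⟩ := this
        rcases h.cover y with rfl | ⟨x, rfl⟩
        · exact absurd (hy.symm.trans h.T_r) ((hW.fin j).2.2 b)
        · exact ⟨x, (h.T_f x).symm.trans hy⟩
      · exact h
  · rintro ⟨B, hB, hrange⟩
    -- The forgotten token accounts for one more occupied lock position.
    refine ⟨insert (.lock k b) B, ?_, ?_⟩
    · rintro p (rfl | hp)
      · exact ⟨k, b, hW.box, rfl⟩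
      · obtain ⟨k', b', hk, rfl⟩ := hB p hp
        exact ⟨k', b', hk.1, rfl⟩
    · ext p
      constructor
      · rintro ⟨y, rfl⟩
        rcases h.cover y with rfl | ⟨x, rfl⟩
        · exact .inr (.inl h.T_r)
        · have : t.T x ∈ Set.range W.fin ∪ B := hrange ▸ ⟨x, rfl⟩
          rw [h.T_f]
          exact this.imp id .inr
      · rintro (hp | rfl | hp)
        · obtain ⟨x, hx⟩ : p ∈ Set.range t.T := hrange ▸ .inl hp
          exact ⟨f x, (h.T_f x).trans hx⟩
        · exact ⟨r, h.T_r⟩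
        · obtain ⟨x, hx⟩ : p ∈ Set.range t.T := hrange ▸ .inr hp
          exact ⟨f x, (h.T_f x).trans hx⟩

theorem readOut_iff (hW : W.Reserved k e) (h : Discards k b e s t f r) (a : InitPos Γ ≃. FinPos Γ)
    (φ : Qubits (FinPos Γ)) : W.ReadOut s a φ ↔ (W.opened k b e).ReadOut t a φ := by
  have hinl : ∀ i, f (.inl i) = .inl i := fun i => tok_injective (h.tok_f _)
  have hT : ∀ i, s.T (.inl i) = t.T (.inl i) := fun i => by rw [← h.T_f, hinl]
  refine and_congr (by simp only [hT]; rfl) ⟨fun H g z h1 h2 => ?_, fun H g z h1 h2 => ?_⟩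
  -- An assignment of the smaller register is extended by the classical value `b` at the forgotten
  -- token, which is the value prescribed by its lock position.
  · have e1 : ∀ x, Function.extend f z (fun _ => b) (f x) = z x := fun x => h.inj.extend_apply _ _ _
    have e2 : Function.extend f z (fun _ => b) r = b :=
      Function.extend_apply' _ _ _ fun ⟨x, hx⟩ => h.ne x hx
    rw [H g (Function.extend f z fun _ => b), h.P]
    · simp only [Qubits.adjoinBit, e2, if_true]
      exact congrArg t.P (funext e1)
    · intro y j hy
      rcases h.cover y with rfl | ⟨x, rfl⟩
      · exact absurd (hy.symm.trans h.T_r) ((hW.fin j).2.2 b)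
      · rw [e1]
        exact h1 x j ((h.T_f x).symm.trans hy)
    · intro y k' b' hy
      rcases h.cover y with rfl | ⟨x, rfl⟩
      · rw [h.T_r] at hy
        cases hy
        exact e2
      · rw [e1]
        exact h2 x k' b' ((h.T_f x).symm.trans hy)
  · rw [H g (z ∘ f) (fun x j hx => h1 _ j ((h.T_f x).trans hx))
      (fun x k' b' hx => h2 _ k' b' ((h.T_f x).trans hx)), h.P]
    simp only [Qubits.adjoinBit, h2 r k b h.T_r, if_true]

/-- The token that has opened a box may be forgotten. -/
theorem val_eq (hW : W.Reserved k e) (h : Discards k b e s t f r) (o : Outcome Γ) :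
    W.sys.val s o = (W.opened k b e).sys.val t o := by
  refine TSys.val_eq_of_bisim (sim hW) (sim' hW) ?_ ⟨f, r, h⟩ o
  rintro s t ⟨f, r, h⟩ - - (_ | ⟨a, φ⟩)
  · exact not_congr (h.finalImage_iff hW)
  · exact and_congr (h.finalImage_iff hW) (h.readOut_iff hW a φ)

end Discards

end Wiring

end Discard

end QSMLL

namespace QSMLL

/-! ### The wiring of a structure -/

namespace Formula

theorem dual_dual (A : Formula) : A.dual.dual = A := by
  induction A <;> simp_all [dual]

theorem pol_dual (A : Formula) (m : List Bool) : A.dual.pol m = (A.pol m).map not := by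
  induction A generalizing m with
  | tens A B iA iB | par A B iA iB => rcases m with _ | ⟨_ | _, m⟩ <;> simp [dual, pol, iA, iB]
  | _ => cases m <;> simp [dual, pol]

theorem addrs_dual (A : Formula) : A.dual.addrs = A.addrs := by
  induction A <;> simp_all [dual, addrs]

theorem isPos_dual (A : Formula) : A.dual.isPos = A.isNeg := by
  induction A <;> simp_all [dual, isPos, isNeg]

theorem mem_addrs_of_pol {A : Formula} {m : List Bool} {b : Bool} (h : A.pol m = some b) :
    m ∈ A.addrs := by
  induction A generalizing m with
  | tens A B iA iB | par A B iA iB =>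
    rcases m with _ | ⟨_ | _, m⟩
    · simp [pol] at h
    · simpa [addrs] using iA h
    · simpa [addrs] using iB h
  | _ => cases m <;> simp_all [pol, addrs]

theorem pol_of_isPos {A : Formula} (hA : A.isPos = true) {m : List Bool} (hm : m ∈ A.addrs) :
    A.pol m = some true := by
  induction A generalizing m with
  | tens A B iA iB =>
    simp only [isPos, Bool.and_eq_true] at hA
    simp only [addrs, List.mem_append, List.mem_map] at hm
    rcases hm with ⟨m, hm, rfl⟩ | ⟨m, hm, rfl⟩
    · exact iA hA.1 hm
    · exact iB hA.2 hm
  | _ => simp_all [isPos, addrs, pol]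

theorem pol_of_isNeg {A : Formula} (hA : A.isNeg = true) {m : List Bool} (hm : m ∈ A.addrs) :
    A.pol m = some false := by
  rw [← isPos_dual] at hA
  rw [← addrs_dual] at hm
  have := pol_of_isPos hA hm
  rw [pol_dual] at this
  rcases h : A.pol m with _ | b
  · simp [h] at this
  · simpa [h] using this

theorem not_isPos_and_isNeg {A : Formula} (h : A.isPos = true) : A.isNeg = false := by
  cases A <;> simp_all [isPos, isNeg]

theorem addrs_nodup (A : Formula) : A.addrs.Nodup := by
  induction A with
  | tens A B iA iB | par A B iA iB =>
    simp only [addrs]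
    refine List.Nodup.append (iA.map fun _ _ h => by simpa using h)
      (iB.map fun _ _ h => by simpa using h) ?_
    intro m h1 h2
    simp only [List.mem_map] at h1 h2
    obtain ⟨_, _, rfl⟩ := h1
    obtain ⟨_, _, h⟩ := h2
    simp at h
  | _ => simp [addrs]

end Formula

/-- Renaming of edges in positions. -/
def Pos.map (σ : ℕ → ℕ) : Pos → Pos
  | .edge e m => .edge (σ e) m
  | .lock k b => .lock k b

@[simp] theorem Pos.map_edge (σ : ℕ → ℕ) (e : ℕ) (m : List Bool) :
    Pos.map σ (.edge e m) = .edge (σ e) m := rfl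

@[simp] theorem Pos.map_lock (σ : ℕ → ℕ) (k : ℕ) (b : Bool) :
    Pos.map σ (.lock k b) = .lock k b := rfl

theorem Pos.map_id (p : Pos) : p.map id = p := by cases p <;> rfl

namespace Node

variable {G : GateSet}

theorem rename_id (v : Node G) : v.rename id = v := by
  cases v <;> simp [rename]

/-- Edges from which the node takes premisses, including the conclusions of its contents. -/
def tgts (v : Node G) : List ℕ := v.prems ++ v.inner

/-- Elementary connections between edges: `Link v g s e l e'` means that tokens move between `(e, m)`
and `(e', l ++ m)`, leaving `e` if the polarity of `m` is `s`. -/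
inductive Link : Node G → Option (ℕ × Bool) → Bool → ℕ → List Bool → ℕ → Prop
  | ax (a b : ℕ) : Link (.ax a b) none false a [] b
  | cut (a b : ℕ) : Link (.cut a b) none true a [] b
  | tens_left (a b c : ℕ) : Link (.tens a b c) none true a [false] c
  | tens_right (a b c : ℕ) : Link (.tens a b c) none true b [true] c
  | par_left (a b c : ℕ) : Link (.par a b c) none true a [false] c
  | par_right (a b c : ℕ) : Link (.par a b c) none true b [true] c
  | box (k : ℕ) (aux : List ℕ) (cont : Bool → List ℕ) (b : Bool) (x y : ℕ)
      (h : (x, y) ∈ (cont b).zip aux) : Link (.box k aux cont) (some (k, b)) true x [] y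

/-- The moves of single tokens through a node. -/
inductive Mv (ty : ℕ → Formula) (v : Node G) (g : Option (ℕ × Bool)) : Pos → Pos → Prop
  | fwd {s : Bool} {e e' : ℕ} {l m : List Bool} (h : v.Link g s e l e')
      (hm : (ty e).pol m = some s) : Mv ty v g (.edge e m) (.edge e' (l ++ m))
  | bwd {s : Bool} {e e' : ℕ} {l m : List Bool} (h : v.Link g s e l e')
      (hm : (ty e).pol m = some (!s)) : Mv ty v g (.edge e' (l ++ m)) (.edge e m)

/-- The positions through which tokens enter a node. -/
inductive Cons (ty : ℕ → Formula) (v : Node G) : Pos → Prop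
  | tgt {e : ℕ} {m : List Bool} (h : e ∈ v.tgts) (hm : (ty e).pol m = some true) :
      Cons ty v (.edge e m)
  | concl {e : ℕ} {m : List Bool} (h : e ∈ v.concls) (hm : (ty e).pol m = some false) :
      Cons ty v (.edge e m)

/-- The positions through which tokens leave a node. -/
inductive Prod (ty : ℕ → Formula) (v : Node G) : Pos → Prop
  | tgt {e : ℕ} {m : List Bool} (h : e ∈ v.tgts) (hm : (ty e).pol m = some false) :
      Prod ty v (.edge e m)
  | concl {e : ℕ} {m : List Bool} (h : e ∈ v.concls) (hm : (ty e).pol m = some true) :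
      Prod ty v (.edge e m)

variable {ty : ℕ → Formula} {v : Node G}

theorem zip_ty {k : ℕ} {aux : List ℕ} {cont : Bool → List ℕ}
    (hv : (Node.box k aux cont : Node G).WellTyped ty) {b : Bool} {x y : ℕ}
    (h : (x, y) ∈ (cont b).zip aux) : ty x = ty y := by
  have h2 := hv.2 b
  obtain ⟨i, hi, h3⟩ := List.mem_iff_getElem.1 h
  rw [List.getElem_zip, Prod.mk.injEq] at h3
  simp only [List.length_zip, lt_inf_iff] at hi
  rw [← h3.1, ← h3.2]
  have e1 : ((cont b).map ty)[i]'(by simpa using hi.1) = (aux.map ty)[i]'(by simpa using hi.2) := by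
    simp only [h2]
  simpa using e1

/-- There are three kinds of links: between two conclusions (axiom), between two targets (cut), and
from a target to a conclusion. Polarity is reversed by the first two kinds and kept by the third;
together with the direction of movement this decides on which side tokens enter and leave a node. -/
theorem Link.spec {g : Option (ℕ × Bool)} {s : Bool} {e e' : ℕ} {l : List Bool}
    (h : v.Link g s e l e') (hv : v.WellTyped ty) :
    (s = false ∧ e ∈ v.concls ∧ e' ∈ v.concls ∧ ∀ m, (ty e').pol (l ++ m) = ((ty e).pol m).map not) ∨
    (s = true ∧ e ∈ v.tgts ∧ e' ∈ v.tgts ∧ ∀ m, (ty e').pol (l ++ m) = ((ty e).pol m).map not) ∨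
    (s = true ∧ e ∈ v.tgts ∧ e' ∈ v.concls ∧ ∀ m, (ty e').pol (l ++ m) = (ty e).pol m) := by
  cases h with
  | ax a b =>
    refine .inl ⟨rfl, by simp [concls], by simp [concls], fun m => ?_⟩
    rw [show ty e' = (ty e).dual from hv]
    exact Formula.pol_dual _ _
  | cut a b =>
    refine .inr (.inl ⟨rfl, by simp [tgts, prems], by simp [tgts, prems], fun m => ?_⟩)
    rw [show ty e' = (ty e).dual from hv]
    exact Formula.pol_dual _ _
  | tens_left a b c =>
    refine .inr (.inr ⟨rfl, by simp [tgts, prems], by simp [concls], fun m => ?_⟩)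
    rw [show ty e' = _ from hv]
    rfl
  | tens_right a b c =>
    refine .inr (.inr ⟨rfl, by simp [tgts, prems], by simp [concls], fun m => ?_⟩)
    rw [show ty e' = _ from hv]
    rfl
  | par_left a b c =>
    refine .inr (.inr ⟨rfl, by simp [tgts, prems], by simp [concls], fun m => ?_⟩)
    rw [show ty e' = _ from hv]
    rfl
  | par_right a b c =>
    refine .inr (.inr ⟨rfl, by simp [tgts, prems], by simp [concls], fun m => ?_⟩)
    rw [show ty e' = _ from hv]
    rfl
  | box k aux cont b x y h =>
    refine .inr (.inr ⟨rfl, ?_, ?_, fun m => ?_⟩)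
    · have := (List.of_mem_zip h).1
      cases b <;> simp [tgts, inner, this]
    · simp [concls, (List.of_mem_zip h).2]
    · have : ty e = ty e' := zip_ty hv h
      rw [this]
      rfl

theorem Mv.cons {g : Option (ℕ × Bool)} {p q : Pos} (h : v.Mv ty g p q) (hv : v.WellTyped ty) :
    v.Cons ty p := by
  cases h with
  | fwd h hm =>
    rcases h.spec hv with ⟨rfl, h1, h2, h3⟩ | ⟨rfl, h1, h2, h3⟩ | ⟨rfl, h1, h2, h3⟩
    · exact .concl h1 hm
    · exact .tgt h1 hm
    · exact .tgt h1 hm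
  | bwd h hm =>
    rcases h.spec hv with ⟨rfl, h1, h2, h3⟩ | ⟨rfl, h1, h2, h3⟩ | ⟨rfl, h1, h2, h3⟩
    · exact .concl h2 (by simp [h3, hm])
    · exact .tgt h2 (by simp [h3, hm])
    · exact .concl h2 (by simp [h3, hm])

theorem Mv.prod {g : Option (ℕ × Bool)} {p q : Pos} (h : v.Mv ty g p q) (hv : v.WellTyped ty) :
    v.Prod ty q := by
  cases h with
  | fwd h hm =>
    rcases h.spec hv with ⟨rfl, h1, h2, h3⟩ | ⟨rfl, h1, h2, h3⟩ | ⟨rfl, h1, h2, h3⟩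
    · exact .concl h2 (by simp [h3, hm])
    · exact .tgt h2 (by simp [h3, hm])
    · exact .concl h2 (by simp [h3, hm])
  | bwd h hm =>
    rcases h.spec hv with ⟨rfl, h1, h2, h3⟩ | ⟨rfl, h1, h2, h3⟩ | ⟨rfl, h1, h2, h3⟩
    · exact .concl h1 hm
    · exact .tgt h1 hm
    · exact .tgt h1 hm

theorem Mv.edges {g : Option (ℕ × Bool)} {p q : Pos} (h : v.Mv ty g p q) :
    (∃ e m, p = .edge e m) ∧ ∃ e m, q = .edge e m := by
  cases h <;> exact ⟨⟨_, _, rfl⟩, _, _, rfl⟩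

/-- Positions on the in-edges of a sync node. -/
def inPos (ty : ℕ → Formula) (l : List (ℕ × ℕ)) : List Pos :=
  l.flatMap fun p => (ty p.1).addrs.map (Pos.edge (if (ty p.1).isPos = true then p.1 else p.2))

/-- Positions on the out-edges of a sync node. -/
def outPos (ty : ℕ → Formula) (l : List (ℕ × ℕ)) : List Pos :=
  l.flatMap fun p => (ty p.1).addrs.map (Pos.edge (if (ty p.1).isPos = true then p.2 else p.1))

theorem cons_of_mem_inPos {u : G.Sym} {l : List (ℕ × ℕ)}
    (hv : (Node.sync u l : Node G).WellTyped ty) {p : Pos} (hp : p ∈ inPos ty l) :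
    (Node.sync u l : Node G).Cons ty p := by
  simp only [inPos, List.mem_flatMap, List.mem_map] at hp
  obtain ⟨x, hx, m, hm, rfl⟩ := hp
  obtain ⟨h1, h2⟩ := hv.2.1 x hx
  split_ifs with h
  · exact .tgt (by simpa [tgts, prems, inner] using ⟨x.2, hx⟩) (Formula.pol_of_isPos h hm)
  · have h3 := h2.resolve_left h
    refine .concl (by simpa [concls] using ⟨x.1, hx⟩) ?_
    rw [← h1]
    exact Formula.pol_of_isNeg h3 hm

theorem prod_of_mem_outPos {u : G.Sym} {l : List (ℕ × ℕ)}
    (hv : (Node.sync u l : Node G).WellTyped ty) {p : Pos} (hp : p ∈ outPos ty l) :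
    (Node.sync u l : Node G).Prod ty p := by
  simp only [outPos, List.mem_flatMap, List.mem_map] at hp
  obtain ⟨x, hx, m, hm, rfl⟩ := hp
  obtain ⟨h1, h2⟩ := hv.2.1 x hx
  split_ifs with h
  · refine .concl (by simpa [concls] using ⟨x.1, hx⟩) ?_
    rw [← h1]
    exact Formula.pol_of_isPos h hm
  · have h3 := h2.resolve_left h
    exact .tgt (by simpa [tgts, prems, inner] using ⟨x.2, hx⟩) (Formula.pol_of_isNeg h3 hm)

theorem inPos_map {ty' : ℕ → Formula} {σ : ℕ → ℕ} {l : List (ℕ × ℕ)}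
    (h : ∀ p ∈ l, ty' (σ p.1) = ty p.1) :
    inPos ty' (l.map fun p => (σ p.1, σ p.2)) = (inPos ty l).map (Pos.map σ) := by
  simp only [inPos, List.flatMap_map, List.map_flatMap, List.map_map]
  refine List.flatMap_congr fun p hp => ?_
  rw [h p hp]
  refine List.map_congr_left fun m _ => ?_
  simp only [Function.comp, Pos.map_edge]
  split_ifs <;> rfl

theorem outPos_map {ty' : ℕ → Formula} {σ : ℕ → ℕ} {l : List (ℕ × ℕ)}
    (h : ∀ p ∈ l, ty' (σ p.1) = ty p.1) :
    outPos ty' (l.map fun p => (σ p.1, σ p.2)) = (outPos ty l).map (Pos.map σ) := by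
  simp only [outPos, List.flatMap_map, List.map_flatMap, List.map_map]
  refine List.flatMap_congr fun p hp => ?_
  rw [h p hp]
  refine List.map_congr_left fun m _ => ?_
  simp only [Function.comp, Pos.map_edge]
  split_ifs <;> rfl

/-! Renaming -/

/-- `σ` does not rename the lock of `v`. -/
def LockFixed (σ : ℕ → ℕ) (v : Node G) : Prop := ∀ k aux cont, v = .box k aux cont → σ k = k

/-- The guard of a link through a box names the lock, and guards are not renamed; this is why `σ`
has to fix locks. -/
theorem Link.rename {σ : ℕ → ℕ} (hσ : v.LockFixed σ) {g : Option (ℕ × Bool)} {s : Bool} {e e' : ℕ}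
    {l : List Bool} (h : v.Link g s e l e') : (v.rename σ).Link g s (σ e) l (σ e') := by
  cases h with
  | ax a b => exact .ax _ _
  | cut a b => exact .cut _ _
  | tens_left a b c => exact .tens_left _ _ _
  | tens_right a b c => exact .tens_right _ _ _
  | par_left a b c => exact .par_left _ _ _
  | par_right a b c => exact .par_right _ _ _
  | box k aux cont b x y h =>
    have := Link.box (G := G) (σ k) (aux.map σ) (fun b => (cont b).map σ) b (σ e) (σ e') (by
      rw [List.zip_map]
      exact List.mem_map.2 ⟨_, h, rfl⟩)
    rw [hσ k aux cont rfl] at this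
    simpa [Node.rename, hσ k aux cont rfl] using this

theorem Link.of_rename {σ : ℕ → ℕ} (hσ : v.LockFixed σ) {g : Option (ℕ × Bool)} {s : Bool} {f f' : ℕ}
    {l : List Bool} (h : (v.rename σ).Link g s f l f') :
    ∃ e e', v.Link g s e l e' ∧ f = σ e ∧ f' = σ e' := by
  cases v with
  | ax a b => cases h; exact ⟨_, _, .ax _ _, rfl, rfl⟩
  | cut a b => cases h; exact ⟨_, _, .cut _ _, rfl, rfl⟩
  | tens a b c =>
    cases h
    · exact ⟨_, _, .tens_left _ _ _, rfl, rfl⟩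
    · exact ⟨_, _, .tens_right _ _ _, rfl, rfl⟩
  | par a b c =>
    cases h
    · exact ⟨_, _, .par_left _ _ _, rfl, rfl⟩
    · exact ⟨_, _, .par_right _ _ _, rfl, rfl⟩
  | one c => cases h
  | sync u l => cases h
  | box k aux cont =>
    simp only [Node.rename, hσ k aux cont rfl] at h
    cases h with
    | box _ _ _ b _ _ h =>
      rw [List.zip_map, List.mem_map] at h
      obtain ⟨⟨x, y⟩, h, h2⟩ := h
      simp only [Prod.map, Prod.mk.injEq] at h2
      exact ⟨x, y, .box _ _ _ _ _ _ h, h2.1.symm, h2.2.symm⟩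

theorem Link.mem {g : Option (ℕ × Bool)} {s : Bool} {e e' : ℕ} {l : List Bool}
    (h : v.Link g s e l e') : e ∈ v.tgts ++ v.concls ∧ e' ∈ v.tgts ++ v.concls := by
  cases h with
  | box k aux cont b x y h =>
    have h := List.of_mem_zip h
    cases b <;> simp [tgts, prems, inner, concls, h.1, h.2]
  | _ => simp [tgts, prems, inner, concls]

theorem Mv.rename {ty' : ℕ → Formula} {σ : ℕ → ℕ} (hσ : v.LockFixed σ)
    (hty : ∀ x ∈ v.tgts ++ v.concls, ty' (σ x) = ty x) {g : Option (ℕ × Bool)} {p q : Pos}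
    (h : v.Mv ty g p q) : (v.rename σ).Mv ty' g (p.map σ) (q.map σ) := by
  cases h with
  | fwd h hm => exact .fwd (h.rename hσ) (by rwa [hty _ h.mem.1])
  | bwd h hm => exact .bwd (h.rename hσ) (by rwa [hty _ h.mem.1])

theorem Mv.of_rename {ty' : ℕ → Formula} {σ : ℕ → ℕ} (hσ : v.LockFixed σ)
    (hty : ∀ x ∈ v.tgts ++ v.concls, ty' (σ x) = ty x) {g : Option (ℕ × Bool)} {p' q' : Pos}
    (h : (v.rename σ).Mv ty' g p' q') :
    ∃ p q, v.Mv ty g p q ∧ p' = p.map σ ∧ q' = q.map σ := by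
  cases h with
  | fwd h hm =>
    obtain ⟨e, e', h₀, rfl, rfl⟩ := h.of_rename hσ
    rw [hty _ h₀.mem.1] at hm
    exact ⟨_, _, .fwd h₀ hm, rfl, rfl⟩
  | bwd h hm =>
    obtain ⟨e, e', h₀, rfl, rfl⟩ := h.of_rename hσ
    rw [hty _ h₀.mem.1] at hm
    exact ⟨_, _, .bwd h₀ hm, rfl, rfl⟩

end Node

end QSMLL

/-! ### Linearity of edges and the wiring of a structure -/

namespace QSMLL

section StructWiring

variable {G : GateSet} {n : ℕ} {Γ : Fin n → Formula}

theorem _root_.Multiset.eq_of_nodup_bind {α β : Type*} {s : Multiset α} {f : α → Multiset β}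
    (h : (s.bind f).Nodup) {v w : α} (hv : v ∈ s) (hw : w ∈ s) {e : β} (h1 : e ∈ f v)
    (h2 : e ∈ f w) : v = w := by
  by_contra hne
  obtain ⟨t, rfl⟩ := Multiset.exists_cons_of_mem hv
  have hw' : w ∈ t := by
    rcases Multiset.mem_cons.1 hw with h | h
    · exact absurd h.symm hne
    · exact h
  rw [Multiset.cons_bind, Multiset.nodup_add] at h
  exact Multiset.disjoint_left.1 h.2.2 h1 (Multiset.mem_bind.2 ⟨w, hw', h2⟩)

namespace Struct

variable (R : Struct G Γ)

/-- The edges counted by targets are the same multiset as the edges counted by sources, so linearity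
of sources carries over to targets. -/
theorem tgt_nodup : ((List.ofFn R.concl : Multiset ℕ) +
    R.nodes.bind fun v => (v.tgts : Multiset ℕ)).Nodup := R.src_eq_tgt ▸ R.src_nodup

variable {R}

theorem concls_unique {v w : Node G} (hv : v ∈ R.nodes) (hw : w ∈ R.nodes) {e : ℕ}
    (h1 : e ∈ v.concls) (h2 : e ∈ w.concls) : v = w :=
  Multiset.eq_of_nodup_bind R.src_nodup hv hw (Multiset.mem_coe.2 h1) (Multiset.mem_coe.2 h2)

theorem tgts_unique {v w : Node G} (hv : v ∈ R.nodes) (hw : w ∈ R.nodes) {e : ℕ}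
    (h1 : e ∈ v.tgts) (h2 : e ∈ w.tgts) : v = w :=
  Multiset.eq_of_nodup_bind (Multiset.nodup_add.1 R.tgt_nodup).2.1 hv hw (Multiset.mem_coe.2 h1)
    (Multiset.mem_coe.2 h2)

theorem concl_not_mem_tgts {v : Node G} (hv : v ∈ R.nodes) (i : Fin n) : R.concl i ∉ v.tgts :=
  fun h => Multiset.disjoint_left.1 (Multiset.nodup_add.1 R.tgt_nodup).2.2
    (Multiset.mem_coe.2 (List.mem_ofFn.2 ⟨i, rfl⟩)) (Multiset.mem_bind.2 ⟨v, hv, h⟩)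

theorem concls_nodup {v : Node G} (hv : v ∈ R.nodes) : v.concls.Nodup :=
  Multiset.coe_nodup.1 ((Multiset.nodup_bind.1 R.src_nodup).1 v hv)

theorem tgts_nodup {v : Node G} (hv : v ∈ R.nodes) : v.tgts.Nodup :=
  Multiset.coe_nodup.1 ((Multiset.nodup_bind.1 (Multiset.nodup_add.1 R.tgt_nodup).2.1).1 v hv)

theorem isEdge_of_tgts {v : Node G} (hv : v ∈ R.nodes) {e : ℕ} (h : e ∈ v.tgts) : R.IsEdge e := by
  have : e ∈ R.nodes.bind fun v => (v.concls : Multiset ℕ) := by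
    rw [R.src_eq_tgt]
    exact Multiset.mem_add.2 (.inr (Multiset.mem_bind.2 ⟨v, hv, h⟩))
  obtain ⟨w, hw, he⟩ := Multiset.mem_bind.1 this
  exact ⟨w, hw, he⟩

theorem isEdge_concl (i : Fin n) : R.IsEdge (R.concl i) := by
  have : R.concl i ∈ R.nodes.bind fun v => (v.concls : Multiset ℕ) := by
    rw [R.src_eq_tgt]
    exact Multiset.mem_add.2 (.inl (Multiset.mem_coe.2 (List.mem_ofFn.2 ⟨i, rfl⟩)))
  obtain ⟨w, hw, he⟩ := Multiset.mem_bind.1 this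
  exact ⟨w, hw, he⟩

theorem isEdge_of_mem {v : Node G} (hv : v ∈ R.nodes) {e : ℕ} (h : e ∈ v.tgts ++ v.concls) :
    R.IsEdge e := by
  rcases List.mem_append.1 h with h | h
  · exact isEdge_of_tgts hv h
  · exact ⟨v, hv, h⟩

/-- A repeated node would repeat one of its conclusions, or one of its premisses in the case of a
cut. A sync node has a conclusion because its list of pairs is nonempty. -/
theorem nodes_nodup : R.nodes.Nodup := by
  rw [Multiset.nodup_iff_ne_cons_cons]
  intro v t h
  have h1 := R.src_nodup
  have h2 := (Multiset.nodup_add.1 R.tgt_nodup).2.1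
  have hv : v.WellTyped R.ty := R.ty_node v (by simp [h])
  simp only [h, Multiset.cons_bind, Multiset.nodup_add] at h1 h2
  replace h1 : ∀ e, e ∉ v.concls := fun e he => Multiset.disjoint_left.1 h1.2.2
    (Multiset.mem_coe.2 he) (Multiset.mem_add.2 (.inl (Multiset.mem_coe.2 he)))
  replace h2 : ∀ e, e ∉ v.tgts := fun e he => Multiset.disjoint_left.1 h2.2.2
    (Multiset.mem_coe.2 he) (Multiset.mem_add.2 (.inl (Multiset.mem_coe.2 he)))
  cases v with
  | ax a b => exact h1 a (by simp [Node.concls])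
  | cut a b => exact h2 a (by simp [Node.tgts, Node.prems])
  | tens a b c => exact h1 c (by simp [Node.concls])
  | par a b c => exact h1 c (by simp [Node.concls])
  | one c => exact h1 c (by simp [Node.concls])
  | sync u l =>
    obtain ⟨p, l, rfl⟩ := List.exists_cons_of_ne_nil hv.1
    exact h1 p.2 (by simp [Node.concls])
  | box k aux cont => exact h1 k (by simp [Node.concls])

/-- Polarity tells whether a token on an edge travels up or down, and the edge is a conclusion of
only one node and a target of only one node. Hence at most one node can take the token. -/
theorem cons_unique {v w : Node G} (hv : v ∈ R.nodes) (hw : w ∈ R.nodes) {p : Pos}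
    (h1 : v.Cons R.ty p) (h2 : w.Cons R.ty p) : v = w := by
  cases h1 with
  | tgt h hm =>
    cases h2 with
    | tgt h' hm' => exact tgts_unique hv hw h h'
    | concl h' hm' => simp [hm] at hm'
  | concl h hm =>
    cases h2 with
    | tgt h' hm' => simp [hm] at hm'
    | concl h' hm' => exact concls_unique hv hw h h'

theorem prod_unique {v w : Node G} (hv : v ∈ R.nodes) (hw : w ∈ R.nodes) {p : Pos}
    (h1 : v.Prod R.ty p) (h2 : w.Prod R.ty p) : v = w := by
  cases h1 with
  | tgt h hm =>
    cases h2 with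
    | tgt h' hm' => exact tgts_unique hv hw h h'
    | concl h' hm' => simp [hm] at hm'
  | concl h hm =>
    cases h2 with
    | tgt h' hm' => simp [hm] at hm'
    | concl h' hm' => exact concls_unique hv hw h h'

theorem pol_atoms {A : Formula} {b : Bool} (m : (A.atoms b : Finset (List Bool))) :
    A.pol m = some b := by
  have := m.2
  simp only [Formula.atoms, List.mem_toFinset, List.mem_filter, decide_eq_true_eq] at this
  exact this.2

/-- Final positions are positive, so tokens there travel down, and a conclusion of the structure is
the target of no node. -/
theorem not_cons_fin {v : Node G} (hv : v ∈ R.nodes) (j : FinPos Γ) : ¬ v.Cons R.ty (R.finPos j) := by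
  intro h
  cases h with
  | tgt h hm => exact concl_not_mem_tgts hv _ h
  | concl h hm =>
    rw [R.ty_concl, pol_atoms] at hm
    simp at hm

theorem not_prod_init {v : Node G} (hv : v ∈ R.nodes) (i : InitPos Γ) :
    ¬ v.Prod R.ty (R.initPos i) := by
  intro h
  cases h with
  | tgt h hm => exact concl_not_mem_tgts hv _ h
  | concl h hm =>
    rw [R.ty_concl, pol_atoms] at hm
    simp at hm

/-- Pairs of equal polarity are separated by linearity of premisses or of conclusions. An edge
shared by pairs of opposite polarity would have a type both positive and negative. -/
theorem sync_inEdge_inj {u : G.Sym} {l : List (ℕ × ℕ)} (h : Node.sync u l ∈ R.nodes)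
    {p q : ℕ × ℕ} (hp : p ∈ l) (hq : q ∈ l) {m m' : List Bool}
    (he : Pos.edge (R.inEdge p) m = .edge (R.inEdge q) m') :
    p = q ∧ m = m' := by
  simp only [Pos.edge.injEq] at he
  refine ⟨?_, he.2⟩
  have ht := R.ty_node _ h
  have hn1 : (l.map Prod.fst).Nodup := by
    simpa [Node.tgts, Node.prems, Node.inner] using tgts_nodup h
  have hn2 : (l.map Prod.snd).Nodup := by simpa [Node.concls] using concls_nodup h
  have hp2 := ht.2.1 p hp
  have hq2 := ht.2.1 q hq
  have he := he.1
  unfold inEdge at he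
  split_ifs at he with h1 h2 h2
  · exact List.inj_on_of_nodup_map hn1 hp hq he
  · have h3 := hq2.2.resolve_left h2
    rw [hq2.1, ← he] at h3
    simp [Formula.not_isPos_and_isNeg h1] at h3
  · have h3 := hp2.2.resolve_left h1
    rw [hp2.1, he] at h3
    simp [Formula.not_isPos_and_isNeg h2] at h3
  · exact List.inj_on_of_nodup_map hn2 hp hq he

theorem inPos_nodup {u : G.Sym} {l : List (ℕ × ℕ)} (h : Node.sync u l ∈ R.nodes) :
    (Node.inPos R.ty l).Nodup := by
  have hn : l.Nodup := by
    have hn2 : (l.map Prod.snd).Nodup := by simpa [Node.concls] using concls_nodup h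
    exact hn2.of_map
  rw [Node.inPos, List.nodup_flatMap]
  refine ⟨fun p _ => (Formula.addrs_nodup _).map fun _ _ h => by simpa using h, ?_⟩
  refine hn.pairwise_of_forall_ne fun p hp q hq hpq => ?_
  intro x hx hx'
  simp only [List.mem_map] at hx hx'
  obtain ⟨m, hm, rfl⟩ := hx
  obtain ⟨m', hm', he⟩ := hx'
  exact hpq (sync_inEdge_inj h hp hq he.symm).1

/-- The wiring of a structure. -/
def wiring (R : Struct G Γ) : Wiring G Γ where
  mv g p q := ∃ v ∈ R.nodes, v.Mv R.ty g p q
  syn u I O := ∃ l, Node.sync u l ∈ R.nodes ∧ I = Node.inPos R.ty l ∧ O = Node.outPos R.ty l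
  one g e := Node.one e ∈ R.nodes ∧ g = R.loc e
  box k := ∃ aux cont, Node.box k aux cont ∈ R.nodes
  fin := R.finPos
  mv_edge := fun ⟨_, _, h⟩ => h.edges.1
  syn_edge := by
    rintro u I O ⟨l, hl, rfl, rfl⟩ p hp
    cases Node.cons_of_mem_inPos (R.ty_node _ hl) hp <;> exact ⟨_, _, rfl⟩
  syn_nodup := by
    rintro u I O ⟨l, hl, rfl, rfl⟩
    exact inPos_nodup hl

/-- The machine's rules for `ax` and `cut` are symmetric in the two edges; here they become the two
directions of a single link, translated by reversing polarity under duality. -/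
theorem move_iff {s : State Γ} {p q : Pos} :
    R.Move s p q ↔ ∃ g, s.Opens g ∧ R.wiring.mv g p q := by
  have triv : s.Opens none := fun _ _ h => by simp at h
  have hopen : ∀ k b, s.Unlocked k b → s.Opens (some (k, b)) := by
    rintro k b h k' b' hkb
    cases hkb
    exact h
  constructor
  · intro h
    cases h with
    | ax a b m h hm =>
      refine ⟨none, triv, ?_⟩
      rcases h with h | h
      · exact ⟨_, h, .fwd (.ax a b) hm⟩
      · refine ⟨_, h, .bwd (l := []) (.ax b a) ?_⟩
        have ht : R.ty a = (R.ty b).dual := R.ty_node _ h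
        rw [← Formula.dual_dual (R.ty b), ← ht, Formula.pol_dual, hm]
        rfl
    | cut a b m h hm =>
      refine ⟨none, triv, ?_⟩
      rcases h with h | h
      · exact ⟨_, h, .fwd (.cut a b) hm⟩
      · refine ⟨_, h, .bwd (l := []) (.cut b a) ?_⟩
        have ht : R.ty a = (R.ty b).dual := R.ty_node _ h
        rw [← Formula.dual_dual (R.ty b), ← ht, Formula.pol_dual, hm]
        rfl
    | downLeft a b c m h hm =>
      refine ⟨none, triv, ?_⟩
      rcases h with h | h
      · exact ⟨_, h, .fwd (.tens_left a b c) hm⟩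
      · exact ⟨_, h, .fwd (.par_left a b c) hm⟩
    | downRight a b c m h hm =>
      refine ⟨none, triv, ?_⟩
      rcases h with h | h
      · exact ⟨_, h, .fwd (.tens_right a b c) hm⟩
      · exact ⟨_, h, .fwd (.par_right a b c) hm⟩
    | upLeft a b c m h hm =>
      refine ⟨none, triv, ?_⟩
      rcases h with h | h
      · exact ⟨_, h, .bwd (l := [false]) (.tens_left a b c) hm⟩
      · exact ⟨_, h, .bwd (l := [false]) (.par_left a b c) hm⟩
    | upRight a b c m h hm =>
      refine ⟨none, triv, ?_⟩
      rcases h with h | h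
      · exact ⟨_, h, .bwd (l := [true]) (.tens_right a b c) hm⟩
      · exact ⟨_, h, .bwd (l := [true]) (.par_right a b c) hm⟩
    | exit k aux cont b x y m h hu hxy hm =>
      exact ⟨_, hopen k b hu, _, h, .fwd (.box k aux cont b x y hxy) hm⟩
    | enter k aux cont b x y m h hu hxy hm =>
      refine ⟨_, hopen k b hu, _, h, .bwd (l := []) (.box k aux cont b x y hxy) ?_⟩
      rw [Node.zip_ty (R.ty_node _ h) hxy, hm]
      rfl
  · rintro ⟨g, hg, v, hv, h⟩
    have ht := R.ty_node v hv
    cases h with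
    | @fwd s e e' l m h hm =>
      cases h with
      | ax => exact .ax _ _ _ (.inl hv) hm
      | cut => exact .cut _ _ _ (.inl hv) hm
      | tens_left => exact .downLeft _ _ _ _ (.inl hv) hm
      | tens_right => exact .downRight _ _ _ _ (.inl hv) hm
      | par_left => exact .downLeft _ _ _ _ (.inr hv) hm
      | par_right => exact .downRight _ _ _ _ (.inr hv) hm
      | box k aux cont b x y h => exact .exit k aux cont b _ _ _ hv (hg k b rfl) h hm
    | @bwd s e e' l m h hm =>
      cases h with
      | ax =>
        refine .ax _ _ _ (.inr hv) ?_
        rw [show R.ty e' = _ from ht, Formula.pol_dual]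
        simp [hm]
      | cut =>
        refine .cut _ _ _ (.inr hv) ?_
        rw [show R.ty e' = _ from ht, Formula.pol_dual]
        simp [hm]
      | tens_left => exact .upLeft _ _ _ _ (.inl hv) hm
      | tens_right => exact .upRight _ _ _ _ (.inl hv) hm
      | par_left => exact .upLeft _ _ _ _ (.inr hv) hm
      | par_right => exact .upRight _ _ _ _ (.inr hv) hm
      | box k aux cont b x y h =>
        refine .enter k aux cont b _ _ _ hv (hg k b rfl) h ?_
        rw [← Node.zip_ty ht h]
        exact hm

end Struct

end StructWiring

end QSMLL

/-! ### The machine of a structure is the machine of its wiring -/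

namespace QSMLL

section Interpretation

variable {G : GateSet} {n : ℕ} {Γ : Fin n → Formula}

open State

namespace Struct

variable {R : Struct G Γ}

theorem step_iff {s : State Γ} {F : Fam (State Γ)} : R.Step s F ↔ R.wiring.sys.step s F := by
  constructor
  · intro h
    cases h with
    | move x p h =>
      obtain ⟨g, hg, hm⟩ := move_iff.1 h
      exact ⟨.move (tok x) (s.T x) p, x, g, rfl, rfl, hg, hm, rfl⟩
    | sync u l q T' h hin hout hrest =>
      exact ⟨.sync u (fun j => tok (q j)) _ _, q, T', fun _ => rfl, ⟨l, h, rfl, rfl⟩, hin, hout,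
        hrest, rfl⟩
    | one e h ha he => exact ⟨.one e, R.loc e, ⟨h, rfl⟩, ha, he, rfl⟩
    | measure x k aux cont h hx => exact ⟨.meas (tok x) k, x, rfl, ⟨aux, cont, h⟩, hx, rfl⟩
  · rintro ⟨ℓ, h⟩
    cases ℓ with
    | move x p q =>
      obtain ⟨x, g, rfl, rfl, hg, hm, rfl⟩ := h
      exact .move s x q (move_iff.2 ⟨g, hg, hm⟩)
    | sync u q I O =>
      obtain ⟨q, T', -, ⟨l, hl, rfl, rfl⟩, hI, hO, hr, rfl⟩ := h
      exact .sync s u l q T' hl hI hO hr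
    | one e =>
      obtain ⟨g, ⟨h, rfl⟩, hg, he, rfl⟩ := h
      exact .one s e h hg he
    | meas x k =>
      obtain ⟨x, rfl, ⟨aux, cont, hk⟩, hx, rfl⟩ := h
      exact .measure s x k aux cont hk hx

theorem terminal_iff {s : State Γ} : R.Terminal s ↔ R.wiring.sys.Terminal s :=
  forall_congr' fun _ => not_congr step_iff

theorem finalImage_iff {s : State Γ} : R.FinalImage s ↔ R.wiring.FinalImage s := by
  constructor
  · rintro ⟨B, hB, h⟩
    refine ⟨B, fun p hp => ?_, h⟩
    obtain ⟨k, b, aux, cont, hk, rfl⟩ := hB hp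
    exact ⟨k, b, ⟨aux, cont, hk⟩, rfl⟩
  · rintro ⟨B, hB, h⟩
    refine ⟨B, fun p hp => ?_, h⟩
    obtain ⟨k, b, ⟨aux, cont, hk⟩, rfl⟩ := hB p hp
    exact ⟨k, b, aux, cont, hk, rfl⟩

theorem eval_iff {s : State Γ} {D : Outcome Γ →₀ ℝ≥0} : R.Eval s D ↔ R.wiring.sys.Eval s D := by
  constructor
  · intro h
    induction h with
    | zero s => exact .zero s
    | final s f φ ht hs ho => exact .final s _ (terminal_iff.1 ht) ⟨finalImage_iff.1 hs, ho⟩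
    | stuck s ht hs => exact .final s none (terminal_iff.1 ht) fun h => hs (finalImage_iff.2 h)
    | step s F D h hD ih => exact .step s F D (step_iff.1 h) ih
  · intro h
    induction h with
    | zero s => exact .zero s
    | final s o ht ho =>
      rcases o with _ | ⟨f, φ⟩
      · exact .stuck s (terminal_iff.2 ht) fun h => ho (finalImage_iff.1 h)
      · exact .final s f φ (terminal_iff.2 ht) (finalImage_iff.2 ho.1) ho.2
    | step s F D h hD ih => exact .step s F D (step_iff.2 h) ih

end Struct

theorem QStruct.interp_eq_val (R : QStruct G Γ) (ψ : {ψ : Qubits (InitPos Γ) // ‖ψ‖ = 1})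
    (o : Outcome Γ) : R.interp ψ o = R.net.wiring.sys.val (R.initState ψ) o := by
  simp only [QStruct.interp, TSys.val, Struct.eval_iff]

end Interpretation

end QSMLL

/-! ### Local replacement of nodes -/

namespace QSMLL

section Surgery

variable {G : GateSet} {n : ℕ} {Γ : Fin n → Formula}

open View

/-- The node `w`, with edges of types `ty`, corresponds to `w.rename σ`, with edges of types `ty'`. -/
structure Node.Kept (ty ty' : ℕ → Formula) (σ : ℕ → ℕ) (v v' : View) (A : Set ℕ) (w : Node G) :
    Prop where
  fix : ∀ x ∈ w.concls, σ x = x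
  ty_eq : ∀ x ∈ w.tgts ++ w.concls, ty' (σ x) = ty x
  cons : ∀ {p}, w.Cons ty p → Consumed v v' p (p.map σ)
  prod : ∀ {p}, (∀ c ∈ A, w ≠ .one c) → w.Prod ty p → Produced v v' p (p.map σ)

theorem _root_.List.forall₂_map_of {α β : Type} {P : α → β → Prop} {f : α → β} {l : List α}
    (h : ∀ x ∈ l, P x (f x)) : List.Forall₂ P l (l.map f) := by
  rw [List.forall₂_map_right_iff, List.forall₂_same]
  exact h

namespace Node.Kept

variable {ty ty' : ℕ → Formula} {σ : ℕ → ℕ} {v v' : View} {A : Set ℕ} {w : Node G}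

theorem lockFixed (h : w.Kept ty ty' σ v v' A) : w.LockFixed σ := by
  rintro k aux cont rfl
  exact h.fix k (by simp [concls])

theorem mv (h : w.Kept ty ty' σ v v' A) (hw : w.WellTyped ty) {g : Option (ℕ × Bool)} {p q : Pos}
    (hm : w.Mv ty g p q) : (w.rename σ).Mv ty' g (p.map σ) (q.map σ) ∧
      Consumed v v' p (p.map σ) ∧ Produced v v' q (q.map σ) := by
  refine ⟨hm.rename h.lockFixed h.ty_eq, h.cons (hm.cons hw), h.prod ?_ (hm.prod hw)⟩
  -- The exception made for sources in `A` is harmless here, because a `one` node has no moves.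
  rintro c - rfl
  cases hm with
  | fwd hl => cases hl
  | bwd hl => cases hl

theorem mv' (h : w.Kept ty ty' σ v v' A) (hw : w.WellTyped ty) {g : Option (ℕ × Bool)} {p' q' : Pos}
    (hm : (w.rename σ).Mv ty' g p' q') : ∃ p q, w.Mv ty g p q ∧
      Consumed v v' p p' ∧ Produced v v' q q' := by
  obtain ⟨p, q, hm₀, rfl, rfl⟩ := hm.of_rename h.lockFixed h.ty_eq
  exact ⟨p, q, hm₀, (h.mv hw hm₀).2⟩

theorem syn {u : G.Sym} {l : List (ℕ × ℕ)} (h : (Node.sync u l : Node G).Kept ty ty' σ v v' A)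
    (hw : (Node.sync u l : Node G).WellTyped ty) :
    List.Forall₂ (Consumed v v') (inPos ty l) (inPos ty' (l.map fun p => (σ p.1, σ p.2))) ∧
    List.Forall₂ (Produced v v') (outPos ty l) (outPos ty' (l.map fun p => (σ p.1, σ p.2))) := by
  have hty : ∀ p ∈ l, ty' (σ p.1) = ty p.1 := fun p hp => h.ty_eq _ (by
    simp only [tgts, prems, inner, List.append_nil, List.mem_append, List.mem_map]
    exact .inl ⟨p, hp, rfl⟩)
  rw [inPos_map hty, outPos_map hty]
  exact ⟨List.forall₂_map_of fun p hp => h.cons (cons_of_mem_inPos hw hp),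
    List.forall₂_map_of fun p hp => h.prod (by simp) (prod_of_mem_outPos hw hp)⟩

theorem syn_of_rename {u : G.Sym} {l : List (ℕ × ℕ)} (h : w.rename σ = .sync u l) :
    ∃ l₀, w = .sync u l₀ ∧ l = l₀.map fun p => (σ p.1, σ p.2) := by
  cases w <;> simp only [rename, reduceCtorEq, Node.sync.injEq] at h
  obtain ⟨rfl, rfl⟩ := h
  exact ⟨_, rfl, rfl⟩

theorem one_of_rename (h : w.Kept ty ty' σ v v' A) {c : ℕ} (hc : w.rename σ = .one c) :
    w = .one c := by
  cases w <;> simp only [rename, reduceCtorEq, Node.one.injEq] at hc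
  rw [← hc, h.fix _ (by simp [concls])]

theorem one {c : ℕ} (h : (Node.one c : Node G).Kept ty ty' σ v v' A)
    (hw : (Node.one c : Node G).WellTyped ty) (hc : c ∉ A) :
    Produced v v' (.edge c []) (.edge c []) := by
  have := h.prod (p := .edge c []) (by rintro c' hc' ⟨⟩; exact hc hc')
    (.concl (by simp [concls]) (by rw [show ty c = _ from hw]; rfl))
  rwa [Pos.map_edge, h.fix c (by simp [concls])] at this

theorem rename_box {k : ℕ} {aux : List ℕ} {cont : Bool → List ℕ}
    (h : (Node.box k aux cont : Node G).Kept ty ty' σ v v' A) :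
    (Node.box k aux cont : Node G).rename σ = .box k (aux.map σ) fun b => (cont b).map σ := by
  rw [rename, h.fix k (by simp [concls])]

theorem box_of_rename (h : w.Kept ty ty' σ v v' A) {k : ℕ} {aux : List ℕ} {cont : Bool → List ℕ}
    (hc : w.rename σ = .box k aux cont) : ∃ aux cont, w = .box k aux cont := by
  cases w <;> simp only [rename, reduceCtorEq, Node.box.injEq] at hc
  rw [h.fix _ (by simp [concls])] at hc
  obtain ⟨rfl, -⟩ := hc
  exact ⟨_, _, rfl⟩

theorem box {k : ℕ} {aux : List ℕ} {cont : Bool → List ℕ}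
    (h : (Node.box k aux cont : Node G).Kept ty ty' σ v v' A)
    (hw : (Node.box k aux cont : Node G).WellTyped ty) :
    Consumed v v' (.edge k []) (.edge k []) := by
  have := h.cons (p := .edge k []) (.concl (by simp [concls]) (by rw [hw.1]; rfl))
  rwa [Pos.map_edge, h.fix k (by simp [concls])] at this

end Node.Kept

/-- The structure `S` arises from `R` by replacing the nodes `X` by the nodes `X'` and renaming the
edges. -/
structure Surgery (R S : Struct G Γ) (v v' : View) (A : Set ℕ) (σ : ℕ → ℕ) (X X' K : Set (Node G)) :
    Prop where
  mem : ∀ w, w ∈ R.nodes ↔ w ∈ X ∨ w ∈ K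
  mem' : ∀ w, w ∈ S.nodes ↔ w ∈ X' ∨ ∃ u ∈ K, w = u.rename σ
  kept : ∀ w ∈ K, w.Kept R.ty S.ty σ v v' A
  loc : ∀ c, .one c ∈ K → S.loc c = R.loc c
  simple : ∀ w ∈ X, (∀ c, w ≠ .one c) ∧ ∀ k aux cont, w ≠ .box k aux cont
  simple' : ∀ w ∈ X', (∀ c, w ≠ .one c) ∧ ∀ k aux cont, w ≠ .box k aux cont
  sil : ∀ {p q}, v.sil p q → v.good p →
    R.wiring.mv none p q ∧ v.φ p = v.φ q ∧ v.good q ∧ v.w q < v.w p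
  sil' : ∀ {p q}, v'.sil p q → v'.good p →
    S.wiring.mv none p q ∧ v'.φ p = v'.φ q ∧ v'.good q ∧ v'.w q < v'.w p
  lock : ∀ r k b, v.φ r = .lock k b ↔ r = .lock k b
  lock' : ∀ r k b, v'.φ r = .lock k b ↔ r = .lock k b
  good_lock : ∀ k b, v.good (.lock k b)
  good_lock' : ∀ k b, v'.good (.lock k b)
  mv : ∀ w ∈ X, ∀ {g p q}, w.Mv R.ty g p q → v.good p →
    v.sil p q ∨ ∃ p' q', S.wiring.mv g p' q' ∧ Consumed v v' p p' ∧ Produced v v' q q'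
  mv' : ∀ w ∈ X', ∀ {g p q}, w.Mv S.ty g p q → v'.good p →
    v'.sil p q ∨ ∃ p' q', R.wiring.mv g p' q' ∧ Consumed v' v p p' ∧ Produced v' v q q'
  syn : ∀ {u l}, .sync u l ∈ X → (∀ p ∈ Node.inPos R.ty l, v.good p) →
    ∃ I O, S.wiring.syn u I O ∧ List.Forall₂ (Consumed v v') (Node.inPos R.ty l) I ∧
      List.Forall₂ (Produced v v') (Node.outPos R.ty l) O
  syn' : ∀ {u l}, .sync u l ∈ X' → (∀ p ∈ Node.inPos S.ty l, v'.good p) →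
    ∃ I O, R.wiring.syn u I O ∧ List.Forall₂ (Consumed v' v) (Node.inPos S.ty l) I ∧
      List.Forall₂ (Produced v' v) (Node.outPos S.ty l) O
  fin : ∀ j, Consumed v v' (R.finPos j) (S.finPos j)

namespace Surgery

variable {R S : Struct G Γ} {v v' : View} {A : Set ℕ} {σ : ℕ → ℕ} {X X' K : Set (Node G)}

theorem produced_lock (h : Surgery R S v v' A σ X X' K) (k : ℕ) (b : Bool) :
    Produced v v' (.lock k b) (.lock k b) :=
  ⟨h.good_lock k b, h.good_lock' k b, by rw [(h.lock _ k b).2 rfl, (h.lock' _ k b).2 rfl]⟩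

/-- Transitions through kept nodes are matched by their renamed copies. Sources and boxes are always
kept, so only moves and synchronizations of the replaced nodes need individual data. -/
theorem simulated (h : Surgery R S v v' A σ X X' K) : R.wiring.Simulated S.wiring v v' A where
  sil_mv := h.sil
  lock {r k b} _ hr := by
    rw [(h.lock _ k b).2 rfl] at hr
    exact (h.lock' _ _ _).1 hr
  mv := by
    rintro g p q ⟨w, hw, hm⟩ hp -
    rcases (h.mem w).1 hw with hX | hK
    · exact h.mv w hX hm hp
    · obtain ⟨h1, h2⟩ := (h.kept w hK).mv (R.ty_node w hw) hm
      exact .inr ⟨_, _, ⟨_, (h.mem' _).2 (.inr ⟨w, hK, rfl⟩), h1⟩, h2⟩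
  syn := by
    rintro u I O ⟨l, hl, rfl, rfl⟩ hI
    rcases (h.mem _).1 hl with hX | hK
    · exact h.syn hX hI
    · exact ⟨_, _, ⟨_, (h.mem' _).2 (.inr ⟨_, hK, rfl⟩), rfl, rfl⟩,
        (h.kept _ hK).syn (R.ty_node _ hl)⟩
  one := by
    rintro g c ⟨hc, rfl⟩ hA -
    rcases (h.mem _).1 hc with hX | hK
    · exact absurd rfl ((h.simple _ hX).1 c)
    · refine ⟨⟨(h.mem' _).2 (.inr ⟨_, hK, ?_⟩), (h.loc c hK).symm⟩,
        (h.kept _ hK).one (R.ty_node _ hc) hA⟩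
      rw [Node.rename, (h.kept _ hK).fix c (by simp [Node.concls])]
  box := by
    rintro k ⟨aux, cont, hk⟩ -
    rcases (h.mem _).1 hk with hX | hK
    · exact absurd rfl ((h.simple _ hX).2 k aux cont)
    · exact ⟨⟨_, _, (h.mem' _).2 (.inr ⟨_, hK, (h.kept _ hK).rename_box.symm⟩)⟩,
        (h.kept _ hK).box (R.ty_node _ hk), h.produced_lock k⟩
  box_lock := by
    rintro k b ⟨aux, cont, hk⟩ -
    rcases (h.mem _).1 hk with hX | hK
    · exact absurd rfl ((h.simple _ hX).2 k aux cont)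
    · exact ⟨_, _, (h.mem' _).2 (.inr ⟨_, hK, (h.kept _ hK).rename_box.symm⟩)⟩
  fin := h.fin

theorem simulated' (h : Surgery R S v v' A σ X X' K) : S.wiring.Simulated R.wiring v' v A where
  sil_mv := h.sil'
  lock {r k b} _ hr := by
    rw [(h.lock' _ k b).2 rfl] at hr
    exact (h.lock _ _ _).1 hr
  mv := by
    rintro g p q ⟨w, hw, hm⟩ hp -
    rcases (h.mem' w).1 hw with hX | ⟨w, hK, rfl⟩
    · exact h.mv' w hX hm hp
    · have hw := (h.mem w).2 (.inr hK)
      obtain ⟨p', q', h1, h2, h3⟩ := (h.kept w hK).mv' (R.ty_node w hw) hm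
      exact .inr ⟨_, _, ⟨_, hw, h1⟩, h2.symm, h3.symm⟩
  syn := by
    rintro u I O ⟨l, hl, rfl, rfl⟩ hI
    rcases (h.mem' _).1 hl with hX | ⟨w, hK, hw⟩
    · exact h.syn' hX hI
    · obtain ⟨l, rfl, rfl⟩ := Node.Kept.syn_of_rename hw.symm
      have hl := (h.mem _).2 (.inr hK)
      obtain ⟨h1, h2⟩ := (h.kept _ hK).syn (R.ty_node _ hl)
      exact ⟨_, _, ⟨_, hl, rfl, rfl⟩, h1.flip.imp fun _ _ h => View.Consumed.symm h,
        h2.flip.imp fun _ _ h => View.Produced.symm h⟩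
  one := by
    rintro g c ⟨hc, rfl⟩ hA -
    rcases (h.mem' _).1 hc with hX | ⟨w, hK, hw⟩
    · exact absurd rfl ((h.simple' _ hX).1 c)
    · obtain rfl := (h.kept _ hK).one_of_rename hw.symm
      have hc := (h.mem _).2 (.inr hK)
      exact ⟨⟨hc, h.loc c hK⟩, ((h.kept _ hK).one (R.ty_node _ hc) hA).symm⟩
  box := by
    rintro k ⟨aux, cont, hk⟩ -
    rcases (h.mem' _).1 hk with hX | ⟨w, hK, hw⟩
    · exact absurd rfl ((h.simple' _ hX).2 k aux cont)
    · obtain ⟨aux, cont, rfl⟩ := (h.kept _ hK).box_of_rename hw.symm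
      have hk := (h.mem _).2 (.inr hK)
      exact ⟨⟨_, _, hk⟩, ((h.kept _ hK).box (R.ty_node _ hk)).symm,
        fun b => (h.produced_lock k b).symm⟩
  box_lock := by
    rintro k b ⟨aux, cont, hk⟩ -
    rcases (h.mem' _).1 hk with hX | ⟨w, hK, hw⟩
    · exact absurd rfl ((h.simple' _ hX).2 k aux cont)
    · obtain ⟨aux, cont, rfl⟩ := (h.kept _ hK).box_of_rename hw.symm
      exact ⟨_, _, (h.mem _).2 (.inr hK)⟩
  fin j := (h.fin j).symm

/-- Initial states correspond: tokens of the input by `hinit`, and tokens of the register because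
they stand on conclusions of `one` nodes, which are never replaced. -/
theorem interp_eq (h : Surgery R S v v' ∅ σ X X' K)
    (hinit : ∀ i, Produced v v' (R.initPos i) (S.initPos i)) {reg : Finset ℕ}
    (hreg : ∀ e ∈ reg, Node.one e ∈ R.nodes)
    {hR : R.HoldsOnes reg} {hS : S.HoldsOnes reg} {Q : Qubits reg} {hQ : ‖Q‖ = 1}
    (ψ : {ψ : Qubits (InitPos Γ) // ‖ψ‖ = 1}) (o : Outcome Γ) :
    (⟨R, reg, hR, Q, hQ⟩ : QStruct G Γ).interp ψ o = (⟨S, reg, hS, Q, hQ⟩ : QStruct G Γ).interp ψ o := by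
  rw [QStruct.interp_eq_val, QStruct.interp_eq_val]
  refine h.simulated.val_eq h.simulated' ⟨reg, _, _, _, rfl, rfl, by simp, ?_⟩ o
  rintro (i | ⟨e, he⟩)
  · exact hinit i
  · have hc := hreg e he
    rcases (h.mem _).1 hc with hX | hK
    · exact absurd rfl ((h.simple _ hX).1 e)
    · exact (h.kept _ hK).one (R.ty_node _ hc) (by simp)

end Surgery

end Surgery

end QSMLL

/-! ### Commutation of a sync node with a node that passes tokens on -/

namespace QSMLL

section SyncShift

variable {G : GateSet} {n : ℕ} {Γ : Fin n → Formula}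

open View

/-- Nodes that only pass tokens on. -/
def Node.Passive (w : Node G) : Prop :=
  (∀ c, w ≠ .one c) ∧ (∀ k aux cont, w ≠ .box k aux cont) ∧ ∀ u l, w ≠ .sync u l

namespace Node

variable {ty ty' : ℕ → Formula}

theorem inPos_append (l l' : List (ℕ × ℕ)) : inPos ty (l ++ l') = inPos ty l ++ inPos ty l' :=
  List.flatMap_append

theorem outPos_append (l l' : List (ℕ × ℕ)) : outPos ty (l ++ l') = outPos ty l ++ outPos ty l' :=
  List.flatMap_append

theorem inPos_congr {l : List (ℕ × ℕ)} (h : ∀ p ∈ l, ty' p.1 = ty p.1) :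
    inPos ty' l = inPos ty l :=
  List.flatMap_congr fun p hp => by rw [h p hp]

theorem outPos_congr {l : List (ℕ × ℕ)} (h : ∀ p ∈ l, ty' p.1 = ty p.1) :
    outPos ty' l = outPos ty l :=
  List.flatMap_congr fun p hp => by rw [h p hp]

end Node

namespace Struct

variable {R S : Struct G Γ}

theorem isEdge_of_cons {w : Node G} (hw : w ∈ R.nodes) {p : Pos} (h : w.Cons R.ty p) :
    ∃ e m, p = .edge e m ∧ R.IsEdge e := by
  cases h with
  | tgt h => exact ⟨_, _, rfl, isEdge_of_tgts hw h⟩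
  | concl h => exact ⟨_, _, rfl, w, hw, h⟩

theorem isEdge_of_prod {w : Node G} (hw : w ∈ R.nodes) {p : Pos} (h : w.Prod R.ty p) :
    ∃ e m, p = .edge e m ∧ R.IsEdge e := by
  cases h with
  | tgt h => exact ⟨_, _, rfl, isEdge_of_tgts hw h⟩
  | concl h => exact ⟨_, _, rfl, w, hw, h⟩

theorem finPos_eq (hc : S.concl = R.concl) (j : FinPos Γ) : S.finPos j = R.finPos j := by
  rw [finPos, finPos, hc]

theorem initPos_eq (hc : S.concl = R.concl) (i : InitPos Γ) : S.initPos i = R.initPos i := by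
  rw [initPos, initPos, hc]

theorem not_mem_rest {w : Node G} {rest : Multiset (Node G)} (h : R.nodes = w ::ₘ rest) :
    w ∉ rest := by
  have := R.nodes_nodup
  rw [h] at this
  exact (Multiset.nodup_cons.1 this).1

open Classical in
/-- The general form of the commutation of a sync node with another node. -/
theorem interp_eq_of_shift_aux {n₁ n₁' : Node G} {u : G.Sym} {l l' : List (ℕ × ℕ)}
    {rest : Multiset (Node G)} (hR : R.nodes = n₁ ::ₘ .sync u l ::ₘ rest)
    (hS : S.nodes = n₁' ::ₘ .sync u l' ::ₘ rest) (hc : S.concl = R.concl)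
    (hty : ∀ w ∈ rest, ∀ x ∈ w.tgts ++ w.concls, S.ty x = R.ty x)
    (hloc : ∀ c, .one c ∈ rest → S.loc c = R.loc c) (hn : n₁.Passive) (hn' : n₁'.Passive)
    (φ φ' : Pos → Pos) (J J' : Pos → Prop)
    (hJ : ∀ p, J p → p ∈ Node.inPos R.ty l) (hJ' : ∀ p, J' p → p ∈ Node.outPos S.ty l')
    (hφ : ∀ p, ¬ J p → φ p = p) (hφ' : ∀ p, ¬ J' p → φ' p = p)
    (hmv : ∀ g p q, n₁.Mv R.ty g p q ↔ g = none ∧ J q ∧ p = φ q)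
    (hmv' : ∀ g p q, n₁'.Mv S.ty g p q ↔ g = none ∧ J' p ∧ q = φ' p)
    (hinj : ∀ p q, J p → J q → φ p = φ q → p = q)
    (hin : Node.inPos S.ty l' = (Node.inPos R.ty l).map φ)
    (hout : Node.outPos R.ty l = (Node.outPos S.ty l').map φ')
    (hfresh : ∀ e m, J' (.edge e m) → ¬ R.IsEdge e)
    {reg : Finset ℕ} {hR₁ : R.HoldsOnes reg} {hS₁ : S.HoldsOnes reg} {Q : Qubits reg} {hQ : ‖Q‖ = 1}
    (ψ : {ψ : Qubits (InitPos Γ) // ‖ψ‖ = 1}) (o : Outcome Γ) :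
    (⟨R, reg, hR₁, Q, hQ⟩ : QStruct G Γ).interp ψ o =
      (⟨S, reg, hS₁, Q, hQ⟩ : QStruct G Γ).interp ψ o := by
  have m₁ : n₁ ∈ R.nodes := by simp [hR]
  have ms : .sync u l ∈ R.nodes := by simp [hR]
  have m₁' : n₁' ∈ S.nodes := by simp [hS]
  have ms' : .sync u l' ∈ S.nodes := by simp [hS]
  have hn₁ : n₁ ∉ rest := fun h => not_mem_rest hR (Multiset.mem_cons_of_mem h)
  have hs : .sync u l ∉ rest := fun h =>
    not_mem_rest (R := R) (w := .sync u l) (rest := n₁ ::ₘ rest)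
      (by rw [hR, Multiset.cons_swap]) (Multiset.mem_cons_of_mem h)
  have mvJ : ∀ {p}, J p → n₁.Mv R.ty none (φ p) p := fun h => (hmv _ _ _).2 ⟨rfl, h, rfl⟩
  have mvJ' : ∀ {p}, J' p → n₁'.Mv S.ty none p (φ' p) := fun h => (hmv' _ _ _).2 ⟨rfl, h, rfl⟩
  have consJ : ∀ {p}, J p → (Node.sync u l).Cons R.ty p := fun h =>
    Node.cons_of_mem_inPos (R.ty_node _ ms) (hJ _ h)
  have prodJ : ∀ {p}, J p → n₁.Prod R.ty p := fun h => (mvJ h).prod (R.ty_node _ m₁)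
  have consφ : ∀ {p}, J p → n₁.Cons R.ty (φ p) := fun h => (mvJ h).cons (R.ty_node _ m₁)
  have J_cons : ∀ {w p}, w ∈ R.nodes → w ≠ .sync u l → w.Cons R.ty p → ¬ J p :=
    fun hw hne h hp => hne (cons_unique hw ms h (consJ hp))
  have J_prod : ∀ {w p}, w ∈ R.nodes → w ≠ n₁ → w.Prod R.ty p → ¬ J p :=
    fun hw hne h hp => hne (prod_unique hw m₁ h (prodJ hp))
  have φ_cons : ∀ {w p}, w ∈ R.nodes → w ≠ n₁ → w.Cons R.ty p → ∀ r, J r → φ r ≠ p :=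
    fun hw hne h r hr he => hne (cons_unique hw m₁ h (he ▸ consφ hr))
  have J'_edge : ∀ {p}, (∃ e m, p = .edge e m ∧ R.IsEdge e) → ¬ J' p := by
    rintro _ ⟨e, m, rfl, he⟩ hp
    exact hfresh e m hp he
  have out_φ' : ∀ {p}, J' p → φ' p ∈ Node.outPos R.ty l := fun h =>
    hout ▸ List.mem_map_of_mem (hJ' _ h)
  have out_prod : ∀ {p}, p ∈ Node.outPos R.ty l → (Node.sync u l).Prod R.ty p := fun h =>
    Node.prod_of_mem_outPos (R.ty_node _ ms) h
  have J'φ' : ∀ {p}, J' p → ¬ J' (φ' p) := fun h =>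
    J'_edge (isEdge_of_prod ms (out_prod (out_φ' h)))
  -- In `R`, `J` consists of the positions between `n₁` and the sync node, identified by `φ` with
  -- those before `n₁`. In `S`, `J'` consists of the positions between the sync node and `n₁'`,
  -- identified by `φ'` with those after `n₁'`. Passing `n₁` or `n₁'` is silent, and the weights
  -- record which of these moves is still to be made.
  let v : View := ⟨φ, fun p q => J q ∧ p = φ q, fun p => if J p then 0 else 1, fun _ => True⟩
  let v' : View := ⟨φ', fun p q => J' p ∧ q = φ' p, fun p => if J' p then 1 else 0, fun _ => True⟩
  have step' : ∀ {r p}, φ' r = p → Relation.ReflTransGen v'.sil r p := by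
    rintro r p rfl
    by_cases hr : J' r
    · exact .single ⟨hr, rfl⟩
    · rw [hφ' r hr]
  -- Other nodes take tokens neither from the new intermediate positions nor from a position where a
  -- token is about to enter `n₁`.
  have consumed : ∀ {p}, ¬ J p → ¬ J' p → (∀ r, J r → φ r ≠ p) → Consumed v v' p p := by
    intro p h1 h2 h3
    refine ⟨(hφ p h1).trans (hφ' p h2).symm, fun r _ hr => step' (hr.trans (hφ p h1)),
      fun r _ hr => ?_⟩
    change φ r = φ' p at hr
    rw [hφ' p h2] at hr
    by_cases h : J r
    · exact absurd hr (h3 r h)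
    · rw [← hr, hφ r h]
  have produced : ∀ {p}, ¬ J p → ¬ J' p → Produced v v' p p := fun {p} h1 h2 =>
    ⟨trivial, trivial, (hφ p h1).trans (hφ' p h2).symm⟩
  -- The sync node of `R` waits behind `n₁`, that of `S` before it; a token waiting at `φ p` reaches
  -- `p` by the one silent move through `n₁`.
  have hI : List.Forall₂ (Consumed v v') (Node.inPos R.ty l) (Node.inPos S.ty l') := by
    rw [hin]
    refine List.forall₂_map_of fun p hp => ?_
    have h2 : ¬ J' (φ p) := by
      by_cases h : J p
      · exact J'_edge (isEdge_of_cons m₁ (consφ h))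
      · rw [hφ p h]
        exact J'_edge (isEdge_of_cons ms (Node.cons_of_mem_inPos (R.ty_node _ ms) hp))
    refine ⟨(hφ' _ h2).symm, fun r _ hr => step' hr, fun r _ hr => ?_⟩
    change φ r = φ' (φ p) at hr
    rw [hφ' _ h2] at hr
    by_cases hp' : J p
    · by_cases hr' : J r
      · rw [hinj r p hr' hp' hr]
      · rw [hφ r hr'] at hr
        exact .single ⟨hp', hr⟩
    · rw [hφ p hp'] at hr
      by_cases hr' : J r
      · exact absurd hr (φ_cons ms (fun h => hn.2.2 _ _ h.symm)
          (Node.cons_of_mem_inPos (R.ty_node _ ms) hp) r hr')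
      · rw [hφ r hr'] at hr
        rw [hr]
  have hO : List.Forall₂ (Produced v v') (Node.outPos R.ty l) (Node.outPos S.ty l') := by
    rw [hout, List.forall₂_map_left_iff, List.forall₂_same]
    intro p hp
    exact ⟨trivial, trivial, hφ _ (J_prod ms (fun h => hn.2.2 _ _ h.symm)
      (out_prod (hout ▸ List.mem_map_of_mem hp)))⟩
  have key : Surgery R S v v' ∅ id {n₁, .sync u l} {n₁', .sync u l'} {w | w ∈ rest} := by
    have hrest : ∀ w ∈ rest, w ∈ R.nodes ∧ w ≠ n₁ ∧ w ≠ .sync u l := fun w hw =>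
      ⟨by simp [hR, hw], fun h => hn₁ (h ▸ hw), fun h => hs (h ▸ hw)⟩
    refine ⟨?_, ?_, ?_, hloc, ?_, ?_, ?_, ?_, ?_, ?_, fun _ _ => trivial, fun _ _ => trivial,
      ?_, ?_, ?_, ?_, ?_⟩
    · intro w
      simp [hR, or_assoc]
    · intro w
      simp [hS, or_assoc, Node.rename_id]
    · intro w hw
      obtain ⟨hw', h1, h2⟩ := hrest w hw
      refine ⟨fun _ _ => rfl, fun x hx => hty w hw x hx, fun {p} hp => ?_, fun {p} _ hp => ?_⟩
      · rw [Pos.map_id]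
        exact consumed (J_cons hw' h2 hp) (J'_edge (isEdge_of_cons hw' hp)) (φ_cons hw' h1 hp)
      · rw [Pos.map_id]
        exact produced (J_prod hw' h1 hp) (J'_edge (isEdge_of_prod hw' hp))
    · rintro w (rfl | rfl)
      · exact ⟨hn.1, hn.2.1⟩
      · simp
    · rintro w (rfl | rfl)
      · exact ⟨hn'.1, hn'.2.1⟩
      · simp
    · rintro p q ⟨hq, rfl⟩ -
      have : ¬ J (φ q) := J_cons m₁ (hn.2.2 _ _) (consφ hq)
      refine ⟨⟨n₁, m₁, mvJ hq⟩, hφ _ this, trivial, ?_⟩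
      simp [v, hq, this]
    · rintro p q ⟨hp, rfl⟩ -
      refine ⟨⟨n₁', m₁', mvJ' hp⟩, (hφ' _ (J'φ' hp)).symm, trivial, ?_⟩
      simp [v', hp, J'φ' hp]
    · intro r k b
      by_cases h : J r
      · obtain ⟨⟨e, m, h1⟩, e', m', h2⟩ := (mvJ h).edges
        change φ r = _ ↔ _
        rw [h1, h2]
        simp
      · simp [v, hφ r h]
    · intro r k b
      by_cases h : J' r
      · obtain ⟨⟨e, m, h1⟩, e', m', h2⟩ := (mvJ' h).edges
        change φ' r = _ ↔ _
        rw [h2, h1]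
        simp
      · simp [v', hφ' r h]
    · rintro w (rfl | rfl) g p q hm -
      · exact .inl ((hmv _ _ _).1 hm).2
      · cases hm with
        | fwd h => cases h
        | bwd h => cases h
    · rintro w (rfl | rfl) g p q hm -
      · exact .inl ((hmv' _ _ _).1 hm).2
      · cases hm with
        | fwd h => cases h
        | bwd h => cases h
    · rintro u₀ l₀ (h | h) -
      · exact absurd h.symm (hn.2.2 _ _)
      · obtain ⟨rfl, rfl⟩ := Node.sync.inj h
        exact ⟨_, _, ⟨l', ms', rfl, rfl⟩, hI, hO⟩
    · rintro u₀ l₀ (h | h) -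
      · exact absurd h.symm (hn'.2.2 _ _)
      · obtain ⟨rfl, rfl⟩ := Node.sync.inj h
        exact ⟨_, _, ⟨l, ms, rfl, rfl⟩, hI.flip.imp fun _ _ h => View.Consumed.symm h,
          hO.flip.imp fun _ _ h => View.Produced.symm h⟩
    · intro j
      rw [finPos_eq hc]
      refine consumed (fun h => not_cons_fin ms j (consJ h))
        (J'_edge ⟨_, _, rfl, isEdge_concl _⟩) fun r hr h => not_cons_fin m₁ j (h ▸ consφ hr)
  refine key.interp_eq (fun i => ?_) (fun e he => (hR₁ e he).1) ψ o
  rw [initPos_eq hc]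
  exact produced (fun h => not_prod_init m₁ i (prodJ h)) (J'_edge ⟨_, _, rfl, isEdge_concl _⟩)

/-- A sync node preceded by a node `n₁`, through which tokens reach the edges `x`, is replaced by a
sync node followed by a node `n₁'`, through which tokens leave the edges `y`. -/
theorem interp_eq_of_shift {n₁ n₁' : Node G} {u : G.Sym} {l₁ l₂ x y : List (ℕ × ℕ)}
    {rest : Multiset (Node G)} (hR : R.nodes = n₁ ::ₘ .sync u (l₁ ++ x ++ l₂) ::ₘ rest)
    (hS : S.nodes = n₁' ::ₘ .sync u (l₁ ++ y ++ l₂) ::ₘ rest) (hc : S.concl = R.concl)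
    (hl : ∀ p ∈ l₁ ++ l₂, S.ty p.1 = R.ty p.1)
    (hty : ∀ w ∈ rest, ∀ x ∈ w.tgts ++ w.concls, S.ty x = R.ty x)
    (hloc : ∀ c, .one c ∈ rest → S.loc c = R.loc c) (hn : n₁.Passive) (hn' : n₁'.Passive)
    (φ φ' : Pos → Pos)
    (hmv : ∀ g p q, n₁.Mv R.ty g p q ↔ g = none ∧ q ∈ Node.inPos R.ty x ∧ p = φ q)
    (hmv' : ∀ g p q, n₁'.Mv S.ty g p q ↔ g = none ∧ p ∈ Node.outPos S.ty y ∧ q = φ' p)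
    (hin : Node.inPos S.ty y = (Node.inPos R.ty x).map φ)
    (hout : Node.outPos R.ty x = (Node.outPos S.ty y).map φ')
    (hfresh : ∀ e m, .edge e m ∈ Node.outPos S.ty y → ¬ R.IsEdge e)
    {reg : Finset ℕ} {hR₁ : R.HoldsOnes reg} {hS₁ : S.HoldsOnes reg} {Q : Qubits reg} {hQ : ‖Q‖ = 1}
    (ψ : {ψ : Qubits (InitPos Γ) // ‖ψ‖ = 1}) (o : Outcome Γ) :
    (⟨R, reg, hR₁, Q, hQ⟩ : QStruct G Γ).interp ψ o =
      (⟨S, reg, hS₁, Q, hQ⟩ : QStruct G Γ).interp ψ o := by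
  classical
  have ms : .sync u (l₁ ++ x ++ l₂) ∈ R.nodes := by simp [hR]
  have hnd := inPos_nodup ms
  have ms' : .sync u (l₁ ++ y ++ l₂) ∈ S.nodes := by simp [hS]
  have hnd' := inPos_nodup ms'
  rw [Node.inPos_append, Node.inPos_append] at hnd hnd'
  have hl₁ : ∀ p ∈ l₁, S.ty p.1 = R.ty p.1 := fun p hp => hl p (by simp [hp])
  have hl₂ : ∀ p ∈ l₂, S.ty p.1 = R.ty p.1 := fun p hp => hl p (by simp [hp])
  have hd := (List.nodup_append'.1 hnd).2.2
  have hd' := (List.nodup_append'.1 (List.nodup_append'.1 hnd).1).2.2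
  -- The images under `φ` are input positions of the sync node of `S`, which are pairwise distinct.
  have hinj : ∀ p q, p ∈ Node.inPos R.ty x → q ∈ Node.inPos R.ty x → φ p = φ q → p = q := by
    have := (List.nodup_append'.1 (List.nodup_append'.1 hnd').1).2.1
    rw [hin] at this
    exact fun p q hp hq => List.inj_on_of_nodup_map this hp hq
  refine interp_eq_of_shift_aux hR hS hc hty hloc hn hn'
    -- Only the values of `φ` and `φ'` on the intermediate positions matter; elsewhere they are
    -- replaced by the identity.
    (fun p => if p ∈ Node.inPos R.ty x then φ p else p)
    (fun p => if p ∈ Node.outPos S.ty y then φ' p else p)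
    (fun p => p ∈ Node.inPos R.ty x) (fun p => p ∈ Node.outPos S.ty y) (fun p hp => ?_)
    (fun p hp => ?_) (fun p hp => if_neg hp) (fun p hp => if_neg hp) (fun g p q => ?_)
    (fun g p q => ?_) (fun p q hp hq h => ?_) ?_ ?_ hfresh ψ o
  · simp [Node.inPos_append, hp]
  · simp [Node.outPos_append, hp]
  · rw [hmv]
    exact and_congr_right fun _ => and_congr_right fun h => by rw [if_pos h]
  · rw [hmv']
    exact and_congr_right fun _ => and_congr_right fun h => by rw [if_pos h]
  · rw [if_pos hp, if_pos hq] at h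
    exact hinj p q hp hq h
  · rw [Node.inPos_append, Node.inPos_append, Node.inPos_append, Node.inPos_append, List.map_append,
      List.map_append, Node.inPos_congr hl₁, Node.inPos_congr hl₂, hin]
    congr 1
    · congr 1
      · refine (List.map_id' _).symm.trans (List.map_congr_left fun p hp => (if_neg ?_).symm)
        exact fun h => List.disjoint_left.1 hd' hp h
      · exact List.map_congr_left fun p hp => (if_pos hp).symm
    · refine (List.map_id' _).symm.trans (List.map_congr_left fun p hp => (if_neg ?_).symm)
      exact fun h => List.disjoint_left.1 hd (List.mem_append_right _ h) hp
  · have hed : ∀ p ∈ Node.outPos R.ty (l₁ ++ x ++ l₂), p ∉ Node.outPos S.ty y := fun p hp h => by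
      obtain ⟨e, m, rfl, he⟩ := isEdge_of_prod ms (Node.prod_of_mem_outPos (R.ty_node _ ms) hp)
      exact hfresh e m h he
    simp only [Node.outPos_append, List.mem_append] at hed
    rw [Node.outPos_append, Node.outPos_append, Node.outPos_append, Node.outPos_append,
      List.map_append, List.map_append, Node.outPos_congr hl₁, Node.outPos_congr hl₂, hout]
    congr 1
    · congr 1
      · exact (List.map_id' _).symm.trans (List.map_congr_left fun p hp =>
          (if_neg (hed p (.inl (.inl hp)))).symm)
      · exact List.map_congr_left fun p hp => (if_pos hp).symm
    · exact (List.map_id' _).symm.trans (List.map_congr_left fun p hp =>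
        (if_neg (hed p (.inr hp))).symm)

end Struct

end SyncShift

end QSMLL

/-! ### The four sync rules -/

namespace QSMLL

section SyncRules

variable {G : GateSet} {n : ℕ} {Γ : Fin n → Formula}

namespace Formula

theorem mem_addrs_iff_of_isPos {A : Formula} (hA : A.isPos = true) {m : List Bool} :
    m ∈ A.addrs ↔ A.pol m = some true :=
  ⟨pol_of_isPos hA, mem_addrs_of_pol⟩

theorem mem_addrs_iff_of_isNeg {A : Formula} (hA : A.isNeg = true) {m : List Bool} :
    m ∈ A.addrs ↔ A.pol m = some false :=
  ⟨pol_of_isNeg hA, mem_addrs_of_pol⟩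

theorem pol_ne_of_isPos {A : Formula} (hA : A.isPos = true) {m : List Bool} :
    A.pol m ≠ some false := fun h => by
  have := pol_of_isPos hA (mem_addrs_of_pol h)
  simp [h] at this

theorem pol_ne_of_isNeg {A : Formula} (hA : A.isNeg = true) {m : List Bool} :
    A.pol m ≠ some true := fun h => by
  have := pol_of_isNeg hA (mem_addrs_of_pol h)
  simp [h] at this

theorem isPos_ne_of_isNeg {A : Formula} (hA : A.isNeg = true) : ¬ A.isPos = true := fun h => by
  simp [not_isPos_and_isNeg h] at hA

end Formula

namespace Node

variable {ty : ℕ → Formula} {g : Option (ℕ × Bool)} {p q : Pos}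

theorem mv_ax_iff {a b : ℕ} : (Node.ax a b : Node G).Mv ty g p q ↔ g = none ∧ ∃ m,
    ((ty a).pol m = some false ∧ p = .edge a m ∧ q = .edge b m) ∨
    ((ty a).pol m = some true ∧ p = .edge b m ∧ q = .edge a m) := by
  constructor
  · intro h
    cases h with
    | fwd h hm => cases h; exact ⟨rfl, _, .inl ⟨hm, rfl, rfl⟩⟩
    | bwd h hm => cases h; exact ⟨rfl, _, .inr ⟨hm, rfl, rfl⟩⟩
  · rintro ⟨rfl, m, ⟨hm, rfl, rfl⟩ | ⟨hm, rfl, rfl⟩⟩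
    · exact .fwd (.ax a b) hm
    · exact .bwd (l := []) (.ax a b) hm

theorem mv_cut_iff {a b : ℕ} : (Node.cut a b : Node G).Mv ty g p q ↔ g = none ∧ ∃ m,
    ((ty a).pol m = some true ∧ p = .edge a m ∧ q = .edge b m) ∨
    ((ty a).pol m = some false ∧ p = .edge b m ∧ q = .edge a m) := by
  constructor
  · intro h
    cases h with
    | fwd h hm => cases h; exact ⟨rfl, _, .inl ⟨hm, rfl, rfl⟩⟩
    | bwd h hm => cases h; exact ⟨rfl, _, .inr ⟨hm, rfl, rfl⟩⟩
  · rintro ⟨rfl, m, ⟨hm, rfl, rfl⟩ | ⟨hm, rfl, rfl⟩⟩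
    · exact .fwd (.cut a b) hm
    · exact .bwd (l := []) (.cut a b) hm

/-- The moves through a node `tens` or `par`. -/
inductive SplitMv (ty : ℕ → Formula) (a b c : ℕ) : Pos → Pos → Prop
  | downLeft (m : List Bool) (h : (ty a).pol m = some true) :
      SplitMv ty a b c (.edge a m) (.edge c (false :: m))
  | downRight (m : List Bool) (h : (ty b).pol m = some true) :
      SplitMv ty a b c (.edge b m) (.edge c (true :: m))
  | upLeft (m : List Bool) (h : (ty a).pol m = some false) :
      SplitMv ty a b c (.edge c (false :: m)) (.edge a m)
  | upRight (m : List Bool) (h : (ty b).pol m = some false) :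
      SplitMv ty a b c (.edge c (true :: m)) (.edge b m)

theorem mv_tens_iff {a b c : ℕ} :
    (Node.tens a b c : Node G).Mv ty g p q ↔ g = none ∧ SplitMv ty a b c p q := by
  constructor
  · intro h
    cases h with
    | fwd h hm => cases h <;> exact ⟨rfl, by constructor; exact hm⟩
    | bwd h hm => cases h <;> exact ⟨rfl, by constructor; exact hm⟩
  · rintro ⟨rfl, h⟩
    cases h with
    | downLeft m h => exact .fwd (.tens_left a b c) h
    | downRight m h => exact .fwd (.tens_right a b c) h
    | upLeft m h => exact .bwd (l := [false]) (.tens_left a b c) h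
    | upRight m h => exact .bwd (l := [true]) (.tens_right a b c) h

theorem mv_par_iff {a b c : ℕ} :
    (Node.par a b c : Node G).Mv ty g p q ↔ g = none ∧ SplitMv ty a b c p q := by
  constructor
  · intro h
    cases h with
    | fwd h hm => cases h <;> exact ⟨rfl, by constructor; exact hm⟩
    | bwd h hm => cases h <;> exact ⟨rfl, by constructor; exact hm⟩
  · rintro ⟨rfl, h⟩
    cases h with
    | downLeft m h => exact .fwd (.par_left a b c) h
    | downRight m h => exact .fwd (.par_right a b c) h
    | upLeft m h => exact .bwd (l := [false]) (.par_left a b c) h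
    | upRight m h => exact .bwd (l := [true]) (.par_right a b c) h

end Node

/-- From the positions on `c` to the positions on `a` and `b`. -/
def Pos.split (a b : ℕ) : Pos → Pos
  | .edge _ (false :: m) => .edge a m
  | .edge _ (true :: m) => .edge b m
  | p => p

/-- From the positions on `a` and other edges to the positions on `c`. -/
def Pos.join (a c : ℕ) : Pos → Pos
  | .edge e m => .edge c (decide (e ≠ a) :: m)
  | p => p

namespace Struct

variable {R S : Struct G Γ}

theorem Agree.ty_rest (hA : R.Agree S) {w : Node G} (hw : w ∈ R.nodes) {x : ℕ}
    (hx : x ∈ w.tgts ++ w.concls) : S.ty x = R.ty x := (hA x (isEdge_of_mem hw hx)).1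

theorem Agree.loc_one (hA : R.Agree S) {c : ℕ} (hc : .one c ∈ R.nodes) : S.loc c = R.loc c :=
  (hA c ⟨_, hc, by simp [Node.concls]⟩).2

theorem isEdge_sync_left {u : G.Sym} {l : List (ℕ × ℕ)} (h : Node.sync u l ∈ R.nodes) {p : ℕ × ℕ}
    (hp : p ∈ l) : R.IsEdge p.1 :=
  isEdge_of_tgts h (by simpa [Node.tgts, Node.prems, Node.inner] using ⟨p.2, hp⟩)

theorem isEdge_sync_right {u : G.Sym} {l : List (ℕ × ℕ)} (h : Node.sync u l ∈ R.nodes) {p : ℕ × ℕ}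
    (hp : p ∈ l) : R.IsEdge p.2 := ⟨_, h, by simpa [Node.concls] using ⟨p.1, hp⟩⟩

theorem sync_ty {u : G.Sym} {l : List (ℕ × ℕ)} (h : Node.sync u l ∈ R.nodes) {p : ℕ × ℕ}
    (hp : p ∈ l) : R.ty p.1 = R.ty p.2 ∧ ((R.ty p.1).isPos = true ∨ (R.ty p.1).isNeg = true) :=
  (R.ty_node _ h).2.1 p hp

variable {reg : Finset ℕ} {hR₁ : R.HoldsOnes reg} {hS₁ : S.HoldsOnes reg} {Q : Qubits reg}
  {hQ : ‖Q‖ = 1} (ψ : {ψ : Qubits (InitPos Γ) // ‖ψ‖ = 1}) (o : Outcome Γ)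

/-- A sync node acts on a tensor only at positive type, so tokens go down: in `R` they pass the
tensor before the sync node, in `S` after it. -/
theorem interp_sync_tens {a b c d a' b' : ℕ} {u : G.Sym} {l₁ l₂ : List (ℕ × ℕ)}
    {rest : Multiset (Node G)}
    (hR : R.nodes = .tens a b c ::ₘ .sync u (l₁ ++ (c, d) :: l₂) ::ₘ rest)
    (hne : a' ≠ b') (ha : R.Fresh S a' a) (hb : R.Fresh S b' b)
    (hS : S.nodes = .tens a' b' d ::ₘ .sync u (l₁ ++ (a, a') :: (b, b') :: l₂) ::ₘ rest)
    (hc : S.concl = R.concl) (hA : R.Agree S) :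
    (⟨R, reg, hR₁, Q, hQ⟩ : QStruct G Γ).interp ψ o =
      (⟨S, reg, hS₁, Q, hQ⟩ : QStruct G Γ).interp ψ o := by
  have m₁ : .tens a b c ∈ R.nodes := by simp [hR]
  have ms : .sync u (l₁ ++ (c, d) :: l₂) ∈ R.nodes := by simp [hR]
  have hrest : ∀ w ∈ rest, w ∈ R.nodes := fun w hw => by simp [hR, hw]
  have hty : R.ty c = .tens (R.ty a) (R.ty b) := R.ty_node _ m₁
  obtain ⟨-, hpos⟩ := sync_ty ms (p := (c, d)) (by simp)
  have hpos : (R.ty c).isPos = true := hpos.resolve_right (by simp [hty, Formula.isNeg])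
  have hab := hpos
  rw [hty, Formula.isPos, Bool.and_eq_true] at hab
  have hSa : S.ty a = R.ty a := hA.ty_rest m₁ (by simp [Node.tgts, Node.prems])
  have hSb : S.ty b = R.ty b := hA.ty_rest m₁ (by simp [Node.tgts, Node.prems])
  have hin : Node.inPos R.ty [(c, d)] =
      (R.ty a).addrs.map (fun m => .edge c (false :: m)) ++
        (R.ty b).addrs.map (fun m => .edge c (true :: m)) := by
    simp [Node.inPos, hpos]
    simp [hty, Formula.addrs, Function.comp_def]
  have hout : Node.outPos S.ty [(a, a'), (b, b')] =
      (R.ty a).addrs.map (Pos.edge a') ++ (R.ty b).addrs.map (Pos.edge b') := by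
    simp [Node.outPos, hSa, hSb, hab.1, hab.2]
  refine interp_eq_of_shift (l₁ := l₁) (l₂ := l₂) (x := [(c, d)]) (y := [(a, a'), (b, b')])
    (by simpa using hR) (by simpa using hS) hc (fun p hp => ?_)
    (fun w hw x hx => hA.ty_rest (hrest w hw) hx) (fun c hc => hA.loc_one (hrest _ hc))
    ⟨by simp, by simp, by simp⟩ ⟨by simp, by simp, by simp⟩ (Pos.split a b) (Pos.join a' d)
    (fun g p q => ?_) (fun g p q => ?_) ?_ ?_ ?_ ψ o
  · exact (hA _ (isEdge_sync_left ms (by rcases List.mem_append.1 hp with h | h <;> simp [h]))).1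
  · rw [Node.mv_tens_iff, hin]
    refine and_congr_right fun _ => ?_
    simp only [List.mem_append, List.mem_map, Formula.mem_addrs_iff_of_isPos hab.1,
      Formula.mem_addrs_iff_of_isPos hab.2]
    constructor
    · intro h
      cases h with
      | downLeft m h => exact ⟨.inl ⟨m, h, rfl⟩, rfl⟩
      | downRight m h => exact ⟨.inr ⟨m, h, rfl⟩, rfl⟩
      | upLeft m h => exact absurd h (Formula.pol_ne_of_isPos hab.1)
      | upRight m h => exact absurd h (Formula.pol_ne_of_isPos hab.2)
    · rintro ⟨⟨m, h, rfl⟩ | ⟨m, h, rfl⟩, rfl⟩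
      · exact .downLeft m h
      · exact .downRight m h
  · rw [Node.mv_tens_iff, hout]
    refine and_congr_right fun _ => ?_
    simp only [List.mem_append, List.mem_map, Formula.mem_addrs_iff_of_isPos hab.1,
      Formula.mem_addrs_iff_of_isPos hab.2]
    constructor
    · intro h
      cases h with
      | downLeft m h => exact ⟨.inl ⟨m, ha.2.1 ▸ h, rfl⟩, by simp [Pos.join]⟩
      | downRight m h => exact ⟨.inr ⟨m, hb.2.1 ▸ h, rfl⟩, by simp [Pos.join, hne.symm]⟩
      | upLeft m h => exact absurd (ha.2.1 ▸ h) (Formula.pol_ne_of_isPos hab.1)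
      | upRight m h => exact absurd (hb.2.1 ▸ h) (Formula.pol_ne_of_isPos hab.2)
    · rintro ⟨⟨m, h, rfl⟩ | ⟨m, h, rfl⟩, rfl⟩
      · simpa [Pos.join] using Node.SplitMv.downLeft (b := b') (c := d) m (ha.2.1.symm ▸ h)
      · simpa [Pos.join, hne.symm] using Node.SplitMv.downRight (a := a') (c := d) m (hb.2.1.symm ▸ h)
  · rw [hin]
    simp [Node.inPos, hSa, hSb, hab.1, hab.2, Function.comp_def, Pos.split]
  · rw [hout]
    simp [Node.outPos, hpos, Function.comp_def, Pos.join, hne.symm]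
    simp [hty, Formula.addrs, Function.comp_def]
  · intro e m h
    rw [hout] at h
    simp only [List.mem_append, List.mem_map, Pos.edge.injEq] at h
    rcases h with ⟨_, _, rfl, -⟩ | ⟨_, _, rfl, -⟩
    · exact ha.1
    · exact hb.1

/-- At a par the type is negative and tokens go up, so it is in `S` that they pass the par before
the sync node. The general commutation is therefore applied with the roles of `R` and `S` exchanged.
-/
theorem interp_sync_par {a b c d a' b' : ℕ} {u : G.Sym} {l₁ l₂ : List (ℕ × ℕ)}
    {rest : Multiset (Node G)}
    (hR : R.nodes = .par a b c ::ₘ .sync u (l₁ ++ (c, d) :: l₂) ::ₘ rest)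
    (hne : a' ≠ b') (ha : R.Fresh S a' a) (hb : R.Fresh S b' b)
    (hS : S.nodes = .par a' b' d ::ₘ .sync u (l₁ ++ (a, a') :: (b, b') :: l₂) ::ₘ rest)
    (hc : S.concl = R.concl) (hA : R.Agree S) :
    (⟨R, reg, hR₁, Q, hQ⟩ : QStruct G Γ).interp ψ o =
      (⟨S, reg, hS₁, Q, hQ⟩ : QStruct G Γ).interp ψ o := by
  have m₁ : .par a b c ∈ R.nodes := by simp [hR]
  have ms : .sync u (l₁ ++ (c, d) :: l₂) ∈ R.nodes := by simp [hR]
  have hrest : ∀ w ∈ rest, w ∈ R.nodes := fun w hw => by simp [hR, hw]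
  have hty : R.ty c = .par (R.ty a) (R.ty b) := R.ty_node _ m₁
  obtain ⟨-, hneg⟩ := sync_ty ms (p := (c, d)) (by simp)
  have hneg : (R.ty c).isNeg = true := hneg.resolve_left (by simp [hty, Formula.isPos])
  have hab := hneg
  rw [hty, Formula.isNeg, Bool.and_eq_true] at hab
  have hnc := Formula.isPos_ne_of_isNeg hneg
  have hna := Formula.isPos_ne_of_isNeg hab.1
  have hnb := Formula.isPos_ne_of_isNeg hab.2
  have hSa : S.ty a = R.ty a := hA.ty_rest m₁ (by simp [Node.tgts, Node.prems])
  have hSb : S.ty b = R.ty b := hA.ty_rest m₁ (by simp [Node.tgts, Node.prems])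
  have hin : Node.inPos S.ty [(a, a'), (b, b')] =
      (R.ty a).addrs.map (Pos.edge a') ++ (R.ty b).addrs.map (Pos.edge b') := by
    simp [Node.inPos, hSa, hSb, hna, hnb]
  have hout : Node.outPos R.ty [(c, d)] =
      (R.ty a).addrs.map (fun m => .edge c (false :: m)) ++
        (R.ty b).addrs.map (fun m => .edge c (true :: m)) := by
    simp [Node.outPos, hnc]
    simp [hty, Formula.addrs, Function.comp_def]
  symm
  refine interp_eq_of_shift (l₁ := l₁) (l₂ := l₂) (x := [(a, a'), (b, b')]) (y := [(c, d)])
    (by simpa using hS) (by simpa using hR) hc.symm (fun p hp => ?_)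
    (fun w hw x hx => (hA.ty_rest (hrest w hw) hx).symm)
    (fun c hc => (hA.loc_one (hrest _ hc)).symm)
    ⟨by simp, by simp, by simp⟩ ⟨by simp, by simp, by simp⟩ (Pos.join a' d) (Pos.split a b)
    (fun g p q => ?_) (fun g p q => ?_) ?_ ?_ ?_ ψ o
  · exact (hA _ (isEdge_sync_left ms
      (by rcases List.mem_append.1 hp with h | h <;> simp [h]))).1.symm
  · rw [Node.mv_par_iff, hin]
    refine and_congr_right fun _ => ?_
    simp only [List.mem_append, List.mem_map, Formula.mem_addrs_iff_of_isNeg hab.1,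
      Formula.mem_addrs_iff_of_isNeg hab.2]
    constructor
    · intro h
      cases h with
      | downLeft m h => exact absurd (ha.2.1 ▸ h) (Formula.pol_ne_of_isNeg hab.1)
      | downRight m h => exact absurd (hb.2.1 ▸ h) (Formula.pol_ne_of_isNeg hab.2)
      | upLeft m h => exact ⟨.inl ⟨m, ha.2.1 ▸ h, rfl⟩, by simp [Pos.join]⟩
      | upRight m h => exact ⟨.inr ⟨m, hb.2.1 ▸ h, rfl⟩, by simp [Pos.join, hne.symm]⟩
    · rintro ⟨⟨m, h, rfl⟩ | ⟨m, h, rfl⟩, rfl⟩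
      · simpa [Pos.join] using Node.SplitMv.upLeft (b := b') (c := d) m (ha.2.1.symm ▸ h)
      · simpa [Pos.join, hne.symm] using Node.SplitMv.upRight (a := a') (c := d) m (hb.2.1.symm ▸ h)
  · rw [Node.mv_par_iff, hout]
    refine and_congr_right fun _ => ?_
    simp only [List.mem_append, List.mem_map, Formula.mem_addrs_iff_of_isNeg hab.1,
      Formula.mem_addrs_iff_of_isNeg hab.2]
    constructor
    · intro h
      cases h with
      | downLeft m h => exact absurd h (Formula.pol_ne_of_isNeg hab.1)
      | downRight m h => exact absurd h (Formula.pol_ne_of_isNeg hab.2)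
      | upLeft m h => exact ⟨.inl ⟨m, h, rfl⟩, rfl⟩
      | upRight m h => exact ⟨.inr ⟨m, h, rfl⟩, rfl⟩
    · rintro ⟨⟨m, h, rfl⟩ | ⟨m, h, rfl⟩, rfl⟩
      · exact .upLeft m h
      · exact .upRight m h
  · rw [hin]
    simp [Node.inPos, hnc, Function.comp_def, Pos.join, hne.symm]
    simp [hty, Formula.addrs, Function.comp_def]
  · rw [hout]
    simp [Node.outPos, hSa, hSb, hna, hnb, Function.comp_def, Pos.split]
  -- With exchanged roles the intermediate edge is `c`, which must not be an edge of `S`: its source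
  -- in `R` is the replaced par, and the new edges are fresh.
  · rintro e m h ⟨w, hw, he⟩
    rw [hout] at h
    have hec : e = c := by
      simp only [List.mem_append, List.mem_map, Pos.edge.injEq] at h
      rcases h with ⟨_, _, rfl, -⟩ | ⟨_, _, rfl, -⟩ <;> rfl
    subst hec
    have hce : e ∈ (Node.par a b e : Node G).concls := by simp [Node.concls]
    have hsync : e ∉ (Node.sync u (l₁ ++ (e, d) :: l₂) : Node G).concls := fun h =>
      absurd (concls_unique ms m₁ h hce) (by simp)
    simp only [Node.concls, List.map_append, List.map_cons, List.mem_append, List.mem_cons,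
      not_or] at hsync
    have hRe : R.IsEdge e := ⟨_, m₁, hce⟩
    rw [hS] at hw
    simp only [Multiset.mem_cons] at hw
    rcases hw with rfl | rfl | hw
    · simp only [Node.concls, List.mem_singleton] at he
      exact hsync.2.1 he
    · simp only [Node.concls, List.map_append, List.map_cons, List.mem_append, List.mem_cons] at he
      rcases he with he | rfl | rfl | he
      · exact hsync.1 he
      · exact ha.1 hRe
      · exact hb.1 hRe
      · exact hsync.2.2 he
    · have := concls_unique (hrest w hw) m₁ he hce
      subst this
      exact not_mem_rest hR (Multiset.mem_cons_of_mem hw)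

/-- In `R` a token comes up on `q`, crosses the axiom to `p` and then the sync node to `d`. In `S`
it crosses the sync node from `q` to `w` and then the axiom to `d`. -/
theorem interp_sync_ax {p q d w : ℕ} {v : Node G} {u : G.Sym} {l₁ l₂ : List (ℕ × ℕ)}
    {rest : Multiset (Node G)} (hv : v = .ax p q ∨ v = .ax q p) (hp : (R.ty p).isPos = true)
    (hR : R.nodes = v ::ₘ .sync u (l₁ ++ (p, d) :: l₂) ::ₘ rest) (hw : R.Fresh S w q)
    (hS : S.nodes = .ax d w ::ₘ .sync u (l₁ ++ (w, q) :: l₂) ::ₘ rest)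
    (hc : S.concl = R.concl) (hA : R.Agree S) :
    (⟨R, reg, hR₁, Q, hQ⟩ : QStruct G Γ).interp ψ o =
      (⟨S, reg, hS₁, Q, hQ⟩ : QStruct G Γ).interp ψ o := by
  have m₁ : v ∈ R.nodes := by simp [hR]
  have ms : .sync u (l₁ ++ (p, d) :: l₂) ∈ R.nodes := by simp [hR]
  have hrest : ∀ w ∈ rest, w ∈ R.nodes := fun w hw => by simp [hR, hw]
  have hty : R.ty q = (R.ty p).dual := by
    have := R.ty_node _ m₁
    rcases hv with rfl | rfl
    · exact this
    · rw [show R.ty p = _ from this, Formula.dual_dual]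
  have hd : S.ty d = R.ty p := by
    rw [(hA d (isEdge_sync_right ms (p := (p, d)) (by simp))).1]
    exact (sync_ty ms (p := (p, d)) (by simp)).1.symm
  have hSw : S.ty w = (R.ty p).dual := hw.2.1.trans hty
  have hnw : ¬ ((R.ty p).dual).isPos = true := by
    rw [Formula.isPos_dual]
    simp [Formula.not_isPos_and_isNeg hp]
  have hin : Node.inPos R.ty [(p, d)] = (R.ty p).addrs.map (Pos.edge p) := by
    simp [Node.inPos, hp]
  have hout : Node.outPos S.ty [(w, q)] = (R.ty p).addrs.map (Pos.edge w) := by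
    simp [Node.outPos, hSw, hnw, Formula.addrs_dual]
  refine interp_eq_of_shift (l₁ := l₁) (l₂ := l₂) (x := [(p, d)]) (y := [(w, q)])
    (by simpa using hR) (by simpa using hS) hc (fun p hp => ?_)
    (fun w hw x hx => hA.ty_rest (hrest w hw) hx) (fun c hc => hA.loc_one (hrest _ hc))
    (by rcases hv with rfl | rfl <;> exact ⟨by simp, by simp, by simp⟩) ⟨by simp, by simp, by simp⟩
    (Pos.map fun _ => q) (Pos.map fun _ => d) (fun g x y => ?_) (fun g x y => ?_) ?_ ?_ ?_ ψ o
  · exact (hA _ (isEdge_sync_left ms (by rcases List.mem_append.1 hp with h | h <;> simp [h]))).1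
  · rw [hin]
    simp only [List.mem_map, Formula.mem_addrs_iff_of_isPos hp]
    rcases hv with rfl | rfl
    · rw [Node.mv_ax_iff]
      refine and_congr_right fun _ => ⟨?_, ?_⟩
      · rintro ⟨m, ⟨h, rfl, rfl⟩ | ⟨h, rfl, rfl⟩⟩
        · exact absurd h (Formula.pol_ne_of_isPos hp)
        · exact ⟨⟨m, h, rfl⟩, rfl⟩
      · rintro ⟨⟨m, h, rfl⟩, rfl⟩
        exact ⟨m, .inr ⟨h, rfl, rfl⟩⟩
    · rw [Node.mv_ax_iff, hty]
      simp only [Formula.pol_dual]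
      refine and_congr_right fun _ => ⟨?_, ?_⟩
      · rintro ⟨m, ⟨h, rfl, rfl⟩ | ⟨h, rfl, rfl⟩⟩
        · exact ⟨⟨m, by simpa using h, rfl⟩, rfl⟩
        · exact absurd (by simpa using h) (Formula.pol_ne_of_isPos hp (m := m))
      · rintro ⟨⟨m, h, rfl⟩, rfl⟩
        exact ⟨m, .inl ⟨by simp [h], rfl, rfl⟩⟩
  · rw [Node.mv_ax_iff, hout, hd]
    simp only [List.mem_map, Formula.mem_addrs_iff_of_isPos hp]
    refine and_congr_right fun _ => ⟨?_, ?_⟩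
    · rintro ⟨m, ⟨h, rfl, rfl⟩ | ⟨h, rfl, rfl⟩⟩
      · exact absurd h (Formula.pol_ne_of_isPos hp)
      · exact ⟨⟨m, h, rfl⟩, rfl⟩
    · rintro ⟨⟨m, h, rfl⟩, rfl⟩
      exact ⟨m, .inr ⟨h, rfl, rfl⟩⟩
  · rw [hin]
    simp [Node.inPos, hSw, hnw, Formula.addrs_dual, Function.comp_def]
  · rw [hout]
    simp [Node.outPos, hp, Function.comp_def]
  · intro e m h
    rw [hout] at h
    simp only [List.mem_map, Pos.edge.injEq] at h
    obtain ⟨_, _, rfl, -⟩ := h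
    exact hw.1

/-- In `R` a token comes down on `p`, crosses the cut to `m` and then the sync node to `x`. In `S`
it crosses the sync node from `p` to `w` and then the cut to `x`. -/
theorem interp_sync_cut {x m p w : ℕ} {v : Node G} {u : G.Sym} {l₁ l₂ : List (ℕ × ℕ)}
    {rest : Multiset (Node G)} (hv : v = .cut m p ∨ v = .cut p m) (hm : (R.ty m).isNeg = true)
    (hR : R.nodes = v ::ₘ .sync u (l₁ ++ (x, m) :: l₂) ::ₘ rest) (hw : R.Fresh S w p)
    (hS : S.nodes = .cut x w ::ₘ .sync u (l₁ ++ (p, w) :: l₂) ::ₘ rest)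
    (hc : S.concl = R.concl) (hA : R.Agree S) :
    (⟨R, reg, hR₁, Q, hQ⟩ : QStruct G Γ).interp ψ o =
      (⟨S, reg, hS₁, Q, hQ⟩ : QStruct G Γ).interp ψ o := by
  have m₁ : v ∈ R.nodes := by simp [hR]
  have ms : .sync u (l₁ ++ (x, m) :: l₂) ∈ R.nodes := by simp [hR]
  have hrest : ∀ w ∈ rest, w ∈ R.nodes := fun w hw => by simp [hR, hw]
  have hty : R.ty p = (R.ty m).dual := by
    have := R.ty_node _ m₁
    rcases hv with rfl | rfl
    · exact this
    · rw [show R.ty m = _ from this, Formula.dual_dual]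
  have hx : R.ty x = R.ty m := (sync_ty ms (p := (x, m)) (by simp)).1
  have hSx : S.ty x = R.ty m := by
    rw [(hA x (isEdge_sync_left ms (p := (x, m)) (by simp))).1, hx]
  have hSp : S.ty p = (R.ty m).dual := by
    rw [hA.ty_rest m₁ (by rcases hv with rfl | rfl <;> simp [Node.tgts, Node.prems]), hty]
  have hpp : ((R.ty m).dual).isPos = true := by rw [Formula.isPos_dual]; exact hm
  have hnm := Formula.isPos_ne_of_isNeg hm
  have hin : Node.inPos R.ty [(x, m)] = (R.ty m).addrs.map (Pos.edge m) := by
    simp [Node.inPos, hx, hnm]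
  have hout : Node.outPos S.ty [(p, w)] = (R.ty m).addrs.map (Pos.edge w) := by
    simp [Node.outPos, hSp, hpp, Formula.addrs_dual]
  refine interp_eq_of_shift (l₁ := l₁) (l₂ := l₂) (x := [(x, m)]) (y := [(p, w)])
    (by simpa using hR) (by simpa using hS) hc (fun p hp => ?_)
    (fun w hw x hx => hA.ty_rest (hrest w hw) hx) (fun c hc => hA.loc_one (hrest _ hc))
    (by rcases hv with rfl | rfl <;> exact ⟨by simp, by simp, by simp⟩) ⟨by simp, by simp, by simp⟩
    (Pos.map fun _ => p) (Pos.map fun _ => x) (fun g y z => ?_) (fun g y z => ?_) ?_ ?_ ?_ ψ o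
  · exact (hA _ (isEdge_sync_left ms (by rcases List.mem_append.1 hp with h | h <;> simp [h]))).1
  · rw [hin]
    simp only [List.mem_map, Formula.mem_addrs_iff_of_isNeg hm]
    rcases hv with rfl | rfl
    · rw [Node.mv_cut_iff]
      refine and_congr_right fun _ => ⟨?_, ?_⟩
      · rintro ⟨i, ⟨h, rfl, rfl⟩ | ⟨h, rfl, rfl⟩⟩
        · exact absurd h (Formula.pol_ne_of_isNeg hm)
        · exact ⟨⟨i, h, rfl⟩, rfl⟩
      · rintro ⟨⟨i, h, rfl⟩, rfl⟩
        exact ⟨i, .inr ⟨h, rfl, rfl⟩⟩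
    · rw [Node.mv_cut_iff, hty]
      simp only [Formula.pol_dual]
      refine and_congr_right fun _ => ⟨?_, ?_⟩
      · rintro ⟨i, ⟨h, rfl, rfl⟩ | ⟨h, rfl, rfl⟩⟩
        · exact ⟨⟨i, by simpa using h, rfl⟩, rfl⟩
        · exact absurd (by simpa using h) (Formula.pol_ne_of_isNeg hm (m := i))
      · rintro ⟨⟨i, h, rfl⟩, rfl⟩
        exact ⟨i, .inl ⟨by simp [h], rfl, rfl⟩⟩
  · rw [Node.mv_cut_iff, hout, hSx]
    simp only [List.mem_map, Formula.mem_addrs_iff_of_isNeg hm]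
    refine and_congr_right fun _ => ⟨?_, ?_⟩
    · rintro ⟨i, ⟨h, rfl, rfl⟩ | ⟨h, rfl, rfl⟩⟩
      · exact absurd h (Formula.pol_ne_of_isNeg hm)
      · exact ⟨⟨i, h, rfl⟩, rfl⟩
    · rintro ⟨⟨i, h, rfl⟩, rfl⟩
      exact ⟨i, .inr ⟨h, rfl, rfl⟩⟩
  · rw [hin]
    simp [Node.inPos, hSp, hpp, Formula.addrs_dual, Function.comp_def]
  · rw [hout]
    simp [Node.outPos, hx, hnm, Function.comp_def]
  · intro e i h
    rw [hout] at h
    simp only [List.mem_map, Pos.edge.injEq] at h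
    obtain ⟨_, _, rfl, -⟩ := h
    exact hw.1

end Struct

end SyncRules

end QSMLL

/-! ### Axiom against cut -/

namespace QSMLL

section CutRules

variable {G : GateSet} {n : ℕ} {Γ : Fin n → Formula}

open View

namespace Struct

variable {R S : Struct G Γ}

/-- An edge that is a premiss of `w` is not a target of other nodes, nor a conclusion. -/
theorem not_mem_tgts {w w' : Node G} (hw : w ∈ R.nodes) (hw' : w' ∈ R.nodes) (hne : w' ≠ w) {x : ℕ}
    (hx : x ∈ w.tgts) : x ∉ w'.tgts := fun h => hne (tgts_unique hw' hw h hx)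

theorem not_mem_concls {w w' : Node G} (hw : w ∈ R.nodes) (hw' : w' ∈ R.nodes) (hne : w' ≠ w)
    {x : ℕ} (hx : x ∈ w.concls) : x ∉ w'.concls := fun h => hne (concls_unique hw' hw h hx)

variable {reg : Finset ℕ} {hR₁ : R.HoldsOnes reg} {hS₁ : S.HoldsOnes reg} {Q : Qubits reg}
  {hQ : ‖Q‖ = 1} (ψ : {ψ : Qubits (InitPos Γ) // ‖ψ‖ = 1}) (o : Outcome Γ)

/-- An axiom cut against itself is erased. -/
theorem interp_loop {a b : ℕ} {v w : Node G} {rest : Multiset (Node G)}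
    (hv : v = .ax a b ∨ v = .ax b a) (hw : w = .cut b a ∨ w = .cut a b)
    (hR : R.nodes = v ::ₘ w ::ₘ rest) (hS : S.nodes = rest) (hc : S.concl = R.concl)
    (hA : R.Agree S) :
    (⟨R, reg, hR₁, Q, hQ⟩ : QStruct G Γ).interp ψ o =
      (⟨S, reg, hS₁, Q, hQ⟩ : QStruct G Γ).interp ψ o := by
  have mv : v ∈ R.nodes := by simp [hR]
  have mw : w ∈ R.nodes := by simp [hR]
  have hvr : v ∉ rest := fun h => not_mem_rest hR (Multiset.mem_cons_of_mem h)
  have hwr : w ∉ rest := fun h => not_mem_rest (R := R) (w := w) (rest := v ::ₘ rest)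
    (by rw [hR, Multiset.cons_swap]) (Multiset.mem_cons_of_mem h)
  have hvc : v.concls ⊆ [a, b] ∧ a ∈ v.concls ∧ b ∈ v.concls ∧ v.tgts = [] := by
    rcases hv with rfl | rfl <;> simp [Node.concls, Node.tgts, Node.prems, Node.inner]
  have hwt : w.tgts ⊆ [a, b] ∧ a ∈ w.tgts ∧ b ∈ w.tgts ∧ w.concls = [] := by
    rcases hw with rfl | rfl <;> simp [Node.concls, Node.tgts, Node.prems, Node.inner]
  -- The axiom and the cut form an isolated loop. No token starts on its two edges and no remaining
  -- node produces one there, so all tokens stay off it.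
  let good : Pos → Prop := fun p => ∀ m, p ≠ .edge a m ∧ p ≠ .edge b m
  let v₁ : View := ⟨fun p => p, fun _ _ => False, fun _ => 0, good⟩
  have consumed : ∀ p, Consumed v₁ v₁ p p := fun p => by
    refine ⟨rfl, fun r _ h => ?_, fun r _ h => ?_⟩ <;>
    · change r = p at h
      rw [h]
  have produced : ∀ {p}, good p → Produced v₁ v₁ p p := fun h => ⟨h, h, rfl⟩
  have hgood : ∀ {e m}, e ≠ a → e ≠ b → good (.edge e m) := fun h1 h2 m => by
    simp [h1, h2]
  have hconcl : ∀ i, R.concl i ≠ a ∧ R.concl i ≠ b := fun i =>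
    ⟨fun h => concl_not_mem_tgts mw i (h ▸ hwt.2.1), fun h => concl_not_mem_tgts mw i (h ▸ hwt.2.2.1)⟩
  have key : Surgery R S v₁ v₁ ∅ id {v, w} ∅ {w | w ∈ rest} := by
    have hrest : ∀ u ∈ rest, u ∈ R.nodes ∧ u ≠ v ∧ u ≠ w := fun u hu =>
      ⟨by simp [hR, hu], fun h => hvr (h ▸ hu), fun h => hwr (h ▸ hu)⟩
    refine ⟨fun u => by simp [hR, or_assoc], fun u => by simp [hS, Node.rename_id],
      fun u hu => ?_, fun c hc => hA.loc_one (hrest _ hc).1, ?_, by simp, fun h => h.elim,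
      fun h => h.elim, fun _ _ _ => Iff.rfl, fun _ _ _ => Iff.rfl,
      fun k b m => ⟨by simp, by simp⟩, fun k b m => ⟨by simp, by simp⟩,
      fun u hu g p q hm hp => ?_, by simp, fun {u l} hu => ?_, by simp, fun j => ?_⟩
    · obtain ⟨hu', h1, h2⟩ := hrest u hu
      refine ⟨fun _ _ => rfl, fun x hx => hA.ty_rest hu' hx, fun {p} _ => ?_, fun {p} _ hp => ?_⟩
      · rw [Pos.map_id]
        exact consumed p
      · rw [Pos.map_id]
        refine produced ?_
        cases hp with
        | tgt h hm =>
          exact hgood (fun he => not_mem_tgts mw hu' h2 hwt.2.1 (he ▸ h))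
            (fun he => not_mem_tgts mw hu' h2 hwt.2.2.1 (he ▸ h))
        | concl h hm =>
          exact hgood (fun he => not_mem_concls mv hu' h1 hvc.2.1 (he ▸ h))
            (fun he => not_mem_concls mv hu' h1 hvc.2.2.1 (he ▸ h))
    · rintro u (rfl | rfl)
      · rcases hv with rfl | rfl <;> simp
      · rcases hw with rfl | rfl <;> simp
    -- A move through the axiom or the cut starts on the loop, where no good position lies.
    · exfalso
      have hu' : u ∈ R.nodes := by rcases hu with rfl | rfl <;> assumption
      have : ∀ e m, p = .edge e m → e = a ∨ e = b := by
        rintro e m rfl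
        rcases hu with rfl | rfl
        · cases hm.cons (R.ty_node _ hu') with
          | tgt h => simp [hvc.2.2.2] at h
          | concl h => simpa using hvc.1 h
        · cases hm.cons (R.ty_node _ hu') with
          | tgt h => simpa using hwt.1 h
          | concl h => simp [hwt.2.2.2] at h
      obtain ⟨⟨e, m, rfl⟩, -⟩ := hm.edges
      rcases this e m rfl with rfl | rfl
      · exact (hp m).1 rfl
      · exact (hp m).2 rfl
    · rcases hu with h | h
      · rcases hv with rfl | rfl <;> simp at h
      · have h : Node.sync u l = w := h
        rcases hw with rfl | rfl <;> simp at h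
    · rw [finPos_eq hc]
      exact consumed _
  refine key.interp_eq (fun i => ?_) (fun e he => (hR₁ e he).1) ψ o
  rw [initPos_eq hc]
  exact produced (hgood (hconcl _).1 (hconcl _).2)

open Classical in
/-- An axiom cut against another node. -/
theorem interp_ax_cut {a b c : ℕ} {v w : Node G} {rest : Multiset (Node G)} (hac : a ≠ c)
    (hv : v = .ax a b ∨ v = .ax b a) (hw : w = .cut b c ∨ w = .cut c b)
    (hR : R.nodes = v ::ₘ w ::ₘ rest)
    (hS : S.nodes = rest.map (Node.rename (Function.update id a c)))
    (hc : S.concl = Function.update id a c ∘ R.concl) (hA : R.Agree S) :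
    (⟨R, reg, hR₁, Q, hQ⟩ : QStruct G Γ).interp ψ o =
      (⟨S, reg, hS₁, Q, hQ⟩ : QStruct G Γ).interp ψ o := by
  have mv : v ∈ R.nodes := by simp [hR]
  have mw : w ∈ R.nodes := by simp [hR]
  have hvr : v ∉ rest := fun h => not_mem_rest hR (Multiset.mem_cons_of_mem h)
  have hwr : w ∉ rest := fun h => not_mem_rest (R := R) (w := w) (rest := v ::ₘ rest)
    (by rw [hR, Multiset.cons_swap]) (Multiset.mem_cons_of_mem h)
  have hvc : a ∈ v.concls ∧ b ∈ v.concls := by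
    rcases hv with rfl | rfl <;> simp [Node.concls]
  have hwt : b ∈ w.tgts ∧ c ∈ w.tgts := by
    rcases hw with rfl | rfl <;> simp [Node.tgts, Node.prems]
  have hab : a ≠ b := by
    have := concls_nodup mv
    rcases hv with rfl | rfl <;> simp [Node.concls] at this
    · exact this
    · exact Ne.symm this
  have hbc : b ≠ c := by
    have := tgts_nodup mw
    rcases hw with rfl | rfl <;> simp [Node.tgts, Node.prems, Node.inner] at this
    · exact this
    · exact Ne.symm this
  have tb : R.ty b = (R.ty a).dual := by
    have := R.ty_node _ mv
    rcases hv with rfl | rfl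
    · exact this
    · rw [show R.ty a = _ from this, Formula.dual_dual]
  have tc : R.ty c = R.ty a := by
    have := R.ty_node _ mw
    rcases hw with rfl | rfl
    · rw [show R.ty c = _ from this, tb, Formula.dual_dual]
    · rw [← Formula.dual_dual (R.ty c), ← show R.ty b = _ from this, tb, Formula.dual_dual]
  have pb : ∀ m s, (R.ty b).pol m = some s ↔ (R.ty a).pol m = some (!s) := by
    intro m s
    rw [tb, Formula.pol_dual]
    rcases (R.ty a).pol m with _ | t
    · simp
    · cases s <;> cases t <;> simp
  have mvv : ∀ {g p q}, v.Mv R.ty g p q ↔ g = none ∧ ∃ m,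
      ((R.ty a).pol m = some false ∧ p = .edge a m ∧ q = .edge b m) ∨
      ((R.ty a).pol m = some true ∧ p = .edge b m ∧ q = .edge a m) := by
    intro g p q
    rcases hv with rfl | rfl
    · exact Node.mv_ax_iff
    · rw [Node.mv_ax_iff]
      simp only [pb, Bool.not_true, Bool.not_false]
      exact and_congr_right fun _ => exists_congr fun m => or_comm
  have mvw : ∀ {g p q}, w.Mv R.ty g p q ↔ g = none ∧ ∃ m,
      ((R.ty a).pol m = some false ∧ p = .edge b m ∧ q = .edge c m) ∨
      ((R.ty a).pol m = some true ∧ p = .edge c m ∧ q = .edge b m) := by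
    intro g p q
    rcases hw with rfl | rfl
    · rw [Node.mv_cut_iff]
      simp only [pb, Bool.not_true, Bool.not_false]
    · rw [Node.mv_cut_iff, tc]
      exact and_congr_right fun _ => exists_congr fun m => or_comm
  let σ : ℕ → ℕ := Function.update id a c
  have σa : σ a = c := Function.update_self _ _ _
  have σe : ∀ {e}, e ≠ a → σ e = e := fun h => Function.update_of_ne h _ _
  -- All three edges `a`, `b`, `c` of `R` are identified with the edge `c` of `S`.
  let τ : ℕ → ℕ := fun e => if e = b then c else σ e
  have τσ : ∀ {e}, e ≠ b → τ e = σ e := fun h => if_neg h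
  -- On these edges a token travels along `a`, `b`, `c` or along `c`, `b`, `a`, according to its
  -- polarity in the common type of `a` and `c`; `rank` counts the silent moves it still has to
  -- make.
  let rank : ℕ → Bool → ℕ := fun e s => if e = b then 1 else if (e = a ↔ s = true) then 0 else 2
  let v₁ : View := ⟨Pos.map τ, fun p q => v.Mv R.ty none p q ∨ w.Mv R.ty none p q,
    fun p => match p with
      | .edge e m => rank e ((R.ty e).pol m = some true ↔ e ≠ b)
      | .lock _ _ => 0, fun _ => True⟩
  let v₂ : View := ⟨fun p => p, fun _ _ => False, fun _ => 0, fun _ => True⟩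
  -- The remaining nodes take positive positions from `a` and negative ones from `c`, which are just
  -- the ends of the two silent paths.
  have consumed : ∀ {e m}, e ≠ b → (e = a → (R.ty a).pol m = some true) →
      (e = c → (R.ty a).pol m = some false) → Consumed v₁ v₂ (.edge e m) (.edge (σ e) m) := by
    intro e m hb ha hcc
    refine ⟨by change Pos.edge (τ e) m = _; rw [τσ hb], fun r _ h => ?_, fun r _ h => ?_⟩
    · change r = Pos.edge (τ e) m at h
      rw [h, τσ hb]
    · change Pos.map τ r = Pos.edge (σ e) m at h
      rcases r with ⟨x, m'⟩ | _
      · simp only [Pos.map_edge, Pos.edge.injEq] at h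
        obtain ⟨h, rfl⟩ := h
        by_cases hea : e = a
        · subst hea
          have hp := ha rfl
          have s1 : v₁.sil (.edge b m') (.edge e m') := .inl (mvv.2 ⟨rfl, m', .inr ⟨hp, rfl, rfl⟩⟩)
          have s2 : v₁.sil (.edge c m') (.edge b m') := .inr (mvw.2 ⟨rfl, m', .inr ⟨hp, rfl, rfl⟩⟩)
          rw [σa] at h
          by_cases hxb : x = b
          · subst hxb; exact .single s1
          · rw [τσ hxb] at h
            by_cases hxa : x = e
            · rw [hxa]
            · rw [σe hxa] at h
              subst h
              exact .head s2 (.single s1)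
        · rw [σe hea] at h
          by_cases hec : e = c
          · subst hec
            have hp := hcc rfl
            have s1 : v₁.sil (.edge a m') (.edge b m') := .inl (mvv.2 ⟨rfl, m', .inl ⟨hp, rfl, rfl⟩⟩)
            have s2 : v₁.sil (.edge b m') (.edge e m') := .inr (mvw.2 ⟨rfl, m', .inl ⟨hp, rfl, rfl⟩⟩)
            by_cases hxb : x = b
            · subst hxb; exact .single s2
            · rw [τσ hxb] at h
              by_cases hxa : x = a
              · subst hxa; exact .head s1 (.single s2)
              · rw [σe hxa] at h
                rw [h]
          · have hxb : x ≠ b := by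
              rintro rfl
              exact hec (by rw [← h]; exact if_pos rfl)
            rw [τσ hxb] at h
            have hxa : x ≠ a := by
              rintro rfl
              exact hec (by rw [← h, σa])
            rw [σe hxa] at h
            rw [h]
      · simp at h
  have produced : ∀ {e m}, e ≠ b → Produced v₁ v₂ (.edge e m) (.edge (σ e) m) := fun {e m} hb =>
    ⟨trivial, trivial, by change Pos.edge (τ e) m = _; rw [τσ hb]⟩
  have hrest : ∀ u ∈ rest, u ∈ R.nodes ∧ u ≠ v ∧ u ≠ w := fun u hu =>
    ⟨by simp [hR, hu], fun h => hvr (h ▸ hu), fun h => hwr (h ▸ hu)⟩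
  have hconcl : ∀ i, R.concl i ≠ b ∧ R.concl i ≠ c := fun i =>
    ⟨fun h => concl_not_mem_tgts mw i (h ▸ hwt.1), fun h => concl_not_mem_tgts mw i (h ▸ hwt.2)⟩
  have key : Surgery R S v₁ v₂ ∅ σ {v, w} ∅ {w | w ∈ rest} := by
    refine ⟨fun u => by simp [hR, or_assoc], fun u => ?_,
      fun u hu => ?_, fun c hc => hA.loc_one (hrest _ hc).1, ?_, by simp, fun {p q} h _ => ?_,
      fun h => h.elim, fun r k b => ?_, fun _ _ _ => Iff.rfl,
      fun k b => trivial, fun k b => trivial,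
      fun u hu g p q hm hp => ?_, by simp, fun {u l} hu => ?_, by simp, fun j => ?_⟩
    · rw [hS, Multiset.mem_map]
      simp [eq_comm, σ]
    · obtain ⟨hu', h1, h2⟩ := hrest u hu
      have nb : ∀ {x}, x ∈ u.tgts ∨ x ∈ u.concls → x ≠ b := by
        rintro x (h | h) rfl
        · exact not_mem_tgts mw hu' h2 hwt.1 h
        · exact not_mem_concls mv hu' h1 hvc.2 h
      have na : a ∉ u.concls := not_mem_concls mv hu' h1 hvc.1
      have nc : c ∉ u.tgts := not_mem_tgts mw hu' h2 hwt.2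
      refine ⟨fun x hx => σe (by rintro rfl; exact na hx), fun x hx => ?_, fun {p} hp => ?_,
        fun {p} _ hp => ?_⟩
      · by_cases h : x = a
        · rw [h, σa, hA.ty_rest mw (List.mem_append_left _ hwt.2), tc]
        · rw [σe h]
          exact hA.ty_rest hu' hx
      · cases hp with
        | @tgt e m h hm =>
          exact consumed (nb (.inl h)) (by rintro rfl; exact hm) (by rintro rfl; exact absurd h nc)
        | @concl e m h hm =>
          exact consumed (nb (.inr h)) (by rintro rfl; exact absurd h na)
            (by rintro rfl; rw [← tc]; exact hm)
      · cases hp with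
        | tgt h hm => exact produced (nb (.inl h))
        | concl h hm => exact produced (nb (.inr h))
    · rintro u (rfl | rfl)
      · rcases hv with rfl | rfl <;> simp
      · rcases hw with rfl | rfl <;> simp
    · have hτa : τ a = c := (τσ hab).trans σa
      have hτb : τ b = c := if_pos rfl
      have hτc : τ c = c := (τσ hbc.symm).trans (σe hac.symm)
      refine ⟨?_, ?_, trivial, ?_⟩
      · rcases h with h | h
        · exact ⟨v, mv, h⟩
        · exact ⟨w, mw, h⟩
      · rcases h with h | h
        · obtain ⟨-, m, ⟨-, rfl, rfl⟩ | ⟨-, rfl, rfl⟩⟩ := mvv.1 h <;> simp [v₁, hτa, hτb]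
        · obtain ⟨-, m, ⟨-, rfl, rfl⟩ | ⟨-, rfl, rfl⟩⟩ := mvw.1 h <;> simp [v₁, hτc, hτb]
      · rcases h with h | h
        · obtain ⟨-, m, ⟨hm, rfl, rfl⟩ | ⟨hm, rfl, rfl⟩⟩ := mvv.1 h <;>
            simp [v₁, rank, hm, hab]
        · obtain ⟨-, m, ⟨hm, rfl, rfl⟩ | ⟨hm, rfl, rfl⟩⟩ := mvw.1 h <;>
            simp [v₁, rank, hm, hbc.symm, hac.symm, tc]
    · rcases r with ⟨x, m⟩ | ⟨x, m⟩ <;> simp [v₁]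
    · left
      rcases hu with rfl | rfl
      · obtain ⟨rfl, -⟩ := mvv.1 hm
        exact .inl hm
      · obtain ⟨rfl, -⟩ := mvw.1 hm
        exact .inr hm
    · rcases hu with h | h
      · rcases hv with rfl | rfl <;> simp at h
      · have h : Node.sync u l = w := h
        rcases hw with rfl | rfl <;> simp at h
    · have : S.finPos j = .edge (σ (R.concl j.1)) j.2 := by rw [finPos, hc]; rfl
      rw [this]
      refine consumed (hconcl _).1 (fun h => ?_) (fun h => absurd h (hconcl _).2)
      rw [← h, R.ty_concl]
      exact pol_atoms _
  refine key.interp_eq (fun i => ?_) (fun e he => (hR₁ e he).1) ψ o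
  have : S.initPos i = .edge (σ (R.concl i.1)) i.2 := by rw [initPos, hc]; rfl
  rw [this]
  exact produced (hconcl _).1

end Struct

end CutRules

end QSMLL

/-! ### Tensor against par, and all rules that do not touch the register -/

namespace QSMLL

section TensPar

variable {G : GateSet} {n : ℕ} {Γ : Fin n → Formula}

open View

namespace Struct

theorem splitMv_iff {ty : ℕ → Formula} {a b c : ℕ} {p q : Pos} :
    Node.SplitMv ty a b c p q ↔ ∃ s m,
      ((ty (bif s then b else a)).pol m = some true ∧ p = .edge (bif s then b else a) m ∧
        q = .edge c (s :: m)) ∨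
      ((ty (bif s then b else a)).pol m = some false ∧ p = .edge c (s :: m) ∧
        q = .edge (bif s then b else a) m) := by
  constructor
  · intro h
    cases h with
    | downLeft m h => exact ⟨false, m, .inl ⟨h, rfl, rfl⟩⟩
    | downRight m h => exact ⟨true, m, .inl ⟨h, rfl, rfl⟩⟩
    | upLeft m h => exact ⟨false, m, .inr ⟨h, rfl, rfl⟩⟩
    | upRight m h => exact ⟨true, m, .inr ⟨h, rfl, rfl⟩⟩
  · rintro ⟨_ | _, m, ⟨h, rfl, rfl⟩ | ⟨h, rfl, rfl⟩⟩
    · exact .downLeft m h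
    · exact .upLeft m h
    · exact .downRight m h
    · exact .upRight m h

variable {R S : Struct G Γ} {reg : Finset ℕ} {hR₁ : R.HoldsOnes reg} {hS₁ : S.HoldsOnes reg}
  {Q : Qubits reg} {hQ : ‖Q‖ = 1} (ψ : {ψ : Qubits (InitPos Γ) // ‖ψ‖ = 1}) (o : Outcome Γ)

-- Crossing the tensor or the par only adds or removes the first bit of the address and is taken as
-- silent. The cut between `c` and `c'` then acts, according to this bit, as one of the two cuts
-- between premisses.
open Classical in
theorem interp_tens_par {a b c a' b' c' : ℕ} {w : Node G} {rest : Multiset (Node G)}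
    (hw : w = .cut c c' ∨ w = .cut c' c)
    (hR : R.nodes = .tens a b c ::ₘ .par a' b' c' ::ₘ w ::ₘ rest)
    (hS : S.nodes = .cut a a' ::ₘ .cut b b' ::ₘ rest)
    (hc : S.concl = R.concl) (hA : R.Agree S) :
    (⟨R, reg, hR₁, Q, hQ⟩ : QStruct G Γ).interp ψ o =
      (⟨S, reg, hS₁, Q, hQ⟩ : QStruct G Γ).interp ψ o := by
  have mt : .tens a b c ∈ R.nodes := by simp [hR]
  have mp : .par a' b' c' ∈ R.nodes := by simp [hR]
  have mw : w ∈ R.nodes := by simp [hR]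
  have hrest : ∀ u ∈ rest, u ∈ R.nodes ∧ u ≠ .tens a b c ∧ u ≠ .par a' b' c' ∧ u ≠ w := by
    have := R.nodes_nodup
    rw [hR] at this
    simp only [Multiset.nodup_cons, Multiset.mem_cons, not_or] at this
    exact fun u hu => ⟨by simp [hR, hu], fun h => this.1.2.2 (h ▸ hu),
      fun h => this.2.1.2 (h ▸ hu), fun h => this.2.2.1 (h ▸ hu)⟩
  -- Uniform notation: `t` selects tensor or par, `s` the left or right premiss, so that `X t s` is
  -- a premiss of the node with conclusion `C t`.
  let C : Bool → ℕ := fun t => bif t then c' else c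
  let X : Bool → Bool → ℕ := fun t s => bif t then bif s then b' else a' else bif s then b else a
  have hCw : ∀ t, C t ∈ w.tgts := by
    rcases hw with rfl | rfl <;> rintro (_ | _) <;> simp [C, Node.tgts, Node.prems]
  have hXt : ∀ s, X false s ∈ (Node.tens a b c : Node G).tgts := by
    rintro (_ | _) <;> simp [X, Node.tgts, Node.prems]
  have hXp : ∀ s, X true s ∈ (Node.par a' b' c' : Node G).tgts := by
    rintro (_ | _) <;> simp [X, Node.tgts, Node.prems]
  have wt : w ≠ .tens a b c ∧ w ≠ .par a' b' c' := by rcases hw with rfl | rfl <;> simp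
  have hCC : c ≠ c' := by
    have := tgts_nodup mw
    rcases hw with rfl | rfl <;> simp [Node.tgts, Node.prems, Node.inner] at this
    · exact this
    · exact Ne.symm this
  have hCinj : ∀ {t t'}, C t = C t' → t = t' := by
    rintro (_ | _) (_ | _) h <;> simp_all [C, eq_comm]
  have hXC : ∀ t s t', X t s ≠ C t' := by
    rintro (_ | _) s t' h
    · exact not_mem_tgts mw mt wt.1.symm (hCw t') (h ▸ hXt s)
    · exact not_mem_tgts mw mp wt.2.symm (hCw t') (h ▸ hXp s)
  have hXinj : ∀ {t s t' s'}, X t s = X t' s' → t = t' ∧ s = s' := by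
    have n1 := tgts_nodup mt
    have n2 := tgts_nodup mp
    simp only [Node.tgts, Node.prems, Node.inner, List.append_nil, List.nodup_cons,
      List.mem_singleton] at n1 n2
    have n3 : ∀ s s', X false s ≠ X true s' := fun s s' h =>
      not_mem_tgts mp mt (by simp) (hXp s') (h ▸ hXt s)
    rintro (_ | _) s (_ | _) s' h
    · refine ⟨rfl, ?_⟩
      rcases s <;> rcases s' <;> simp_all [X, eq_comm]
    · exact absurd h (n3 _ _)
    · exact absurd h.symm (n3 _ _)
    · refine ⟨rfl, ?_⟩
      rcases s <;> rcases s' <;> simp_all [X, eq_comm]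
  have tt : R.ty c = .tens (R.ty a) (R.ty b) := R.ty_node _ mt
  have tp : R.ty c' = .par (R.ty a') (R.ty b') := R.ty_node _ mp
  have tw : R.ty c' = (R.ty c).dual := by
    have := R.ty_node _ mw
    rcases hw with rfl | rfl
    · exact this
    · rw [show R.ty c = _ from this, Formula.dual_dual]
  have tX : ∀ s, R.ty (X true s) = (R.ty (X false s)).dual := by
    rw [tt, tp, Formula.dual, Formula.par.injEq] at tw
    rintro (_ | _)
    · exact tw.1
    · exact tw.2
  have polX : ∀ {t s m b}, (R.ty (X t s)).pol m = some b ↔ (R.ty (X (!t) s)).pol m = some (!b) := by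
    have : ∀ {s m b}, (R.ty (X true s)).pol m = some b ↔ (R.ty (X false s)).pol m = some (!b) := by
      intro s m b
      rw [tX, Formula.pol_dual]
      rcases (R.ty (X false s)).pol m with _ | t
      · simp
      · cases b <;> cases t <;> simp
    rintro (_ | _) s m b
    · rw [Bool.not_false, this, Bool.not_not]
    · exact this
  have polC : ∀ t s m, (R.ty (C t)).pol (s :: m) = (R.ty (X t s)).pol m := by
    rintro (_ | _) (_ | _) m
    · exact congrArg (Formula.pol · _) tt
    · exact congrArg (Formula.pol · _) tt
    · exact congrArg (Formula.pol · _) tp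
    · exact congrArg (Formula.pol · _) tp
  have polC₀ : ∀ t, (R.ty (C t)).pol [] = none := by
    rintro (_ | _)
    · exact (congrArg (Formula.pol · _) tt).trans rfl
    · exact (congrArg (Formula.pol · _) tp).trans rfl
  have mvt : ∀ {g p q}, ((Node.tens a b c : Node G).Mv R.ty g p q ∨
      (Node.par a' b' c' : Node G).Mv R.ty g p q) ↔ g = none ∧ ∃ t s m,
        ((R.ty (X t s)).pol m = some true ∧ p = .edge (X t s) m ∧ q = .edge (C t) (s :: m)) ∨
        ((R.ty (X t s)).pol m = some false ∧ p = .edge (C t) (s :: m) ∧ q = .edge (X t s) m) := by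
    intro g p q
    rw [Node.mv_tens_iff, Node.mv_par_iff, ← and_or_left, splitMv_iff, splitMv_iff]
    refine and_congr_right fun _ => ⟨?_, ?_⟩
    · rintro (h | h)
      · exact ⟨false, h⟩
      · exact ⟨true, h⟩
    · rintro ⟨_ | _, h⟩
      · exact .inl h
      · exact .inr h
  have mvw : ∀ {g p q}, w.Mv R.ty g p q ↔ g = none ∧ ∃ t s m, (R.ty (X t s)).pol m = some true ∧
      p = .edge (C t) (s :: m) ∧ q = .edge (C (!t)) (s :: m) := by
    have key : ∀ {p q : Pos}, (∃ t s m, (R.ty (X t s)).pol m = some true ∧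
        p = .edge (C t) (s :: m) ∧ q = .edge (C (!t)) (s :: m)) ↔ ∃ l,
        ((R.ty c).pol l = some true ∧ p = .edge c l ∧ q = .edge c' l) ∨
        ((R.ty c').pol l = some true ∧ p = .edge c' l ∧ q = .edge c l) := by
      intro p q
      constructor
      · rintro ⟨_ | _, s, m, h, rfl, rfl⟩
        · exact ⟨s :: m, .inl ⟨(polC false s m).trans h, rfl, rfl⟩⟩
        · exact ⟨s :: m, .inr ⟨(polC true s m).trans h, rfl, rfl⟩⟩
      · rintro ⟨l, h⟩
        -- The empty address is no atom, since the types of `c` and `c'` are compound.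
        rcases l with _ | ⟨s, m⟩
        · rcases h with ⟨h, -⟩ | ⟨h, -⟩
          · exact absurd ((polC₀ false).symm.trans h) (by simp)
          · exact absurd ((polC₀ true).symm.trans h) (by simp)
        · rcases h with ⟨h, rfl, rfl⟩ | ⟨h, rfl, rfl⟩
          · exact ⟨false, s, m, (polC false s m).symm.trans h, rfl, rfl⟩
          · exact ⟨true, s, m, (polC true s m).symm.trans h, rfl, rfl⟩
    have pc : ∀ l, ((R.ty c').pol l = some true ↔ (R.ty c).pol l = some false) ∧
        ((R.ty c').pol l = some false ↔ (R.ty c).pol l = some true) := by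
      intro l
      rw [tw, Formula.pol_dual]
      rcases (R.ty c).pol l with _ | _ | _ <;> simp
    intro g p q
    rw [key]
    rcases hw with rfl | rfl
    · rw [Node.mv_cut_iff]
      simp only [pc]
    · rw [Node.mv_cut_iff]
      simp only [pc]
      exact and_congr_right fun _ => exists_congr fun _ => or_comm
  have tyS : ∀ t s, S.ty (X t s) = R.ty (X t s) := by
    rintro (_ | _) s
    · exact hA.ty_rest mt (List.mem_append_left _ (hXt s))
    · exact hA.ty_rest mp (List.mem_append_left _ (hXp s))
  have mvS : ∀ {s g p q}, (Node.cut (X false s) (X true s) : Node G).Mv S.ty g p q ↔ g = none ∧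
      ∃ t m, (R.ty (X t s)).pol m = some true ∧ p = .edge (X t s) m ∧ q = .edge (X (!t) s) m := by
    intro s g p q
    rw [Node.mv_cut_iff, tyS]
    refine and_congr_right fun _ => ?_
    rw [Bool.exists_bool, ← exists_or]
    refine exists_congr fun m => or_congr Iff.rfl ?_
    rw [polX (t := true)]
    rfl
  let φ : Pos → Pos := fun p => match p with
    | .edge e (s :: m) => if e = C false then .edge (X false s) m else
        if e = C true then .edge (X true s) m else .edge e (s :: m)
    | p => p
  have φC : ∀ t s m, φ (.edge (C t) (s :: m)) = .edge (X t s) m := by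
    rintro (_ | _) s m
    · exact if_pos rfl
    · exact (if_neg fun h => absurd (hCinj h) (by simp)).trans (if_pos rfl)
  have φe : ∀ {e m}, (∀ t, e ≠ C t) → φ (.edge e m) = .edge e m := by
    rintro e (_ | ⟨s, m⟩) h
    · rfl
    · exact (if_neg (h _)).trans (if_neg (h _))
  have φX : ∀ t s m, φ (.edge (X t s) m) = .edge (X t s) m := fun t s m => φe (hXC t s)
  have φinv : ∀ {r e m}, φ r = .edge e m → r = .edge e m ∨
      ∃ t s, e = X t s ∧ r = .edge (C t) (s :: m) := by
    rintro (⟨e', _ | ⟨s, m'⟩⟩ | _) e m h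
    · exact .inl h
    · by_cases hC : ∃ t, e' = C t
      · obtain ⟨t, rfl⟩ := hC
        rw [φC, Pos.edge.injEq] at h
        obtain ⟨rfl, rfl⟩ := h
        exact .inr ⟨t, s, rfl, rfl⟩
      · push Not at hC
        exact .inl ((φe hC).symm.trans h)
    · exact .inl h
  -- Weight one marks tokens that have yet to cross the tensor or par: positive ones on a premiss
  -- and negative ones on a conclusion.
  let v₁ : View := ⟨φ, fun p q => ∃ t s m,
      ((R.ty (X t s)).pol m = some true ∧ p = .edge (X t s) m ∧ q = .edge (C t) (s :: m)) ∨
      ((R.ty (X t s)).pol m = some false ∧ p = .edge (C t) (s :: m) ∧ q = .edge (X t s) m),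
    fun p => match p with
      | .edge e m => if ((R.ty e).pol m = some true ↔ ∃ t s, e = X t s) then 1 else 0
      | .lock _ _ => 0, fun _ => True⟩
  let v₂ : View := ⟨fun p => p, fun _ _ => False, fun _ => 0, fun _ => True⟩
  have consumed₁ : ∀ {t s m}, (R.ty (X t s)).pol m = some true →
      Consumed v₁ v₂ (.edge (C t) (s :: m)) (.edge (X t s) m) := by
    intro t s m hm
    refine ⟨φC t s m, fun r _ h => ?_, fun r _ h => ?_⟩
    · change r = φ (.edge (C t) (s :: m)) at h
      rw [h, φC]
    · rcases φinv h with rfl | ⟨t', s', h1, rfl⟩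
      · exact .single ⟨t, s, m, .inl ⟨hm, rfl, rfl⟩⟩
      · obtain ⟨rfl, rfl⟩ := hXinj h1
        exact .refl
  have consumed₂ : ∀ {e m}, (∀ t, e ≠ C t) → (∀ t s, e = X t s → (R.ty e).pol m = some false) →
      Consumed v₁ v₂ (.edge e m) (.edge e m) := by
    intro e m hC hX
    refine ⟨φe hC, fun r _ h => ?_, fun r _ h => ?_⟩
    · change r = φ (.edge e m) at h
      rw [h, φe hC]
    · rcases φinv h with rfl | ⟨t', s', rfl, rfl⟩
      · exact .refl
      · exact .single ⟨t', s', m, .inr ⟨hX _ _ rfl, rfl, rfl⟩⟩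
  have produced₁ : ∀ {t s m}, Produced v₁ v₂ (.edge (C t) (s :: m)) (.edge (X t s) m) :=
    fun {t s m} => ⟨trivial, trivial, φC t s m⟩
  have produced₂ : ∀ {e m}, (∀ t, e ≠ C t) → Produced v₁ v₂ (.edge e m) (.edge e m) :=
    fun hC => ⟨trivial, trivial, φe hC⟩
  have hconcl : ∀ i t, R.concl i ≠ C t := fun i t h => concl_not_mem_tgts mw i (h ▸ hCw t)
  have hconclX : ∀ i t s, R.concl i ≠ X t s := by
    rintro i (_ | _) s h
    · exact concl_not_mem_tgts mt i (h ▸ hXt s)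
    · exact concl_not_mem_tgts mp i (h ▸ hXp s)
  have key : Surgery R S v₁ v₂ ∅ id {.tens a b c, .par a' b' c', w}
      {.cut (X false false) (X true false), .cut (X false true) (X true true)} {w | w ∈ rest} := by
    refine ⟨fun u => by simp [hR, or_assoc], fun u => by simp [hS, X, Node.rename_id, or_assoc],
      fun u hu => ?_, fun c hc => hA.loc_one (hrest _ hc).1, ?_, ?_, fun {p q} h _ => ?_,
      fun h => h.elim, fun r k b => ?_, fun _ _ _ => Iff.rfl,
      fun k b => trivial, fun k b => trivial,
      fun u hu g p q hm hp => ?_, fun u hu g p q hm hp => .inr ?_, fun {u l} hu => ?_,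
      fun {u l} hu => ?_, fun j => ?_⟩
    · obtain ⟨hu', h1, h2, h3⟩ := hrest u hu
      have nt : ∀ t, C t ∉ u.tgts := fun t => not_mem_tgts mw hu' h3 (hCw t)
      have nc : ∀ t, C t ∉ u.concls := by
        rintro (_ | _)
        · exact not_mem_concls mt hu' h1 (by simp [C, Node.concls])
        · exact not_mem_concls mp hu' h2 (by simp [C, Node.concls])
      have nX : ∀ t s, X t s ∉ u.tgts := by
        rintro (_ | _) s
        · exact not_mem_tgts mt hu' h1 (hXt s)
        · exact not_mem_tgts mp hu' h2 (hXp s)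
      refine ⟨fun _ _ => rfl, fun x hx => hA.ty_rest hu' hx, fun {p} hp => ?_,
        fun {p} _ hp => ?_⟩
      · rw [Pos.map_id]
        cases hp with
        | tgt h hm => exact consumed₂ (fun t he => nt t (he ▸ h)) fun t s he => absurd (he ▸ h) (nX t s)
        | concl h hm => exact consumed₂ (fun t he => nc t (he ▸ h)) fun t s _ => hm
      · rw [Pos.map_id]
        cases hp with
        | tgt h hm => exact produced₂ fun t he => nt t (he ▸ h)
        | concl h hm => exact produced₂ fun t he => nc t (he ▸ h)
    · rintro u (rfl | rfl | rfl)
      · simp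
      · simp
      · rcases hw with rfl | rfl <;> simp
    · rintro u (rfl | rfl) <;> simp
    · refine ⟨?_, ?_, trivial, ?_⟩
      · rcases mvt.2 ⟨rfl, h⟩ with h | h
        · exact ⟨_, mt, h⟩
        · exact ⟨_, mp, h⟩
      · obtain ⟨t, s, m, ⟨hm, rfl, rfl⟩ | ⟨hm, rfl, rfl⟩⟩ := h
        · exact (φX t s m).trans (φC t s m).symm
        · exact (φC t s m).trans (φX t s m).symm
      · have hex : ∀ t s, ∃ t' s', X t s = X t' s' := fun t s => ⟨t, s, rfl⟩
        have hCX : ∀ t, ¬ ∃ t' s', C t = X t' s' := fun t ⟨t', s', h⟩ => hXC t' s' t h.symm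
        obtain ⟨t, s, m, ⟨hm, rfl, rfl⟩ | ⟨hm, rfl, rfl⟩⟩ := h
        · change (if _ then 1 else 0) < if _ then 1 else 0
          rw [if_pos (iff_of_true hm (hex t s)), if_neg]
          · exact Nat.zero_lt_one
          · rw [polC]
            exact fun h => hCX t (h.1 hm)
        · change (if _ then 1 else 0) < if _ then 1 else 0
          rw [if_pos (iff_of_false (by rw [polC, hm]; simp) (hCX t)), if_neg]
          · exact Nat.zero_lt_one
          · intro h
            simpa [hm] using h.2 (hex t s)
    · change φ r = _ ↔ _
      rcases r with ⟨e, _ | ⟨s, m⟩⟩ | ⟨k', b'⟩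
      · simp [φ]
      · by_cases hC : ∃ t, e = C t
        · obtain ⟨t, rfl⟩ := hC
          simp [φC]
        · push Not at hC
          simp [φe hC]
      · simp [φ]
    · rcases hu with rfl | rfl | rfl
      · exact .inl (mvt.1 (.inl hm)).2
      · exact .inl (mvt.1 (.inr hm)).2
      · obtain ⟨rfl, t, s, m, pm, rfl, rfl⟩ := mvw.1 hm
        refine .inr ⟨_, _, ⟨.cut (X false s) (X true s), ?_, mvS.2 ⟨rfl, t, m, pm, rfl, rfl⟩⟩,
          consumed₁ pm, produced₁⟩
        cases s <;> simp [hS, X]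
    · obtain ⟨s, rfl⟩ : ∃ s, u = .cut (X false s) (X true s) := by
        rcases hu with rfl | rfl
        · exact ⟨_, rfl⟩
        · exact ⟨_, rfl⟩
      obtain ⟨rfl, t, m, pm, rfl, rfl⟩ := mvS.1 hm
      exact ⟨_, _, ⟨w, mw, mvw.2 ⟨rfl, t, s, m, pm, rfl, rfl⟩⟩, (consumed₁ pm).symm, produced₁.symm⟩
    · rcases hu with h | h | h
      · simp at h
      · simp at h
      · have h : Node.sync u l = w := h
        rcases hw with rfl | rfl <;> simp at h
    · rcases hu with h | h <;> simp at h
    · rw [finPos_eq hc]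
      exact consumed₂ (hconcl _) fun t s h => absurd h (hconclX _ t s)
  refine key.interp_eq (fun i => ?_) (fun e he => (hR₁ e he).1) ψ o
  rw [initPos_eq hc]
  exact produced₂ (hconcl _)

theorem interp_red (h : R.Red S) :
    (⟨R, reg, hR₁, Q, hQ⟩ : QStruct G Γ).interp ψ o =
      (⟨S, reg, hS₁, Q, hQ⟩ : QStruct G Γ).interp ψ o := by
  cases h with
  | ax_cut a b c v w rest hv hw hR hd hS hc hA =>
    -- If the cut closes the axiom on itself, the renaming is the identity and the loop just
    -- disappears.
    by_cases hac : a = c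
    · subst hac
      have hid : Function.update id a a = (id : ℕ → ℕ) := Function.update_eq_self a id
      rw [hid] at hS hc
      refine interp_loop ψ o hv hw hR ?_ hc hA
      rw [hS, show Node.rename (G := G) id = id from funext Node.rename_id, Multiset.map_id]
    · exact interp_ax_cut ψ o hac hv hw hR hS hc hA
  | tens_par a b c a' b' c' w rest hw hR hd hS hc hA => exact interp_tens_par ψ o hw hR hS hc hA
  | sync_tens a b c d a' b' u l₁ l₂ rest hR hd hne ha hb hS hc hA =>
    exact interp_sync_tens ψ o hR hne ha hb hS hc hA
  | sync_par a b c d a' b' u l₁ l₂ rest hR hd hne ha hb hS hc hA =>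
    exact interp_sync_par ψ o hR hne ha hb hS hc hA
  | sync_ax p q d w v u l₁ l₂ rest hv hp hR hd hw hS hc hA =>
    exact interp_sync_ax ψ o hv hp hR hw hS hc hA
  | sync_cut x m p w v u l₁ l₂ rest hv hm hR hd hw hS hc hA =>
    exact interp_sync_cut ψ o hv hm hR hw hS hc hA

end Struct

end TensPar

end QSMLL

/-! ### New qubits and execution of sync nodes -/

namespace QSMLL

namespace Qubits

variable {ι κ : Type}

/-- The tensor product of two registers. -/
noncomputable def tmul (ψ : Qubits ι) (Q : Qubits κ) : Qubits (ι ⊕ κ) :=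
  WithLp.toLp 2 fun x => ψ (fun i => x (.inl i)) * Q (fun e => x (.inr e))

theorem applyGate_tmul {m : ℕ} (U : Matrix (Fin m → Bool) (Fin m → Bool) ℂ) {q : Fin m → κ}
    {q' : Fin m → ι ⊕ κ} (hq : ∀ j, q' j = .inr (q j)) (ψ : Qubits ι) (Q : Qubits κ) :
    applyGate U q' (tmul ψ Q) = tmul ψ (applyGate U q Q) := by
  obtain rfl : q' = Sum.inr ∘ q := funext hq
  ext x
  simp only [applyGate, tmul, Finset.mul_sum]
  refine Finset.sum_congr rfl fun y _ => ?_
  have h1 : (fun i => Function.extend (Sum.inr ∘ q) y x (Sum.inl i : ι ⊕ κ)) = fun i => x (.inl i) :=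
    funext fun i => Function.extend_apply' _ _ _ fun ⟨j, hj⟩ => by simp at hj
  have h2 : (fun e => Function.extend (Sum.inr ∘ q) y x (Sum.inr e : ι ⊕ κ)) =
      Function.extend q y fun e => x (.inr e) :=
    extend_comp_apply Sum.inr_injective y x
  rw [h1, h2]
  have : x ∘ Sum.inr ∘ q = (fun e => x (.inr e)) ∘ q := rfl
  rw [this]
  ring

theorem proj_tmul (r : κ) (b : Bool) (ψ : Qubits ι) (Q : Qubits κ) :
    proj (.inr r) b (tmul ψ Q) = tmul ψ (proj r b Q) := by
  ext x
  simp only [proj, tmul]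
  split_ifs <;> simp

variable [Fintype ι] [DecidableEq ι] [Fintype κ] [DecidableEq κ]

theorem norm_tmul (ψ : Qubits ι) (Q : Qubits κ) : ‖tmul ψ Q‖ = ‖ψ‖ * ‖Q‖ := by
  rw [← sq_eq_sq₀ (norm_nonneg _) (by positivity), mul_pow, norm_sq_eq, norm_sq_eq, norm_sq_eq,
    Finset.sum_mul_sum, ← Finset.sum_product']
  refine Fintype.sum_equiv (Equiv.sumArrowEquivProdArrow ι κ Bool) _ _ fun x => ?_
  simp only [tmul, norm_mul, mul_pow]
  rfl

/-- The input register has norm one, so measuring a qubit of the other factor is not influenced by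
it. -/
theorem prob_tmul {ψ : Qubits ι} (hψ : ‖ψ‖ = 1) (r : κ) (b : Bool) (Q : Qubits κ) :
    prob (.inr r) b (tmul ψ Q) = prob r b Q := by
  rw [prob, prob, proj_tmul]
  congr 1
  apply NNReal.eq
  rw [coe_nnnorm, coe_nnnorm, norm_tmul, hψ, one_mul]

theorem collapse_tmul {ψ : Qubits ι} (hψ : ‖ψ‖ = 1) (r : κ) (b : Bool) (Q : Qubits κ) :
    collapse (.inr r) b (tmul ψ Q) = tmul ψ (collapse r b Q) := by
  rw [collapse, collapse, proj_tmul, norm_tmul, hψ, one_mul]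
  ext x
  simp only [tmul, PiLp.smul_apply, smul_eq_mul]
  ring

end Qubits

section RegisterRules

variable {G : GateSet} {n : ℕ} {Γ : Fin n → Formula}

open View State

theorem QStruct.initState_eq (R : Struct G Γ) {reg : Finset ℕ} {hR : R.HoldsOnes reg}
    {Q : Qubits reg} {hQ : ‖Q‖ = 1} (ψ : Qubits (InitPos Γ)) :
    (⟨R, reg, hR, Q, hQ⟩ : QStruct G Γ).initState ψ =
      ⟨reg, Sum.elim R.initPos fun e => .edge e [], Qubits.tmul ψ Q⟩ := rfl

namespace Struct

variable {R S : Struct G Γ} {reg : Finset ℕ} {hR₁ : R.HoldsOnes reg} {hS₁ : S.HoldsOnes reg}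
  {Q : Qubits reg} {hQ : ‖Q‖ = 1} (ψ : {ψ : Qubits (InitPos Γ) // ‖ψ‖ = 1}) (o : Outcome Γ)

/-- Letting the source `e` fire first turns the initial state for `reg` into the initial state for
`insert e reg`. -/
theorem interp_new {e : ℕ} (he : e ∉ reg) (hone : Node.one e ∈ R.nodes) (hd : R.loc e = none)
    {hRn : R.HoldsOnes (insert e reg)} {Qn : Qubits (insert e reg : Finset ℕ)} {hQn : ‖Qn‖ = 1}
    (h : Qn = Qubits.adjoinZero (fun i : reg => ⟨i, Finset.mem_insert_of_mem i.2⟩)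
        ⟨e, Finset.mem_insert_self e reg⟩ Q) :
    (⟨R, reg, hR₁, Q, hQ⟩ : QStruct G Γ).interp ψ o =
      (⟨R, insert e reg, hRn, Qn, hQn⟩ : QStruct G Γ).interp ψ o := by
  rw [QStruct.interp_eq_val, QStruct.interp_eq_val, QStruct.initState_eq,
    Wiring.val_issue (W := R.wiring) (e := e) (s := ⟨reg, _, _⟩) ⟨hone, hd.symm⟩ he]
  congr 1
  refine mk_congr (o := insert e reg) ?_ ?_
  · funext y
    rcases y with i | ⟨i, hi⟩
    · rfl
    · rw [issueT_inr]
      split_ifs with hie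
      · exact congrArg (Pos.edge · []) (show e = i from hie.symm)
      · rfl
  · subst h
    ext x
    simp only [Qubits.adjoinZero, Qubits.tmul]
    rw [mul_ite, mul_zero]
    rfl

theorem one_ty {c : ℕ} (h : Node.one c ∈ R.nodes) : R.ty c = .one := R.ty_node _ h

theorem prod_one {c : ℕ} (h : Node.one c ∈ R.nodes) :
    (Node.one c : Node G).Prod R.ty (.edge c []) :=
  .concl (by simp [Node.concls]) (by rw [one_ty h]; rfl)

/-- Erasing a sync node below `one` nodes, when the tokens have already passed it. -/
theorem surgery_eraseSync {u : G.Sym} {l : List (ℕ × ℕ)} {rest : Multiset (Node G)} {σ : ℕ → ℕ}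
    (hR : R.nodes = .sync u l ::ₘ rest) (hl : ∀ p ∈ l, .one p.1 ∈ rest ∧ σ p.2 = p.1)
    (hσ : ∀ x, x ∉ l.map Prod.snd → σ x = x) (hS : S.nodes = rest.map (Node.rename σ))
    (hc : S.concl = σ ∘ R.concl) (hA : R.Agree S) :
    Surgery R S ⟨Pos.map σ, fun _ _ => False, fun _ => 0,
        fun p => ∀ e m, p = .edge e m → e ∉ l.map Prod.fst⟩
      ⟨fun p => p, fun _ _ => False, fun _ => 0, fun _ => True⟩ {e | e ∈ l.map Prod.fst} σ
      {.sync u l} ∅ {w | w ∈ rest} := by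
  have ms : .sync u l ∈ R.nodes := by simp [hR]
  have hsr : .sync u l ∉ rest := not_mem_rest hR
  have hrest : ∀ w ∈ rest, w ∈ R.nodes ∧ w ≠ .sync u l := fun w hw =>
    ⟨by simp [hR, hw], fun h => hsr (h ▸ hw)⟩
  have htgt : (Node.sync u l : Node G).tgts = l.map Prod.fst := by
    simp [Node.tgts, Node.prems, Node.inner]
  have hcon : (Node.sync u l : Node G).concls = l.map Prod.snd := rfl
  have hnd : (l.map Prod.fst).Nodup := htgt ▸ tgts_nodup ms
  -- The renaming identifies conclusions of the sync node with its premisses; off the premisses,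
  -- where no token of this view stands, it is injective.
  have hinj : ∀ {x y}, x ∉ l.map Prod.fst → y ∉ l.map Prod.fst → σ x = σ y → x = y := by
    intro x y hx hy h
    by_cases h1 : x ∈ l.map Prod.snd <;> by_cases h2 : y ∈ l.map Prod.snd
    · obtain ⟨p, hp, rfl⟩ := List.mem_map.1 h1
      obtain ⟨q, hq, rfl⟩ := List.mem_map.1 h2
      rw [(hl p hp).2, (hl q hq).2] at h
      rw [List.inj_on_of_nodup_map hnd hp hq h]
    · obtain ⟨p, hp, rfl⟩ := List.mem_map.1 h1
      rw [(hl p hp).2, hσ y h2] at h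
      exact absurd (List.mem_map.2 ⟨p, hp, h⟩) hy
    · obtain ⟨q, hq, rfl⟩ := List.mem_map.1 h2
      rw [(hl q hq).2, hσ x h1] at h
      exact absurd (List.mem_map.2 ⟨q, hq, h.symm⟩) hx
    · rwa [hσ x h1, hσ y h2] at h
  have consumed : ∀ {e m}, e ∉ l.map Prod.fst → Consumed ⟨Pos.map σ, fun _ _ => False, fun _ => 0,
      fun p => ∀ e m, p = .edge e m → e ∉ l.map Prod.fst⟩
      ⟨fun p => p, fun _ _ => False, fun _ => 0, fun _ => True⟩ (.edge e m) (.edge (σ e) m) := by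
    intro e m he
    refine ⟨rfl, fun r _ h => ?_, fun r hr h => ?_⟩
    · change r = .edge (σ e) m at h
      rw [h]
    · rcases r with ⟨x, m'⟩ | _
      · simp only [Pos.map_edge, Pos.edge.injEq] at h
        rw [hinj (hr x m' rfl) he h.1, h.2]
      · simp at h
  refine ⟨fun u => by simp [hR], fun u => ?_,
      fun w hw => ?_, fun c hc => hA.loc_one (hrest _ hc).1, by simp, by simp, fun h => h.elim,
      fun h => h.elim, fun r k b => ?_, fun _ _ _ => Iff.rfl,
      fun k b => by simp, fun k b => trivial,
      fun w hw g p q hm hp => ?_, by simp, fun {u' l'} hu hg => ?_, by simp, fun j => ?_⟩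
  · rw [hS, Multiset.mem_map]
    simp [eq_comm]
  · obtain ⟨hw', h1⟩ := hrest w hw
    have nt : ∀ {x}, x ∈ w.tgts → x ∉ l.map Prod.fst := fun hx h =>
      not_mem_tgts ms hw' h1 (htgt ▸ h) hx
    have nc : ∀ {x}, x ∈ w.concls → x ∉ l.map Prod.snd := fun hx h =>
      not_mem_concls ms hw' h1 (hcon ▸ h) hx
    have no : ∀ {x}, x ∈ w.concls → x ∈ l.map Prod.fst → w = .one x := fun hx h => by
      obtain ⟨p, hp, rfl⟩ := List.mem_map.1 h
      exact concls_unique hw' (hrest _ (hl p hp).1).1 hx (by simp [Node.concls])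
    refine ⟨fun x hx => hσ x (nc hx), fun x hx => ?_, fun {p} hp => ?_, fun {p} hA hp => ?_⟩
    · by_cases h : x ∈ l.map Prod.snd
      · obtain ⟨p, hp, rfl⟩ := List.mem_map.1 h
        rw [(hl p hp).2, ← (sync_ty ms hp).1]
        exact (hA _ (isEdge_sync_left ms hp)).1
      · rw [hσ x h]
        exact hA.ty_rest hw' hx
    · cases hp with
      | tgt h hm => exact consumed (nt h)
      | @concl e m h hm =>
        -- The source of a premiss is a `one` node, whose positive conclusion has no negative
        -- position to be consumed.
        refine consumed fun he => ?_
        obtain rfl := no h he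
        have ho := Formula.pol_of_isPos (A := R.ty e) (by rw [one_ty hw']; rfl)
          (Formula.mem_addrs_of_pol hm)
        simp [hm] at ho
    · refine ⟨?_, trivial, rfl⟩
      rintro e m rfl he
      cases hp with
      | tgt h hm => exact nt h he
      | concl h hm => exact hA e he (no h he)
  · rcases r with ⟨x, m⟩ | ⟨x, m⟩ <;> simp
  · obtain rfl : w = .sync u l := hw
    cases hm with
    | fwd h => cases h
    | bwd h => cases h
  -- The sync node can no longer fire: it has a premiss, and no good position lies on its premisses.
  · obtain ⟨rfl, rfl⟩ := Node.sync.inj hu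
    obtain ⟨p, hp⟩ := List.exists_mem_of_ne_nil _ (R.ty_node _ ms).1
    have h1 := one_ty (hrest _ (hl p hp).1).1
    refine absurd (hg (.edge p.1 []) ?_ p.1 [] rfl) (by simpa using ⟨p.2, hp⟩)
    simp only [Node.inPos, List.mem_flatMap, List.mem_map]
    exact ⟨p, hp, [], by simp [h1, Formula.addrs], by simp [h1, Formula.isPos]⟩
  · have : S.finPos j = .edge (σ (R.concl j.1)) j.2 := by rw [finPos, hc]; rfl
    rw [this]
    exact consumed fun h => concl_not_mem_tgts ms _ (htgt ▸ h)

-- At the start the tokens of `q` occupy all inputs of the sync node and can only cross it. After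
-- the crossing the premisses are empty for good, their sources having fired, and the node may be
-- erased.
open Classical in
theorem interp_sync {u : G.Sym} {l : List (ℕ × ℕ)} {q : Fin (G.arity u) → reg}
    (hq : List.ofFn (fun j => (q j : ℕ)) = l.map Prod.fst) (h : R.EraseSync S u l)
    {Qn : Qubits reg} {hQn : ‖Qn‖ = 1} (hU : Qn = Qubits.applyGate (G.op u) q Q) :
    (⟨R, reg, hR₁, Q, hQ⟩ : QStruct G Γ).interp ψ o =
      (⟨S, reg, hS₁, Qn, hQn⟩ : QStruct G Γ).interp ψ o := by
  obtain ⟨rest, σ, hR, hl, hσ, hS, hc, hA⟩ := h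
  have ms : .sync u l ∈ R.nodes := by simp [hR]
  have hone : ∀ p ∈ l, .one p.1 ∈ R.nodes := fun p hp => by simp [hR, (hl p hp).1]
  have htgt : (Node.sync u l : Node G).tgts = l.map Prod.fst := by
    simp [Node.tgts, Node.prems, Node.inner]
  have hnd : (l.map Prod.fst).Nodup := htgt ▸ tgts_nodup ms
  have hkey := surgery_eraseSync hR (fun p hp => ⟨(hl p hp).1, (hl p hp).2.2⟩) hσ hS hc hA
  have hin : Node.inPos R.ty l = l.map fun p => .edge p.1 [] := by
    rw [Node.inPos, List.map_eq_flatMap]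
    refine List.flatMap_congr fun p hp => ?_
    simp [one_ty (hone p hp), Formula.addrs, Formula.isPos]
  have hout : Node.outPos R.ty l = l.map fun p => .edge p.2 [] := by
    rw [Node.outPos, List.map_eq_flatMap]
    refine List.flatMap_congr fun p hp => ?_
    simp [one_ty (hone p hp), Formula.addrs, Formula.isPos]
  have mem_I : ∀ {p}, p ∈ Node.inPos R.ty l → ∃ x ∈ l, p = .edge x.1 [] := by
    intro p hp
    rw [hin] at hp
    obtain ⟨x, hx, rfl⟩ := List.mem_map.1 hp
    exact ⟨x, hx, rfl⟩
  have mem_q : ∀ {x}, x ∈ l → ∃ j, (q j : ℕ) = x.1 := fun {x} hx => by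
    have : x.1 ∈ List.ofFn fun j => (q j : ℕ) := hq ▸ List.mem_map_of_mem hx
    exact List.mem_ofFn.1 this
  -- The edge on which a register token stands after the crossing; `σ` undoes it.
  let τ : ℕ → ℕ := fun e => if h : ∃ p ∈ l, p.1 = e then h.choose.2 else e
  have τl : ∀ p ∈ l, τ p.1 = p.2 := fun p hp => by
    have h : ∃ p' ∈ l, p'.1 = p.1 := ⟨p, hp, rfl⟩
    have h1 : h.choose = p := List.inj_on_of_nodup_map hnd h.choose_spec.1 hp h.choose_spec.2
    simp only [τ, dif_pos h, h1]
  have τe : ∀ e, e ∉ l.map Prod.fst → τ e = e := fun e he =>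
    dif_neg fun ⟨p, hp, h⟩ => he (List.mem_map.2 ⟨p, hp, h⟩)
  rw [QStruct.interp_eq_val, QStruct.interp_eq_val, QStruct.initState_eq, QStruct.initState_eq]
  rw [Wiring.val_sync (W := R.wiring) (s := ⟨reg, _, _⟩) (u := u) (I := Node.inPos R.ty l) (O := Node.outPos R.ty l)
    (q := fun j => .inr (q j)) (T' := Sum.elim R.initPos fun e => .edge (τ e) [])
    ⟨l, ms, rfl, rfl⟩]
  · refine hkey.simulated.val_eq hkey.simulated' ⟨reg, _, Sum.elim S.initPos fun e => .edge e [],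
      _, rfl, ?_, ?_, ?_⟩ o
    · rw [hU, Qubits.applyGate_tmul _ fun _ => rfl]
    · intro e he
      obtain ⟨p, hp, rfl⟩ := List.mem_map.1 he
      obtain ⟨j, hj⟩ := mem_q hp
      exact hj ▸ (q j).2
    · rintro (i | ⟨e, he⟩)
      · refine ⟨?_, trivial, ?_⟩
        · rintro e m h he
          simp only [Sum.elim_inl, initPos, Pos.edge.injEq] at h
          exact concl_not_mem_tgts ms i.1 (htgt ▸ h.1 ▸ he)
        · simp only [Sum.elim_inl, initPos, hc]
          rfl
      · by_cases h : e ∈ l.map Prod.fst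
        · obtain ⟨p, hp, rfl⟩ := List.mem_map.1 h
          refine ⟨?_, trivial, ?_⟩
          · rintro e m h he
            simp only [Sum.elim_inr, τl p hp, Pos.edge.injEq] at h
            obtain ⟨rfl, -⟩ := h
            obtain ⟨p', hp', h⟩ := List.mem_map.1 he
            exact absurd (concls_unique (hone p' hp') ms (e := p'.1) (by simp [Node.concls])
              (by rw [h]; exact List.mem_map_of_mem hp)) (by simp)
          · simp [τl p hp, (hl p hp).2.2]
        · refine ⟨?_, trivial, ?_⟩
          · rintro e' m h' he'
            simp only [Sum.elim_inr, τe e h, Pos.edge.injEq] at h'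
            exact h (h'.1 ▸ he')
          · have : e ∉ l.map Prod.snd := fun h => absurd (concls_unique (hR₁ e he).1 ms (e := e)
              (by simp [Node.concls]) h) (by simp)
            simp [τe e h, hσ e this]
  · rw [hin]
    simp only [Sum.elim_inr]
    have := congrArg (List.map fun e => Pos.edge e []) hq
    rwa [List.map_ofFn, List.map_map] at this
  · rw [hout]
    simp only [Sum.elim_inr]
    have := congrArg (List.map fun e => Pos.edge (τ e) []) hq
    rw [List.map_ofFn, List.map_map] at this
    refine this.trans (List.map_congr_left fun p hp => ?_)
    simp [τl p hp]
  · rintro (i | ⟨e, he⟩) hx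
    · rfl
    · have : e ∉ l.map Prod.fst := fun h => by
        obtain ⟨p, hp, rfl⟩ := List.mem_map.1 h
        obtain ⟨j, hj⟩ := mem_q hp
        exact hx j (congrArg Sum.inr (Subtype.ext hj))
      simp [τe e this]
  · rintro g p r ⟨w, hw, hm⟩
    -- A move out of an input position would go through the sync node, a move into it through a
    -- `one` node; neither has moves of single tokens.
    refine ⟨fun hp => ?_, fun hr => ?_⟩
    · obtain rfl := cons_unique hw ms (hm.cons (R.ty_node _ hw))
        (Node.cons_of_mem_inPos (R.ty_node _ ms) hp)
      cases hm with
      | fwd h => cases h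
      | bwd h => cases h
    · obtain ⟨x, hx, rfl⟩ := mem_I hr
      obtain rfl := prod_unique hw (hone x hx) (hm.prod (R.ty_node _ hw)) (prod_one (hone x hx))
      revert hm
      generalize Pos.edge x.1 [] = r
      intro hm
      cases hm with
      | fwd h => cases h
      | bwd h => cases h
  · rintro k ⟨aux, cont, hk⟩ hI
    obtain ⟨x, hx, h⟩ := mem_I hI
    simp only [Pos.edge.injEq, and_true] at h
    exact absurd (concls_unique hk (hone x hx) (e := k) (by simp [Node.concls])
      (by simp [Node.concls, h])) (by simp)
  · intro k b hI
    obtain ⟨x, hx, h⟩ := mem_I hI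
    simp at h
  · rintro u' I' O' ⟨l', hl', rfl, rfl⟩
    refine ⟨fun p hp hI => ?_, ?_⟩
    · obtain ⟨x, hx, rfl⟩ := mem_I hI
      exact absurd (prod_unique hl' (hone x hx) (Node.prod_of_mem_outPos (R.ty_node _ hl') hp)
        (prod_one (hone x hx))) (by simp)
    · rintro ⟨p, hp, hp'⟩
      have := cons_unique hl' ms (Node.cons_of_mem_inPos (R.ty_node _ hl') hp')
        (Node.cons_of_mem_inPos (R.ty_node _ ms) hp)
      obtain ⟨rfl, rfl⟩ := Node.sync.inj this
      exact ⟨rfl, rfl, rfl⟩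
  · rintro g c - hI
    obtain ⟨x, hx, h⟩ := mem_I hI
    obtain ⟨j, hj⟩ := mem_q hx
    simp only [Pos.edge.injEq, and_true] at h
    exact ⟨j, congrArg Sum.inr (hj.trans h.symm)⟩
  · rintro (i | ⟨e, he⟩) hI
    · obtain ⟨x, hx, h⟩ := mem_I hI
      replace h : R.initPos i = .edge x.1 [] := h
      exact absurd (h ▸ prod_one (hone x hx)) (not_prod_init (hone x hx) i)
    · obtain ⟨x, hx, h⟩ := mem_I hI
      obtain ⟨j, hj⟩ := mem_q hx
      simp only [Sum.elim_inr, Pos.edge.injEq, and_true] at h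
      exact ⟨j, congrArg Sum.inr (Subtype.ext (hj.trans h.symm))⟩

end Struct

end RegisterRules

end QSMLL

/-! ### Opening a box -/

namespace QSMLL

section Opening

variable {G : GateSet} {n : ℕ} {Γ : Fin n → Formula}

open View State

theorem Formula.addrs_ne_nil (A : Formula) : A.addrs ≠ [] := by
  induction A <;> simp_all [Formula.addrs]

theorem Node.Mv.box_of_guard {ty : ℕ → Formula} {w : Node G} {k : ℕ} {b : Bool} {p q : Pos}
    (h : w.Mv ty (some (k, b)) p q) : k ∈ w.concls := by
  cases h with
  | fwd h => cases h; simp [Node.concls]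
  | bwd h => cases h; simp [Node.concls]

namespace Struct

variable {R S : Struct G Γ}

theorem Inside.congr {k : ℕ} {b : Bool} {x y : ℕ} (h : R.Inside k b x) (hxy : R.loc y = R.loc x) :
    R.Inside k b y := by
  cases h with
  | here _ h => exact .here _ (hxy.trans h)
  | deeper _ k' b' h h' => exact .deeper _ k' b' (hxy.trans h) h'

theorem not_inside {k : ℕ} {b : Bool} {x : ℕ} (h : R.loc x = none) : ¬ R.Inside k b x := by
  rintro (⟨_, h'⟩ | ⟨_, _, _, h'⟩) <;> simp [h] at h'

/-- The data of the opening of a box. -/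
structure Opening (R S : Struct G Γ) (e k : ℕ) (aux : List ℕ) (cont : Bool → List ℕ) (b : Bool)
    (v : Node G) (rest : Multiset (Node G)) (σ : ℕ → ℕ) : Prop where
  cut : v = .cut e k ∨ v = .cut k e
  nodes : R.nodes = .one e ::ₘ v ::ₘ .box k aux cont ::ₘ rest
  loc_one : R.loc e = none
  map_aux : aux.map σ = cont b
  fix : ∀ x, x ∉ aux → σ x = x
  mem_nodes : ∀ w, w ∈ S.nodes ↔
    ∃ u, (u ∈ rest ∧ ∀ x ∈ u.prems ++ u.concls, ¬ R.Inside k (!b) x) ∧ u.rename σ = w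
  concl : S.concl = σ ∘ R.concl
  ty : ∀ x, R.IsEdge x → S.ty x = R.ty x
  loc : ∀ x, R.IsEdge x → S.loc x = if R.loc x = some (k, b) then none else R.loc x

theorem OpenBox.opening {e : ℕ} {b : Bool} (h : R.OpenBox S e b) :
    ∃ k aux cont v rest σ, R.Opening S e k aux cont b v rest σ := by
  obtain ⟨k, aux, cont, v, rest, σ, h1, h2, h3, h4, h5, h6, h7, h8⟩ := h
  exact ⟨k, aux, cont, v, rest, σ, h1, h2, h3, h4, h5, fun w => by simp [h6], h7,
    fun x hx => (h8 x hx).1, fun x hx => (h8 x hx).2.trans (by congr)⟩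

/-- The edges which remain when the box is opened. -/
def Outer (R : Struct G Γ) (k e : ℕ) (b : Bool) (x : ℕ) : Prop :=
  ¬ R.Inside k (!b) x ∧ x ≠ e ∧ x ≠ k

/-- The crossing of the border of the opened box. -/
inductive Border (R : Struct G Γ) (aux : List ℕ) (σ : ℕ → ℕ) : Pos → Pos → Prop
  | exit {y : ℕ} {m : List Bool} (hy : y ∈ aux) (hm : (R.ty y).pol m = some true) :
    Border R aux σ (.edge (σ y) m) (.edge y m)
  | enter {y : ℕ} {m : List Bool} (hy : y ∈ aux) (hm : (R.ty y).pol m = some false) :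
    Border R aux σ (.edge y m) (.edge (σ y) m)

open Classical in
/-- The view of the positions of `R` that identifies the sides of the border of the opened box. -/
noncomputable def borderView (R : Struct G Γ) (aux : List ℕ) (σ : ℕ → ℕ) (k e : ℕ) (b : Bool) :
    View where
  φ := Pos.map σ
  sil := R.Border aux σ
  w p := if ∃ q, R.Border aux σ p q then 1 else 0
  good p := (∀ x m, p = .edge x m → R.Outer k e b x) ∧
    ∀ k' c, p = .lock k' c → ¬ R.Inside k (!b) k' ∧ k' ≠ k

/-- The view that identifies nothing. -/
def _root_.QSMLL.View.trivial : View := ⟨fun p => p, fun _ _ => False, fun _ => 0, fun _ => True⟩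

namespace Opening

variable {e k : ℕ} {aux : List ℕ} {cont : Bool → List ℕ} {b : Bool} {v : Node G}
  {rest : Multiset (Node G)} {σ : ℕ → ℕ}

theorem one_mem (h : R.Opening S e k aux cont b v rest σ) : .one e ∈ R.nodes := by simp [h.nodes]

theorem cut_mem (h : R.Opening S e k aux cont b v rest σ) : v ∈ R.nodes := by simp [h.nodes]

theorem box_mem (h : R.Opening S e k aux cont b v rest σ) : .box k aux cont ∈ R.nodes := by simp [h.nodes]

theorem mem_iff (h : R.Opening S e k aux cont b v rest σ) {w : Node G} :
    w ∈ R.nodes ↔ w = .one e ∨ w = v ∨ w = .box k aux cont ∨ w ∈ rest := by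
  simp [h.nodes]

theorem rest_mem (h : R.Opening S e k aux cont b v rest σ) {w : Node G} (hw : w ∈ rest) :
    w ∈ R.nodes ∧ w ≠ .one e ∧ w ≠ v ∧ w ≠ .box k aux cont := by
  have hn := R.nodes_nodup
  rw [h.nodes] at hn
  simp only [Multiset.nodup_cons, Multiset.mem_cons, not_or] at hn
  refine ⟨h.mem_iff.2 (by simp [hw]), ?_, ?_, ?_⟩
  · rintro rfl; exact hn.1.2.2 hw
  · rintro rfl; exact hn.2.1.2 hw
  · rintro rfl; exact hn.2.2.1 hw

theorem tgts_cut (h : R.Opening S e k aux cont b v rest σ) {x : ℕ} : x ∈ v.tgts ↔ x = e ∨ x = k := by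
  rcases h.cut with rfl | rfl <;> simp [Node.tgts, Node.prems, Node.inner, or_comm]

theorem ty_one (h : R.Opening S e k aux cont b v rest σ) : R.ty e = .one := R.ty_node _ h.one_mem

theorem ty_lock (h : R.Opening S e k aux cont b v rest σ) : R.ty k = .bot := (R.ty_node _ h.box_mem).1

theorem loc_lock (h : R.Opening S e k aux cont b v rest σ) : R.loc k = none := by
  rw [← h.loc_one]
  exact R.loc_node _ h.cut_mem k (by rcases h.cut with rfl | rfl <;> simp [Node.prems]) e
    (by rcases h.cut with rfl | rfl <;> simp [Node.prems])

theorem loc_aux (h : R.Opening S e k aux cont b v rest σ) {y : ℕ} (hy : y ∈ aux) : R.loc y = none := by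
  rw [← h.loc_lock]
  exact R.loc_node _ h.box_mem y (by simp [Node.prems, Node.concls, hy]) k
    (by simp [Node.prems, Node.concls])

theorem loc_cont (h : R.Opening S e k aux cont b v rest σ) {x : ℕ} (hx : x ∈ cont b) : R.loc x = some (k, b) :=
  R.loc_content _ h.box_mem b x hx

theorem mem_tgts_of_cont (h : R.Opening S e k aux cont b v rest σ) {x : ℕ} (hx : x ∈ cont b) :
    x ∈ (Node.box k aux cont : Node G).tgts := by
  cases b <;> simp [Node.tgts, Node.inner, hx]

theorem not_mem_aux (h : R.Opening S e k aux cont b v rest σ) {x : ℕ} (hx : x ∈ cont b) : x ∉ aux := fun hy => by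
  simpa [h.loc_aux hy] using h.loc_cont hx

theorem zip_eq (h : R.Opening S e k aux cont b v rest σ) : (cont b).zip aux = aux.map fun y => (σ y, y) := by
  rw [← h.map_aux, List.map_prod_right_eq_zip]

theorem σ_mem (h : R.Opening S e k aux cont b v rest σ) {y : ℕ} (hy : y ∈ aux) : σ y ∈ cont b := by
  rw [← h.map_aux]
  exact List.mem_map_of_mem hy

theorem ty_σ (h : R.Opening S e k aux cont b v rest σ) {y : ℕ} (hy : y ∈ aux) : R.ty (σ y) = R.ty y :=
  Node.zip_ty (R.ty_node _ h.box_mem) (b := b)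
    (by rw [h.zip_eq]; exact List.mem_map_of_mem (f := fun y => (σ y, y)) hy)

theorem σ_inj (h : R.Opening S e k aux cont b v rest σ) {x y : ℕ} (hx : x ∈ aux) (hy : y ∈ aux) (hxy : σ x = σ y) : x = y := by
  have hn : (cont b).Nodup := by
    have := tgts_nodup h.box_mem
    simp only [Node.tgts, Node.prems, Node.inner, List.nil_append] at this
    cases b
    · exact (List.nodup_append.1 this).1
    · exact (List.nodup_append.1 this).2.1
  rw [← h.map_aux] at hn
  exact List.inj_on_of_nodup_map hn hx hy hxy

/-- An auxiliary conclusion is at depth `0` and its inner counterpart is not, so a second crossing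
would have to go back, against the polarity. Silent runs thus have length at most one, which
justifies the weight of `borderView`. -/
theorem border_tgt (h : R.Opening S e k aux cont b v rest σ) {p q q' : Pos} (h1 : R.Border aux σ p q) : ¬ R.Border aux σ q q' := by
  intro h2
  cases h1 with
  | @exit y m hy hm =>
    generalize hz : Pos.edge y m = r at h2
    cases h2 with
    | @exit z m' hz' hm' =>
      simp only [Pos.edge.injEq] at hz
      exact h.not_mem_aux (h.σ_mem hz') (hz.1 ▸ hy)
    | @enter z m' hz' hm' =>
      simp only [Pos.edge.injEq] at hz
      obtain ⟨rfl, rfl⟩ := hz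
      simp [hm] at hm'
  | @enter y m hy hm =>
    generalize hz : Pos.edge (σ y) m = r at h2
    cases h2 with
    | @exit z m' hz' hm' =>
      simp only [Pos.edge.injEq] at hz
      obtain ⟨hz, rfl⟩ := hz
      obtain rfl := h.σ_inj hy hz' hz
      simp [hm] at hm'
    | @enter z m' hz' hm' =>
      simp only [Pos.edge.injEq] at hz
      exact h.not_mem_aux (h.σ_mem hy) (hz.1 ▸ hz')

/-- A position on one side of the border can be reached silently from the other side if it is
negative inside or positive outside. By `consumed_of_cons` these are the only border positions that
nodes other than the box take tokens from. -/
theorem consumed (h : R.Opening S e k aux cont b v rest σ) {x : ℕ} {m : List Bool}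
    (hc : x ∈ cont b → (R.ty x).pol m = some false) (ha : x ∈ aux → (R.ty x).pol m = some true) :
    Consumed (R.borderView aux σ k e b) View.trivial (.edge x m) (.edge (σ x) m) := by
  refine ⟨rfl, fun r _ hr => ?_, fun r _ hr => ?_⟩
  · change r = .edge (σ x) m at hr
    rw [hr]
  · change r.map σ = .edge (σ x) m at hr
    rcases r with ⟨z, m'⟩ | _
    · simp only [Pos.map_edge, Pos.edge.injEq] at hr
      obtain ⟨hr, rfl⟩ := hr
      by_cases hz : z ∈ aux <;> by_cases hx : x ∈ aux
      · rw [h.σ_inj hz hx hr]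
      · rw [h.fix x hx] at hr
        subst hr
        refine .single (.enter hz ?_)
        rw [← h.ty_σ hz]
        exact hc (h.σ_mem hz)
      · rw [h.fix z hz] at hr
        subst hr
        exact .single (.exit hx (ha hx))
      · rw [h.fix z hz, h.fix x hx] at hr
        rw [hr]
    · simp at hr

theorem consumed_of_cons (h : R.Opening S e k aux cont b v rest σ) {w : Node G} (hw : w ∈ R.nodes) (hne : w ≠ .box k aux cont) {p : Pos}
    (hp : w.Cons R.ty p) : Consumed (R.borderView aux σ k e b) View.trivial p (p.map σ) := by
  cases hp with
  | tgt hx hm =>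
    exact h.consumed (fun hc => absurd (tgts_unique hw h.box_mem hx (h.mem_tgts_of_cont hc)) hne)
      fun _ => hm
  | concl hx hm =>
    exact h.consumed (fun _ => hm) fun ha =>
      absurd (concls_unique hw h.box_mem hx (by simp [Node.concls, ha])) hne

/-- The delicate edges are the conclusions of the contents of a kept box: they lie in the discarded
content only if the lock of that box does, or if the box is the opened one, which is not in `rest`.
-/
theorem outer_of_kept (h : R.Opening S e k aux cont b v rest σ) {w : Node G} (hw : w ∈ rest)
    (hk : ∀ x ∈ w.prems ++ w.concls, ¬ R.Inside k (!b) x) {x : ℕ} (hx : x ∈ w.tgts ++ w.concls) :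
    R.Outer k e b x := by
  obtain ⟨hw', h1, h2, h3⟩ := h.rest_mem hw
  refine ⟨?_, ?_, ?_⟩
  · by_cases hp : x ∈ w.prems ++ w.concls
    · exact hk x hp
    · have hi : x ∈ w.inner := by
        simp only [Node.tgts, List.mem_append, not_or] at hx hp
        tauto
      cases w with
      | box k' aux' cont' =>
        have hkk : k' ∈ (Node.box k' aux' cont' : Node G).concls := by simp [Node.concls]
        have hl : ∃ c, R.loc x = some (k', c) := by
          rcases List.mem_append.1 hi with hi | hi
          · exact ⟨_, R.loc_content _ hw' _ _ hi⟩
          · exact ⟨_, R.loc_content _ hw' _ _ hi⟩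
        obtain ⟨c, hl⟩ := hl
        rintro (⟨_, h'⟩ | ⟨_, k₂, c₂, h', h''⟩)
        · rw [hl] at h'
          obtain ⟨rfl, -⟩ := Prod.mk.inj (Option.some.inj h')
          exact h3 (concls_unique hw' h.box_mem hkk (by simp [Node.concls]))
        · rw [hl] at h'
          obtain ⟨rfl, -⟩ := Prod.mk.inj (Option.some.inj h')
          exact hk k' (by simp [Node.concls]) h''
      | _ => simp [Node.inner] at hi
  · rintro rfl
    rcases List.mem_append.1 hx with hx | hx
    · exact h2 (tgts_unique hw' h.cut_mem hx (h.tgts_cut.2 (.inl rfl)))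
    · exact h1 (concls_unique hw' h.one_mem hx (by simp [Node.concls]))
  · rintro rfl
    rcases List.mem_append.1 hx with hx | hx
    · exact h2 (tgts_unique hw' h.cut_mem hx (h.tgts_cut.2 (.inr rfl)))
    · exact h3 (concls_unique hw' h.box_mem hx (by simp [Node.concls]))

/-- All premisses and conclusions of a node share one location, and an edge concluding a content of
a box in the discarded content would itself lie in the discarded content. -/
theorem kept_of_outer {w : Node G} (hw : w ∈ R.nodes) {x : ℕ} (hx : x ∈ w.tgts ++ w.concls)
    (ho : ¬ R.Inside k (!b) x) : ∀ y ∈ w.prems ++ w.concls, ¬ R.Inside k (!b) y := by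
  intro y hy hi
  by_cases hp : x ∈ w.prems ++ w.concls
  · exact ho (hi.congr (R.loc_node w hw x hp y hy))
  · have hxi : x ∈ w.inner := by
      simp only [Node.tgts, List.mem_append, not_or] at hx hp
      tauto
    cases w with
    | box k' aux' cont' =>
      have hl : ∃ c, R.loc x = some (k', c) := by
        rcases List.mem_append.1 hxi with hi | hi
        · exact ⟨_, R.loc_content _ hw _ _ hi⟩
        · exact ⟨_, R.loc_content _ hw _ _ hi⟩
      obtain ⟨c, hl⟩ := hl
      exact ho (.deeper _ _ _ hl
        (hi.congr (R.loc_node _ hw k' (by simp [Node.concls]) y hy)))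
    | _ => simp [Node.inner] at hxi

theorem isEdge_σ (h : R.Opening S e k aux cont b v rest σ) {x : ℕ} (hx : R.IsEdge x) : R.IsEdge (σ x) ∧ R.ty (σ x) = R.ty x := by
  by_cases ha : x ∈ aux
  · exact ⟨isEdge_of_tgts h.box_mem (h.mem_tgts_of_cont (h.σ_mem ha)), h.ty_σ ha⟩
  · rw [h.fix x ha]
    exact ⟨hx, rfl⟩

theorem kept (h : R.Opening S e k aux cont b v rest σ) {w : Node G} (hw : w ∈ rest)
    (hk : ∀ x ∈ w.prems ++ w.concls, ¬ R.Inside k (!b) x) :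
    w.Kept R.ty S.ty σ (R.borderView aux σ k e b) View.trivial ∅ := by
  obtain ⟨hw', h1, h2, h3⟩ := h.rest_mem hw
  refine ⟨fun x hx => h.fix x fun ha => h3 (concls_unique hw' h.box_mem hx
    (by simp [Node.concls, ha])), fun x hx => ?_, h.consumed_of_cons hw' h3, fun {p} _ hp => ?_⟩
  · obtain ⟨h4, h5⟩ := h.isEdge_σ (isEdge_of_mem hw' hx)
    rw [h.ty _ h4, h5]
  · refine ⟨⟨?_, ?_⟩, True.intro, rfl⟩
    · rintro x m rfl
      refine h.outer_of_kept hw hk ?_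
      cases hp with
      | tgt h => exact List.mem_append_left _ h
      | concl h => exact List.mem_append_right _ h
    · rintro k' c rfl
      cases hp

/-- A node that consumes a good position is kept. -/
theorem kept_of_cons (h : R.Opening S e k aux cont b v rest σ) {w : Node G} (hw : w ∈ R.nodes) (hne : w ≠ .box k aux cont) {p : Pos}
    (hp : w.Cons R.ty p) (hg : (R.borderView aux σ k e b).good p) :
    w ∈ rest ∧ ∀ x ∈ w.prems ++ w.concls, ¬ R.Inside k (!b) x := by
  obtain ⟨x, m, rfl, hx⟩ : ∃ x m, p = .edge x m ∧ x ∈ w.tgts ++ w.concls := by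
    cases hp with
    | tgt h => exact ⟨_, _, rfl, List.mem_append_left _ h⟩
    | concl h => exact ⟨_, _, rfl, List.mem_append_right _ h⟩
  obtain ⟨h1, h2, h3⟩ := hg.1 x m rfl
  refine ⟨?_, kept_of_outer hw hx h1⟩
  rcases h.mem_iff.1 hw with rfl | rfl | rfl | hw
  · simp [Node.tgts, Node.prems, Node.inner, Node.concls, h2] at hx
  · rcases List.mem_append.1 hx with hx | hx
    · exact absurd (h.tgts_cut.1 hx) (by simp [h2, h3])
    · rcases h.cut with rfl | rfl <;> simp [Node.concls] at hx
  · exact absurd rfl hne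
  · exact hw

theorem rename_mem (h : R.Opening S e k aux cont b v rest σ) {w : Node G} (hw : w ∈ rest ∧ ∀ x ∈ w.prems ++ w.concls, ¬ R.Inside k (!b) x) :
    w.rename σ ∈ S.nodes := (h.mem_nodes _).2 ⟨w, hw, rfl⟩

theorem fin_consumed (h : R.Opening S e k aux cont b v rest σ) (j : FinPos Γ) :
    Consumed (R.borderView aux σ k e b) View.trivial (R.finPos j) (S.finPos j) := by
  have : S.finPos j = .edge (σ (R.concl j.1)) j.2 := by rw [finPos, h.concl]; rfl
  rw [this]
  refine h.consumed (fun hc => absurd (h.mem_tgts_of_cont hc) (concl_not_mem_tgts h.box_mem _))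
    fun _ => ?_
  rw [R.ty_concl, pol_atoms]

theorem outer_border (h : R.Opening S e k aux cont b v rest σ) {y : ℕ} (hy : y ∈ aux) : R.Outer k e b y ∧ R.Outer k e b (σ y) := by
  have hl := h.loc_cont (h.σ_mem hy)
  refine ⟨⟨not_inside (h.loc_aux hy), ?_, ?_⟩, ?_, ?_, ?_⟩
  · rintro rfl
    exact absurd (concls_unique h.one_mem h.box_mem (e := y) (by simp [Node.concls])
      (by simp [Node.concls, hy])) (by simp)
  · rintro rfl
    have := concls_nodup h.box_mem
    simp [Node.concls, hy] at this
  · rintro (⟨_, h'⟩ | ⟨_, k₂, c₂, h', h''⟩)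
    · rw [hl] at h'
      simp at h'
    · rw [hl] at h'
      obtain ⟨rfl, -⟩ := Prod.mk.inj (Option.some.inj h')
      exact not_inside h.loc_lock h''
  · intro he
    rw [he, h.loc_one] at hl
    cases hl
  · intro he
    rw [he, h.loc_lock] at hl
    cases hl

theorem link (h : R.Opening S e k aux cont b v rest σ) {y : ℕ} (hy : y ∈ aux) :
    (Node.box k aux cont : Node G).Link (some (k, b)) true (σ y) [] y :=
  .box k aux cont b _ _ (by rw [h.zip_eq]; exact List.mem_map_of_mem (f := fun y => (σ y, y)) hy)

theorem box_mv_iff (h : R.Opening S e k aux cont b v rest σ) {p q : Pos} :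
    (Node.box k aux cont : Node G).Mv R.ty (some (k, b)) p q ↔ R.Border aux σ p q := by
  constructor
  · intro hm
    cases hm with
    | fwd hl hm =>
      cases hl with
      | box _ _ _ _ x y hxy =>
        rw [h.zip_eq, List.mem_map] at hxy
        obtain ⟨z, hz, hxy⟩ := hxy
        obtain ⟨rfl, rfl⟩ := Prod.mk.inj hxy
        exact .exit hz (by rwa [← h.ty_σ hz])
    | bwd hl hm =>
      cases hl with
      | box _ _ _ _ x y hxy =>
        rw [h.zip_eq, List.mem_map] at hxy
        obtain ⟨z, hz, hxy⟩ := hxy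
        obtain ⟨rfl, rfl⟩ := Prod.mk.inj hxy
        exact .enter hz (by rwa [← h.ty_σ hz])
  · intro hb
    cases hb with
    | exit hy hm => exact .fwd (h.link hy) (by rwa [h.ty_σ hy])
    | enter hy hm => exact .bwd (h.link hy) (by rwa [h.ty_σ hy])

theorem lock_produced {k' : ℕ} (hi : ¬ R.Inside k (!b) k') (hk : k' ≠ k) (c : Bool) :
    Produced (R.borderView aux σ k e b) View.trivial (.lock k' c) (.lock k' c) :=
  ⟨⟨by simp, by rintro _ _ ⟨⟩; exact ⟨hi, hk⟩⟩, True.intro, rfl⟩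

/-- Only crossings of the border of content `b` are silent. Tokens never stand in the discarded
content, so whatever else happens goes through a node that survives the opening. -/
theorem simulated (h : R.Opening S e k aux cont b v rest σ) : (R.wiring.opened k b e).Simulated S.wiring (R.borderView aux σ k e b)
    View.trivial ∅ where
  sil_mv {p q} hs _ := by
    refine ⟨.inr ⟨rfl, _, h.box_mem, h.box_mv_iff.2 hs⟩, ?_, ?_, ?_⟩
    · cases hs with
      | exit hy hm => simp [borderView, h.fix _ (h.not_mem_aux (h.σ_mem hy))]
      | enter hy hm => simp [borderView, h.fix _ (h.not_mem_aux (h.σ_mem hy))]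
    · cases hs with
      | exit hy hm =>
        exact ⟨by rintro _ _ ⟨⟩; exact (h.outer_border hy).1, by simp⟩
      | enter hy hm =>
        exact ⟨by rintro _ _ he; cases he; exact (h.outer_border hy).2, by simp⟩
    · simp only [borderView]
      rw [if_neg (fun ⟨_, h'⟩ => h.border_tgt hs h'), if_pos ⟨_, hs⟩]
      exact zero_lt_one
  lock _ hr := hr
  mv := by
    rintro g p q hm hp -
    obtain ⟨w, hw, g', hm, hgg⟩ : ∃ w ∈ R.nodes, ∃ g', w.Mv R.ty g' p q ∧
        ((g' = g ∧ ∀ c, g ≠ some (k, c)) ∨ (g = none ∧ g' = some (k, b))) := by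
      rcases hm with ⟨⟨w, hw, hm⟩, hg⟩ | ⟨rfl, w, hw, hm⟩
      · exact ⟨w, hw, g, hm, .inl ⟨rfl, hg⟩⟩
      · exact ⟨w, hw, _, hm, .inr ⟨rfl, rfl⟩⟩
    by_cases hne : w = .box k aux cont
    · subst hne
      left
      have hgk : ∃ c, g' = some (k, c) := by
        cases hm with
        | fwd hl => cases hl; exact ⟨_, rfl⟩
        | bwd hl => cases hl; exact ⟨_, rfl⟩
      -- Of the moves through the opened box only those of content `b` occur in the opened wiring,
      -- and these are the silent ones.
      rcases hgg with ⟨rfl, hg⟩ | ⟨-, rfl⟩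
      · obtain ⟨c, hc⟩ := hgk
        exact absurd hc (hg c)
      · exact h.box_mv_iff.1 hm
    · right
      obtain ⟨hr, hk⟩ := h.kept_of_cons hw hne (hm.cons (R.ty_node _ hw)) hp
      obtain ⟨h1, h2⟩ := (h.kept hr hk).mv (R.ty_node _ hw) hm
      rcases hgg with ⟨rfl, hg⟩ | ⟨-, rfl⟩
      · exact ⟨_, _, ⟨_, h.rename_mem ⟨hr, hk⟩, h1⟩, h2⟩
      · exact absurd (concls_unique hw h.box_mem hm.box_of_guard (by simp [Node.concls])) hne
  syn := by
    rintro u I O ⟨l, hl, rfl, rfl⟩ hI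
    obtain ⟨p, hp⟩ : ∃ p, p ∈ Node.inPos R.ty l := by
      obtain ⟨x, hx⟩ := List.exists_mem_of_ne_nil _ (R.ty_node _ hl).1
      obtain ⟨m, hm⟩ := List.exists_mem_of_ne_nil _ (R.ty x.1).addrs_ne_nil
      exact ⟨_, List.mem_flatMap.2 ⟨x, hx, List.mem_map_of_mem hm⟩⟩
    obtain ⟨hr, hk⟩ := h.kept_of_cons hl (by simp)
      (Node.cons_of_mem_inPos (R.ty_node _ hl) hp) (hI p hp)
    exact ⟨_, _, ⟨_, h.rename_mem ⟨hr, hk⟩, rfl, rfl⟩, (h.kept hr hk).syn (R.ty_node _ hl)⟩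
  one := by
    rintro g c ⟨hce, hc⟩ - hg
    have hc' : Node.one c ∈ R.nodes ∧ ¬ R.Inside k (!b) c ∧
        g = if R.loc c = some (k, b) then none else R.loc c := by
      rcases hc with ⟨⟨hc, rfl⟩, hgk⟩ | ⟨rfl, hc, hl⟩
      · refine ⟨hc, ?_, (if_neg (hgk b)).symm⟩
        -- A source deeper in the discarded content is guarded by a lock position there, which is
        -- not good; one directly in it has had its guard removed by `opened`.
        rintro (⟨_, h'⟩ | ⟨_, k₂, c₂, h', h''⟩)
        · exact hgk _ h'
        · exact ((hg _ _ h').2 _ _ rfl).1 h''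
      · refine ⟨hc, ?_, (if_pos hl.symm).symm⟩
        rintro (⟨_, h'⟩ | ⟨_, k₂, c₂, h', h''⟩)
        · rw [← hl] at h'
          simp at h'
        · rw [← hl] at h'
          obtain ⟨rfl, -⟩ := Prod.mk.inj (Option.some.inj h')
          exact not_inside h.loc_lock h''
    obtain ⟨hm, hi, rfl⟩ := hc'
    have hr : Node.one c ∈ rest := by
      rcases h.mem_iff.1 hm with hw | hw | hw | hw
      · exact absurd (Node.one.inj hw) hce
      · rcases h.cut with rfl | rfl <;> simp at hw
      · simp at hw
      · exact hw
    have hk := kept_of_outer hm (x := c) (by simp [Node.concls]) hi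
    have hK := h.kept hr hk
    refine ⟨⟨?_, (h.loc c ⟨_, hm, by simp [Node.concls]⟩).symm⟩,
      hK.one (R.ty_node _ hm) (by simp)⟩
    have := h.rename_mem ⟨hr, hk⟩
    rwa [Node.rename, hK.fix c (by simp [Node.concls])] at this
  box := by
    rintro k' ⟨⟨aux', cont', hm⟩, hne⟩ hg
    obtain ⟨hr, hk⟩ := h.kept_of_cons hm (by simp [hne])
      (.concl (m := []) (by simp [Node.concls]) (by rw [(R.ty_node _ hm).1]; rfl)) hg
    have hK := h.kept hr hk
    exact ⟨⟨_, _, hK.rename_box ▸ h.rename_mem ⟨hr, hk⟩⟩, hK.box (R.ty_node _ hm),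
      lock_produced (hk k' (by simp [Node.concls])) hne⟩
  box_lock := by
    rintro k' c ⟨⟨aux', cont', hm⟩, hne⟩ hg
    have hk := kept_of_outer hm (x := k') (by simp [Node.concls]) (hg.2 _ _ rfl).1
    have hr : .box k' aux' cont' ∈ rest := by
      rcases h.mem_iff.1 hm with hw | hw | hw | hw
      · simp at hw
      · rcases h.cut with rfl | rfl <;> simp at hw
      · exact absurd (Node.box.inj hw).1 hne
      · exact hw
    exact ⟨_, _, (h.kept hr hk).rename_box ▸ h.rename_mem ⟨hr, hk⟩⟩
  fin := h.fin_consumed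

theorem simulated' (h : R.Opening S e k aux cont b v rest σ) : S.wiring.Simulated (R.wiring.opened k b e) View.trivial
    (R.borderView aux σ k e b) ∅ where
  sil_mv hs := hs.elim
  lock {r k' c} _ hr := by
    change r.map σ = .lock k' c at hr
    rcases r with _ | _ <;> simp_all
  mv := by
    rintro g p q ⟨w', hw', hm⟩ - -
    obtain ⟨w, ⟨hr, hk⟩, rfl⟩ := (h.mem_nodes _).1 hw'
    obtain ⟨hw, -, -, hne⟩ := h.rest_mem hr
    obtain ⟨p', q', h1, h2, h3⟩ := (h.kept hr hk).mv' (R.ty_node w hw) hm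
    refine .inr ⟨_, _, .inl ⟨⟨_, hw, h1⟩, ?_⟩, h2.symm, h3.symm⟩
    rintro c rfl
    exact hne (concls_unique hw h.box_mem h1.box_of_guard (by simp [Node.concls]))
  syn := by
    rintro u I O ⟨l, hl, rfl, rfl⟩ -
    obtain ⟨w, ⟨hr, hk⟩, hw⟩ := (h.mem_nodes _).1 hl
    obtain ⟨l, rfl, rfl⟩ := Node.Kept.syn_of_rename hw
    have hl := (h.rest_mem hr).1
    obtain ⟨h1, h2⟩ := (h.kept hr hk).syn (R.ty_node _ hl)
    exact ⟨_, _, ⟨_, hl, rfl, rfl⟩, h1.flip.imp fun _ _ h => View.Consumed.symm h,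
      h2.flip.imp fun _ _ h => View.Produced.symm h⟩
  one := by
    rintro g c ⟨hc, rfl⟩ - -
    obtain ⟨w, ⟨hr, hk⟩, hw⟩ := (h.mem_nodes _).1 hc
    obtain rfl := (h.kept hr hk).one_of_rename hw
    obtain ⟨hw, h1, -, -⟩ := h.rest_mem hr
    refine ⟨⟨fun hce => h1 (by rw [hce]), ?_⟩,
      ((h.kept hr hk).one (R.ty_node _ hw) (by simp)).symm⟩
    rw [h.loc c ⟨_, hw, by simp [Node.concls]⟩]
    split_ifs with hl
    · exact .inr ⟨rfl, hw, hl.symm⟩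
    · refine .inl ⟨⟨hw, rfl⟩, fun c' hc' => ?_⟩
      by_cases hcb : c' = b
      · exact hl (hcb ▸ hc')
      -- A guard on the other content would place the source in the discarded content, from which no
      -- node is kept.
      · refine hk c (by simp [Node.concls]) (.here _ ?_)
        rw [hc']
        cases c' <;> cases b <;> simp_all
  box := by
    rintro k' ⟨aux', cont', hm⟩ -
    obtain ⟨w, ⟨hr, hk⟩, hw⟩ := (h.mem_nodes _).1 hm
    obtain ⟨aux', cont', rfl⟩ := (h.kept hr hk).box_of_rename hw
    obtain ⟨hw, -, -, h3⟩ := h.rest_mem hr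
    have hne : k' ≠ k := fun hkk =>
      h3 (concls_unique hw h.box_mem (e := k') (by simp [Node.concls]) (by simp [Node.concls, hkk]))
    exact ⟨⟨⟨_, _, hw⟩, hne⟩, ((h.kept hr hk).box (R.ty_node _ hw)).symm,
      fun c => (lock_produced (hk k' (by simp [Node.concls])) hne c).symm⟩
  box_lock := by
    rintro k' c ⟨aux', cont', hm⟩ -
    obtain ⟨w, ⟨hr, hk⟩, hw⟩ := (h.mem_nodes _).1 hm
    obtain ⟨aux', cont', rfl⟩ := (h.kept hr hk).box_of_rename hw
    obtain ⟨hw, -, -, h3⟩ := h.rest_mem hr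
    exact ⟨⟨_, _, hw⟩, fun hkk =>
      h3 (concls_unique hw h.box_mem (e := k') (by simp [Node.concls]) (by simp [Node.concls, hkk]))⟩
  fin j := (h.fin_consumed j).symm

theorem cons_one (h : R.Opening S e k aux cont b v rest σ) : v.Cons R.ty (.edge e []) :=
  .tgt (h.tgts_cut.2 (.inl rfl)) (by rw [h.ty_one]; rfl)

theorem cons_lock (h : R.Opening S e k aux cont b v rest σ) : (Node.box k aux cont : Node G).Cons R.ty (.edge k []) :=
  .concl (by simp [Node.concls]) (by rw [h.ty_lock]; rfl)

theorem prod_lock (h : R.Opening S e k aux cont b v rest σ) : v.Prod R.ty (.edge k []) :=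
  .tgt (h.tgts_cut.2 (.inr rfl)) (by rw [h.ty_lock]; rfl)

theorem cut_mv (h : R.Opening S e k aux cont b v rest σ) : v.Mv R.ty none (.edge e []) (.edge k []) := by
  rcases h.cut with rfl | rfl
  · exact .fwd (.cut e k) (by rw [h.ty_one]; rfl)
  · exact .bwd (.cut k e) (by rw [h.ty_lock]; rfl)

theorem cut_mv_iff (h : R.Opening S e k aux cont b v rest σ) {g : Option (ℕ × Bool)} {p q : Pos} (hm : v.Mv R.ty g p q) :
    (∃ m, p = .edge e m ∧ q = .edge k m) ∨ ∃ m, p = .edge k m ∧ q = .edge e m := by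
  rcases h.cut with rfl | rfl
  · obtain ⟨-, m, ⟨-, rfl, rfl⟩ | ⟨-, rfl, rfl⟩⟩ := Node.mv_cut_iff.1 hm
    · exact .inl ⟨m, rfl, rfl⟩
    · exact .inr ⟨m, rfl, rfl⟩
  · obtain ⟨-, m, ⟨-, rfl, rfl⟩ | ⟨-, rfl, rfl⟩⟩ := Node.mv_cut_iff.1 hm
    · exact .inr ⟨m, rfl, rfl⟩
    · exact .inl ⟨m, rfl, rfl⟩

/-- Tokens come onto `e` only from its `one` node and onto the lock only through the cut, that is,
from `e`. So the token of `e` is the only one that can open this box. -/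
theorem reserved (h : R.Opening S e k aux cont b v rest σ) : R.wiring.Reserved k e where
  mv := by
    rintro g p q ⟨w, hw, hm⟩ hp
    have hq := hm.prod (R.ty_node _ hw)
    refine ⟨?_, ?_, ?_⟩
    · rintro rfl
      obtain rfl := prod_unique hw h.one_mem hq (prod_one h.one_mem)
      generalize Pos.edge e [] = r at hm
      cases hm with
      | fwd h => cases h
      | bwd h => cases h
    · rintro rfl
      obtain rfl := prod_unique hw h.cut_mem hq h.prod_lock
      rcases h.cut_mv_iff hm with ⟨m, rfl, hq⟩ | ⟨m, rfl, hq⟩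
      · simp only [Pos.edge.injEq, true_and] at hq
        exact hp.1 (by rw [hq])
      · simp only [Pos.edge.injEq] at hq
        exact hp.2.1 (by rw [hq.2])
    · rintro c rfl
      obtain ⟨-, x, m, hx⟩ := hm.edges
      simp at hx
  syn := by
    rintro u I O ⟨l, hl, rfl, rfl⟩ q hq
    have hq := Node.prod_of_mem_outPos (R.ty_node _ hl) hq
    refine ⟨?_, ?_, ?_⟩
    · rintro rfl
      exact absurd (prod_unique hl h.one_mem hq (prod_one h.one_mem)) (by simp)
    · rintro rfl
      have := prod_unique hl h.cut_mem hq h.prod_lock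
      rcases h.cut with rfl | rfl <;> simp at this
    · rintro c rfl
      cases hq
  one := by
    rintro g c ⟨hc, -⟩ hce
    refine ⟨by simp [hce], ?_, by simp⟩
    intro hck
    simp only [Pos.edge.injEq, and_true] at hck
    exact absurd (concls_unique hc h.box_mem (e := c) (by simp [Node.concls])
      (by simp [Node.concls, hck])) (by simp)
  fin j := by
    refine ⟨fun hj => ?_, fun hj => ?_, fun c hj => ?_⟩
    · exact not_cons_fin h.cut_mem j (show v.Cons R.ty (R.finPos j) from
        (show R.finPos j = _ from hj) ▸ h.cons_one)
    · exact not_cons_fin h.box_mem j (show Node.Cons R.ty _ (R.finPos j) from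
        (show R.finPos j = _ from hj) ▸ h.cons_lock)
    · cases hj
  box := ⟨_, _, h.box_mem⟩

end Opening

end Struct

end Opening

end QSMLL

/-! ### Measurement and preservation of the interpretation -/

namespace QSMLL

section Soundness

variable {G : GateSet} {n : ℕ} {Γ : Fin n → Formula}

open View State

theorem Qubits.exists_prob_ne_zero {ι : Type} [Fintype ι] [DecidableEq ι] {Q : Qubits ι}
    (hQ : ‖Q‖ = 1) (r : ι) : ∃ b, prob r b Q ≠ 0 := by
  by_contra! h
  have : Q = 0 := by
    ext x
    have h0 : proj r (x r) Q = 0 := by simpa [prob] using h (x r)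
    have h1 : proj r (x r) Q x = 0 := by rw [h0]; rfl
    simpa [proj] using h1
  simp [this] at hQ

/-- The machine's average over both bits and the reduction's average over the possible outcomes
differ only by terms of weight zero. -/
theorem sum_support {p : Bool → ℝ≥0} [Fintype {b // p b ≠ 0}] (f : Bool → ℝ≥0∞)
    (g : {b // p b ≠ 0} → ℝ≥0∞) (h : ∀ b, f b.1 = g b) :
    ∑ b, (p b : ℝ≥0∞) * f b = ∑ b, (p b.1 : ℝ≥0∞) * g b := by
  refine (Finset.sum_of_injOn Subtype.val (fun b _ b' _ hb => Subtype.ext hb)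
    (fun b _ => Finset.mem_coe.2 (Finset.mem_univ _)) ?_ fun b _ => by rw [h]).symm
  intro b _ hb
  by_cases h0 : p b = 0
  · simp [h0]
  · exact absurd ⟨⟨b, h0⟩, Finset.mem_coe.2 (Finset.mem_univ _), rfl⟩ hb

namespace Struct

variable {R : Struct G Γ}

namespace Opening

variable {S S' : Struct G Γ} {e k k' : ℕ} {aux aux' : List ℕ} {cont cont' : Bool → List ℕ} {b b' : Bool}
  {v v' : Node G} {rest rest' : Multiset (Node G)} {σ σ' : ℕ → ℕ}

theorem _root_.Function.update_update_of_ne {α β : Type*} [DecidableEq α] {x y : α} (hxy : x ≠ y)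
    (f : α → β) (a b : β) : Function.update (Function.update f y a) y b x = f x :=
  (Function.update_of_ne hxy _ _).trans (Function.update_of_ne hxy _ _)

/-- Each outcome comes with its own description of the opened box. The lock is nevertheless
determined: it is the other premiss of the unique node having `e` as a premiss, and it differs from
`e` by its type. -/
theorem lock_eq (h : R.Opening S e k aux cont b v rest σ)
    (h' : R.Opening S' e k' aux' cont' b' v' rest' σ') : k' = k := by
  have hv : v' = v := tgts_unique h'.cut_mem h.cut_mem (h'.tgts_cut.2 (.inl rfl))
    (h.tgts_cut.2 (.inl rfl))
  have hk : k' ∈ v.tgts := hv ▸ h'.tgts_cut.2 (.inr rfl)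
  refine (h.tgts_cut.1 hk).resolve_left fun hke => ?_
  have := h'.ty_lock
  rw [hke, h.ty_one] at this
  cases this

theorem ne_one (h : R.Opening S e k aux cont b v rest σ) {i : ℕ} (hi : Node.one i ∈ R.nodes) :
    i ≠ k := fun hik =>
  absurd (concls_unique hi h.box_mem (e := i) (by simp [Node.concls]) (by simp [Node.concls, hik]))
    (by simp)

theorem produced_one (h : R.Opening S e k aux cont b v rest σ) {i : ℕ} (hi : Node.one i ∈ R.nodes)
    (hl : R.loc i = none) (hne : i ≠ e) :
    Produced (R.borderView aux σ k e b) View.trivial (.edge i []) (.edge i []) := by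
  have hr : Node.one i ∈ rest := by
    rcases h.mem_iff.1 hi with hw | hw | hw | hw
    · exact absurd (Node.one.inj hw) hne
    · rcases h.cut with rfl | rfl <;> simp at hw
    · simp at hw
    · exact hw
  exact (h.kept hr (kept_of_outer hi (x := i) (by simp [Node.concls]) (not_inside hl))).one
    (R.ty_node _ hi) (by simp)

theorem produced_init (h : R.Opening S e k aux cont b v rest σ) (i : InitPos Γ) :
    Produced (R.borderView aux σ k e b) View.trivial (R.initPos i) (S.initPos i) := by
  refine ⟨⟨?_, by rintro _ _ hi; cases hi⟩, True.intro, ?_⟩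
  · rintro x m hi
    obtain ⟨rfl, -⟩ := Pos.edge.inj hi
    refine ⟨not_inside (R.loc_concl _), ?_, ?_⟩
    · intro he
      exact concl_not_mem_tgts h.cut_mem i.1 (h.tgts_cut.2 (.inl he))
    · intro he
      exact concl_not_mem_tgts h.cut_mem i.1 (h.tgts_cut.2 (.inr he))
  · have : S.initPos i = .edge (σ (R.concl i.1)) i.2 := by rw [initPos, h.concl]; rfl
    rw [this]
    rfl

/-- After the measurement, the machine for `R` behaves as the machine for the opened structure. -/
theorem val_observed {T : QStruct G Γ} (h : R.Opening T.net e k aux cont b v rest σ)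
    {reg : Finset ℕ} (hR : R.HoldsOnes reg) {Q : Qubits reg} (he : e ∈ reg)
    (hreg : T.reg = reg.erase e)
    (hvec : ∀ x, T.vec x = Qubits.discard e b (Qubits.collapse ⟨e, he⟩ b Q)
      (fun i => x ⟨i, by rw [hreg]; exact i.2⟩))
    (ψ : {ψ : Qubits (InitPos Γ) // ‖ψ‖ = 1}) (o : Outcome Γ) :
    R.wiring.sys.val (State.observed ⟨reg, Function.update
      (Sum.elim R.initPos fun i : reg => .edge i []) (.inr ⟨e, he⟩) (.edge k []),
      Qubits.tmul ψ.1 Q⟩ (.inr ⟨e, he⟩) k b) o = T.interp ψ o := by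
  obtain ⟨S, reg', hS, Q', hQ'⟩ := T
  dsimp only at hreg h hvec
  subst hreg
  rw [QStruct.interp_eq_val, QStruct.initState_eq]
  -- The measured token is forgotten before the wirings are compared, since `e` is no edge of the
  -- register of the reduct.
  rw [Wiring.Discards.val_eq (k := k) (b := b) (e := e) (f := Sum.map id fun i : (reg.erase e : Finset ℕ) =>
      (⟨i, Finset.mem_of_mem_erase i.2⟩ : reg)) (r := .inr ⟨e, he⟩)
      (t := ⟨reg.erase e, Sum.elim R.initPos fun i => .edge i [], Qubits.tmul ψ.1 Q'⟩) h.reserved]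
  · refine h.simulated.val_eq h.simulated' ⟨reg.erase e, _,
      Sum.elim S.initPos fun i => .edge i [], _, rfl, rfl, by simp, ?_⟩ o
    rintro (i | ⟨i, hi⟩)
    · exact h.produced_init i
    · have hi := Finset.mem_erase.1 hi
      exact h.produced_one (hR i hi.2).1 (hR i hi.2).2 hi.1
  · refine ⟨?_, rfl, Finset.notMem_erase e reg, ?_, ?_, ?_, ?_, ?_⟩
    · rintro (i | i) <;> rfl
    · rintro (i | ⟨i, hi⟩)
      · exact .inr ⟨.inl i, rfl⟩
      · by_cases hie : i = e
        · subst hie; exact .inl rfl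
        · exact .inr ⟨.inr ⟨i, Finset.mem_erase.2 ⟨hie, hi⟩⟩, rfl⟩
    · rintro (i | ⟨i, hi⟩)
      · have hne : (Sum.inl i : InitPos Γ ⊕ reg) ≠ .inr ⟨e, he⟩ := Sum.inl_ne_inr
        exact Function.update_update_of_ne hne _ (Pos.edge k []) (Pos.lock k b)
      · have hne : (Sum.inr ⟨i, Finset.mem_of_mem_erase hi⟩ : InitPos Γ ⊕ reg) ≠ .inr ⟨e, he⟩ :=
          fun h => Finset.ne_of_mem_erase hi (congrArg Subtype.val (Sum.inr.inj h))
        exact Function.update_update_of_ne hne _ (Pos.edge k []) (Pos.lock k b)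
    · exact Function.update_self _ _ _
    · change Qubits.collapse (.inr ⟨e, he⟩) b (Qubits.tmul ψ.1 Q) = _
      rw [Qubits.collapse_tmul ψ.2]
      ext x
      simp only [Qubits.tmul, Qubits.adjoinBit]
      -- Where the measured qubit has the value `b`, discarding it loses nothing; elsewhere the
      -- collapsed register vanishes.
      by_cases hx : x (.inr ⟨e, he⟩) = b
      · refine Eq.trans ?_ (if_pos hx).symm
        rw [hvec]
        simp only [Qubits.discard]
        refine congrArg₂ (· * ·) rfl (congrArg (Qubits.collapse _ b Q) (funext fun i => ?_))
        split_ifs with hi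
        · have : i = ⟨e, he⟩ := Subtype.ext hi
          rw [this, hx]
        · rfl
      · refine Eq.trans ?_ (if_neg hx).symm
        simp [Qubits.collapse, Qubits.proj, hx]
    · rintro (i | ⟨i, hi⟩)
      · refine ⟨fun hj => ?_, fun hj => ?_, fun c hj => ?_⟩
        · replace hj : R.initPos i = .edge e [] := hj
          exact not_prod_init h.one_mem i (hj ▸ prod_one h.one_mem)
        · replace hj : R.initPos i = .edge k [] := hj
          exact not_prod_init h.cut_mem i (hj ▸ h.prod_lock)
        · cases hj
      · have hi := Finset.mem_erase.1 hi
        exact ⟨by simp [hi.1], by simp [h.ne_one (hR i hi.2).1], by simp⟩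

end Opening

/-- The token of `e` has no choice but to cross the cut and be measured on the lock. As the input is
normalized, the machine observes each bit with the probability given by the reduction rule. -/
theorem interp_measure {reg : Finset ℕ} {hR : R.HoldsOnes reg} {Q : Qubits reg} {hQ : ‖Q‖ = 1}
    {e : ℕ} (he : e ∈ reg) {S : {b : Bool // Qubits.prob ⟨e, he⟩ b Q ≠ 0} → QStruct G Γ}
    [Fintype {b : Bool // Qubits.prob ⟨e, he⟩ b Q ≠ 0}]
    (h : ∀ b, R.OpenBox (S b).net e b) (hreg : ∀ b, (S b).reg = reg.erase e)
    (hvec : ∀ b x, (S b).vec x = Qubits.discard e b (Qubits.collapse ⟨e, he⟩ b Q)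
      (fun i => x ⟨i, by rw [hreg b]; exact i.2⟩))
    (ψ : {ψ : Qubits (InitPos Γ) // ‖ψ‖ = 1}) (o : Outcome Γ) :
    (⟨R, reg, hR, Q, hQ⟩ : QStruct G Γ).interp ψ o =
      ∑ b, (Qubits.prob ⟨e, he⟩ b.1 Q : ℝ≥0∞) * (S b).interp ψ o := by
  -- The box is only described by the outcomes of the reduction; one of them exists because the
  -- register is nonzero.
  obtain ⟨b₀, hb₀⟩ := Qubits.exists_prob_ne_zero hQ ⟨e, he⟩
  obtain ⟨k, aux, cont, v, rest, σ, h₀⟩ := (h ⟨b₀, hb₀⟩).opening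
  rw [QStruct.interp_eq_val, QStruct.initState_eq]
  rw [Wiring.val_move (W := R.wiring) (s := ⟨reg, _, _⟩) (x := .inr ⟨e, he⟩) (q := .edge k [])
    ⟨v, h₀.cut_mem, h₀.cut_mv⟩]
  · rw [Wiring.val_meas (W := R.wiring) (s := ⟨reg, _, _⟩) (x := .inr ⟨e, he⟩) (k := k)
      ⟨_, _, h₀.box_mem⟩ (Function.update_self _ _ _)]
    · simp only [Qubits.prob_tmul ψ.2]
      refine sum_support _ _ fun b => ?_
      obtain ⟨k', aux', cont', v', rest', σ', h'⟩ := (h b).opening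
      obtain rfl := h₀.lock_eq h'
      exact h'.val_observed hR he (hreg b) (hvec b) ψ o
    · rintro g q ⟨w, hw, hm⟩
      obtain rfl := cons_unique hw h₀.box_mem (hm.cons (R.ty_node _ hw)) h₀.cons_lock
      -- A box passes tokens only between the conclusions of its contents and its auxiliary
      -- conclusions, and the lock is neither: conclusions are distinct, and contents are not at
      -- depth `0`.
      have hc : ∀ x, x ∈ aux ∨ x ∈ cont false ∨ x ∈ cont true → x ≠ k := by
        rintro x hx rfl
        rcases hx with hx | hx | hx
        · simpa [Node.concls, hx] using concls_nodup h₀.box_mem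
        · have := R.loc_content _ h₀.box_mem _ _ hx
          rw [h₀.loc_lock] at this; cases this
        · have := R.loc_content _ h₀.box_mem _ _ hx
          rw [h₀.loc_lock] at this; cases this
      generalize hp : Pos.edge k [] = p at hm
      cases hm with
      | fwd hl =>
        cases hl with
        | box _ _ _ c x y hxy =>
          refine hc _ ?_ (Pos.edge.inj hp).1.symm
          have := (List.of_mem_zip hxy).1
          cases c <;> simp [this]
      | bwd hl =>
        cases hl with
        | box _ _ _ c x y hxy =>
          exact hc _ (.inl (List.of_mem_zip hxy).2) (Pos.edge.inj hp).1.symm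
    · rintro u I O ⟨l, hl, rfl, rfl⟩ hI
      exact absurd (cons_unique hl h₀.box_mem (Node.cons_of_mem_inPos (R.ty_node _ hl) hI)
        h₀.cons_lock) (by simp)
  · rintro g q ⟨w, hw, hm⟩
    replace hm : w.Mv R.ty g (.edge e []) q := hm
    obtain rfl := cons_unique hw h₀.cut_mem (hm.cons (R.ty_node _ hw)) h₀.cons_one
    rcases h₀.cut_mv_iff hm with ⟨m, hp, rfl⟩ | ⟨m, hp, -⟩
    · rw [(Pos.edge.inj hp).2]
    · exact absurd (Pos.edge.inj hp).1 (h₀.ne_one h₀.one_mem)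
  · rintro u I O ⟨l, hl, rfl, rfl⟩ hI
    replace hI : Pos.edge e [] ∈ Node.inPos R.ty l := hI
    have := cons_unique hl h₀.cut_mem (Node.cons_of_mem_inPos (R.ty_node _ hl) hI) h₀.cons_one
    rcases h₀.cut with rfl | rfl <;> simp at this
  · rintro k' ⟨aux', cont', hk⟩ hx
    replace hx : Pos.edge e [] = Pos.edge k' [] := hx
    exact absurd (concls_unique hk h₀.one_mem (e := k') (by simp [Node.concls])
      (by simp [Node.concls, (Pos.edge.inj hx).1])) (by simp)

end Struct

/-- One-step reduction preserves the interpretation. -/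
theorem QRed.interp_eq {R : QStruct G Γ} {F : Fam (QStruct G Γ)} (h : QRed R F)
    (ψ : {ψ : Qubits (InitPos Γ) // ‖ψ‖ = 1}) (o : Outcome Γ) :
    R.interp ψ o = ∑ i, (F.weight i : ℝ≥0∞) * (F.pt i).interp ψ o := by
  cases h with
  | struct R S reg hR hS Q hQ h =>
    rw [TSys.sum_pure]
    simpa [Fam.pure] using Struct.interp_red ψ o h
  | new R reg hR Q hQ e he hone hd hRn Qn hQn h =>
    rw [TSys.sum_pure]
    simpa [Fam.pure] using Struct.interp_new ψ o he hone hd h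
  | sync R S reg hR hS Q hQ u l q hq h Qn hQn hU =>
    rw [TSys.sum_pure]
    simpa [Fam.pure] using Struct.interp_sync ψ o hq h hU
  | measure R reg hR Q hQ e he S h hreg hvec =>
    let : Fintype {b : Bool // Qubits.prob ⟨e, he⟩ b Q ≠ 0} := Fintype.ofFinite _
    exact Struct.interp_measure he h hreg hvec ψ o

/-- The interpretation of a distribution is linear in the weights, which lets the multi-step
induction pass through the sum in the `step` rule. -/
theorem interpDist_sum {ι : Type} [Fintype ι] (p : ι → ℝ≥0) (D : ι → QStruct G Γ →₀ ℝ≥0)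
    (ψ : {ψ : Qubits (InitPos Γ) // ‖ψ‖ = 1}) (o : Outcome Γ) :
    interpDist (∑ i, p i • D i) ψ o = ∑ i, (p i : ℝ≥0∞) * interpDist (D i) ψ o := by
  classical
  simp only [interpDist]
  rw [← Finsupp.sum_finsetSum_index (by simp) (by simp [add_mul])]
  refine Finset.sum_congr rfl fun i _ => ?_
  rw [Finsupp.sum_smul_index (by simp), Finsupp.mul_sum]
  simp [mul_assoc]

/-- Multi-step reduction preserves the interpretation. -/
theorem QRedStar.interp_eq {R : QStruct G Γ} {D : QStruct G Γ →₀ ℝ≥0} (h : QRedStar R D) :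
    R.interp = interpDist D := by
  funext ψ o
  induction h with
  | refl R => simp [interpDist]
  | step R F D h _ ih =>
    rw [h.interp_eq ψ o, interpDist_sum]
    exact Finset.sum_congr rfl fun i _ => by rw [ih i]

end Soundness

end QSMLL

theorem mainTheorem9 (G : QSMLL.GateSet) {n : ℕ} (Γ : Fin n → QSMLL.Formula)
    (R : QSMLL.QStruct G Γ) (hR : R.net.Correct)
    (D : QSMLL.QStruct G Γ →₀ ℝ≥0) (hD : QSMLL.QRedStar R D) :
    R.interp = QSMLL.interpDist D :=
  hD.interp_eq
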